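/- **Setting.** Let $n=n_k$, $N=N_k\to\infty$ with $n/N\to c\in(0,1]$. Let $R_n$ ($n\times N$) and $T_n$ ($n\times n$, nonnegative definite) be nonrandom complex matrices such that $T_n$ and $R_nR_n^*$ commute, and let $(s_i,t_i)_{i\le n}$ be the paired eigenvalues of $\frac1NR_nR_n^*$ and $T_n$. Assume that $\frac1n\sum_{i}\delta_{(s_i,t_i)}$ converges weakly to a probability measure $H$. Let $X_n=(x_{ij}^{(n)})$ be $n\times N$ random matrices whose entries are independent with mean $0$ and $\mathbf E|x^{(n)}_{ij}|^2=1$ and satisfy, for every $\eta>0$, $$\frac1{\eta^2nN}\sum_{i,j}\mathbf E\big(|x^{(n)}_{ij}|^2I(|x^{(n)}_{ij}|\ge\eta\sqrt n)\big)\to0 .$$ Let $\underline F$ be the probability measure to which the spectral distributions of the $N\times N$ matrices $\underline B_n=\frac1N(R_n+T_n^{1/2}X_n)^*(R_n+T_n^{1/2}X_n)$ converge weakly almost surely. Assume that $H$ has bounded support and that $\int t^{-1}\,\mathrm dH(s,t)<\infty$. Put $\underline m(z)=\int(\lambda-z)^{-1}\mathrm d\underline F(\lambda)$ and consider the system $$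 z\,m=-(1-c)-c\int\frac{\mathrm dH(s,t)}{1+sg+tm},\qquad z=-\frac1g+c\int\frac{t\,\mathrm dH(s,t)}{1+sg+tm},\qquad(\ast)$$ in which $g\ne0$ and the integrals converge absolutely. For $\Im z>0$, a *co-solution* at $z$ is a number $\underline g(z)$ with $\Im\underline g(z)>0$ such that $(z,\underline m(z),\underline g(z))$ satisfies $(\ast)$. An *extended solution* is a triple $(z,m,g)=\lim_k(z_k,\underline m(z_k),\underline g(z_k))$ with $\Im z_k>0$ and $\underline g(z_k)$ a co-solution at $z_k$. It is *real* if $z,m,g$ are real. Put $$A_j=\int\frac{st^{j-1}\mathrm dH(s,t)}{|1+sg+tm|^2},\quad B_j=\int\frac{t^j\mathrm dH(s,t)}{|1+sg+tm|^2},\quad V_0=|g|^{-2}-cA_2,\quad V=\frac{c^2A_1B_2}{V_0}+cB_1 .$$ **Theorem.** (i) Let $x_0>0$ lie outside the support of $\underline F$. Then: (a) There are a disc $D\subset\mathbb C$ centred at $x_0$ and a function $\underline g$ on $\mathbb C$, which is a co-solution at every $z$ with $\Im z>0$, such that $\underline m$ and $\underline g$ are analytic in $D$. For every real $x>0$ in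 $D$, $(x,\underline m(x),\underline g(x))$ is a real extended solution and satisfies $(\ast)$; the integrals $A_1,A_2,B_1,B_2$ at this triple are finite, $V_0>0$, and $V<x$. If moreover $\int (s/t)\,\mathrm dH(s,t)\le 1/c$, then $\underline m(x)\neq0$ for all these $x$, so that the first equation of $(\ast)$ may be divided by $\underline m(x)$. (b) $1+s\,\underline g(x_0)+t\,\underline m(x_0)\ne0$ for every $(s,t)$ in the support of $H$. (ii) Conversely, let $(x_0,\underline m_0,\underline g_0)$ be a real extended solution with $x_0>0$ and $1+s\underline g_0+t\underline m_0\neq0$ for every $(s,t)$ in the support of $H$. Then there are real analytic functions $x=x(g)$ and $m=m(g)$ on an open interval around $\underline g_0$ such that $x(\underline g_0)=x_0$, $m(\underline g_0)=\underline m_0$, and $(x(g),m(g),g)$ satisfies $(\ast)$ for all $g$ in this interval; for $(g,m)$ near $(\underline g_0,\underline m_0)$ the equation $$c\,g^2\int\frac{s\,\mathrm dH(s,t)}{1+sg+tm}+m-g=0$$ holds if and only if $m=m(g)$. If $x'(\underline g_0)\ne0$, then $x_0$ lies outside the support of $\underline F$. -/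

import Mathlib

open MeasureTheory ProbabilityTheory Filter Topology
open scoped Matrix ComplexOrder

namespace NoncentralCov

/-- Weak convergence of empirical distributions: the uniform distributions on the points
`pts k 0, …, pts k (d k - 1)` converge weakly to `μ` as `k → ∞`. -/
def EmpiricalTendsto {E : Type*} [TopologicalSpace E] [MeasurableSpace E]
    (d : ℕ → ℕ) (pts : ∀ k, Fin (d k) → E) (μ : Measure E) : Prop :=
  ∀ f : BoundedContinuousFunction E ℝ,
    Tendsto (fun k => ((d k : ℝ))⁻¹ * ∑ i, f (pts k i)) atTop (𝓝 (∫ x, f x ∂μ))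

/-- The non-central matrix model: for `k → ∞`, nonrandom `R k` (of size `n k × N k`), nonrandom
nonnegative definite `T k` commuting with `R k (R k)ᴴ`, with nonnegative definite square root
`sqrtT k`, and a random matrix `X k` with independent standardized entries that satisfy a
Lindeberg condition; `n / N → c`, and the joint spectral distribution of `N⁻¹ R Rᴴ` and `T`
converges weakly to `H`. -/
structure Model {Ω : Type*} [MeasurableSpace Ω] (P : Measure Ω) (c : ℝ)
    (H : Measure (ℝ × ℝ)) where
  n : ℕ → ℕ
  N : ℕ → ℕ
  n_tendsto : Tendsto n atTop atTop
  N_tendsto : Tendsto N atTop atTop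
  ratio_tendsto : Tendsto (fun k => (n k : ℝ) / (N k : ℝ)) atTop (𝓝 c)
  R : ∀ k, Matrix (Fin (n k)) (Fin (N k)) ℂ
  T : ∀ k, Matrix (Fin (n k)) (Fin (n k)) ℂ
  T_posSemidef : ∀ k, (T k).PosSemidef
  commute : ∀ k, Commute (T k) (R k * (R k)ᴴ)
  sqrtT : ∀ k, Matrix (Fin (n k)) (Fin (n k)) ℂ
  sqrtT_posSemidef : ∀ k, (sqrtT k).PosSemidef
  sqrtT_mul_self : ∀ k, sqrtT k * sqrtT k = T k
  /-- A unitary matrix whose columns are common eigenvectors. -/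
  U : ∀ k, Matrix.unitaryGroup (Fin (n k)) ℂ
  /-- The paired eigenvalues of `N⁻¹ R Rᴴ` and of `T`. -/
  s : ∀ k, Fin (n k) → ℝ
  t : ∀ k, Fin (n k) → ℝ
  diag_R : ∀ k, ((N k : ℂ))⁻¹ • (R k * (R k)ᴴ) =
    (U k : Matrix (Fin (n k)) (Fin (n k)) ℂ) * Matrix.diagonal (fun i => (s k i : ℂ)) *
      (U k : Matrix (Fin (n k)) (Fin (n k)) ℂ)ᴴ
  diag_T : ∀ k, T k =
    (U k : Matrix (Fin (n k)) (Fin (n k)) ℂ) * Matrix.diagonal (fun i => (t k i : ℂ)) *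
      (U k : Matrix (Fin (n k)) (Fin (n k)) ℂ)ᴴ
  joint_tendsto : EmpiricalTendsto n (fun k i => (s k i, t k i)) H
  X : ∀ k, Ω → Matrix (Fin (n k)) (Fin (N k)) ℂ
  X_measurable : ∀ k i j, Measurable (fun ω => X k ω i j)
  X_indep : ∀ k, iIndepFun (fun (a : Fin (n k) × Fin (N k)) ω => X k ω a.1 a.2) P
  X_memLp : ∀ k i j, MemLp (fun ω => X k ω i j) 2 P
  X_mean : ∀ k i j, ∫ ω, X k ω i j ∂P = 0
  X_variance : ∀ k i j, ∫ ω, ‖X k ω i j‖ ^ 2 ∂P = 1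
  lindeberg : ∀ η : ℝ, 0 < η →
    Tendsto (fun k => (η ^ 2 * (n k : ℝ) * (N k : ℝ))⁻¹ *
      ∑ i, ∑ j, ∫ ω in {ω | η * √(n k : ℝ) ≤ ‖X k ω i j‖}, ‖X k ω i j‖ ^ 2 ∂P) atTop (𝓝 0)

section
variable {Ω : Type*} [MeasurableSpace Ω] {P : Measure Ω} {c : ℝ} {H : Measure (ℝ × ℝ)}

/-- The `N × N` matrix `N⁻¹ (R + T^{1/2} X)ᴴ (R + T^{1/2} X)`. -/
noncomputable def Model.companion (M : Model P c H) (k : ℕ) (ω : Ω) :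
    Matrix (Fin (M.N k)) (Fin (M.N k)) ℂ :=
  ((M.N k : ℝ))⁻¹ • ((M.R k + M.sqrtT k * M.X k ω)ᴴ * (M.R k + M.sqrtT k * M.X k ω))

theorem Model.companion_isHermitian (M : Model P c H) (k : ℕ) (ω : Ω) :
    (M.companion k ω).IsHermitian := by
  unfold Matrix.IsHermitian Model.companion
  rw [Matrix.conjTranspose_smul, Matrix.conjTranspose_mul, Matrix.conjTranspose_conjTranspose]
  simp

/-- `F` is the almost sure weak limit of the spectral distributions of the companion matrices. -/
def Model.IsLSD (M : Model P c H) (F : Measure ℝ) : Prop :=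
  ∀ᵐ ω ∂P, EmpiricalTendsto M.N (fun k => (M.companion_isHermitian k ω).eigenvalues) F

end

/-- The Stieltjes transform of `F`. -/
noncomputable def stieltjes (F : Measure ℝ) (z : ℂ) : ℂ := ∫ l : ℝ, ((l : ℂ) - z)⁻¹ ∂F

/-- The denominator `1 + s g + t m` at `p = (s, t)`. -/
noncomputable def den (m g : ℂ) (p : ℝ × ℝ) : ℂ := 1 + (p.1 : ℂ) * g + (p.2 : ℂ) * m

/-- The system
`z m = -(1 - c) - c ∫ dH / (1 + s g + t m)`, `z = -1 / g + c ∫ t dH / (1 + s g + t m)`,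
the integrals being absolutely convergent. The first equation is multiplied by `m`, so that it
keeps its meaning at `m = 0`. -/
def Solves (c : ℝ) (H : Measure (ℝ × ℝ)) (z m g : ℂ) : Prop :=
  g ≠ 0 ∧
  Integrable (fun p => 1 / den m g p) H ∧
  Integrable (fun p : ℝ × ℝ => (p.2 : ℂ) / den m g p) H ∧
  z * m = -(1 - (c : ℂ)) - (c : ℂ) * ∫ p, 1 / den m g p ∂H ∧
  z = -1 / g + (c : ℂ) * ∫ p : ℝ × ℝ, (p.2 : ℂ) / den m g p ∂H

/-- `g` is the co-solution of the Stieltjes transform of `F` at a point `z` of the upper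
half-plane: `g` lies in the upper half-plane and solves the system together with it. -/
def IsCoSolution (c : ℝ) (H : Measure (ℝ × ℝ)) (F : Measure ℝ) (z g : ℂ) : Prop :=
  0 < g.im ∧ Solves c H z (stieltjes F z) g

/-- Extended solutions: limits of `(z, m, g)` along sequences in the upper half-plane, where `m`
is the Stieltjes transform of `F` at `z`, and `g` is its co-solution. -/
def IsExtendedSolution (c : ℝ) (H : Measure (ℝ × ℝ)) (F : Measure ℝ) (z m g : ℂ) : Prop :=
  ∃ (zs gs : ℕ → ℂ), (∀ k, 0 < (zs k).im ∧ IsCoSolution c H F (zs k) (gs k)) ∧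
    Tendsto zs atTop (𝓝 z) ∧ Tendsto (fun k => stieltjes F (zs k)) atTop (𝓝 m) ∧
    Tendsto gs atTop (𝓝 g)

/-- The integrand `s^i t^j / |1 + s g + t m|²`. -/
noncomputable def kern (i j : ℕ) (m g : ℂ) (p : ℝ × ℝ) : ℝ :=
  p.1 ^ i * p.2 ^ j / ‖den m g p‖ ^ 2

/-- `A_j = ∫ s t^{j-1} dH / |1 + s g + t m|²` is `quad H 1 (j-1) m g`, and
`B_j = ∫ t^j dH / |1 + s g + t m|²` is `quad H 0 j m g`. -/
noncomputable def quad (H : Measure (ℝ × ℝ)) (i j : ℕ) (m g : ℂ) : ℝ :=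
  ∫ p, kern i j m g p ∂H

/-- `V₀ = |g|⁻² - c A₂`. -/
noncomputable def V₀ (c : ℝ) (H : Measure (ℝ × ℝ)) (m g : ℂ) : ℝ :=
  (‖g‖ ^ 2)⁻¹ - c * quad H 1 1 m g

/-- `V = c² A₁ B₂ / V₀ + c B₁`. -/
noncomputable def V (c : ℝ) (H : Measure (ℝ × ℝ)) (m g : ℂ) : ℝ :=
  c ^ 2 * quad H 1 0 m g * quad H 0 2 m g / V₀ c H m g + c * quad H 0 1 m g

/-- The four integrals in the definition of `V` converge, and `V₀` is positive. -/
def VDefined (c : ℝ) (H : Measure (ℝ × ℝ)) (m g : ℂ) : Prop :=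
  Integrable (kern 1 0 m g) H ∧ Integrable (kern 1 1 m g) H ∧
  Integrable (kern 0 1 m g) H ∧ Integrable (kern 0 2 m g) H ∧ 0 < V₀ c H m g

end NoncentralCov

set_option linter.unusedSectionVars false

/-! The proof has two halves. The first, existence of co-solutions, is random matrix theory; the
second studies the system (∗) and uses no matrices.

Existence. In the common eigenbasis, and after discarding the o(N) eigenvalue pairs outside a
bounded square (a perturbation of small rank), the data have columns y_j = a_j + N^{-1/2} B x_j with
∑ a_j a_jᴴ = diag(s) and B Bᴴ = diag(t) = T. Let Q be the resolvent of the Gram matrix, δ = N⁻¹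
tr(TQ) and g_N = -1/(z(1+δ)). Removing one column by the Sherman–Morrison formula shows that
weighted averages of z(1 + t_i m_N + s_i g_N) Q_ii + 1 are small in L¹ (`average_eq_sum_colErr`,
`exists_average_bound`). The Lindeberg condition suffices, since quadratic forms need to concentrate
only in first mean. Weights proportional to 1/(1+sg+tm) and t/(1+sg+tm), with g in a finite net of a
compact set, produce approximate solutions of (∗), and compactness an exact one
(`Model.exists_isCoSolution`).

Tools for (∗). Imaginary parts give Im(zm) = c(A₁ Im g + B₁ Im m) and V₀ Im g = Im z + c B₂ Im m.
Subtracting (∗) at two points gives a linear relation between g - g', z - z' and m - m', in which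
Cauchy–Schwarz bounds the factor of g - g' below by the smaller V₀ (`le_norm_bracket`). Hence
co-solutions are unique and holomorphic.

Gaps. Near x₀ outside the support, Im m is comparable to Im z. The first identity then bounds B₁,
and so |g| from below; a limit argument that needs ∫ 1/t dH < ∞ and c ≤ 1 bounds |g| from above. It
follows that Im g = O(Im z), that V₀ is bounded below, that g is Lipschitz, and that g extends by
reflection. A denominator cannot vanish at a point of supp H: its zero would move transversally, so
all nearby p would have a root r(p) in the gap, while the bound on B₁ gives every interval of length
η only O(η²) of the t-weighted law of r, hence no mass at all (`regular_of_gap`). Finally Im m (Re z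
- V) = Im z (cA₁/V₀ - Re m), and cA₁/V₀ > m at the real points (`Solves.lt_of_real`), so V < x.

Converse. V₀ > 0 persists at a real extended solution with nonvanishing denominators. There g²V₀ is
the m-derivative of the equation left after eliminating z, so the implicit function theorem yields
m(g) and then x(g). If x' ≠ 0, inverting x(g) continues the Stieltjes transform through x₀ with real
values on the real line; so Im m(x+iη) = O(η), short intervals of length η carry F-mass O(η²), and a
neighbourhood of x₀ is a null set. -/

namespace NoncentralCov

/-! ### Concentration of quadratic forms in independent entries -/

section QuadraticForms

variable {Ω : Type*} [MeasurableSpace Ω] {P : Measure Ω} [IsProbabilityMeasure P]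
  {ι : Type*} [Fintype ι] [DecidableEq ι]

lemma integral_norm_le_sqrt {f : Ω → ℂ} (hf : MemLp f 2 P) :
    ∫ ω, ‖f ω‖ ∂P ≤ √(∫ ω, ‖f ω‖ ^ 2 ∂P) := by
  apply Real.le_sqrt_of_sq_le
  have h1 : MemLp (fun ω => ‖f ω‖) 2 P := hf.norm
  have h := ProbabilityTheory.variance_eq_sub h1
  have h2 := ProbabilityTheory.variance_nonneg (fun ω => ‖f ω‖) P
  simp only [Pi.pow_apply] at h
  linarith

/-- Orthogonality of independent centred variables. -/
lemma integral_norm_sq_sum {ξ : ι → Ω → ℂ} (hL : ∀ i, MemLp (ξ i) 2 P)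
    (hI : Pairwise fun i j => IndepFun (ξ i) (ξ j) P) (h0 : ∀ i, ∫ ω, ξ i ω ∂P = 0)
    (a : ι → ℂ) (S : Finset ι) :
    ∫ ω, ‖∑ i ∈ S, a i * ξ i ω‖ ^ 2 ∂P = ∑ i ∈ S, ‖a i‖ ^ 2 * ∫ ω, ‖ξ i ω‖ ^ 2 ∂P := by
  have hint : ∀ i j, Integrable (fun ω => (a i * ξ i ω) * (starRingEnd ℂ) (a j * ξ j ω)) P := by
    intro i j
    have h1 : MemLp (fun ω => a i * ξ i ω) 2 P := (hL i).const_mul _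
    have h2 : MemLp (fun ω => (starRingEnd ℂ) (a j * ξ j ω)) 2 P :=
      ((hL j).const_mul (a j)).star
    exact h1.integrable_mul h2
  have hij : ∀ i j, ∫ ω, (a i * ξ i ω) * (starRingEnd ℂ) (a j * ξ j ω) ∂P =
      if i = j then ((‖a i‖ ^ 2 * ∫ ω, ‖ξ i ω‖ ^ 2 ∂P : ℝ) : ℂ) else 0 := by
    intro i j
    split_ifs with h
    · subst h
      rw [← integral_const_mul, ← integral_complex_ofReal]
      congr 1
      ext ω
      rw [Complex.mul_conj, Complex.normSq_eq_norm_sq, norm_mul]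
      push_cast
      ring
    · have hc : IndepFun (fun ω => a i * ξ i ω) (fun ω => (starRingEnd ℂ) (a j * ξ j ω)) P :=
        (hI h).comp (φ := fun w => a i * w) (ψ := fun w => (starRingEnd ℂ) (a j * w))
          (by fun_prop) (by fun_prop)
      rw [hc.integral_fun_mul_eq_mul_integral
        ((hL i).const_mul _).aestronglyMeasurable ((hL j).const_mul (a j)).star.aestronglyMeasurable]
      rw [integral_const_mul, h0 i]
      simp
  have key : ((∫ ω, ‖∑ i ∈ S, a i * ξ i ω‖ ^ 2 ∂P : ℝ) : ℂ) =
      ((∑ i ∈ S, ‖a i‖ ^ 2 * ∫ ω, ‖ξ i ω‖ ^ 2 ∂P : ℝ) : ℂ) := by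
    rw [← integral_complex_ofReal]
    have : ∀ ω, (((‖∑ i ∈ S, a i * ξ i ω‖ ^ 2 : ℝ)) : ℂ) =
        ∑ i ∈ S, ∑ j ∈ S, (a i * ξ i ω) * (starRingEnd ℂ) (a j * ξ j ω) := by
      intro ω
      rw [← Complex.normSq_eq_norm_sq, ← Complex.mul_conj, map_sum, Finset.sum_mul_sum]
    simp_rw [this]
    rw [integral_finsetSum _ (fun i _ => integrable_finsetSum _ (fun j _ => hint i j))]
    push_cast
    refine Finset.sum_congr rfl fun i hi => ?_
    rw [integral_finsetSum _ (fun j _ => hint i j)]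
    simp_rw [hij]
    simp [hi]
  exact_mod_cast key

/-- Induction on `S`. A new index p contributes x̄_p u + x_p w̄ with u, w linear in the old
variables. This is orthogonal to the old sum because x_p is centred and independent of them, so no
moment above the second is needed. The factor 2 pays for the product of the two halves of the
increment. -/
lemma offDiag_second_moment {x : ι → Ω → ℂ} (hm : ∀ i, Measurable (x i)) (hI : iIndepFun x P)
    (hL : ∀ i, MemLp (x i) 2 P) (h0 : ∀ i, ∫ ω, x i ω ∂P = 0)
    (h1 : ∀ i, ∫ ω, ‖x i ω‖ ^ 2 ∂P = 1) (A : Matrix ι ι ℂ) (S : Finset ι) :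
    MemLp (fun ω => ∑ i ∈ S, ∑ k ∈ S.erase i, star (x i ω) * A i k * x k ω) 2 P ∧
    ∫ ω, ‖∑ i ∈ S, ∑ k ∈ S.erase i, star (x i ω) * A i k * x k ω‖ ^ 2 ∂P ≤
      2 * ∑ i ∈ S, ∑ k ∈ S.erase i, ‖A i k‖ ^ 2 := by
  induction S using Finset.induction_on with
  | empty => simp
  | insert p S hp ih =>
    obtain ⟨ihL, ih2⟩ := ih
    set Z : Ω → ℂ := fun ω => ∑ i ∈ S, ∑ k ∈ S.erase i, star (x i ω) * A i k * x k ω with hZ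
    set u : Ω → ℂ := fun ω => ∑ i ∈ S, A p i * x i ω with hu
    set w : Ω → ℂ := fun ω => ∑ i ∈ S, star (A i p) * x i ω with hw
    have split : ∀ f : ι → ι → ℂ, ∑ i ∈ insert p S, ∑ k ∈ (insert p S).erase i, f i k =
        ∑ i ∈ S, ∑ k ∈ S.erase i, f i k + (∑ i ∈ S, f p i + ∑ i ∈ S, f i p) := by
      intro f
      rw [Finset.sum_insert hp, Finset.erase_insert hp]
      have : ∀ i ∈ S, ∑ k ∈ (insert p S).erase i, f i k = f i p + ∑ k ∈ S.erase i, f i k := by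
        intro i hi
        have hne : p ≠ i := fun h => hp (h ▸ hi)
        rw [Finset.erase_insert_of_ne hne, Finset.sum_insert]
        simp [hp]
      rw [Finset.sum_congr rfl this, Finset.sum_add_distrib]
      ring
    have splitR : ∀ f : ι → ι → ℝ, ∑ i ∈ insert p S, ∑ k ∈ (insert p S).erase i, f i k =
        ∑ i ∈ S, ∑ k ∈ S.erase i, f i k + (∑ i ∈ S, f p i + ∑ i ∈ S, f i p) := by
      intro f
      have := split (fun i k => (f i k : ℂ))
      exact_mod_cast this
    have hdec : ∀ ω, ∑ i ∈ insert p S, ∑ k ∈ (insert p S).erase i, star (x i ω) * A i k * x k ω =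
        Z ω + (star (x p ω) * u ω + x p ω * star (w ω)) := by
      intro ω
      rw [split (fun i k => star (x i ω) * A i k * x k ω)]
      simp only [hZ, hu, hw, Finset.mul_sum, star_sum, star_mul, star_star]
      congr 1
      congr 1
      · exact Finset.sum_congr rfl fun i _ => by ring
      · exact Finset.sum_congr rfl fun i _ => by ring
    have hpair : Pairwise fun i j => IndepFun (x i) (x j) P := fun i j h => hI.indepFun h
    have huL : MemLp u 2 P := memLp_finsetSum _ fun i _ => (hL i).const_mul _
    have hwL : MemLp w 2 P := memLp_finsetSum _ fun i _ => (hL i).const_mul _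
    have hu2 : ∫ ω, ‖u ω‖ ^ 2 ∂P = ∑ i ∈ S, ‖A p i‖ ^ 2 := by
      simpa [h1] using integral_norm_sq_sum hL hpair h0 (fun i => A p i) S
    have hw2 : ∫ ω, ‖w ω‖ ^ 2 ∂P = ∑ i ∈ S, ‖A i p‖ ^ 2 := by
      simpa [h1, hw] using integral_norm_sq_sum hL hpair h0 (fun i => star (A i p)) S
    -- independence of `x p` and any function of the coordinates in `S`
    have hind : ∀ (φ : (S → ℂ) → ℂ), Measurable φ →
        IndepFun (x p) (fun ω => φ (fun i => x i ω)) P := by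
      intro φ hφ
      have h := hI.indepFun_finset {p} S (by simpa using hp) hm
      exact h.comp (φ := fun v : (({p} : Finset ι) → ℂ) => v ⟨p, by simp⟩) (ψ := φ)
        (measurable_pi_apply _) hφ
    have huI : IndepFun (x p) u P := by
      have := hind (fun v => ∑ i : S, A p i * v i) (by fun_prop)
      convert this using 2 with ω
      exact (Finset.sum_coe_sort S (fun i => A p i * x i ω)).symm
    have hwI : IndepFun (x p) w P := by
      have := hind (fun v => ∑ i : S, star (A i p) * v i) (by fun_prop)
      convert this using 2 with ω
      exact (Finset.sum_coe_sort S (fun i => star (A i p) * x i ω)).symm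
    have hprodsq : ∀ v : Ω → ℂ, MemLp v 2 P → IndepFun (x p) v P →
        Integrable (fun ω => ‖x p ω‖ ^ 2 * ‖v ω‖ ^ 2) P ∧
        ∫ ω, ‖x p ω‖ ^ 2 * ‖v ω‖ ^ 2 ∂P = ∫ ω, ‖v ω‖ ^ 2 ∂P := by
      intro v hv hiv
      have hc : IndepFun (fun ω => ‖x p ω‖ ^ 2) (fun ω => ‖v ω‖ ^ 2) P :=
        hiv.comp (φ := fun w => ‖w‖ ^ 2) (ψ := fun w => ‖w‖ ^ 2) (by fun_prop) (by fun_prop)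
      refine ⟨hc.integrable_mul (hL p).integrable_norm_pow' hv.integrable_norm_pow', ?_⟩
      rw [hc.integral_fun_mul_eq_mul_integral, h1 p, one_mul]
      · exact (hL p).integrable_norm_pow'.aestronglyMeasurable
      · exact hv.integrable_norm_pow'.aestronglyMeasurable
    have hmul : ∀ v : Ω → ℂ, MemLp v 2 P → IndepFun (x p) v P →
        MemLp (fun ω => star (x p ω) * v ω) 2 P ∧ MemLp (fun ω => x p ω * star (v ω)) 2 P := by
      intro v hv hiv
      obtain ⟨hi, -⟩ := hprodsq v hv hiv
      constructor
      · refine (memLp_two_iff_integrable_sq_norm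
          ((hL p).star.aestronglyMeasurable.mul hv.aestronglyMeasurable)).2 ?_
        refine hi.congr (ae_of_all _ fun ω => ?_)
        simp [mul_pow]
      · refine (memLp_two_iff_integrable_sq_norm
          ((hL p).aestronglyMeasurable.mul hv.star.aestronglyMeasurable)).2 ?_
        refine hi.congr (ae_of_all _ fun ω => ?_)
        simp [mul_pow]
    set D : Ω → ℂ := fun ω => star (x p ω) * u ω + x p ω * star (w ω) with hD
    have hDL : MemLp D 2 P := (hmul u huL huI).1.add (hmul w hwL hwI).2
    have hD2 : ∫ ω, ‖D ω‖ ^ 2 ∂P ≤ 2 * (∑ i ∈ S, ‖A p i‖ ^ 2 + ∑ i ∈ S, ‖A i p‖ ^ 2) := by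
      obtain ⟨i1, e1⟩ := hprodsq u huL huI
      obtain ⟨i2, e2⟩ := hprodsq w hwL hwI
      calc ∫ ω, ‖D ω‖ ^ 2 ∂P
          ≤ ∫ ω, 2 * (‖x p ω‖ ^ 2 * ‖u ω‖ ^ 2 + ‖x p ω‖ ^ 2 * ‖w ω‖ ^ 2) ∂P := by
            refine integral_mono hDL.integrable_norm_pow' ((i1.add i2).const_mul 2) fun ω => ?_
            have h3 : ‖D ω‖ ≤ ‖x p ω‖ * ‖u ω‖ + ‖x p ω‖ * ‖w ω‖ := by
              refine (norm_add_le _ _).trans ?_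
              simp
            have h4 := norm_nonneg (D ω)
            change ‖D ω‖ ^ 2 ≤ 2 * (‖x p ω‖ ^ 2 * ‖u ω‖ ^ 2 + ‖x p ω‖ ^ 2 * ‖w ω‖ ^ 2)
            nlinarith [sq_nonneg (‖x p ω‖ * ‖u ω‖ - ‖x p ω‖ * ‖w ω‖)]
        _ = _ := by rw [integral_const_mul, integral_add i1 i2, e1, e2, hu2, hw2]
    -- the cross term vanishes
    have hcross0 : ∀ (v : Ω → ℂ), (∃ φ : (S → ℂ) → ℂ, Measurable φ ∧
        ∀ ω, v ω = φ (fun i => x i ω)) → ∫ ω, x p ω * v ω ∂P = 0 := by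
      rintro v ⟨φ, hφ, hv⟩
      have : v = fun ω => φ (fun i => x i ω) := funext hv
      subst this
      rw [(hind φ hφ).integral_fun_mul_eq_mul_integral (hm p).aestronglyMeasurable
        (hφ.comp (measurable_pi_lambda _ fun i => hm i)).aestronglyMeasurable, h0 p, zero_mul]
    have hZφ : ∃ φ : (S → ℂ) → ℂ, Measurable φ ∧ ∀ ω, Z ω = φ (fun i => x i ω) := by
      refine ⟨fun v => ∑ i ∈ S.attach, ∑ k ∈ S.attach.erase i, star (v i) * A i k * v k,
        by fun_prop, fun ω => ?_⟩
      simp only [hZ]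
      rw [← Finset.sum_attach S]
      refine Finset.sum_congr rfl fun i _ => ?_
      refine (Finset.sum_bij (fun (k : S) _ => (k : ι)) ?_ ?_ ?_ ?_).symm
      · intro k hk
        simp only [Finset.mem_erase, Finset.mem_attach, and_true] at hk
        simp only [Finset.mem_erase]
        exact ⟨fun h => hk (Subtype.ext h), k.2⟩
      · intro a _ b _ h
        exact Subtype.ext h
      · intro b hb
        simp only [Finset.mem_erase] at hb
        exact ⟨⟨b, hb.2⟩, by simp [Subtype.ext_iff, hb.1], rfl⟩
      · intro k _
        rfl
    have huφ : ∃ φ : (S → ℂ) → ℂ, Measurable φ ∧ ∀ ω, u ω = φ (fun i => x i ω) :=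
      ⟨fun v => ∑ i : S, A p i * v i, by fun_prop, fun ω =>
        (Finset.sum_coe_sort S (fun i => A p i * x i ω)).symm⟩
    have hwφ : ∃ φ : (S → ℂ) → ℂ, Measurable φ ∧ ∀ ω, w ω = φ (fun i => x i ω) :=
      ⟨fun v => ∑ i : S, star (A i p) * v i, by fun_prop, fun ω =>
        (Finset.sum_coe_sort S (fun i => star (A i p) * x i ω)).symm⟩
    have hcross : ∫ ω, Z ω * star (D ω) ∂P = 0 := by
      have e : ∀ ω, Z ω * star (D ω) =
          x p ω * (Z ω * star (u ω)) + star (x p ω * (star (Z ω) * star (w ω))) := by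
        intro ω
        simp only [hD, star_add, star_mul, star_star]
        ring
      obtain ⟨φZ, hφZ, eZ⟩ := hZφ
      obtain ⟨φu, hφu, eu⟩ := huφ
      obtain ⟨φw, hφw, ew⟩ := hwφ
      have c1 : ∫ ω, x p ω * (Z ω * star (u ω)) ∂P = 0 :=
        hcross0 _ ⟨fun v => φZ v * star (φu v), by fun_prop, fun ω => by rw [eZ, eu]⟩
      have c2 : ∫ ω, x p ω * (star (Z ω) * star (w ω)) ∂P = 0 :=
        hcross0 _ ⟨fun v => star (φZ v) * star (φw v), by fun_prop, fun ω => by rw [eZ, ew]⟩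
      have m1 := (hmul u huL huI).1
      have m2 := (hmul w hwL hwI).2
      have i1 : Integrable (fun ω => x p ω * (Z ω * star (u ω))) P := by
        refine (ihL.integrable_mul m1.star).congr (ae_of_all _ fun ω => ?_)
        simp only [Pi.mul_apply, Pi.star_apply, star_mul, star_star]
        ring
      have i2 : Integrable (fun ω => star (x p ω * (star (Z ω) * star (w ω)))) P := by
        refine (ihL.integrable_mul m2.star).congr (ae_of_all _ fun ω => ?_)
        simp only [Pi.mul_apply, Pi.star_apply, star_mul, star_star]
        ring
      simp_rw [e]
      rw [integral_add i1 i2, c1, zero_add]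
      have : ∫ ω, star (x p ω * (star (Z ω) * star (w ω))) ∂P =
        (starRingEnd ℂ) (∫ ω, x p ω * (star (Z ω) * star (w ω)) ∂P) := integral_conj
      rw [this, c2, map_zero]
    have hsum : ∀ ω, ‖Z ω + D ω‖ ^ 2 = ‖Z ω‖ ^ 2 + ‖D ω‖ ^ 2 + 2 * (Z ω * star (D ω)).re := by
      intro ω
      rw [← Complex.normSq_eq_norm_sq, ← Complex.normSq_eq_norm_sq, ← Complex.normSq_eq_norm_sq,
        Complex.normSq_add]
      rfl
    constructor
    · have : MemLp (fun ω => Z ω + D ω) 2 P := ihL.add hDL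
      refine this.congr_norm ?_ (ae_of_all _ fun ω => by rw [hdec])
      have h5 := this.aestronglyMeasurable
      exact h5.congr (ae_of_all _ fun ω => by simp only [hdec, hD])
    · simp_rw [hdec]
      change ∫ ω, ‖Z ω + D ω‖ ^ 2 ∂P ≤ _
      simp_rw [hsum]
      have iZD : Integrable (fun ω => Z ω * star (D ω)) P := ihL.integrable_mul hDL.star
      have hre : ∫ ω, (Z ω * star (D ω)).re ∂P = 0 := by
        have := integral_re iZD
        simp only [RCLike.re_to_complex] at this
        rw [this, hcross]
        simp
      have i1 : Integrable (fun ω => ‖Z ω‖ ^ 2) P := ihL.integrable_norm_pow'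
      have i2 : Integrable (fun ω => ‖D ω‖ ^ 2) P := hDL.integrable_norm_pow'
      have i3 : Integrable (fun ω => 2 * (Z ω * star (D ω)).re) P := iZD.re.const_mul 2
      have i12 : Integrable (fun ω => ‖Z ω‖ ^ 2 + ‖D ω‖ ^ 2) P := i1.add i2
      rw [integral_add i12 i3, integral_add i1 i2, integral_const_mul, hre,
        splitR (fun i k => ‖A i k‖ ^ 2)]
      linarith

/-- The diagonal part of a quadratic form, by truncation at level `τ`. -/
lemma diag_first_moment {x : ι → Ω → ℂ} (hI : iIndepFun x P)
    (hL : ∀ i, MemLp (x i) 2 P) (hm : ∀ i, Measurable (x i))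
    (h1 : ∀ i, ∫ ω, ‖x i ω‖ ^ 2 ∂P = 1) (b : ι → ℂ) {a τ : ℝ} (hb : ∀ i, ‖b i‖ ≤ a)
    (ha : 0 ≤ a) (hτ : 0 ≤ τ) :
    ∫ ω, ‖∑ i, b i * ((‖x i ω‖ ^ 2 - 1 : ℝ) : ℂ)‖ ∂P ≤
      a * (τ * √(Fintype.card ι) + 2 * ∑ i, ∫ ω in {ω | τ ≤ ‖x i ω‖}, ‖x i ω‖ ^ 2 ∂P) := by
  have hset : ∀ i, MeasurableSet {ω | τ ≤ ‖x i ω‖} := fun i =>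
    measurableSet_le measurable_const (hm i).norm
  have hsq : ∀ i, Integrable (fun ω => ‖x i ω‖ ^ 2) P := fun i => (hL i).integrable_norm_pow'
  -- The part `r` above the level is controlled only in mean. The part `y` below it satisfies E y² ≤
  -- τ² E|x|² = τ², so orthogonality gives its centred sum a square-root bound.
  set r : ι → Ω → ℝ := fun i => {ω | τ ≤ ‖x i ω‖}.indicator (fun ω => ‖x i ω‖ ^ 2) with hr
  set φ : ℂ → ℝ := fun w => if τ ≤ ‖w‖ then 0 else ‖w‖ ^ 2 with hφ
  have hφm : Measurable φ := Measurable.ite (measurableSet_le measurable_const measurable_norm)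
    measurable_const (by fun_prop)
  set y : ι → Ω → ℝ := fun i ω => φ (x i ω) with hy
  have hyr : ∀ i ω, ‖x i ω‖ ^ 2 = y i ω + r i ω := by
    intro i ω
    by_cases h : τ ≤ ‖x i ω‖ <;> simp [hy, hr, hφ, h]
  have hri : ∀ i, Integrable (r i) P := fun i => (hsq i).indicator (hset i)
  have hyi : ∀ i, Integrable (y i) P := by
    intro i
    refine ((hsq i).sub (hri i)).congr (ae_of_all _ fun ω => ?_)
    simp [hyr i ω]
  have hym : ∀ i, Measurable (y i) := fun i => hφm.comp (hm i)
  have hybd : ∀ i ω, 0 ≤ y i ω ∧ y i ω ^ 2 ≤ τ ^ 2 * ‖x i ω‖ ^ 2 := by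
    intro i ω
    by_cases h : τ ≤ ‖x i ω‖
    · simp only [hy, hφ, h, if_true]
      exact ⟨le_rfl, by rw [zero_pow two_ne_zero]; positivity⟩
    · simp only [hy, hφ, h, if_false]
      refine ⟨by positivity, ?_⟩
      have : ‖x i ω‖ ^ 2 ≤ τ ^ 2 := by
        gcongr
        exact (not_le.1 h).le
      nlinarith [sq_nonneg ‖x i ω‖]
  have hy2 : ∀ i, MemLp (y i) 2 P := by
    intro i
    refine (memLp_two_iff_integrable_sq (hym i).aestronglyMeasurable).2 ?_
    refine Integrable.mono' ((hsq i).const_mul (τ ^ 2)) (by fun_prop) (ae_of_all _ fun ω => ?_)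
    rw [Real.norm_eq_abs, abs_of_nonneg (sq_nonneg _)]
    exact (hybd i ω).2
  set ey : ι → ℝ := fun i => ∫ ω, y i ω ∂P
  set er : ι → ℝ := fun i => ∫ ω, r i ω ∂P
  have hey : ∀ i, 1 = ey i + er i := by
    intro i
    rw [← h1 i]
    simp_rw [hyr i]
    exact integral_add (hyi i) (hri i)
  have hrn : ∀ i ω, 0 ≤ r i ω := fun i ω => Set.indicator_nonneg (fun _ _ => by positivity) _
  have hern : ∀ i, 0 ≤ er i := fun i => integral_nonneg (hrn i)
  set ξ : ι → Ω → ℂ := fun i ω => ((y i ω - ey i : ℝ) : ℂ) with hξ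
  have hξL : ∀ i, MemLp (ξ i) 2 P := fun i => ((hy2 i).sub (memLp_const (ey i))).ofReal
  have hξ0 : ∀ i, ∫ ω, ξ i ω ∂P = 0 := by
    intro i
    simp only [hξ]
    rw [integral_complex_ofReal, integral_sub (hyi i) (integrable_const _)]
    simp [ey]
  have hξI : Pairwise fun i j => IndepFun (ξ i) (ξ j) P := by
    intro i j h
    exact (hI.indepFun h).comp (φ := fun w => ((φ w - ey i : ℝ) : ℂ))
      (ψ := fun w => ((φ w - ey j : ℝ) : ℂ)) (by fun_prop) (by fun_prop)
  have hξ2 : ∀ i, ∫ ω, ‖ξ i ω‖ ^ 2 ∂P ≤ τ ^ 2 := by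
    intro i
    have e1 : ∫ ω, ‖ξ i ω‖ ^ 2 ∂P = Var[y i; P] := by
      rw [variance_eq_integral (hym i).aemeasurable]
      congr 1
      ext ω
      simp only [hξ, Complex.norm_real, Real.norm_eq_abs, sq_abs]
      rfl
    rw [e1]
    refine (variance_le_expectation_sq (hym i).aestronglyMeasurable).trans ?_
    calc ∫ ω, (y i ^ 2) ω ∂P ≤ ∫ ω, τ ^ 2 * ‖x i ω‖ ^ 2 ∂P :=
          integral_mono (hy2 i).integrable_sq ((hsq i).const_mul _) fun ω => (hybd i ω).2
      _ = τ ^ 2 := by rw [integral_const_mul, h1 i, mul_one]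
  have hsumL : MemLp (fun ω => ∑ i, b i * ξ i ω) 2 P :=
    memLp_finsetSum _ fun i _ => (hξL i).const_mul _
  have hmain : ∫ ω, ‖∑ i, b i * ξ i ω‖ ∂P ≤ a * (τ * √(Fintype.card ι)) := by
    refine (integral_norm_le_sqrt hsumL).trans ?_
    rw [integral_norm_sq_sum hξL hξI hξ0 b Finset.univ]
    apply Real.sqrt_le_iff.2
    refine ⟨by positivity, ?_⟩
    calc ∑ i, ‖b i‖ ^ 2 * ∫ ω, ‖ξ i ω‖ ^ 2 ∂P ≤ ∑ _i : ι, a ^ 2 * τ ^ 2 := by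
          refine Finset.sum_le_sum fun i _ => ?_
          have := hb i
          have h0 := norm_nonneg (b i)
          have h2 := hξ2 i
          gcongr
      _ = (a * (τ * √(Fintype.card ι))) ^ 2 := by
          rw [Finset.sum_const, Finset.card_univ, nsmul_eq_mul, mul_pow, mul_pow,
            Real.sq_sqrt (Nat.cast_nonneg _)]
          ring
  have hrem : ∀ i, Integrable (fun ω => r i ω + er i) P := fun i =>
    (hri i).add (integrable_const _)
  calc ∫ ω, ‖∑ i, b i * ((‖x i ω‖ ^ 2 - 1 : ℝ) : ℂ)‖ ∂P
      ≤ ∫ ω, (‖∑ i, b i * ξ i ω‖ + a * ∑ i, (r i ω + er i)) ∂P := by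
        refine integral_mono_of_nonneg (ae_of_all _ fun ω => norm_nonneg _) ?_
          (ae_of_all _ fun ω => ?_)
        · exact (hsumL.integrable (by norm_num)).norm.add
            ((integrable_finsetSum _ fun i _ => hrem i).const_mul a)
        · have : ∑ i, b i * ((‖x i ω‖ ^ 2 - 1 : ℝ) : ℂ) =
              ∑ i, b i * ξ i ω + ∑ i, b i * ((r i ω - er i : ℝ) : ℂ) := by
            rw [← Finset.sum_add_distrib]
            refine Finset.sum_congr rfl fun i _ => ?_
            rw [← mul_add, hyr i ω, hey i, hξ]
            push_cast
            ring
          simp only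
          rw [this]
          refine (norm_add_le _ _).trans (add_le_add le_rfl ?_)
          rw [Finset.mul_sum]
          refine (norm_sum_le _ _).trans (Finset.sum_le_sum fun i _ => ?_)
          rw [norm_mul, Complex.norm_real, Real.norm_eq_abs]
          refine mul_le_mul (hb i) ?_ (abs_nonneg _) ha
          rw [abs_le]
          constructor <;> linarith [hrn i ω, hern i]
    _ = ∫ ω, ‖∑ i, b i * ξ i ω‖ ∂P + a * ∑ i, 2 * er i := by
        rw [integral_add (hsumL.integrable (by norm_num)).norm
            ((integrable_finsetSum _ fun i _ => hrem i).const_mul a), integral_const_mul,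
          integral_finsetSum _ fun i _ => hrem i]
        congr 2
        refine Finset.sum_congr rfl fun i _ => ?_
        rw [integral_add (hri i) (integrable_const _)]
        simp [er]
        ring
    _ ≤ _ := by
        have her : ∀ i, er i = ∫ ω in {ω | τ ≤ ‖x i ω‖}, ‖x i ω‖ ^ 2 ∂P := fun i =>
          integral_indicator (hset i)
        simp_rw [her] at *
        rw [← Finset.mul_sum, mul_add a]
        linarith

/-- Concentration of a quadratic form in independent standardized variables, in first mean. -/
lemma quadForm_first_moment {x : ι → Ω → ℂ} (hI : iIndepFun x P)
    (hL : ∀ i, MemLp (x i) 2 P) (hm : ∀ i, Measurable (x i)) (h0 : ∀ i, ∫ ω, x i ω ∂P = 0)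
    (h1 : ∀ i, ∫ ω, ‖x i ω‖ ^ 2 ∂P = 1) (A : Matrix ι ι ℂ) {a τ : ℝ} (ha : 0 ≤ a) (hτ : 0 ≤ τ)
    (hA : ∀ i, ∑ k, ‖A i k‖ ^ 2 ≤ a ^ 2) :
    ∫ ω, ‖star (fun i => x i ω) ⬝ᵥ A *ᵥ (fun i => x i ω) - A.trace‖ ∂P ≤
      a * ((2 + τ) * √(Fintype.card ι) +
        2 * ∑ i, ∫ ω in {ω | τ ≤ ‖x i ω‖}, ‖x i ω‖ ^ 2 ∂P) := by
  obtain ⟨oL, o2⟩ := offDiag_second_moment hm hI hL h0 h1 A Finset.univ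
  have hd := diag_first_moment hI hL hm h1 (fun i => A i i) (a := a) (τ := τ) (fun i => by
    refine abs_le_of_sq_le_sq' ?_ ha |>.2
    exact (Finset.single_le_sum (f := fun k => ‖A i k‖ ^ 2) (fun _ _ => by positivity)
      (Finset.mem_univ i)).trans (hA i)) ha hτ
  have ho : ∫ ω, ‖∑ i, ∑ k ∈ Finset.univ.erase i, star (x i ω) * A i k * x k ω‖ ∂P ≤
      a * (2 * √(Fintype.card ι)) := by
    refine (integral_norm_le_sqrt oL).trans (Real.sqrt_le_iff.2 ⟨by positivity, o2.trans ?_⟩)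
    calc 2 * ∑ i, ∑ k ∈ Finset.univ.erase i, ‖A i k‖ ^ 2 ≤ 2 * ∑ _i : ι, a ^ 2 := by
          gcongr with i
          exact (Finset.sum_le_sum_of_subset_of_nonneg (Finset.erase_subset _ _)
            (fun _ _ _ => by positivity)).trans (hA i)
      _ ≤ _ := by
          rw [Finset.sum_const, Finset.card_univ, nsmul_eq_mul, mul_pow, mul_pow,
            Real.sq_sqrt (Nat.cast_nonneg _)]
          nlinarith [mul_nonneg (Nat.cast_nonneg (α := ℝ) (Fintype.card ι)) (sq_nonneg a)]
  have hdi : Integrable (fun ω => ∑ i, A i i * ((‖x i ω‖ ^ 2 - 1 : ℝ) : ℂ)) P :=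
    integrable_finsetSum _ fun i _ =>
      (((hL i).integrable_norm_pow'.sub (integrable_const (1 : ℝ))).ofReal).const_mul _
  have hoi : Integrable
      (fun ω => ∑ i, ∑ k ∈ Finset.univ.erase i, star (x i ω) * A i k * x k ω) P :=
    oL.integrable (by norm_num)
  have hdec : ∀ ω, star (fun i => x i ω) ⬝ᵥ A *ᵥ (fun i => x i ω) - A.trace =
      ∑ i, ∑ k ∈ Finset.univ.erase i, star (x i ω) * A i k * x k ω +
      ∑ i, A i i * ((‖x i ω‖ ^ 2 - 1 : ℝ) : ℂ) := by
    intro ω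
    simp only [dotProduct, Matrix.mulVec, Matrix.trace, Matrix.diag, Pi.star_apply]
    rw [← Finset.sum_add_distrib, ← Finset.sum_sub_distrib]
    refine Finset.sum_congr rfl fun i _ => ?_
    rw [← Finset.add_sum_erase _ _ (Finset.mem_univ i), mul_add, Finset.mul_sum]
    have : ((‖x i ω‖ ^ 2 - 1 : ℝ) : ℂ) = star (x i ω) * x i ω - 1 := by
      have h := Complex.conj_mul' (x i ω)
      push_cast
      rw [← h]
      rfl
    rw [this]
    simp_rw [mul_assoc]
    ring
  simp_rw [hdec]
  calc _ ≤ ∫ ω, (‖∑ i, ∑ k ∈ Finset.univ.erase i, star (x i ω) * A i k * x k ω‖ +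
        ‖∑ i, A i i * ((‖x i ω‖ ^ 2 - 1 : ℝ) : ℂ)‖) ∂P :=
        integral_mono (hoi.add hdi).norm (hoi.norm.add hdi.norm) fun ω => norm_add_le _ _
    _ ≤ _ := by
        rw [integral_add hoi.norm hdi.norm]
        linarith

end QuadraticForms


/-! ### Resolvents of Hermitian matrices and rank one updates -/

section Resolvents

open scoped Matrix.Norms.L2Operator

set_option linter.unusedDecidableInType false

variable {ι κ : Type*} [Fintype ι] [DecidableEq ι] [Fintype κ] [DecidableEq κ]

/-- The Euclidean norm of a complex vector. -/
noncomputable def vnorm {ι : Type*} [Fintype ι] (u : ι → ℂ) : ℝ := ‖WithLp.toLp 2 u‖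

lemma vnorm_nonneg (u : ι → ℂ) : 0 ≤ vnorm u := norm_nonneg _

lemma vnorm_sq (u : ι → ℂ) : vnorm u ^ 2 = ∑ i, ‖u i‖ ^ 2 := by
  rw [vnorm, EuclideanSpace.norm_sq_eq]

lemma star_dotProduct_self (u : ι → ℂ) : star u ⬝ᵥ u = ((vnorm u ^ 2 : ℝ) : ℂ) := by
  rw [vnorm_sq]
  push_cast
  refine Finset.sum_congr rfl fun i _ => ?_
  rw [Pi.star_apply, ← Complex.conj_mul']
  rfl

lemma star_dotProduct_comm (u v : ι → ℂ) : star u ⬝ᵥ v = star (star v ⬝ᵥ u) := by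
  simp [dotProduct, mul_comm]

lemma norm_star_dotProduct_le (u v : ι → ℂ) : ‖star u ⬝ᵥ v‖ ≤ vnorm u * vnorm v := by
  have h := norm_inner_le_norm (𝕜 := ℂ) (WithLp.toLp 2 u) (WithLp.toLp 2 v)
  rw [EuclideanSpace.inner_toLp_toLp, dotProduct_comm] at h
  exact h

lemma vnorm_mulVec_le (M : Matrix κ ι ℂ) (u : ι → ℂ) : vnorm (M *ᵥ u) ≤ ‖M‖ * vnorm u :=
  Matrix.l2_opNorm_mulVec M (WithLp.toLp 2 u)

lemma norm_bilin_le (u : κ → ℂ) (M : Matrix κ ι ℂ) (v : ι → ℂ) :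
    ‖star u ⬝ᵥ M *ᵥ v‖ ≤ ‖M‖ * vnorm u * vnorm v := by
  calc _ ≤ vnorm u * vnorm (M *ᵥ v) := norm_star_dotProduct_le _ _
    _ ≤ vnorm u * (‖M‖ * vnorm v) := by
      gcongr
      · exact vnorm_nonneg _
      · exact vnorm_mulVec_le _ _
    _ = _ := by ring

lemma opNorm_le_of_vnorm_le {M : Matrix κ ι ℂ} {a : ℝ} (ha : 0 ≤ a)
    (h : ∀ u, vnorm (M *ᵥ u) ≤ a * vnorm u) : ‖M‖ ≤ a := by
  rw [Matrix.l2_opNorm_def]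
  exact ContinuousLinearMap.opNorm_le_bound _ ha fun u => h u.ofLp

lemma vnorm_single (i : ι) : vnorm (Pi.single i (1 : ℂ)) = 1 := by
  have h := vnorm_sq (Pi.single i (1 : ℂ) : ι → ℂ)
  have h2 : ∑ k, ‖(Pi.single i (1 : ℂ) : ι → ℂ) k‖ ^ 2 = 1 := by
    rw [Finset.sum_eq_single i] <;> simp +contextual
  rw [h2] at h
  exact (pow_eq_one_iff_of_nonneg (vnorm_nonneg _) two_ne_zero).1 h

lemma vnorm_add_le (u v : ι → ℂ) : vnorm (u + v) ≤ vnorm u + vnorm v :=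
  norm_add_le (WithLp.toLp 2 u) (WithLp.toLp 2 v)

lemma star_single_dotProduct (i : ι) (v : ι → ℂ) :
    star (Pi.single i (1 : ℂ)) ⬝ᵥ v = v i := by
  rw [← Pi.single_star, star_one, single_one_dotProduct]

lemma norm_entry_le (M : Matrix κ ι ℂ) (i : κ) (j : ι) : ‖M i j‖ ≤ ‖M‖ := by
  have h := norm_bilin_le (Pi.single i (1 : ℂ)) M (Pi.single j 1)
  rw [star_single_dotProduct, vnorm_single, vnorm_single] at h
  simpa using h

lemma sum_row_norm_sq_le (M : Matrix κ ι ℂ) (i : κ) : ∑ j, ‖M i j‖ ^ 2 ≤ ‖M‖ ^ 2 := by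
  have h := vnorm_mulVec_le Mᴴ (Pi.single i (1 : ℂ))
  rw [vnorm_single, mul_one, Matrix.l2_opNorm_conjTranspose] at h
  have h2 := vnorm_sq (Mᴴ *ᵥ (Pi.single i (1 : ℂ)))
  have h3 : ∑ j, ‖M i j‖ ^ 2 = vnorm (Mᴴ *ᵥ (Pi.single i (1 : ℂ))) ^ 2 := by
    rw [h2]
    simp [Matrix.conjTranspose_apply]
  rw [h3]
  exact pow_le_pow_left₀ (vnorm_nonneg _) h 2

/-- The resolvent `(W - z)⁻¹`. -/
noncomputable def res (W : Matrix ι ι ℂ) (z : ℂ) : Matrix ι ι ℂ := (W - z • 1)⁻¹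

variable {W : Matrix ι ι ℂ} {z : ℂ}

lemma im_quad_sub (hW : W.IsHermitian) (p : ι → ℂ) :
    (star p ⬝ᵥ (W - z • 1) *ᵥ p).im = -z.im * vnorm p ^ 2 := by
  rw [Matrix.sub_mulVec, dotProduct_sub, Matrix.smul_mulVec, Matrix.one_mulVec, dotProduct_smul,
    star_dotProduct_self]
  have h : (star p ⬝ᵥ W *ᵥ p).im = 0 := by
    have := hW.im_star_dotProduct_mulVec_self p
    simpa using this
  rw [Complex.sub_im, h, smul_eq_mul, Complex.im_mul_ofReal]
  ring

/-- The quadratic form of a Hermitian matrix is real, so that of W - z has imaginary part -Im z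
|p|². This gives both invertibility off the real axis and the norm bound of the resolvent. -/
lemma le_vnorm_sub_mulVec (hW : W.IsHermitian) (p : ι → ℂ) :
    |z.im| * vnorm p ≤ vnorm ((W - z • 1) *ᵥ p) := by
  have h1 := im_quad_sub (z := z) hW p
  have h2 := norm_star_dotProduct_le p ((W - z • 1) *ᵥ p)
  have h3 := Complex.abs_im_le_norm (star p ⬝ᵥ (W - z • 1) *ᵥ p)
  rw [h1, abs_mul, abs_neg, abs_of_nonneg (sq_nonneg (vnorm p))] at h3
  rcases (vnorm_nonneg p).eq_or_lt with h | h
  · rw [← h, mul_zero]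
    exact vnorm_nonneg _
  · have : |z.im| * vnorm p ^ 2 ≤ vnorm p * vnorm ((W - z • 1) *ᵥ p) := h3.trans h2
    nlinarith

lemma isUnit_sub (hW : W.IsHermitian) (hz : z.im ≠ 0) : IsUnit (W - z • 1) := by
  rw [← Matrix.mulVec_injective_iff_isUnit]
  intro p q hpq
  have h := le_vnorm_sub_mulVec (z := z) hW (p - q)
  have h0 : (W - z • 1) *ᵥ (p - q) = 0 := by
    rw [Matrix.mulVec_sub]
    exact sub_eq_zero.2 hpq
  have hv0 : vnorm (0 : ι → ℂ) = 0 := by simp [vnorm]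
  rw [h0, hv0] at h
  have h2 : vnorm (p - q) = 0 := by
    have := abs_pos.2 hz
    nlinarith [vnorm_nonneg (p - q)]
  have h3 : WithLp.toLp 2 (p - q) = 0 := norm_eq_zero.1 h2
  have h4 : p - q = 0 := (WithLp.toLp_eq_zero 2).1 h3
  exact sub_eq_zero.1 h4

lemma sub_mul_res (hW : W.IsHermitian) (hz : z.im ≠ 0) : (W - z • 1) * res W z = 1 :=
  Matrix.mul_nonsing_inv _ ((Matrix.isUnit_iff_isUnit_det _).1 (isUnit_sub hW hz))

lemma res_eq_of_mul {M : Matrix ι ι ℂ} (h : (W - z • 1) * M = 1) : res W z = M :=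
  Matrix.inv_eq_right_inv h

lemma mul_res (hW : W.IsHermitian) (hz : z.im ≠ 0) : W * res W z = 1 + z • res W z := by
  have h := sub_mul_res hW hz
  rw [Matrix.sub_mul, Matrix.smul_mul, Matrix.one_mul] at h
  rw [← h]
  abel

lemma vnorm_res_mulVec_le (hW : W.IsHermitian) (hz : 0 < z.im) (u : ι → ℂ) :
    vnorm (res W z *ᵥ u) ≤ 1 / z.im * vnorm u := by
  have h := le_vnorm_sub_mulVec (z := z) hW (res W z *ᵥ u)
  rw [Matrix.mulVec_mulVec, sub_mul_res hW hz.ne', Matrix.one_mulVec, abs_of_pos hz] at h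
  rw [one_div, inv_mul_eq_div, le_div_iff₀ hz]
  linarith

lemma norm_res_le (hW : W.IsHermitian) (hz : 0 < z.im) : ‖res W z‖ ≤ 1 / z.im :=
  opNorm_le_of_vnorm_le (by positivity) (vnorm_res_mulVec_le hW hz)

lemma im_bilin_res (hW : W.IsHermitian) (hz : z.im ≠ 0) (u : ι → ℂ) :
    (star u ⬝ᵥ res W z *ᵥ u).im = z.im * vnorm (res W z *ᵥ u) ^ 2 := by
  set p := res W z *ᵥ u with hp
  have hu : u = (W - z • 1) *ᵥ p := by
    rw [hp, Matrix.mulVec_mulVec, sub_mul_res hW hz, Matrix.one_mulVec]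
  have h := im_quad_sub (z := z) hW p
  rw [← hu] at h
  rw [star_dotProduct_comm, Complex.star_def, Complex.conj_im, h]
  ring

lemma conjTranspose_res (hW : W.IsHermitian) : (res W z)ᴴ = res W (star z) := by
  rw [res, res, Matrix.conjTranspose_nonsing_inv, Matrix.conjTranspose_sub, hW.eq,
    Matrix.conjTranspose_smul, Matrix.conjTranspose_one]

/-- Normality of the resolvent, read off from `im_bilin_res` at z and at its conjugate. -/
lemma vnorm_conjTranspose_res (hW : W.IsHermitian) (hz : z.im ≠ 0) (u : ι → ℂ) :
    vnorm ((res W z)ᴴ *ᵥ u) = vnorm (res W z *ᵥ u) := by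
  have h1 := im_bilin_res hW hz u
  have h2 := im_bilin_res (z := star z) hW (by simpa using hz) u
  rw [← conjTranspose_res hW] at h2
  have h3 : star u ⬝ᵥ (res W z)ᴴ *ᵥ u = star (star u ⬝ᵥ res W z *ᵥ u) := by
    rw [star_dotProduct_comm, Matrix.star_mulVec, Matrix.conjTranspose_conjTranspose,
      ← Matrix.dotProduct_mulVec]
  rw [h3, Complex.star_def, Complex.conj_im, h1] at h2
  simp only [Complex.conj_im] at h2
  have h4 : vnorm ((res W z)ᴴ *ᵥ u) ^ 2 = vnorm (res W z *ᵥ u) ^ 2 := by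
    have : z.im * vnorm ((res W z)ᴴ *ᵥ u) ^ 2 = z.im * vnorm (res W z *ᵥ u) ^ 2 := by linarith
    exact mul_left_cancel₀ hz this
  exact (sq_eq_sq₀ (vnorm_nonneg _) (vnorm_nonneg _)).1 h4

/-- With p = Q u the imaginary part equals Im z ⟨p, W p⟩; positivity of W, not only symmetry, enters
here. It is what keeps the denominators of rank one updates, and later 1 + δ, away from 0. -/
lemma im_mul_bilin_res (hW : W.PosSemidef) (hz : 0 < z.im) (u : ι → ℂ) :
    0 ≤ (z * (star u ⬝ᵥ res W z *ᵥ u)).im := by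
  have hH := hW.isHermitian
  set p := res W z *ᵥ u with hp
  have hu : u = (W - z • 1) *ᵥ p := by
    rw [hp, Matrix.mulVec_mulVec, sub_mul_res hH hz.ne', Matrix.one_mulVec]
  have hzp : z • p = W *ᵥ p - u := by
    rw [hu, Matrix.sub_mulVec, Matrix.smul_mulVec, Matrix.one_mulVec]
    abel
  have e1 : z * (star u ⬝ᵥ p) = star u ⬝ᵥ (W *ᵥ p) - star u ⬝ᵥ u := by
    rw [← dotProduct_sub, ← hzp, dotProduct_smul, smul_eq_mul]
  have hpos := hW.dotProduct_mulVec_nonneg p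
  obtain ⟨hre, him⟩ := Complex.le_def.1 hpos
  have e2 : star u ⬝ᵥ (W *ᵥ p) = star (W *ᵥ p) ⬝ᵥ (W *ᵥ p) - star z * (star p ⬝ᵥ W *ᵥ p) := by
    rw [hu, Matrix.sub_mulVec, Matrix.smul_mulVec, Matrix.one_mulVec, star_sub, sub_dotProduct,
      star_smul, smul_dotProduct, smul_eq_mul]
  rw [e1, e2, star_dotProduct_self, star_dotProduct_self]
  simp only [Complex.sub_im, Complex.ofReal_im, Complex.mul_im, Complex.star_def, Complex.conj_re,
    Complex.conj_im]
  simp only [Complex.zero_re, Complex.zero_im] at hre him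
  rw [← him]
  nlinarith

lemma im_res_diag (hW : W.IsHermitian) (hz : 0 < z.im) (i : ι) : 0 ≤ (res W z i i).im := by
  have h := im_bilin_res hW hz.ne' (Pi.single i 1)
  rw [star_single_dotProduct, Matrix.mulVec_single_one] at h
  change (res W z i i).im = _ at h
  rw [h]
  positivity

lemma im_mul_res_diag (hW : W.PosSemidef) (hz : 0 < z.im) (i : ι) :
    0 ≤ (z * res W z i i).im := by
  have h := im_mul_bilin_res hW hz (Pi.single i 1)
  rw [star_single_dotProduct, Matrix.mulVec_single_one] at h
  exact h

/-- The denominator in a rank one update stays away from `0`. -/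
lemma le_norm_one_add_bilin (hW : W.PosSemidef) (hz : 0 < z.im) (u : ι → ℂ) :
    z.im / ‖z‖ ≤ ‖1 + star u ⬝ᵥ res W z *ᵥ u‖ := by
  have h := im_mul_bilin_res hW hz u
  have hz0 : 0 < ‖z‖ := norm_pos_iff.2 (by rintro rfl; simp at hz)
  rw [div_le_iff₀ hz0, mul_comm, ← norm_mul]
  refine le_trans ?_ (Complex.abs_im_le_norm _)
  refine le_trans ?_ (le_abs_self _)
  rw [mul_add, mul_one, Complex.add_im]
  linarith

lemma one_add_bilin_ne_zero (hW : W.PosSemidef) (hz : 0 < z.im) (u : ι → ℂ) :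
    1 + star u ⬝ᵥ res W z *ᵥ u ≠ 0 := by
  have hz0 : 0 < ‖z‖ := norm_pos_iff.2 (by rintro rfl; simp at hz)
  have := le_norm_one_add_bilin hW hz u
  exact norm_pos_iff.1 (lt_of_lt_of_le (by positivity) this)

/-- The Sherman–Morrison formula for resolvents. -/
lemma res_add_vecMulVec (hW : W.PosSemidef) (hz : 0 < z.im) (u : ι → ℂ) :
    res (W + Matrix.vecMulVec u (star u)) z = res W z -
      (1 + star u ⬝ᵥ res W z *ᵥ u)⁻¹ •
        Matrix.vecMulVec (res W z *ᵥ u) (star u ᵥ* res W z) := by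
  have h0 := one_add_bilin_ne_zero hW hz u
  set q := star u ⬝ᵥ res W z *ᵥ u with hq
  have h1 := sub_mul_res hW.isHermitian hz.ne'
  apply res_eq_of_mul
  have e : W + Matrix.vecMulVec u (star u) - z • 1 = (W - z • 1) + Matrix.vecMulVec u (star u) := by
    abel
  rw [e, Matrix.add_mul, Matrix.mul_sub, Matrix.mul_sub, h1, Matrix.mul_smul, Matrix.mul_smul,
    Matrix.mul_vecMulVec, Matrix.mulVec_mulVec, h1, Matrix.one_mulVec, Matrix.vecMulVec_mul,
    Matrix.vecMulVec_mul_vecMulVec, ← hq, Matrix.vecMulVec_smul]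
  have : Matrix.vecMulVec u (star u ᵥ* res W z) =
      (1 + q)⁻¹ • Matrix.vecMulVec u (star u ᵥ* res W z) +
      (1 + q)⁻¹ • q • Matrix.vecMulVec u (star u ᵥ* res W z) := by
    rw [smul_smul, ← add_smul, ← mul_one_add, inv_mul_cancel₀ h0, one_smul]
  nth_rw 2 [this]
  abel

lemma res_add_mulVec (hW : W.PosSemidef) (hz : 0 < z.im) (u : ι → ℂ) :
    res (W + Matrix.vecMulVec u (star u)) z *ᵥ u =
      (1 + star u ⬝ᵥ res W z *ᵥ u)⁻¹ • (res W z *ᵥ u) := by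
  have h0 := one_add_bilin_ne_zero hW hz u
  rw [res_add_vecMulVec hW hz, Matrix.sub_mulVec, Matrix.smul_mulVec, Matrix.vecMulVec_mulVec,
    ← Matrix.dotProduct_mulVec]
  set q := star u ⬝ᵥ res W z *ᵥ u with hq
  ext i
  simp only [Pi.sub_apply, Pi.smul_apply, smul_eq_mul, MulOpposite.smul_eq_mul_unop,
    MulOpposite.unop_op]
  field_simp
  ring

/-- A positive rank one perturbation changes the trace of the resolvent by a bounded amount. -/
lemma norm_trace_res_add_sub_le (hW : W.PosSemidef) (hz : 0 < z.im) (u : ι → ℂ) :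
    ‖(res (W + Matrix.vecMulVec u (star u)) z).trace - (res W z).trace‖ ≤ 1 / z.im := by
  have h0 := one_add_bilin_ne_zero hW hz u
  rw [res_add_vecMulVec hW hz, Matrix.trace_sub, Matrix.trace_smul, Matrix.trace_vecMulVec]
  have hH := hW.isHermitian
  rw [sub_sub_cancel_left, norm_neg, smul_eq_mul, norm_mul, norm_inv, inv_mul_eq_div,
    div_le_div_iff₀ (norm_pos_iff.2 h0) hz, one_mul]
  have e : (res W z *ᵥ u) ⬝ᵥ (star u ᵥ* res W z) =
      star ((res W z)ᴴ *ᵥ u) ⬝ᵥ (res W z *ᵥ u) := by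
    rw [Matrix.star_mulVec, Matrix.conjTranspose_conjTranspose, dotProduct_comm]
  rw [e]
  -- By normality the numerator is at most |Qu|², while the imaginary part of the denominator is
  -- exactly Im z |Qu|²; hence a bound free of u.
  have h1 := norm_star_dotProduct_le ((res W z)ᴴ *ᵥ u) (res W z *ᵥ u)
  rw [vnorm_conjTranspose_res hH hz.ne'] at h1
  have h2 := im_bilin_res hH hz.ne' u
  have h3 := Complex.abs_im_le_norm (1 + star u ⬝ᵥ res W z *ᵥ u)
  rw [Complex.add_im, Complex.one_im, zero_add, h2] at h3
  have h4 := le_abs_self (z.im * vnorm (res W z *ᵥ u) ^ 2)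
  nlinarith

end Resolvents


/-! ### The error made by one column -/

section ColumnError

open scoped Matrix.Norms.L2Operator

variable {ι κ : Type*} [Fintype ι] [DecidableEq ι] [Fintype κ] [DecidableEq κ]

/-- The contribution of one column `y = a + w` to the approximate equation; `Q` is the full
resolvent, `G` the one without this column. -/
noncomputable def colErr (Q G C : Matrix ι ι ℂ) (a y : ι → ℂ) (δ τ : ℂ) : ℂ :=
  star y ⬝ᵥ Q *ᵥ C *ᵥ y - (1 + star y ⬝ᵥ G *ᵥ y)⁻¹ * τ - (1 + δ)⁻¹ * (star a ⬝ᵥ Q *ᵥ C *ᵥ a)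

/-- With the factors T and C the cancellation behind `norm_trace_res_add_sub_le` is lost. A bound
proportional to |y|² is enough, since this difference is later divided by N. -/
lemma norm_trace_res_diff_le {W : Matrix ι ι ℂ} {z : ℂ} (hW : W.PosSemidef) (hz : 0 < z.im)
    (y : ι → ℂ) (T C : Matrix ι ι ℂ) {K : ℝ} (hT : ‖T‖ ≤ K) (hC : ‖C‖ ≤ 1) :
    ‖(T * res (W + Matrix.vecMulVec y (star y)) z * C).trace - (T * res W z * C).trace‖ ≤
      ‖z‖ / z.im * K / z.im ^ 2 * vnorm y ^ 2 := by
  have h0 := one_add_bilin_ne_zero hW hz y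
  have hb := le_norm_one_add_bilin hW hz y
  have hG := norm_res_le hW.isHermitian hz
  have hz0 : 0 < ‖z‖ := norm_pos_iff.2 (by rintro rfl; simp at hz)
  have hK : 0 ≤ K := (norm_nonneg _).trans hT
  set q := star y ⬝ᵥ res W z *ᵥ y
  have e : (T * res (W + Matrix.vecMulVec y (star y)) z * C).trace - (T * res W z * C).trace =
      -((1 + q)⁻¹ * (star y ⬝ᵥ (res W z * C * T * res W z) *ᵥ y)) := by
    rw [res_add_vecMulVec hW hz, Matrix.mul_sub, Matrix.sub_mul, Matrix.trace_sub,
      sub_sub_cancel_left, Matrix.mul_smul, Matrix.smul_mul, Matrix.trace_smul, smul_eq_mul,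
      Matrix.mul_vecMulVec, Matrix.vecMulVec_mul, Matrix.trace_vecMulVec,
      dotProduct_comm (T *ᵥ _), ← Matrix.dotProduct_mulVec, ← Matrix.dotProduct_mulVec, Matrix.mulVec_mulVec,
      Matrix.mulVec_mulVec, Matrix.mulVec_mulVec]
  rw [e, norm_neg, norm_mul, norm_inv]
  have h1 : ‖1 + q‖⁻¹ ≤ ‖z‖ / z.im := by
    rw [← inv_div]
    exact inv_anti₀ (by positivity) hb
  have h2 : ‖res W z * C * T * res W z‖ ≤ K / z.im ^ 2 := by
    calc _ ≤ ‖res W z‖ * ‖C‖ * ‖T‖ * ‖res W z‖ :=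
          (norm_mul_le _ _).trans (by gcongr; exact (norm_mul_le _ _).trans (by
            gcongr; exact norm_mul_le _ _))
      _ ≤ (1 / z.im) * 1 * K * (1 / z.im) := by gcongr
      _ = _ := by field_simp
  have h3 := norm_bilin_le y (res W z * C * T * res W z) y
  calc _ ≤ ‖z‖ / z.im * (K / z.im ^ 2 * vnorm y * vnorm y) := by
        gcongr
        refine h3.trans ?_
        have := vnorm_nonneg y
        gcongr
    _ = _ := by ring

/-- Sherman–Morrison replaces the full resolvent by G, which does not involve the column. After
multiplication by 1 + δ the main terms cancel: every remaining product contains a form linear in the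
noise w, or a quadratic form in w minus its intended value δ or τ. -/
lemma colErr_eq {W : Matrix ι ι ℂ} {z : ℂ} (hW : W.PosSemidef) (hz : 0 < z.im)
    (a w : ι → ℂ) (C : Matrix ι ι ℂ) {δ τ : ℂ} (hδ : 1 + δ ≠ 0) :
    let G := res W z
    let y := a + w
    (1 + δ) * colErr (res (W + Matrix.vecMulVec y (star y)) z) G C a y δ τ =
      (1 + star y ⬝ᵥ G *ᵥ y)⁻¹ * ((1 + δ) * (star w ⬝ᵥ (G * C) *ᵥ a + star a ⬝ᵥ (G * C) *ᵥ w +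
        (star w ⬝ᵥ (G * C) *ᵥ w - τ)) + (star a ⬝ᵥ G *ᵥ a) * (star w ⬝ᵥ (G * C) *ᵥ a) +
        (star a ⬝ᵥ G *ᵥ w) * (star w ⬝ᵥ (G * C) *ᵥ a) -
        (star a ⬝ᵥ (G * C) *ᵥ a) * (star w ⬝ᵥ G *ᵥ a + (star w ⬝ᵥ G *ᵥ w - δ))) := by
  intro G y
  have h0 := one_add_bilin_ne_zero hW hz y
  have hQ : ∀ u v : ι → ℂ, star u ⬝ᵥ res (W + Matrix.vecMulVec y (star y)) z *ᵥ C *ᵥ v =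
      star u ⬝ᵥ (G * C) *ᵥ v -
        (1 + star y ⬝ᵥ G *ᵥ y)⁻¹ * (star u ⬝ᵥ G *ᵥ y) * (star y ⬝ᵥ (G * C) *ᵥ v) := by
    intro u v
    rw [res_add_vecMulVec hW hz, Matrix.sub_mulVec, dotProduct_sub, Matrix.smul_mulVec,
      dotProduct_smul, Matrix.vecMulVec_mulVec, ← Matrix.dotProduct_mulVec, Matrix.mulVec_mulVec,
      dotProduct_smul]
    simp only [smul_eq_mul, MulOpposite.smul_eq_mul_unop, MulOpposite.unop_op, G]
    ring
  rw [colErr, hQ, hQ]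
  have hy : star y = star a + star w := star_add a w
  have ey : star y ⬝ᵥ G *ᵥ y = star a ⬝ᵥ G *ᵥ a + star a ⬝ᵥ G *ᵥ w + star w ⬝ᵥ G *ᵥ a +
      star w ⬝ᵥ G *ᵥ w := by
    rw [hy, Matrix.mulVec_add, add_dotProduct, dotProduct_add, dotProduct_add]
    ring
  have eyC : star y ⬝ᵥ (G * C) *ᵥ y = star a ⬝ᵥ (G * C) *ᵥ a + star a ⬝ᵥ (G * C) *ᵥ w +
      star w ⬝ᵥ (G * C) *ᵥ a + star w ⬝ᵥ (G * C) *ᵥ w := by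
    rw [hy, Matrix.mulVec_add, add_dotProduct, dotProduct_add, dotProduct_add]
    ring
  have eya : star y ⬝ᵥ (G * C) *ᵥ a = star a ⬝ᵥ (G * C) *ᵥ a + star w ⬝ᵥ (G * C) *ᵥ a := by
    rw [hy, add_dotProduct]
  have eay : star a ⬝ᵥ G *ᵥ y = star a ⬝ᵥ G *ᵥ a + star a ⬝ᵥ G *ᵥ w := by
    rw [Matrix.mulVec_add, dotProduct_add]
  change 1 + star y ⬝ᵥ G *ᵥ y ≠ 0 at h0
  rw [eyC, eya, eay]
  rw [ey] at h0 ⊢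
  field_simp
  ring

/-- The traces in δ and τ contain the full resolvent; replacing it by G costs ε each time, and then
all forms in w have coefficients that do not depend on the column. The product of two linear forms
is split into squares so that second moments suffice. -/
lemma norm_colErr_le {W : Matrix ι ι ℂ} {z : ℂ} (hW : W.PosSemidef) (hz : 0 < z.im)
    (a w : ι → ℂ) {T C : Matrix ι ι ℂ} {K N : ℝ} (hT : ‖T‖ ≤ K) (hC : ‖C‖ ≤ 1) (hN : 0 < N)
    (ha : vnorm a ^ 2 ≤ K) :
    let G := res W z
    let y := a + w
    let Q := res (W + Matrix.vecMulVec y (star y)) z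
    let δ := (N : ℂ)⁻¹ * (T * Q).trace
    let Z := ‖z‖ / z.im
    let ε := Z * K / z.im ^ 2 * vnorm y ^ 2 / N
    z.im / ‖z‖ ≤ ‖1 + δ‖ →
    ‖colErr Q G C a y δ ((N : ℂ)⁻¹ * (T * Q * C).trace)‖ ≤
      Z * (‖star w ⬝ᵥ (G * C) *ᵥ a‖ + ‖star a ⬝ᵥ (G * C) *ᵥ w‖ +
        ‖star w ⬝ᵥ (G * C) *ᵥ w - (N : ℂ)⁻¹ * (T * G * C).trace‖ + ε) +
      Z ^ 2 * (K / z.im * ‖star w ⬝ᵥ (G * C) *ᵥ a‖ +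
        (‖star a ⬝ᵥ G *ᵥ w‖ ^ 2 + ‖star w ⬝ᵥ (G * C) *ᵥ a‖ ^ 2) +
        K / z.im * (‖star w ⬝ᵥ G *ᵥ a‖ + ‖star w ⬝ᵥ G *ᵥ w - (N : ℂ)⁻¹ * (T * G).trace‖ + ε)) := by
  intro G y Q δ Z ε hδ
  have hz0 : 0 < ‖z‖ := norm_pos_iff.2 (by rintro rfl; simp at hz)
  have hδ0 : 1 + δ ≠ 0 := norm_pos_iff.1 (lt_of_lt_of_le (by positivity) hδ)
  set τ := (N : ℂ)⁻¹ * (T * Q * C).trace with hτ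
  have hG : ‖G‖ ≤ 1 / z.im := norm_res_le hW.isHermitian hz
  have hGC : ‖G * C‖ ≤ 1 / z.im := by
    calc _ ≤ ‖G‖ * ‖C‖ := norm_mul_le _ _
      _ ≤ 1 / z.im * 1 := by gcongr
      _ = _ := mul_one _
  have hZ : 0 ≤ Z := by positivity
  have hK : 0 ≤ K := (norm_nonneg _).trans hT
  have hβ : ‖(1 + star y ⬝ᵥ G *ᵥ y)⁻¹‖ ≤ Z := by
    rw [norm_inv]
    change _ ≤ ‖z‖ / z.im
    rw [← inv_div]
    exact inv_anti₀ (by positivity) (le_norm_one_add_bilin hW hz y)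
  have hd : ‖(1 + δ)⁻¹‖ ≤ Z := by
    rw [norm_inv]
    change _ ≤ ‖z‖ / z.im
    rw [← inv_div]
    exact inv_anti₀ (by positivity) hδ
  have hNn : ‖(N : ℂ)⁻¹‖ = N⁻¹ := by
    rw [norm_inv, Complex.norm_real, Real.norm_eq_abs, abs_of_pos hN]
  have hτG : ‖τ - (N : ℂ)⁻¹ * (T * G * C).trace‖ ≤ ε := by
    rw [hτ, ← mul_sub, norm_mul, hNn]
    have := norm_trace_res_diff_le hW hz y T C hT hC
    change _ ≤ Z * K / z.im ^ 2 * vnorm y ^ 2 / N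
    rw [div_eq_inv_mul _ N]
    gcongr
  have hone : ‖(1 : Matrix ι ι ℂ)‖ ≤ 1 := opNorm_le_of_vnorm_le zero_le_one (by simp)
  have hδG : ‖δ - (N : ℂ)⁻¹ * (T * G).trace‖ ≤ ε := by
    change ‖(N : ℂ)⁻¹ * (T * Q).trace - (N : ℂ)⁻¹ * (T * G).trace‖ ≤ ε
    rw [← mul_sub, norm_mul, hNn]
    have := norm_trace_res_diff_le hW hz y T 1 hT hone
    rw [Matrix.mul_one, Matrix.mul_one] at this
    change _ ≤ Z * K / z.im ^ 2 * vnorm y ^ 2 / N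
    rw [div_eq_inv_mul _ N]
    gcongr
  have hα : ‖star a ⬝ᵥ G *ᵥ a‖ ≤ K / z.im := by
    refine (norm_bilin_le a G a).trans ?_
    have := vnorm_nonneg a
    calc _ ≤ 1 / z.im * vnorm a * vnorm a := by gcongr
      _ = vnorm a ^ 2 / z.im := by ring
      _ ≤ _ := by gcongr
  have hαC : ‖star a ⬝ᵥ (G * C) *ᵥ a‖ ≤ K / z.im := by
    refine (norm_bilin_le a (G * C) a).trans ?_
    have := vnorm_nonneg a
    calc _ ≤ 1 / z.im * vnorm a * vnorm a := by gcongr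
      _ = vnorm a ^ 2 / z.im := by ring
      _ ≤ _ := by gcongr
  have key := colErr_eq hW hz a w C (τ := τ) hδ0
  simp only at key
  change (1 + δ) * colErr Q G C a y δ τ = _ at key
  set β := (1 + star y ⬝ᵥ G *ᵥ y)⁻¹
  set r3 := star w ⬝ᵥ (G * C) *ᵥ a
  set r4 := star a ⬝ᵥ (G * C) *ᵥ w
  set r1 := star a ⬝ᵥ G *ᵥ w
  set r2 := star w ⬝ᵥ G *ᵥ a
  set kC := star w ⬝ᵥ (G * C) *ᵥ w
  set k := star w ⬝ᵥ G *ᵥ w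
  have e : colErr Q G C a y δ τ = β * (r3 + r4 + (kC - τ)) +
      β * (1 + δ)⁻¹ * ((star a ⬝ᵥ G *ᵥ a) * r3 + r1 * r3 -
        (star a ⬝ᵥ (G * C) *ᵥ a) * (r2 + (k - δ))) := by
    apply mul_left_cancel₀ hδ0
    rw [key]
    field_simp
    ring
  have h1 : ‖kC - τ‖ ≤ ‖kC - (N : ℂ)⁻¹ * (T * G * C).trace‖ + ε := by
    calc _ = ‖(kC - (N : ℂ)⁻¹ * (T * G * C).trace) - (τ - (N : ℂ)⁻¹ * (T * G * C).trace)‖ := by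
          congr 1; ring
      _ ≤ _ := (norm_sub_le _ _).trans (by gcongr)
  have h2 : ‖k - δ‖ ≤ ‖k - (N : ℂ)⁻¹ * (T * G).trace‖ + ε := by
    calc _ = ‖(k - (N : ℂ)⁻¹ * (T * G).trace) - (δ - (N : ℂ)⁻¹ * (T * G).trace)‖ := by
          congr 1; ring
      _ ≤ _ := (norm_sub_le _ _).trans (by gcongr)
  rw [e]
  refine (norm_add_le _ _).trans (add_le_add ?_ ?_)
  · rw [norm_mul]
    refine mul_le_mul hβ ?_ (norm_nonneg _) hZ
    refine (norm_add_le _ _).trans ?_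
    have := norm_add_le r3 r4
    linarith
  · rw [norm_mul, norm_mul, sq]
    refine mul_le_mul (mul_le_mul hβ hd (norm_nonneg _) hZ) ?_ (norm_nonneg _) (by positivity)
    refine (norm_sub_le _ _).trans (add_le_add ((norm_add_le _ _).trans (add_le_add ?_ ?_)) ?_)
    · rw [norm_mul]
      gcongr
    · rw [norm_mul]
      nlinarith [sq_nonneg (‖r1‖ - ‖r3‖), sq_nonneg ‖r1‖, sq_nonneg ‖r3‖]
    · rw [norm_mul]
      refine mul_le_mul hαC ?_ (norm_nonneg _) (by positivity)
      refine (norm_add_le _ _).trans ?_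
      linarith

end ColumnError

/-! ### Gram matrices, trace functionals and the averaged identity -/

section Columns

variable {ι κ : Type*} [Fintype ι] [DecidableEq ι] [Fintype κ] [DecidableEq κ]

/-- The Gram matrix `∑ j, yⱼ yⱼᴴ` of the columns with index in `S`. -/
noncomputable def gram (y : κ → ι → ℂ) (S : Finset κ) : Matrix ι ι ℂ :=
  ∑ j ∈ S, Matrix.vecMulVec (y j) (star (y j))

lemma gram_posSemidef (y : κ → ι → ℂ) (S : Finset κ) : (gram y S).PosSemidef :=
  Matrix.posSemidef_sum _ fun j _ => Matrix.posSemidef_vecMulVec_self_star (y j)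

lemma gram_insert (y : κ → ι → ℂ) {S : Finset κ} {j : κ} (hj : j ∉ S) :
    gram y (insert j S) = gram y S + Matrix.vecMulVec (y j) (star (y j)) := by
  rw [gram, Finset.sum_insert hj, add_comm]
  rfl

lemma gram_erase (y : κ → ι → ℂ) (j : κ) :
    gram y Finset.univ = gram y (Finset.univ.erase j) + Matrix.vecMulVec (y j) (star (y j)) := by
  rw [← gram_insert y (Finset.notMem_erase j _), Finset.insert_erase (Finset.mem_univ j)]

lemma trace_gram_mul (y : κ → ι → ℂ) (S : Finset κ) (M : Matrix ι ι ℂ) :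
    (gram y S * M).trace = ∑ j ∈ S, star (y j) ⬝ᵥ M *ᵥ y j := by
  rw [gram, Finset.sum_mul, Matrix.trace_sum]
  refine Finset.sum_congr rfl fun j _ => ?_
  rw [Matrix.vecMulVec_mul, Matrix.trace_vecMulVec, dotProduct_comm, Matrix.dotProduct_mulVec]

lemma norm_trace_gram_sub_le (y : κ → ι → ℂ) {z : ℂ} (hz : 0 < z.im) (S D : Finset κ)
    (h : Disjoint S D) :
    ‖(res (gram y (S ∪ D)) z).trace - (res (gram y S) z).trace‖ ≤ D.card / z.im := by
  induction D using Finset.induction_on with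
  | empty => simp
  | insert p D hp ih =>
    rw [Finset.disjoint_insert_right] at h
    have ih := ih h.2
    have hp2 : p ∉ S ∪ D := by simp [h.1, hp]
    rw [Finset.union_insert, gram_insert y hp2, Finset.card_insert_of_notMem hp]
    have h1 := norm_trace_res_add_sub_le (gram_posSemidef y (S ∪ D)) hz (y p)
    calc _ ≤ _ := norm_sub_le_norm_sub_add_norm_sub _ (res (gram y (S ∪ D)) z).trace _
      _ ≤ 1 / z.im + D.card / z.im := add_le_add h1 ih
      _ = _ := by push_cast; ring

variable (a w : κ → ι → ℂ) (s t : ι → ℝ) (z : ℂ) (N : ℝ)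

/-- The trace functional `N⁻¹ tr (T Q)`. -/
noncomputable def deltaN (y : κ → ι → ℂ) : ℂ :=
  (N : ℂ)⁻¹ * (Matrix.diagonal (fun i => (t i : ℂ)) * res (gram y Finset.univ) z).trace

/-- The Stieltjes transform of the companion matrix, in terms of the resolvent. -/
noncomputable def mN (y : κ → ι → ℂ) : ℂ :=
  (N : ℂ)⁻¹ * (res (gram y Finset.univ) z).trace - (1 - (Fintype.card ι : ℂ) / N) / z

/-- The random counterpart of the co-solution: (∗) gives -1/(zg) = 1 - (c/z) ∫ t dH/(1+sg+tm), and δ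
plays the part of the last term. -/
noncomputable def gN (y : κ → ι → ℂ) : ℂ := -1 / (z * (1 + deltaN t z N y))

variable {s t z N}

lemma deltaN_eq (y : κ → ι → ℂ) :
    deltaN t z N y = (N : ℂ)⁻¹ * ∑ i, (t i : ℂ) * res (gram y Finset.univ) z i i := by
  simp [deltaN, Matrix.trace, Matrix.diagonal_mul]

lemma im_deltaN (hz : 0 < z.im) (hN : 0 < N) (ht : ∀ i, 0 ≤ t i) (y : κ → ι → ℂ) :
    0 ≤ (deltaN t z N y).im ∧ 0 ≤ (z * deltaN t z N y).im := by
  rw [deltaN_eq, ← Complex.ofReal_inv]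
  constructor
  · rw [Complex.im_ofReal_mul, Complex.im_sum]
    refine mul_nonneg (by positivity) (Finset.sum_nonneg fun i _ => ?_)
    rw [Complex.im_ofReal_mul]
    exact mul_nonneg (ht i) (im_res_diag (gram_posSemidef y _).isHermitian hz i)
  · rw [mul_left_comm, Complex.im_ofReal_mul, Finset.mul_sum, Complex.im_sum]
    refine mul_nonneg (by positivity) (Finset.sum_nonneg fun i _ => ?_)
    rw [mul_left_comm, Complex.im_ofReal_mul]
    exact mul_nonneg (ht i) (im_mul_res_diag (gram_posSemidef y _) hz i)

lemma le_norm_one_add_deltaN (hz : 0 < z.im) (hN : 0 < N) (ht : ∀ i, 0 ≤ t i) (y : κ → ι → ℂ) :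
    z.im / ‖z‖ ≤ ‖1 + deltaN t z N y‖ := by
  have h := (im_deltaN hz hN ht y).2
  have hz0 : 0 < ‖z‖ := norm_pos_iff.2 (by rintro rfl; simp at hz)
  rw [div_le_iff₀ hz0, mul_comm, ← norm_mul]
  refine le_trans ?_ (Complex.abs_im_le_norm _)
  refine le_trans ?_ (le_abs_self _)
  rw [mul_add, mul_one, Complex.add_im]
  linarith

lemma im_mul_mN (hz : 0 < z.im) (hN : 0 < N) (y : κ → ι → ℂ) :
    0 ≤ (z * mN z N y).im := by
  have hz0 : z ≠ 0 := by rintro rfl; simp at hz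
  have e : z * mN z N y = ((N⁻¹ : ℝ) : ℂ) * ∑ i, z * res (gram y Finset.univ) z i i -
      ((1 - Fintype.card ι / N : ℝ) : ℂ) := by
    rw [mN, mul_sub, mul_div_cancel₀ _ hz0, Matrix.trace, ← Finset.mul_sum]
    push_cast
    simp only [Matrix.diag]
    ring
  rw [e, Complex.sub_im, Complex.ofReal_im, sub_zero, Complex.im_ofReal_mul, Complex.im_sum]
  exact mul_nonneg (by positivity)
    (Finset.sum_nonneg fun i _ => im_mul_res_diag (gram_posSemidef y _) hz i)

/-- The approximate equation, as an average of column errors. -/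
lemma average_eq_sum_colErr (hz : 0 < z.im) (hN : N = Fintype.card κ) (hN0 : 0 < N)
    (ht : ∀ i, 0 ≤ t i) (c : ι → ℂ)
    (hS : gram a Finset.univ = Matrix.diagonal (fun i => (s i : ℂ))) :
    let y := a + w
    let Q := res (gram y Finset.univ) z
    let C := Matrix.diagonal c
    let T := Matrix.diagonal (fun i => (t i : ℂ))
    (N : ℂ)⁻¹ * ∑ i, c i * (z * (1 + t i * mN z N y + s i * gN t z N y) * Q i i + 1) =
      (N : ℂ)⁻¹ * ∑ j, colErr Q (res (gram y (Finset.univ.erase j)) z) C (a j) (y j)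
        (deltaN t z N y) ((N : ℂ)⁻¹ * (T * Q * C).trace) := by
  intro y Q C T
  have hz0 : z ≠ 0 := by rintro rfl; simp at hz
  have hH := (gram_posSemidef y Finset.univ).isHermitian
  have hδ : 1 + deltaN t z N y ≠ 0 := by
    have hz1 : 0 < ‖z‖ := norm_pos_iff.2 hz0
    exact norm_pos_iff.1 (lt_of_lt_of_le (by positivity) (le_norm_one_add_deltaN hz hN0 ht y))
  have hNc : (N : ℂ) ≠ 0 := by exact_mod_cast hN0.ne'
  set τ := (N : ℂ)⁻¹ * (T * Q * C).trace with hτ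
  -- the Gram part
  have t1 : ∑ j, star (y j) ⬝ᵥ Q *ᵥ C *ᵥ y j = ∑ i, c i * (z * Q i i + 1) := by
    simp_rw [Matrix.mulVec_mulVec]
    rw [← trace_gram_mul, ← Matrix.mul_assoc, mul_res hH hz.ne']
    simp only [Matrix.trace, Matrix.diag, C, Matrix.mul_diagonal, Matrix.add_apply,
      Matrix.one_apply_eq, Matrix.smul_apply, smul_eq_mul]
    exact Finset.sum_congr rfl fun i _ => by ring
  -- the companion part
  have hβ : ∀ j, star (y j) ⬝ᵥ Q *ᵥ y j =
      1 - (1 + star (y j) ⬝ᵥ res (gram y (Finset.univ.erase j)) z *ᵥ y j)⁻¹ := by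
    intro j
    have hP := gram_posSemidef y (Finset.univ.erase j)
    have h0 := one_add_bilin_ne_zero hP hz (y j)
    change star (y j) ⬝ᵥ res (gram y Finset.univ) z *ᵥ y j = _
    rw [gram_erase y j, res_add_mulVec hP hz, dotProduct_smul, smul_eq_mul]
    field_simp
    ring
  -- Summing y_jᴴ Q y_j = 1 - 1/(1 + y_jᴴ G_j y_j) and using W Q = 1 + zQ identifies the average of
  -- these reciprocals as -z m_N.
  have t2 : ∑ j, (1 + star (y j) ⬝ᵥ res (gram y (Finset.univ.erase j)) z *ᵥ y j)⁻¹ =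
      -(N * (z * mN z N y)) := by
    have h1 : ∑ j, star (y j) ⬝ᵥ Q *ᵥ y j = Fintype.card ι + z * Q.trace := by
      rw [← trace_gram_mul, mul_res hH hz.ne', Matrix.trace_add, Matrix.trace_one,
        Matrix.trace_smul, smul_eq_mul]
    simp_rw [hβ] at h1
    rw [Finset.sum_sub_distrib] at h1
    simp only [Finset.sum_const, Finset.card_univ, nsmul_eq_mul, mul_one] at h1
    have hNN : (N : ℂ) = (Fintype.card κ : ℂ) := by rw [hN]; simp
    rw [← hNN] at h1
    have e2 : (N : ℂ) * (z * mN z N y) = z * Q.trace - N + Fintype.card ι := by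
      rw [mN]
      field_simp
      ring
    rw [e2]
    linear_combination -h1
  have t3 : ∑ j, star (a j) ⬝ᵥ Q *ᵥ C *ᵥ a j = ∑ i, c i * (s i * Q i i) := by
    simp_rw [Matrix.mulVec_mulVec]
    rw [← trace_gram_mul, hS, ← Matrix.mul_assoc]
    simp only [Matrix.trace, Matrix.diag, C, Matrix.mul_diagonal, Matrix.diagonal_mul]
    exact Finset.sum_congr rfl fun i _ => by ring
  have t4 : N * τ = ∑ i, c i * (t i * Q i i) := by
    rw [hτ, mul_inv_cancel_left₀ hNc]
    simp only [Matrix.trace, Matrix.diag, C, T, Matrix.mul_diagonal, Matrix.diagonal_mul]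
    exact Finset.sum_congr rfl fun i _ => by ring
  -- The definition of `gN` is made for this: the factor of the signal term becomes -z g_N.
  have hg : z * gN t z N y = -(1 + deltaN t z N y)⁻¹ := by
    rw [gN]
    field_simp
  congr 1
  simp only [colErr]
  rw [Finset.sum_sub_distrib, Finset.sum_sub_distrib, ← Finset.sum_mul, ← Finset.mul_sum, t1, t2,
    t3]
  have e3 : -(N * (z * mN z N y)) * τ = -(z * mN z N y) * ∑ i, c i * (t i * Q i i) := by
    rw [← t4]; ring
  rw [e3]
  have e4 : (1 + deltaN t z N y)⁻¹ = -(z * gN t z N y) := by rw [hg, neg_neg]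
  rw [e4, Finset.mul_sum, Finset.mul_sum, ← Finset.sum_sub_distrib, ← Finset.sum_sub_distrib]
  exact Finset.sum_congr rfl fun i _ => by ring

end Columns


/-! ### Moments of the forms in one column -/

section ColumnMoments

open scoped Matrix.Norms.L2Operator

variable {Ω : Type*} [MeasurableSpace Ω] {P : Measure Ω} [IsProbabilityMeasure P]
  {ι κ : Type*} [Fintype ι] [DecidableEq ι] [Fintype κ] [DecidableEq κ]

/-- Integrating out an independent variable. -/
lemma integral_le_of_indep {E F : Type*} [MeasurableSpace E] [MeasurableSpace F]
    {ξ : Ω → E} {ζ : Ω → F} (hξ : Measurable ξ) (hζ : Measurable ζ) (hI : IndepFun ξ ζ P)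
    {f : E × F → ℝ} (hf : Measurable f) (h0 : ∀ p, 0 ≤ f p) {b : ℝ} 
    (h : ∀ e, Integrable (fun ω => f (ξ ω, e)) P ∧ ∫ ω, f (ξ ω, e) ∂P ≤ b) :
    Integrable (fun ω => f (ξ ω, ζ ω)) P ∧ ∫ ω, f (ξ ω, ζ ω) ∂P ≤ b := by
  have hne : Nonempty Ω := P.nonempty_of_neZero
  have hb : 0 ≤ b := (integral_nonneg fun ω => h0 _).trans (h (ζ hne.some)).2
  have key : ∫⁻ ω, ENNReal.ofReal (f (ξ ω, ζ ω)) ∂P ≤ ENNReal.ofReal b := by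
    have hm : Measurable fun p => ENNReal.ofReal (f p) := hf.ennreal_ofReal
    have e1 : ∫⁻ ω, ENNReal.ofReal (f (ξ ω, ζ ω)) ∂P =
        ∫⁻ p, ENNReal.ofReal (f p) ∂(P.map fun ω => (ξ ω, ζ ω)) := by
      rw [lintegral_map hm (hξ.prodMk hζ)]
    rw [e1, (indepFun_iff_map_prod_eq_prod_map_map hξ.aemeasurable hζ.aemeasurable).1 hI]
    have : IsProbabilityMeasure (P.map ζ) := Measure.isProbabilityMeasure_map hζ.aemeasurable
    have : IsProbabilityMeasure (P.map ξ) := Measure.isProbabilityMeasure_map hξ.aemeasurable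
    rw [lintegral_prod_symm _ hm.aemeasurable]
    calc _ ≤ ∫⁻ _e, ENNReal.ofReal b ∂(P.map ζ) := by
          refine lintegral_mono fun e => ?_
          rw [lintegral_map (by fun_prop) hξ,
            ← ofReal_integral_eq_lintegral_ofReal (h e).1 (ae_of_all _ fun ω => h0 _)]
          exact ENNReal.ofReal_le_ofReal (h e).2
      _ = _ := by simp
  have hi : Integrable (fun ω => f (ξ ω, ζ ω)) P := by
    refine ⟨(hf.comp (hξ.prodMk hζ)).aestronglyMeasurable, ?_⟩
    rw [hasFiniteIntegral_iff_ofReal (ae_of_all _ fun ω => h0 _)]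
    exact lt_of_le_of_lt key ENNReal.ofReal_lt_top
  refine ⟨hi, ?_⟩
  rw [← ofReal_integral_eq_lintegral_ofReal hi (ae_of_all _ fun ω => h0 _)] at key
  exact (ENNReal.ofReal_le_ofReal_iff hb).1 key

/-- A random vector with independent standardized coordinates. -/
structure Standardized (P : Measure Ω) (x : ι → Ω → ℂ) : Prop where
  meas : ∀ i, Measurable (x i)
  indep : iIndepFun x P
  memLp : ∀ i, MemLp (x i) 2 P
  mean : ∀ i, ∫ ω, x i ω ∂P = 0
  var : ∀ i, ∫ ω, ‖x i ω‖ ^ 2 ∂P = 1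

variable {x : ι → Ω → ℂ}

lemma Standardized.dotProduct_sq (hx : Standardized P x) (u : ι → ℂ) :
    Integrable (fun ω => ‖u ⬝ᵥ (fun i => x i ω)‖ ^ 2) P ∧
    ∫ ω, ‖u ⬝ᵥ (fun i => x i ω)‖ ^ 2 ∂P = vnorm u ^ 2 := by
  constructor
  · have : MemLp (fun ω => ∑ i, u i * x i ω) 2 P :=
      memLp_finsetSum _ fun i _ => (hx.memLp i).const_mul _
    exact this.integrable_norm_pow'
  · have h := integral_norm_sq_sum hx.memLp (fun i j h => hx.indep.indepFun h) hx.mean u Finset.univ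
    rw [vnorm_sq]
    simpa [hx.var, dotProduct] using h

lemma Standardized.vnorm_sq_integral (hx : Standardized P x) :
    Integrable (fun ω => vnorm (fun i => x i ω) ^ 2) P ∧
    ∫ ω, vnorm (fun i => x i ω) ^ 2 ∂P = Fintype.card ι := by
  simp_rw [vnorm_sq]
  have hi : ∀ i, Integrable (fun ω => ‖x i ω‖ ^ 2) P := fun i => (hx.memLp i).integrable_norm_pow'
  refine ⟨integrable_finsetSum _ fun i _ => hi i, ?_⟩
  rw [integral_finsetSum _ fun i _ => hi i]
  simp [hx.var]

lemma Standardized.quadForm_integrable (hx : Standardized P x) (A : Matrix ι ι ℂ) :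
    Integrable (fun ω => star (fun i => x i ω) ⬝ᵥ A *ᵥ (fun i => x i ω)) P := by
  simp only [dotProduct, Matrix.mulVec, Finset.mul_sum, Pi.star_apply]
  refine integrable_finsetSum _ fun i _ => integrable_finsetSum _ fun k _ => ?_
  have h : Integrable (fun ω => star (x i ω) * x k ω) P :=
    (hx.memLp i).star.integrable_mul (hx.memLp k)
  refine (h.const_mul (A i k)).congr (ae_of_all _ fun ω => ?_)
  simp only
  ring

variable {B M : Matrix ι ι ℂ} {t : ι → ℝ} {K N v : ℝ}

lemma norm_sq_le_of_mul_conjTranspose (hB : B * Bᴴ = Matrix.diagonal (fun i => (t i : ℂ)))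
    (ht : ∀ i, 0 ≤ t i ∧ t i ≤ K) (hK : 0 ≤ K) : ‖B‖ ^ 2 ≤ K := by
  have h := Matrix.l2_opNorm_conjTranspose_mul_self Bᴴ
  rw [Matrix.conjTranspose_conjTranspose, Matrix.l2_opNorm_conjTranspose, hB,
    Matrix.l2_opNorm_diagonal] at h
  rw [sq, ← h, pi_norm_le_iff_of_nonneg hK]
  intro i
  rw [Complex.norm_real, Real.norm_eq_abs, abs_of_nonneg (ht i).1]
  exact (ht i).2

/-- The random part `N^{-1/2} B x` of a column. -/
noncomputable def noise (B : Matrix ι ι ℂ) (N : ℝ) (x : ι → ℂ) : ι → ℂ :=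
  ((√N)⁻¹ : ℂ) • (B *ᵥ x)

lemma noise_bilin_left (hN : 0 < N) (hv : 0 < v) (hx : Standardized P x) (hB : ‖B‖ ^ 2 ≤ K)
    (hM : ‖M‖ ≤ 1 / v) (a : ι → ℂ) (ha : vnorm a ^ 2 ≤ K) :
    Integrable (fun ω => ‖star a ⬝ᵥ M *ᵥ noise B N (fun i => x i ω)‖ ^ 2) P ∧
    ∫ ω, ‖star a ⬝ᵥ M *ᵥ noise B N (fun i => x i ω)‖ ^ 2 ∂P ≤ K ^ 2 / (v ^ 2 * N) := by
  have hK : 0 ≤ K := (sq_nonneg _).trans hB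
  obtain ⟨h1, h2⟩ := hx.dotProduct_sq (star a ᵥ* (M * B))
  have e : ∀ ω, ‖star a ⬝ᵥ M *ᵥ noise B N (fun i => x i ω)‖ ^ 2 =
      N⁻¹ * ‖(star a ᵥ* (M * B)) ⬝ᵥ (fun i => x i ω)‖ ^ 2 := by
    intro ω
    rw [noise, Matrix.mulVec_smul, dotProduct_smul, Matrix.mulVec_mulVec, ← Matrix.dotProduct_mulVec,
      norm_smul, mul_pow, norm_inv, Complex.norm_real, Real.norm_eq_abs, inv_pow, sq_abs,
      Real.sq_sqrt hN.le]
  simp_rw [e]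
  refine ⟨h1.const_mul _, ?_⟩
  rw [integral_const_mul, h2]
  have e2 : vnorm (star a ᵥ* (M * B)) = vnorm ((M * B)ᴴ *ᵥ a) := by
    have : star a ᵥ* (M * B) = star ((M * B)ᴴ *ᵥ a) := by
      rw [Matrix.star_mulVec, Matrix.conjTranspose_conjTranspose]
    rw [this, ← sq_eq_sq₀ (vnorm_nonneg _) (vnorm_nonneg _), vnorm_sq, vnorm_sq]
    simp
  rw [e2]
  have h3 := vnorm_mulVec_le (M * B)ᴴ a
  rw [Matrix.l2_opNorm_conjTranspose] at h3
  have h4 : vnorm ((M * B)ᴴ *ᵥ a) ^ 2 ≤ K ^ 2 / v ^ 2 := by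
    calc _ ≤ (‖M * B‖ * vnorm a) ^ 2 := by
          have := vnorm_nonneg ((M * B)ᴴ *ᵥ a)
          gcongr
      _ ≤ (‖M‖ * ‖B‖ * vnorm a) ^ 2 := by
          have := vnorm_nonneg a
          gcongr
          exact norm_mul_le _ _
      _ = ‖M‖ ^ 2 * ‖B‖ ^ 2 * vnorm a ^ 2 := by ring
      _ ≤ (1 / v) ^ 2 * K * K := by gcongr
      _ = _ := by ring
  calc _ ≤ N⁻¹ * (K ^ 2 / v ^ 2) := by gcongr
    _ = _ := by field_simp

lemma noise_bilin_right (hN : 0 < N) (hv : 0 < v) (hx : Standardized P x) (hB : ‖B‖ ^ 2 ≤ K)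
    (hM : ‖M‖ ≤ 1 / v) (a : ι → ℂ) (ha : vnorm a ^ 2 ≤ K) :
    Integrable (fun ω => ‖star (noise B N (fun i => x i ω)) ⬝ᵥ M *ᵥ a‖ ^ 2) P ∧
    ∫ ω, ‖star (noise B N (fun i => x i ω)) ⬝ᵥ M *ᵥ a‖ ^ 2 ∂P ≤ K ^ 2 / (v ^ 2 * N) := by
  have e : ∀ ω, ‖star (noise B N (fun i => x i ω)) ⬝ᵥ M *ᵥ a‖ =
      ‖star a ⬝ᵥ Mᴴ *ᵥ noise B N (fun i => x i ω)‖ := by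
    intro ω
    rw [star_dotProduct_comm, norm_star, Matrix.star_mulVec, ← Matrix.dotProduct_mulVec]
  simp_rw [e]
  exact noise_bilin_left hN hv hx hB (by rwa [Matrix.l2_opNorm_conjTranspose]) a ha

/-- The form has the matrix N⁻¹ Bᴴ M B in the standardized variables, and tr(Bᴴ M B) = tr(T M)
because B Bᴴ = T; so B enters only through T and its norm. -/
lemma noise_quad (hN : 0 < N) (hv : 0 < v) (hx : Standardized P x)
    (hB : B * Bᴴ = Matrix.diagonal (fun i => (t i : ℂ)))
    (hBK : ‖B‖ ^ 2 ≤ K) (hM : ‖M‖ ≤ 1 / v) {τ : ℝ} (hτ : 0 ≤ τ) :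
    let T := Matrix.diagonal (fun i => (t i : ℂ))
    Integrable (fun ω => ‖star (noise B N (fun i => x i ω)) ⬝ᵥ M *ᵥ noise B N (fun i => x i ω) -
      (N : ℂ)⁻¹ * (T * M).trace‖) P ∧
    ∫ ω, ‖star (noise B N (fun i => x i ω)) ⬝ᵥ M *ᵥ noise B N (fun i => x i ω) -
      (N : ℂ)⁻¹ * (T * M).trace‖ ∂P ≤
      K / v * ((2 + τ) * √(Fintype.card ι) +
        2 * ∑ i, ∫ ω in {ω | τ ≤ ‖x i ω‖}, ‖x i ω‖ ^ 2 ∂P) / N := by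
  intro T
  have hK : 0 ≤ K := (sq_nonneg _).trans hBK
  have e : ∀ ω, star (noise B N (fun i => x i ω)) ⬝ᵥ M *ᵥ noise B N (fun i => x i ω) -
      (N : ℂ)⁻¹ * (T * M).trace = (N : ℂ)⁻¹ * (star (fun i => x i ω) ⬝ᵥ
        (Bᴴ * M * B) *ᵥ (fun i => x i ω) - (Bᴴ * M * B).trace) := by
    intro ω
    have h1 : (Bᴴ * M * B).trace = (T * M).trace := by
      rw [Matrix.trace_mul_comm, ← Matrix.mul_assoc, hB]
    have h2 : ((√N)⁻¹ : ℂ) * ((√N)⁻¹ : ℂ) = (N : ℂ)⁻¹ := by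
      rw [← mul_inv, ← Complex.ofReal_mul, Real.mul_self_sqrt hN.le]
    rw [h1, mul_sub]
    congr 1
    rw [noise, star_smul, Matrix.mulVec_smul, smul_dotProduct, dotProduct_smul, Matrix.star_mulVec,
      ← Matrix.dotProduct_mulVec, Matrix.mulVec_mulVec, Matrix.mulVec_mulVec, smul_smul, ← h2,
      smul_eq_mul]
    simp [mul_assoc]
  have hNn : ‖(N : ℂ)⁻¹‖ = N⁻¹ := by
    rw [norm_inv, Complex.norm_real, Real.norm_eq_abs, abs_of_pos hN]
  simp_rw [e, norm_mul, hNn]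
  have hA : ‖Bᴴ * M * B‖ ≤ K / v := by
    calc _ ≤ ‖Bᴴ‖ * ‖M‖ * ‖B‖ := (norm_mul_le _ _).trans (by gcongr; exact norm_mul_le _ _)
      _ = ‖B‖ ^ 2 * ‖M‖ := by rw [Matrix.l2_opNorm_conjTranspose]; ring
      _ ≤ K * (1 / v) := by gcongr
      _ = _ := by ring
  refine ⟨(((hx.quadForm_integrable _).sub (integrable_const _)).norm).const_mul _, ?_⟩
  rw [integral_const_mul]
  have := quadForm_first_moment hx.indep hx.memLp hx.meas hx.mean hx.var (Bᴴ * M * B)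
    (a := K / v) (τ := τ) (by positivity) hτ fun i => (sum_row_norm_sq_le _ i).trans (by gcongr)
  rw [inv_mul_eq_div]
  gcongr

lemma noise_sq (hN : 0 < N) (hx : Standardized P x) (hBK : ‖B‖ ^ 2 ≤ K) (a : ι → ℂ)
    (ha : vnorm a ^ 2 ≤ K) :
    Integrable (fun ω => vnorm (a + noise B N (fun i => x i ω)) ^ 2) P ∧
    ∫ ω, vnorm (a + noise B N (fun i => x i ω)) ^ 2 ∂P ≤ 2 * (K + K * Fintype.card ι / N) := by
  have hK : 0 ≤ K := (sq_nonneg _).trans hBK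
  obtain ⟨h1, h2⟩ := hx.vnorm_sq_integral
  have hw : ∀ y : ι → ℂ, vnorm (noise B N y) ^ 2 ≤ K / N * vnorm y ^ 2 := by
    intro y
    have h3 : vnorm (noise B N y) = (√N)⁻¹ * vnorm (B *ᵥ y) := by
      rw [noise, vnorm, WithLp.toLp_smul, norm_smul, norm_inv, Complex.norm_real,
        Real.norm_eq_abs, abs_of_nonneg (Real.sqrt_nonneg _)]
      rfl
    rw [h3, mul_pow, inv_pow, Real.sq_sqrt hN.le]
    have h4 := vnorm_mulVec_le B y
    have h5 := vnorm_nonneg (B *ᵥ y)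
    calc _ ≤ N⁻¹ * (‖B‖ * vnorm y) ^ 2 := by gcongr
      _ = N⁻¹ * (‖B‖ ^ 2 * vnorm y ^ 2) := by ring
      _ ≤ N⁻¹ * (K * vnorm y ^ 2) := by gcongr
      _ = _ := by ring
  have hle : ∀ ω, vnorm (a + noise B N (fun i => x i ω)) ^ 2 ≤
      2 * (K + K / N * vnorm (fun i => x i ω) ^ 2) := by
    intro ω
    have h3 := vnorm_add_le a (noise B N (fun i => x i ω))
    have h4 := hw (fun i => x i ω)
    have h5 := vnorm_nonneg (a + noise B N (fun i => x i ω))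
    nlinarith [sq_nonneg (vnorm a - vnorm (noise B N (fun i => x i ω)))]
  have hi : Integrable (fun ω => 2 * (K + K / N * vnorm (fun i => x i ω) ^ 2)) P :=
    ((integrable_const _).add (h1.const_mul _)).const_mul _
  have hmeas : AEStronglyMeasurable (fun ω => vnorm (a + noise B N (fun i => x i ω)) ^ 2) P := by
    have hc : Continuous fun y : ι → ℂ => vnorm (a + noise B N y) ^ 2 := by
      simp only [vnorm_sq, noise]
      fun_prop
    exact (hc.measurable.comp (measurable_pi_lambda _ hx.meas)).aestronglyMeasurable
  refine ⟨hi.mono' hmeas (ae_of_all _ fun ω => ?_), ?_⟩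
  · rw [Real.norm_eq_abs, abs_of_nonneg (sq_nonneg _)]
    exact hle ω
  · refine (integral_mono_of_nonneg (ae_of_all _ fun ω => sq_nonneg _) hi
      (ae_of_all _ hle)).trans ?_
    rw [integral_const_mul, integral_add (integrable_const _) (h1.const_mul _), integral_const_mul,
      h2]
    simp
    apply le_of_eq
    ring

/-- The adjugate formula, with a determinant that has no zero off the real axis. It serves for
measurability of the random resolvents. -/
lemma continuous_res {α : Type*} [TopologicalSpace α] {f : α → Matrix ι ι ℂ} (hf : Continuous f)
    (hH : ∀ x, (f x).IsHermitian) {z : ℂ} (hz : z.im ≠ 0) :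
    Continuous fun x => res (f x) z := by
  have h1 : Continuous fun x => f x - z • (1 : Matrix ι ι ℂ) := hf.sub continuous_const
  have h2 : ∀ x, (f x - z • (1 : Matrix ι ι ℂ)).det ≠ 0 := fun x =>
    ((Matrix.isUnit_iff_isUnit_det _).1 (isUnit_sub (hH x) hz)).ne_zero
  have e : (fun x => res (f x) z) = fun x => ((f x - z • (1 : Matrix ι ι ℂ)).det)⁻¹ •
      (f x - z • (1 : Matrix ι ι ℂ)).adjugate := by
    funext x
    rw [res, Matrix.inv_def, Ring.inverse_eq_inv']
  rw [e]
  exact (h1.matrix_det.inv₀ h2).smul h1.matrix_adjugate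

end ColumnMoments


/-! ### Expected error of the averaged identity -/

section AverageBound

open scoped Matrix.Norms.L2Operator

variable {Ω : Type*} [MeasurableSpace Ω] {P : Measure Ω} [IsProbabilityMeasure P]
  {ι κ : Type*} [Fintype ι] [DecidableEq ι] [Fintype κ] [DecidableEq κ]

lemma integral_norm_le_of_sq {f : Ω → ℂ} (hm : AEStronglyMeasurable f P) {q : ℝ}
    (hi : Integrable (fun ω => ‖f ω‖ ^ 2) P) (hq : ∫ ω, ‖f ω‖ ^ 2 ∂P ≤ q) :
    Integrable (fun ω => ‖f ω‖) P ∧ ∫ ω, ‖f ω‖ ∂P ≤ √q := by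
  have hL : MemLp f 2 P := (memLp_two_iff_integrable_sq_norm hm).2 hi
  exact ⟨(hL.integrable (by norm_num)).norm,
    (integral_norm_le_sqrt hL).trans (Real.sqrt_le_sqrt hq)⟩

/-- Since a_j a_jᴴ is dominated by the full Gram matrix, whose quadratic form is at most K times the
identity, testing with a_j itself gives |a_j|⁴ ≤ K |a_j|². -/
lemma vnorm_sq_le_of_gram {a : κ → ι → ℂ} {s : ι → ℝ} {K : ℝ}
    (hS : gram a Finset.univ = Matrix.diagonal (fun i => (s i : ℂ))) (hs : ∀ i, s i ≤ K)
    (hK : 0 ≤ K) (j : κ) :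
    vnorm (a j) ^ 2 ≤ K := by
  have h1 : (star (a j) ⬝ᵥ gram a Finset.univ *ᵥ a j).re ≤ K * vnorm (a j) ^ 2 := by
    rw [hS, vnorm_sq, Finset.mul_sum]
    simp only [dotProduct, Matrix.mulVec_diagonal, Pi.star_apply, Complex.re_sum]
    refine Finset.sum_le_sum fun i _ => ?_
    have : star (a j i) * (s i * a j i) = ((s i * ‖a j i‖ ^ 2 : ℝ) : ℂ) := by
      push_cast
      rw [← Complex.conj_mul']
      simp only [Complex.star_def]
      ring
    rw [this, Complex.ofReal_re]
    gcongr
    exact hs i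
  rw [gram_erase a j, Matrix.add_mulVec, dotProduct_add, Matrix.vecMulVec_mulVec] at h1
  have h2 := ((gram_posSemidef a (Finset.univ.erase j)).re_dotProduct_nonneg (a j))
  have h3 : (star (a j) ⬝ᵥ MulOpposite.op (star (a j) ⬝ᵥ a j) • a j).re = vnorm (a j) ^ 4 := by
    rw [dotProduct_smul, star_dotProduct_self, MulOpposite.smul_eq_mul_unop, MulOpposite.unop_op,
      ← Complex.ofReal_mul, Complex.ofReal_re]
    ring
  rw [Complex.add_re, h3] at h1
  have h2' : 0 ≤ (star (a j) ⬝ᵥ gram a (Finset.univ.erase j) *ᵥ a j).re := h2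
  rcases (sq_nonneg (vnorm (a j))).eq_or_lt with h | h
  · rwa [← h]
  · nlinarith

/-- The columns `a j + N^{-1/2} B x_j`. -/
noncomputable def cols (a : κ → ι → ℂ) (B : Matrix ι ι ℂ) (N : ℝ) (x : ι × κ → ℂ) : κ → ι → ℂ :=
  fun j => a j + noise B N (fun i => x (i, j))

variable {a : κ → ι → ℂ} {B C : Matrix ι ι ℂ} {s t : ι → ℝ} {K N : ℝ} {z : ℂ}

lemma continuous_gram_cols (S : Finset κ) : Continuous fun x => gram (cols a B N x) S := by
  unfold gram cols noise Matrix.vecMulVec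
  fun_prop

lemma continuous_res_cols (hz : z.im ≠ 0) (S : Finset κ) :
    Continuous fun x => res (gram (cols a B N x) S) z :=
  continuous_res (continuous_gram_cols S) (fun _ => (gram_posSemidef _ S).isHermitian) hz

/-- Set the column with index `j` to zero. -/
def zeroCol (j : κ) (x : ι × κ → ℂ) : ι × κ → ℂ := fun p => if p.2 = j then 0 else x p

lemma gram_cols_zeroCol (j : κ) (x : ι × κ → ℂ) :
    gram (cols a B N (zeroCol j x)) (Finset.univ.erase j) =
      gram (cols a B N x) (Finset.univ.erase j) := by
  refine Finset.sum_congr rfl fun k hk => ?_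
  have hk : k ≠ j := Finset.ne_of_mem_erase hk
  have : cols a B N (zeroCol j x) k = cols a B N x k := by simp [cols, zeroCol, hk]
  rw [this]

variable {X : Ω → ι × κ → ℂ}

/-- The resolvent without column j is a function of the array with that column set to zero
(`gram_cols_zeroCol`). This lemma therefore lets the column be integrated out with that resolvent
held fixed. -/
lemma indep_zeroCol (hm : ∀ p, Measurable fun ω => X ω p)
    (hI : iIndepFun (fun p ω => X ω p) P) (j : κ) :
    IndepFun (fun ω i => X ω (i, j)) (fun ω => zeroCol j (X ω)) P := by
  have h := hI.indepFun_finset (Finset.univ.filter fun p => p.2 = j)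
    (Finset.univ.filter fun p => p.2 ≠ j) (Finset.disjoint_filter_filter_not _ _ _) hm
  have h2 := h.comp
    (φ := fun (v : ((Finset.univ.filter fun p : ι × κ => p.2 = j : Finset (ι × κ)) → ℂ)) (i : ι) =>
      v ⟨(i, j), by simp⟩)
    (ψ := fun (v : ((Finset.univ.filter fun p : ι × κ => p.2 ≠ j : Finset (ι × κ)) → ℂ))
      (p : ι × κ) => if hp : p.2 = j then (0 : ℂ) else v ⟨p, by simp [hp]⟩)
    (by fun_prop) (by
      refine measurable_pi_lambda _ fun p => ?_
      by_cases hp : p.2 = j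
      · simp only [hp, dite_true]
        exact measurable_const
      · simp only [hp, dite_false]
        exact measurable_pi_apply _)
  have e : (fun ω => zeroCol j (X ω)) =
      (fun (v : ((Finset.univ.filter fun p : ι × κ => p.2 ≠ j : Finset (ι × κ)) → ℂ))
        (p : ι × κ) => if hp : p.2 = j then (0 : ℂ) else v ⟨p, by simp [hp]⟩) ∘
      fun ω i => X ω i := by
    funext ω p
    by_cases hp : p.2 = j <;> simp [zeroCol, hp]
  rw [e]
  exact h2

lemma standardized_col (hm : ∀ p, Measurable fun ω => X ω p)
    (hI : iIndepFun (fun p ω => X ω p) P) (hL : ∀ p, MemLp (fun ω => X ω p) 2 P)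
    (h0 : ∀ p, ∫ ω, X ω p ∂P = 0) (h1 : ∀ p, ∫ ω, ‖X ω p‖ ^ 2 ∂P = 1) (j : κ) :
    Standardized P (fun i ω => X ω (i, j)) where
  meas i := hm _
  indep := hI.precomp (g := fun i => (i, j)) fun i k h => by simpa using h
  memLp i := hL _
  mean i := h0 _
  var i := h1 _

/-- Bounds for a function of one column and of the resolvent without this column. -/
lemma integral_le_of_leaveOneOut (hm : ∀ p, Measurable fun ω => X ω p)
    (hI : iIndepFun (fun p ω => X ω p) P) (hz : 0 < z.im) (hC : ‖C‖ ≤ 1) (j : κ)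
    {Φ : Matrix ι ι ℂ → (ι → ℂ) → ℝ} (hΦ : Continuous fun p : Matrix ι ι ℂ × (ι → ℂ) => Φ p.1 p.2)
    (h0 : ∀ M u, 0 ≤ Φ M u) {b : ℝ}
    (h : ∀ M, ‖M‖ ≤ 1 / z.im → Integrable (fun ω => Φ M (noise B N fun i => X ω (i, j))) P ∧
      ∫ ω, Φ M (noise B N fun i => X ω (i, j)) ∂P ≤ b) :
    Integrable (fun ω => Φ (res (gram (cols a B N (X ω)) (Finset.univ.erase j)) z * C)
      (noise B N fun i => X ω (i, j))) P ∧
    ∫ ω, Φ (res (gram (cols a B N (X ω)) (Finset.univ.erase j)) z * C)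
      (noise B N fun i => X ω (i, j)) ∂P ≤ b := by
  have hζ : Measurable fun ω => zeroCol j (X ω) := by
    refine measurable_pi_lambda _ fun p => ?_
    by_cases hp : p.2 = j
    · simp only [zeroCol, hp, if_true]
      exact measurable_const
    · simp only [zeroCol, hp, if_false]
      exact hm p
  have hn : Continuous fun x : ι → ℂ => noise B N x := by
    unfold noise
    fun_prop
  have hcont : Continuous fun p : (ι → ℂ) × (ι × κ → ℂ) =>
      Φ (res (gram (cols a B N p.2) (Finset.univ.erase j)) z * C) (noise B N p.1) := by
    have h1 : Continuous fun p : (ι → ℂ) × (ι × κ → ℂ) =>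
        res (gram (cols a B N p.2) (Finset.univ.erase j)) z * C :=
      ((continuous_res_cols hz.ne' _).comp continuous_snd).matrix_mul continuous_const
    exact hΦ.comp (h1.prodMk (hn.comp continuous_fst))
  have key := integral_le_of_indep (P := P) (measurable_pi_lambda _ fun i => hm (i, j)) hζ
    (indep_zeroCol hm hI j) hcont.measurable (fun p => h0 _ _) (b := b) fun e => h _ (by
      calc _ ≤ ‖res (gram (cols a B N e) (Finset.univ.erase j)) z‖ * ‖C‖ := norm_mul_le _ _
        _ ≤ 1 / z.im * 1 := by
          gcongr
          exact norm_res_le (gram_posSemidef _ _).isHermitian hz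
        _ = _ := mul_one _)
  simpa only [gram_cols_zeroCol] using key

/-- The expected error of the approximate equation in one column. -/
noncomputable def colBound (z : ℂ) (K N d L τ : ℝ) : ℝ :=
  2 * (‖z‖ / z.im + (‖z‖ / z.im) ^ 2 * (K / z.im) + (‖z‖ / z.im) ^ 2) *
    (√(K ^ 2 / (z.im ^ 2 * N)) + K ^ 2 / (z.im ^ 2 * N) +
      K / z.im * ((2 + τ) * √d + 2 * L) / N +
      ‖z‖ / z.im * K / z.im ^ 2 * (2 * (K + K * d / N)) / N)

/-- An integrable majorant is produced instead of integrability of the error itself; it is all that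
Markov's inequality will need. -/
lemma integral_norm_colErr_le (hm : ∀ p, Measurable fun ω => X ω p)
    (hI : iIndepFun (fun p ω => X ω p) P) (hL : ∀ p, MemLp (fun ω => X ω p) 2 P)
    (h0 : ∀ p, ∫ ω, X ω p ∂P = 0) (h1 : ∀ p, ∫ ω, ‖X ω p‖ ^ 2 ∂P = 1) (hz : 0 < z.im)
    (hN : 0 < N) (hK : 0 ≤ K) (hB : B * Bᴴ = Matrix.diagonal (fun i => (t i : ℂ)))
    (ht : ∀ i, 0 ≤ t i ∧ t i ≤ K) (hC : ‖C‖ ≤ 1) {τ : ℝ} (hτ : 0 ≤ τ) (j : κ)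
    (ha : vnorm (a j) ^ 2 ≤ K) :
    let y := fun ω => cols a B N (X ω)
    let Q := fun ω => res (gram (y ω) Finset.univ) z
    let T := Matrix.diagonal (fun i => (t i : ℂ))
    let e := fun ω => colErr (Q ω) (res (gram (y ω) (Finset.univ.erase j)) z) C (a j) (y ω j)
        (deltaN t z N (y ω)) ((N : ℂ)⁻¹ * (T * Q ω * C).trace)
    ∃ f : Ω → ℝ, Integrable f P ∧ (∀ ω, ‖e ω‖ ≤ f ω) ∧
      ∫ ω, f ω ∂P ≤ colBound z K N (Fintype.card ι)
        (∑ i, ∫ ω in {ω | τ ≤ ‖X ω (i, j)‖}, ‖X ω (i, j)‖ ^ 2 ∂P) τ := by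
  intro y Q T e
  have hx := standardized_col hm hI hL h0 h1 j
  have hBK := norm_sq_le_of_mul_conjTranspose hB ht hK
  have hone : ‖(1 : Matrix ι ι ℂ)‖ ≤ 1 := opNorm_le_of_vnorm_le zero_le_one (by simp)
  have hT : ‖T‖ ≤ K := by
    rw [Matrix.l2_opNorm_diagonal, pi_norm_le_iff_of_nonneg hK]
    intro i
    rw [Complex.norm_real, Real.norm_eq_abs, abs_of_nonneg (ht i).1]
    exact (ht i).2
  set G := fun ω => res (gram (y ω) (Finset.univ.erase j)) z with hG
  set w := fun ω => noise B N fun i => X ω (i, j) with hw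
  set q := K ^ 2 / (z.im ^ 2 * N) with hq
  set L := ∑ i, ∫ ω in {ω | τ ≤ ‖X ω (i, j)‖}, ‖X ω (i, j)‖ ^ 2 ∂P with hLdef
  set k := K / z.im * ((2 + τ) * √(Fintype.card ι) + 2 * L) / N with hk
  set Z := ‖z‖ / z.im with hZ
  have hmX : Measurable X := measurable_pi_lambda _ hm
  have hGm : Continuous fun x : ι × κ → ℂ => res (gram (cols a B N x) (Finset.univ.erase j)) z :=
    continuous_res_cols hz.ne' _
  have hnm : Continuous fun x : ι × κ → ℂ => noise B N fun i => x (i, j) := by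
    unfold noise
    fun_prop
  have hGC : ∀ D : Matrix ι ι ℂ, Continuous fun x : ι × κ → ℂ =>
      res (gram (cols a B N x) (Finset.univ.erase j)) z * D :=
    fun D => hGm.matrix_mul continuous_const
  -- the linear terms
  have hright : ∀ D : Matrix ι ι ℂ, ‖D‖ ≤ 1 →
      (Integrable (fun ω => ‖star (w ω) ⬝ᵥ (G ω * D) *ᵥ a j‖ ^ 2) P ∧
      ∫ ω, ‖star (w ω) ⬝ᵥ (G ω * D) *ᵥ a j‖ ^ 2 ∂P ≤ q) ∧
      (Integrable (fun ω => ‖star (w ω) ⬝ᵥ (G ω * D) *ᵥ a j‖) P ∧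
      ∫ ω, ‖star (w ω) ⬝ᵥ (G ω * D) *ᵥ a j‖ ∂P ≤ √q) := by
    intro D hD
    have h := integral_le_of_leaveOneOut (a := a) (B := B) (N := N) hm hI hz hD j
      (Φ := fun M u => ‖star u ⬝ᵥ M *ᵥ a j‖ ^ 2) (by fun_prop) (fun _ _ => by positivity)
      fun M hM => noise_bilin_right hN hz hx hBK hM (a j) ha
    refine ⟨h, integral_norm_le_of_sq ?_ h.1 h.2⟩
    have hc : Continuous fun x : ι × κ → ℂ => star (noise B N fun i => x (i, j)) ⬝ᵥ
        (res (gram (cols a B N x) (Finset.univ.erase j)) z * D) *ᵥ a j :=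
      hnm.star.dotProduct ((hGC D).matrix_mulVec continuous_const)
    exact (hc.measurable.comp hmX).aestronglyMeasurable
  have hleft : ∀ D : Matrix ι ι ℂ, ‖D‖ ≤ 1 →
      (Integrable (fun ω => ‖star (a j) ⬝ᵥ (G ω * D) *ᵥ w ω‖ ^ 2) P ∧
      ∫ ω, ‖star (a j) ⬝ᵥ (G ω * D) *ᵥ w ω‖ ^ 2 ∂P ≤ q) ∧
      (Integrable (fun ω => ‖star (a j) ⬝ᵥ (G ω * D) *ᵥ w ω‖) P ∧
      ∫ ω, ‖star (a j) ⬝ᵥ (G ω * D) *ᵥ w ω‖ ∂P ≤ √q) := by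
    intro D hD
    have h := integral_le_of_leaveOneOut (a := a) (B := B) (N := N) hm hI hz hD j
      (Φ := fun M u => ‖star (a j) ⬝ᵥ M *ᵥ u‖ ^ 2) (by fun_prop) (fun _ _ => by positivity)
      fun M hM => noise_bilin_left hN hz hx hBK hM (a j) ha
    refine ⟨h, integral_norm_le_of_sq ?_ h.1 h.2⟩
    have hc : Continuous fun x : ι × κ → ℂ => star (a j) ⬝ᵥ
        (res (gram (cols a B N x) (Finset.univ.erase j)) z * D) *ᵥ noise B N fun i => x (i, j) :=
      continuous_const.dotProduct ((hGC D).matrix_mulVec hnm)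
    exact (hc.measurable.comp hmX).aestronglyMeasurable
  -- the quadratic terms
  have hquad : ∀ D : Matrix ι ι ℂ, ‖D‖ ≤ 1 →
      Integrable (fun ω => ‖star (w ω) ⬝ᵥ (G ω * D) *ᵥ w ω - (N : ℂ)⁻¹ * (T * (G ω * D)).trace‖) P ∧
      ∫ ω, ‖star (w ω) ⬝ᵥ (G ω * D) *ᵥ w ω - (N : ℂ)⁻¹ * (T * (G ω * D)).trace‖ ∂P ≤ k := by
    intro D hD
    exact integral_le_of_leaveOneOut (a := a) (B := B) (N := N) hm hI hz hD j
      (Φ := fun M u => ‖star u ⬝ᵥ M *ᵥ u - (N : ℂ)⁻¹ * (T * M).trace‖) (by fun_prop)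
      (fun _ _ => by positivity) fun M hM => noise_quad hN hz hx hB hBK hM hτ
  obtain ⟨yi, yb⟩ := noise_sq hN hx hBK (a j) ha
  obtain ⟨-, i3, b3⟩ := hright C hC
  obtain ⟨⟨i3s, b3s⟩, -⟩ := hright C hC
  obtain ⟨-, i2, b2⟩ := hright 1 hone
  obtain ⟨-, i4, b4⟩ := hleft C hC
  obtain ⟨⟨i1s, b1s⟩, -⟩ := hleft 1 hone
  obtain ⟨iC, bC⟩ := hquad C hC
  obtain ⟨i5, b5⟩ := hquad 1 hone
  simp only [Matrix.mul_one] at i2 b2 i1s b1s i5 b5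
  simp only [← Matrix.mul_assoc] at iC bC
  set ε := fun ω => Z * K / z.im ^ 2 * vnorm (a j + w ω) ^ 2 / N with hε
  set εb := Z * K / z.im ^ 2 * (2 * (K + K * Fintype.card ι / N)) / N with hεb
  have iε : Integrable ε P := (yi.const_mul _).div_const _
  have bε : ∫ ω, ε ω ∂P ≤ εb := by
    simp only [hε]
    rw [integral_div, integral_const_mul]
    exact div_le_div_of_nonneg_right (mul_le_mul_of_nonneg_left yb (by positivity)) hN.le
  set f1 := fun ω => ‖star (w ω) ⬝ᵥ (G ω * C) *ᵥ a j‖ with hf1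
  set f2 := fun ω => ‖star (a j) ⬝ᵥ (G ω * C) *ᵥ w ω‖ with hf2
  set f3 := fun ω => ‖star (w ω) ⬝ᵥ (G ω * C) *ᵥ w ω - (N : ℂ)⁻¹ * (T * G ω * C).trace‖ with hf3
  set f4 := fun ω => ‖star (a j) ⬝ᵥ G ω *ᵥ w ω‖ ^ 2 with hf4
  set f5 := fun ω => ‖star (w ω) ⬝ᵥ (G ω * C) *ᵥ a j‖ ^ 2 with hf5
  set f6 := fun ω => ‖star (w ω) ⬝ᵥ G ω *ᵥ a j‖ with hf6
  set f7 := fun ω => ‖star (w ω) ⬝ᵥ G ω *ᵥ w ω - (N : ℂ)⁻¹ * (T * G ω).trace‖ with hf7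
  have hZ0 : 0 ≤ Z := by positivity
  have hKz : 0 ≤ K / z.im := by positivity
  have hq0 : 0 ≤ q := by positivity
  have hk0 : 0 ≤ k := (integral_nonneg fun ω => norm_nonneg _).trans bC
  have hεb0 : 0 ≤ εb := by positivity
  refine ⟨fun ω => Z * (f1 ω + f2 ω + f3 ω + ε ω) + Z ^ 2 * (K / z.im * f1 ω + (f4 ω + f5 ω) +
    K / z.im * (f6 ω + f7 ω + ε ω)), ?_, fun ω => ?_, ?_⟩
  · fun_prop
  · have hy : cols a B N (X ω) j = a j + w ω := rfl
    have := norm_colErr_le (gram_posSemidef (y ω) (Finset.univ.erase j)) hz (a j) (w ω) hT hC hN ha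
    simp only [← hy] at this
    rw [← gram_erase (y ω) j] at this
    exact this (le_norm_one_add_deltaN hz hN (fun i => (ht i).1) (y ω))
  · have e1 : ∫ ω, (Z * (f1 ω + f2 ω + f3 ω + ε ω) + Z ^ 2 * (K / z.im * f1 ω + (f4 ω + f5 ω) +
        K / z.im * (f6 ω + f7 ω + ε ω))) ∂P =
        Z * (∫ ω, f1 ω ∂P + ∫ ω, f2 ω ∂P + ∫ ω, f3 ω ∂P + ∫ ω, ε ω ∂P) +
        Z ^ 2 * (K / z.im * ∫ ω, f1 ω ∂P + (∫ ω, f4 ω ∂P + ∫ ω, f5 ω ∂P) +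
          K / z.im * (∫ ω, f6 ω ∂P + ∫ ω, f7 ω ∂P + ∫ ω, ε ω ∂P)) := by
      rw [integral_add (by fun_prop) (by fun_prop), integral_const_mul, integral_const_mul,
        integral_add (by fun_prop) (by fun_prop), integral_add (by fun_prop) (by fun_prop),
        integral_add (by fun_prop) (by fun_prop), integral_add (by fun_prop) (by fun_prop),
        integral_add (by fun_prop) (by fun_prop), integral_const_mul, integral_const_mul,
        integral_add (by fun_prop) (by fun_prop), integral_add (by fun_prop) (by fun_prop),
        integral_add (by fun_prop) (by fun_prop)]
    rw [e1]
    calc _ ≤ Z * (√q + √q + k + εb) + Z ^ 2 * (K / z.im * √q + (q + q) +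
          K / z.im * (√q + k + εb)) := by gcongr
      _ ≤ 2 * (Z + Z ^ 2 * (K / z.im) + Z ^ 2) * (√q + q + k + εb) := by
          have h2 : 0 ≤ Z ^ 2 * (K / z.im) := by positivity
          have h3 := Real.sqrt_nonneg q
          have h4 : 0 ≤ Z ^ 2 := by positivity
          have e2 : Z ^ 2 * (K / z.im * √q + (q + q) + K / z.im * (√q + k + εb)) =
              Z ^ 2 * (K / z.im) * (2 * √q + k + εb) + 2 * (Z ^ 2 * q) := by ring
          rw [e2]
          generalize Z ^ 2 * (K / z.im) = u1 at h2 ⊢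
          nlinarith [mul_nonneg h2 h3, mul_nonneg h2 hq0, mul_nonneg h2 hk0, mul_nonneg h2 hεb0,
            mul_nonneg hZ0 h3, mul_nonneg hZ0 hq0, mul_nonneg hZ0 hk0, mul_nonneg hZ0 hεb0,
            mul_nonneg h4 h3, mul_nonneg h4 hq0, mul_nonneg h4 hk0, mul_nonneg h4 hεb0]

/-- The expected error of the approximate equation. -/
lemma exists_average_bound (hm : ∀ p, Measurable fun ω => X ω p)
    (hI : iIndepFun (fun p ω => X ω p) P) (hL : ∀ p, MemLp (fun ω => X ω p) 2 P)
    (h0 : ∀ p, ∫ ω, X ω p ∂P = 0) (h1 : ∀ p, ∫ ω, ‖X ω p‖ ^ 2 ∂P = 1) (hz : 0 < z.im)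
    (hN : N = Fintype.card κ) (hN0 : 0 < N) (hK : 0 ≤ K)
    (hB : B * Bᴴ = Matrix.diagonal (fun i => (t i : ℂ)))
    (hS : gram a Finset.univ = Matrix.diagonal (fun i => (s i : ℂ)))
    (ht : ∀ i, 0 ≤ t i ∧ t i ≤ K) (hs : ∀ i, s i ≤ K) {τ : ℝ} (hτ : 0 ≤ τ)
    (c : ι → ℂ) (hc : ∀ i, ‖c i‖ ≤ 1) :
    let y := fun ω => cols a B N (X ω)
    ∃ f : Ω → ℝ, Integrable f P ∧
      (∀ ω, ‖(N : ℂ)⁻¹ * ∑ i, c i * (z * (1 + t i * mN z N (y ω) + s i * gN t z N (y ω)) *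
        res (gram (y ω) Finset.univ) z i i + 1)‖ ≤ f ω) ∧
      ∫ ω, f ω ∂P ≤ colBound z K N (Fintype.card ι) (N⁻¹ * ∑ i, ∑ j,
        ∫ ω in {ω | τ ≤ ‖X ω (i, j)‖}, ‖X ω (i, j)‖ ^ 2 ∂P) τ := by
  intro y
  have hC : ‖Matrix.diagonal c‖ ≤ 1 := by
    rw [Matrix.l2_opNorm_diagonal, pi_norm_le_iff_of_nonneg zero_le_one]
    exact hc
  choose f hfi hfe hfb using fun j => integral_norm_colErr_le (a := a) hm hI hL h0 h1 hz hN0 hK hB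
    ht hC hτ j (vnorm_sq_le_of_gram hS hs hK j)
  refine ⟨fun ω => N⁻¹ * ∑ j, f j ω, (integrable_finsetSum _ fun j _ => hfi j).const_mul _,
    fun ω => ?_, ?_⟩
  · have h := average_eq_sum_colErr (κ := κ) a (fun j => noise B N fun i => X ω (i, j)) hz hN hN0
      (fun i => (ht i).1) c hS
    change (N : ℂ)⁻¹ * ∑ i, c i * (z * (1 + t i * mN z N (y ω) + s i * gN t z N (y ω)) *
        res (gram (y ω) Finset.univ) z i i + 1) = _ at h
    rw [h, norm_mul, norm_inv, Complex.norm_real, Real.norm_eq_abs, abs_of_pos hN0]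
    refine mul_le_mul_of_nonneg_left ?_ (by positivity)
    exact (norm_sum_le _ _).trans (Finset.sum_le_sum fun j _ => hfe j ω)
  · rw [integral_const_mul, integral_finsetSum _ fun j _ => hfi j]
    -- The bound is affine in the Lindeberg sum, so averaging over the N columns passes inside it.
    have hlin : ∀ L : κ → ℝ, N⁻¹ * ∑ j, colBound z K N (Fintype.card ι) (L j) τ =
        colBound z K N (Fintype.card ι) (N⁻¹ * ∑ j, L j) τ := by
      intro L
      have hcb : ∀ l, colBound z K N (Fintype.card ι) l τ =
          colBound z K N (Fintype.card ι) 0 τ + 2 * (‖z‖ / z.im + (‖z‖ / z.im) ^ 2 * (K / z.im) +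
            (‖z‖ / z.im) ^ 2) * (K / z.im * 2 / N) * l := by
        intro l
        simp only [colBound]
        ring
      rw [hcb (N⁻¹ * ∑ j, L j), Finset.sum_congr rfl fun j _ => hcb (L j), Finset.sum_add_distrib,
        ← Finset.mul_sum]
      simp only [Finset.sum_const, Finset.card_univ, nsmul_eq_mul, ← hN]
      rw [mul_add, inv_mul_cancel_left₀ hN0.ne']
      ring
    rw [Finset.sum_comm (s := (Finset.univ : Finset ι)), ← hlin]
    exact mul_le_mul_of_nonneg_left (Finset.sum_le_sum fun j _ => hfb j) (by positivity)

end AverageBound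


/-! ### Asymptotics of the error bound and traces of resolvents -/

section Limits

open scoped Matrix.Norms.L2Operator

/-- Truncation at τ = η√n leaves a term τ√n/N, which tends to ηc; all others vanish. Since η is
arbitrary, the remaining constant can be made as small as desired. -/
lemma tendsto_colBound (z : ℂ) (K c η : ℝ) {n N : ℕ → ℕ} (L : ℕ → ℝ)
    (hN : Tendsto N atTop atTop) (hr : Tendsto (fun k => (n k : ℝ) / N k) atTop (𝓝 c))
    (hL : Tendsto (fun k => L k / N k) atTop (𝓝 0)) :
    Tendsto (fun k => colBound z K (N k) (n k) (L k) (η * √(n k))) atTop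
      (𝓝 (2 * (‖z‖ / z.im + (‖z‖ / z.im) ^ 2 * (K / z.im) + (‖z‖ / z.im) ^ 2) *
        (K / z.im * (η * c)))) := by
  have hNR : Tendsto (fun k => (N k : ℝ)) atTop atTop := tendsto_natCast_atTop_atTop.comp hN
  have hi : Tendsto (fun k => ((N k : ℝ))⁻¹) atTop (𝓝 0) := tendsto_inv_atTop_zero.comp hNR
  have hq : Tendsto (fun k => K ^ 2 / (z.im ^ 2 * N k)) atTop (𝓝 0) := by
    have := hi.const_mul (K ^ 2 / z.im ^ 2)
    rw [mul_zero] at this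
    refine this.congr fun k => ?_
    rw [← div_eq_mul_inv, div_div]
  have hsq : Tendsto (fun k => √(K ^ 2 / (z.im ^ 2 * N k))) atTop (𝓝 0) := by
    simpa using hq.sqrt
  have hsn : Tendsto (fun k => √(n k : ℝ) / N k) atTop (𝓝 0) := by
    have h1 : Tendsto (fun k => √((n k : ℝ) / N k * (N k : ℝ)⁻¹)) atTop (𝓝 0) := by
      simpa using (hr.mul hi).sqrt
    refine h1.congr fun k => ?_
    rw [← div_eq_mul_inv, div_div, Real.sqrt_div (Nat.cast_nonneg _),
      Real.sqrt_mul_self (Nat.cast_nonneg _)]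
  have h3 : Tendsto (fun k => K / z.im * ((2 + η * √(n k)) * √(n k) + 2 * L k) / N k) atTop
      (𝓝 (K / z.im * (η * c))) := by
    have := ((hsn.const_mul 2).add ((hr.const_mul η).add (hL.const_mul 2))).const_mul (K / z.im)
    simp only [mul_zero, zero_add, add_zero] at this
    refine this.congr fun k => ?_
    have h := Real.mul_self_sqrt (Nat.cast_nonneg (α := ℝ) (n k))
    rw [mul_div_assoc]
    congr 1
    calc _ = (2 * √(n k) + η * n k + 2 * L k) / N k := by ring
      _ = _ := by nth_rw 2 [← h]; ring
  have h4 : Tendsto (fun k => ‖z‖ / z.im * K / z.im ^ 2 * (2 * (K + K * n k / N k)) / N k) atTop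
      (𝓝 0) := by
    have := (((hr.const_mul K).const_add K).const_mul 2).const_mul (‖z‖ / z.im * K / z.im ^ 2)
    have := this.mul hi
    rw [mul_zero] at this
    refine this.congr fun k => ?_
    ring
  have := (((hsq.add hq).add h3).add h4).const_mul
    (2 * (‖z‖ / z.im + (‖z‖ / z.im) ^ 2 * (K / z.im) + (‖z‖ / z.im) ^ 2))
  simpa [colBound] using this

variable {ι κ : Type*} [Fintype ι] [DecidableEq ι] [Fintype κ] [DecidableEq κ]

lemma trace_res_eq_sum {W : Matrix ι ι ℂ} (hW : W.IsHermitian) {z : ℂ} (hz : z.im ≠ 0) :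
    (res W z).trace = ∑ i, ((hW.eigenvalues i : ℂ) - z)⁻¹ := by
  have hne : ∀ i, (hW.eigenvalues i : ℂ) - z ≠ 0 := by
    intro i h
    apply hz
    have := congrArg Complex.im h
    simpa using this
  set U : Matrix ι ι ℂ := (hW.eigenvectorUnitary).1 with hU
  have hUU : U * star U = 1 := Unitary.coe_mul_star_self _
  have hUU' : star U * U = 1 := Unitary.coe_star_mul_self _
  set Dg : Matrix ι ι ℂ := Matrix.diagonal fun i => (hW.eigenvalues i : ℂ)
  have hsp : W = U * Dg * star U := by
    have := hW.spectral_theorem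
    rw [Unitary.conjStarAlgAut_apply] at this
    exact this
  have e : res W z = U * Matrix.diagonal (fun i => ((hW.eigenvalues i : ℂ) - z)⁻¹) * star U := by
    apply res_eq_of_mul
    have h1 : W - z • 1 = U * (Matrix.diagonal fun i => ((hW.eigenvalues i : ℂ) - z)) * star U := by
      have : (Matrix.diagonal fun i => ((hW.eigenvalues i : ℂ) - z)) = Dg - z • 1 := by
        rw [← Matrix.diagonal_one, ← Matrix.diagonal_smul, Matrix.diagonal_sub]
        simp
      rw [this, Matrix.mul_sub, Matrix.sub_mul, ← hsp, Matrix.mul_smul, Matrix.smul_mul,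
        Matrix.mul_one, hUU]
    rw [h1]
    calc _ = U * ((Matrix.diagonal fun i => ((hW.eigenvalues i : ℂ) - z)) * (star U * U) *
          Matrix.diagonal (fun i => ((hW.eigenvalues i : ℂ) - z)⁻¹)) * star U := by
          simp only [Matrix.mul_assoc]
      _ = 1 := by
          rw [hUU', Matrix.mul_one, Matrix.diagonal_mul_diagonal]
          simp [hne, hUU]
  rw [e, Matrix.trace_mul_comm, ← Matrix.mul_assoc, hUU', Matrix.one_mul, Matrix.trace_diagonal]

/-- The resolvents of `Y Yᴴ` and `Yᴴ Y`. -/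
lemma trace_res_conjTranspose_mul_self (Y : Matrix ι κ ℂ) {z : ℂ} (hz : z.im ≠ 0) :
    (res (Yᴴ * Y) z).trace = (res (Y * Yᴴ) z).trace -
      ((Fintype.card κ : ℂ) - Fintype.card ι) / z := by
  have hz0 : z ≠ 0 := by rintro rfl; simp at hz
  have hH : (Y * Yᴴ).IsHermitian := Matrix.isHermitian_mul_conjTranspose_self Y
  have e : res (Yᴴ * Y) z = z⁻¹ • (Yᴴ * res (Y * Yᴴ) z * Y - 1) := by
    apply res_eq_of_mul
    have h := sub_mul_res hH hz
    have h1 : (Yᴴ * Y - z • 1) * (Yᴴ * res (Y * Yᴴ) z * Y - 1) =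
        Yᴴ * ((Y * Yᴴ - z • 1) * res (Y * Yᴴ) z) * Y - Yᴴ * Y + z • 1 := by
      simp only [Matrix.sub_mul, Matrix.mul_sub, Matrix.smul_mul, Matrix.mul_smul, Matrix.one_mul,
        Matrix.mul_one, Matrix.mul_assoc]
      abel
    rw [Matrix.mul_smul, h1, h, Matrix.mul_one, sub_self, zero_add, smul_smul, inv_mul_cancel₀ hz0,
      one_smul]
  rw [e, Matrix.trace_smul, Matrix.trace_sub, Matrix.trace_one, Matrix.trace_mul_comm,
    ← Matrix.mul_assoc, mul_res hH hz, Matrix.trace_add, Matrix.trace_one, Matrix.trace_smul,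
    smul_eq_mul, smul_eq_mul]
  field_simp
  ring

end Limits

/-! ### Weak convergence against complex test functions -/

section Stieltjes

lemma norm_inv_sub_le (l : ℝ) {z : ℂ} (hz : 0 < z.im) : ‖((l : ℂ) - z)⁻¹‖ ≤ 1 / z.im := by
  rw [norm_inv, ← one_div]
  apply one_div_le_one_div_of_le hz
  have := Complex.abs_im_le_norm ((l : ℂ) - z)
  simp only [Complex.sub_im, Complex.ofReal_im, zero_sub, abs_neg, abs_of_pos hz] at this
  exact this

lemma ofReal_sub_ne_zero (l : ℝ) {z : ℂ} (hz : z.im ≠ 0) : (l : ℂ) - z ≠ 0 := by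
  intro h
  have := congrArg Complex.im h
  simp at this
  exact hz this

/-- Weak convergence for complex test functions. -/
lemma EmpiricalTendsto.complex {E : Type*} [TopologicalSpace E] [MeasurableSpace E]
    [OpensMeasurableSpace E] {d : ℕ → ℕ} {pts : ∀ k, Fin (d k) → E} {μ : Measure E}
    [IsFiniteMeasure μ]
    (h : EmpiricalTendsto d pts μ) {f : E → ℂ} (hf : Continuous f) {C : ℝ} (hC : ∀ x, ‖f x‖ ≤ C) :
    Tendsto (fun k => ((d k : ℂ))⁻¹ * ∑ i, f (pts k i)) atTop (𝓝 (∫ x, f x ∂μ)) := by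
  have hfi : Integrable f μ :=
    Integrable.of_bound (hf.measurable.aestronglyMeasurable) C (ae_of_all _ hC)
  set fr : BoundedContinuousFunction E ℝ := BoundedContinuousFunction.ofNormedAddCommGroup
    (fun x => (f x).re) (by fun_prop) C (fun x => (Complex.abs_re_le_norm _).trans (hC x))
  set fi : BoundedContinuousFunction E ℝ := BoundedContinuousFunction.ofNormedAddCommGroup
    (fun x => (f x).im) (by fun_prop) C (fun x => (Complex.abs_im_le_norm _).trans (hC x))
  have h1 : Tendsto (fun k => ((((d k : ℝ))⁻¹ * ∑ i, fr (pts k i) : ℝ) : ℂ) +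
      (((d k : ℝ))⁻¹ * ∑ i, fi (pts k i) : ℝ) * Complex.I) atTop
      (𝓝 (((∫ x, fr x ∂μ : ℝ) : ℂ) + (∫ x, fi x ∂μ : ℝ) * Complex.I)) :=
    ((Complex.continuous_ofReal.tendsto _).comp (h fr)).add
      (((Complex.continuous_ofReal.tendsto _).comp (h fi)).mul_const _)
  have h2 : ((∫ x, fr x ∂μ : ℝ) : ℂ) + (∫ x, fi x ∂μ : ℝ) * Complex.I = ∫ x, f x ∂μ :=
    integral_re_add_im (𝕜 := ℂ) hfi
  rw [h2] at h1
  refine h1.congr fun k => ?_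
  push_cast
  rw [mul_assoc, ← mul_add, Finset.sum_mul, ← Finset.sum_add_distrib]
  congr 1
  refine Finset.sum_congr rfl fun i _ => ?_
  exact Complex.re_add_im _

end Stieltjes


/-! ### Gram matrices of columns and of rows -/

section Gram

variable {ι κ : Type*} [Fintype ι] [DecidableEq ι] [Fintype κ] [DecidableEq κ]

lemma gram_eq_mul_conjTranspose (Y : Matrix ι κ ℂ) :
    gram (fun j i => Y i j) Finset.univ = Y * Yᴴ := by
  ext i k
  simp [gram, Matrix.sum_apply, Matrix.vecMulVec_apply, Matrix.mul_apply]

/-- Seen in the companion matrix, deleting rows of the data removes rank one terms, so the effect on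
the trace of the resolvent can be counted row by row. -/
lemma gram_rows_eq (V : Matrix ι κ ℂ) (S : Finset ι) :
    gram (fun i j => star (V i j)) S =
      (Matrix.diagonal (fun i => if i ∈ S then (1 : ℂ) else 0) * V)ᴴ *
        (Matrix.diagonal (fun i => if i ∈ S then (1 : ℂ) else 0) * V) := by
  ext j l
  rw [Matrix.mul_apply]
  simp only [gram, Matrix.sum_apply, Matrix.vecMulVec_apply,
    Matrix.conjTranspose_apply, Matrix.diagonal_mul, Pi.star_apply, star_star]
  rw [← Finset.sum_filter_add_sum_filter_not Finset.univ (fun i => i ∈ S)]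
  have h1 : ∑ i ∈ Finset.univ.filter (fun i => i ∉ S),
      star ((if i ∈ S then (1 : ℂ) else 0) * V i j) * ((if i ∈ S then (1 : ℂ) else 0) * V i l) = 0 := by
    refine Finset.sum_eq_zero fun i hi => ?_
    simp only [Finset.mem_filter] at hi
    simp [hi.2]
  rw [h1, add_zero]
  have h2 : Finset.univ.filter (fun i => i ∈ S) = S := by ext; simp
  rw [h2]
  refine Finset.sum_congr rfl fun i hi => ?_
  simp [hi]

end Gram

/-! ### Passage to the common eigenbasis and truncation of the eigenvalues -/

section Truncation

variable {Ω : Type*} [MeasurableSpace Ω] {P : Measure Ω} {c : ℝ} {H : Measure (ℝ × ℝ)}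

namespace Model

variable (M : Model P c H) (K : ℝ) (k : ℕ)

/-- The indices of the eigenvalue pairs bounded by `K`. -/
noncomputable def keep : Finset (Fin (M.n k)) :=
  Finset.univ.filter fun i => M.s k i ≤ K ∧ M.t k i ≤ K

noncomputable def sT (i : Fin (M.n k)) : ℝ := if i ∈ M.keep K k then M.s k i else 0

noncomputable def tT (i : Fin (M.n k)) : ℝ := if i ∈ M.keep K k then M.t k i else 0

/-- The compression to the span of the eigenvectors with bounded eigenvalues. -/
noncomputable def proj : Matrix (Fin (M.n k)) (Fin (M.n k)) ℂ :=
  Matrix.diagonal (fun i => if i ∈ M.keep K k then (1 : ℂ) else 0)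

noncomputable def signal (j : Fin (M.N k)) (i : Fin (M.n k)) : ℂ :=
  ((√(M.N k : ℝ))⁻¹ : ℂ) * (M.proj K k * ((M.U k).1ᴴ * M.R k)) i j

noncomputable def factor : Matrix (Fin (M.n k)) (Fin (M.n k)) ℂ :=
  M.proj K k * ((M.U k).1ᴴ * M.sqrtT k)

/-- The normalized data matrix in the common eigenbasis. -/
noncomputable def data (ω : Ω) : Matrix (Fin (M.n k)) (Fin (M.N k)) ℂ :=
  ((√(M.N k : ℝ))⁻¹ : ℂ) • ((M.U k).1ᴴ * (M.R k + M.sqrtT k * M.X k ω))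

/-- The columns of the truncated data matrix. -/
noncomputable def tcols (ω : Ω) : Fin (M.N k) → Fin (M.n k) → ℂ :=
  cols (M.signal K k) (M.factor K k) (M.N k) fun p => M.X k ω p.1 p.2

lemma tcols_apply (ω : Ω) (j : Fin (M.N k)) (i : Fin (M.n k)) :
    M.tcols K k ω j i = (M.proj K k * M.data k ω) i j := by
  have h : M.proj K k * M.data k ω = ((√(M.N k : ℝ))⁻¹ : ℂ) • (M.proj K k * ((M.U k).1ᴴ * M.R k)) +
      ((√(M.N k : ℝ))⁻¹ : ℂ) • (M.factor K k * M.X k ω) := by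
    rw [data, factor, Matrix.mul_smul, ← smul_add]
    simp only [Matrix.mul_add, Matrix.mul_assoc]
  rw [h]
  simp only [tcols, cols, signal, noise, Pi.add_apply, Pi.smul_apply, smul_eq_mul, Matrix.add_apply,
    Matrix.smul_apply]
  rfl

lemma UU : (M.U k).1 * (M.U k).1ᴴ = 1 := Unitary.coe_mul_star_self (M.U k)

lemma UU' : (M.U k).1ᴴ * (M.U k).1 = 1 := Unitary.coe_star_mul_self (M.U k)

lemma conj_diagonal (v : Fin (M.n k) → ℂ) :
    (M.U k).1ᴴ * ((M.U k : Matrix (Fin (M.n k)) (Fin (M.n k)) ℂ) *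
      Matrix.diagonal v * (M.U k : Matrix (Fin (M.n k)) (Fin (M.n k)) ℂ)ᴴ) * (M.U k).1 =
      Matrix.diagonal v := by
  calc _ = ((M.U k).1ᴴ * (M.U k).1) * Matrix.diagonal v * ((M.U k).1ᴴ * (M.U k).1) := by
        simp only [Matrix.mul_assoc]
    _ = _ := by rw [UU', Matrix.one_mul, Matrix.mul_one]

lemma conj_diag (v : Fin (M.n k) → ℂ) :
    M.proj K k * ((M.U k).1ᴴ * ((M.U k : Matrix (Fin (M.n k)) (Fin (M.n k)) ℂ) *
      Matrix.diagonal v * (M.U k : Matrix (Fin (M.n k)) (Fin (M.n k)) ℂ)ᴴ) * (M.U k).1) *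
        (M.proj K k)ᴴ =
      Matrix.diagonal fun i => if i ∈ M.keep K k then v i else 0 := by
  rw [conj_diagonal, proj, Matrix.diagonal_conjTranspose, Matrix.diagonal_mul_diagonal,
    Matrix.diagonal_mul_diagonal]
  congr 1
  funext i
  by_cases h : i ∈ M.keep K k <;> simp [h]

lemma factor_mul : M.factor K k * (M.factor K k)ᴴ =
    Matrix.diagonal fun i => (M.tT K k i : ℂ) := by
  have h := M.conj_diag K k (fun i => (M.t k i : ℂ))
  rw [← M.diag_T k, ← M.sqrtT_mul_self k] at h
  have h2 : (fun i => (M.tT K k i : ℂ)) =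
      fun i => if i ∈ M.keep K k then (M.t k i : ℂ) else 0 := by
    funext i
    simp only [tT]
    split_ifs <;> simp
  rw [h2, ← h, factor, Matrix.conjTranspose_mul, Matrix.conjTranspose_mul,
    Matrix.conjTranspose_conjTranspose, (M.sqrtT_posSemidef k).isHermitian.eq]
  simp only [Matrix.mul_assoc]

lemma inv_sqrt_mul_self : ((√(M.N k : ℝ))⁻¹ : ℂ) * ((√(M.N k : ℝ))⁻¹ : ℂ) = (M.N k : ℂ)⁻¹ := by
  rw [← mul_inv, ← Complex.ofReal_mul, Real.mul_self_sqrt (Nat.cast_nonneg _)]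
  simp

lemma gram_signal : gram (M.signal K k) Finset.univ =
    Matrix.diagonal fun i => (M.sT K k i : ℂ) := by
  have h := M.conj_diag K k (fun i => (M.s k i : ℂ))
  rw [← M.diag_R k] at h
  have h2 : (fun i => (M.sT K k i : ℂ)) =
      fun i => if i ∈ M.keep K k then (M.s k i : ℂ) else 0 := by
    funext i
    simp only [sT]
    split_ifs <;> simp
  have h3 := gram_eq_mul_conjTranspose
    (((√(M.N k : ℝ))⁻¹ : ℂ) • (M.proj K k * ((M.U k).1ᴴ * M.R k)))
  change gram (M.signal K k) Finset.univ = _ at h3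
  rw [h3, h2, ← h, Matrix.conjTranspose_smul, Matrix.smul_mul, Matrix.mul_smul, smul_smul]
  have h4 : star ((√(M.N k : ℝ))⁻¹ : ℂ) = ((√(M.N k : ℝ))⁻¹ : ℂ) := by simp
  rw [h4, inv_sqrt_mul_self, Matrix.conjTranspose_mul, Matrix.conjTranspose_mul,
    Matrix.conjTranspose_conjTranspose]
  simp only [Matrix.mul_assoc, Matrix.mul_smul, Matrix.smul_mul]

lemma companion_eq (ω : Ω) : M.companion k ω = (M.data k ω)ᴴ * M.data k ω := by
  rw [data, Matrix.conjTranspose_smul, Matrix.smul_mul, Matrix.mul_smul, smul_smul,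
    Matrix.conjTranspose_mul, Matrix.conjTranspose_conjTranspose]
  have h4 : star ((√(M.N k : ℝ))⁻¹ : ℂ) = ((√(M.N k : ℝ))⁻¹ : ℂ) := by simp
  have h5 : (M.R k + M.sqrtT k * M.X k ω)ᴴ * (M.U k).1 *
      ((M.U k).1ᴴ * (M.R k + M.sqrtT k * M.X k ω)) =
      (M.R k + M.sqrtT k * M.X k ω)ᴴ * (M.R k + M.sqrtT k * M.X k ω) := by
    rw [Matrix.mul_assoc, ← Matrix.mul_assoc (M.U k).1, UU, Matrix.one_mul]
  rw [h4, inv_sqrt_mul_self, h5, companion]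
  ext i j
  simp only [Matrix.smul_apply, Complex.real_smul, smul_eq_mul]
  push_cast
  rfl

variable {K k}

/-- Truncation of the eigenvalue pairs has a small effect on the Stieltjes transform. -/
lemma norm_mN_sub_le {z : ℂ} (hz : 0 < z.im) (hN : 0 < M.N k) (ω : Ω) :
    ‖mN z (M.N k) (M.tcols K k ω) - (M.N k : ℂ)⁻¹ * (res (M.companion k ω) z).trace‖ ≤
      (((M.keep K k)ᶜ.card : ℝ) / M.N k) / z.im := by
  set V := M.data k ω with hV
  have hNc : ((M.N k : ℝ) : ℂ) ≠ 0 := by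
    have : (M.N k : ℂ) ≠ 0 := by exact_mod_cast hN.ne'
    simpa using this
  have h1 : gram (M.tcols K k ω) Finset.univ = (M.proj K k * V) * (M.proj K k * V)ᴴ := by
    rw [← gram_eq_mul_conjTranspose]
    congr 1
    funext j i
    exact M.tcols_apply K k ω j i
  -- The term subtracted in `mN` is the contribution of the dimension difference N - n, so `mN` is
  -- the normalized trace of the N × N resolvent, where all rows or only the kept ones can be
  -- compared.
  have h2 : mN z (M.N k) (M.tcols K k ω) =
      (M.N k : ℂ)⁻¹ * (res (gram (fun i j => star (V i j)) (M.keep K k)) z).trace := by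
    rw [gram_rows_eq]
    change _ = (M.N k : ℂ)⁻¹ * (res ((M.proj K k * V)ᴴ * (M.proj K k * V)) z).trace
    rw [trace_res_conjTranspose_mul_self _ hz.ne', ← h1, mN]
    simp only [Fintype.card_fin, Complex.ofReal_natCast] at hNc ⊢
    field_simp
  have h3 : M.companion k ω = gram (fun i j => star (V i j)) (M.keep K k ∪ (M.keep K k)ᶜ) := by
    rw [Finset.union_compl, gram_rows_eq, companion_eq]
    simp [hV]
  rw [h2, h3, ← mul_sub, norm_mul, norm_inv, norm_sub_rev]
  have h4 := norm_trace_gram_sub_le (fun i j => star (V i j)) hz (M.keep K k) (M.keep K k)ᶜ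
    disjoint_compl_right
  rw [Complex.norm_natCast]
  calc _ ≤ (M.N k : ℝ)⁻¹ * (((M.keep K k)ᶜ.card : ℝ) / z.im) := by gcongr
    _ = _ := by ring

lemma s_nonneg (i : Fin (M.n k)) : 0 ≤ M.s k i := by
  have h1 : (((M.N k : ℂ))⁻¹ • (M.R k * (M.R k)ᴴ)).PosSemidef := by
    refine (Matrix.posSemidef_self_mul_conjTranspose (M.R k)).smul ?_
    rw [← Complex.ofReal_natCast, ← Complex.ofReal_inv]
    exact Complex.zero_le_real.2 (by positivity)
  have h2 := h1.conjTranspose_mul_mul_same (M.U k).1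
  rw [M.diag_R k, conj_diagonal] at h2
  have := (Matrix.posSemidef_diagonal_iff.1 h2) i
  exact Complex.zero_le_real.1 this

lemma t_nonneg (i : Fin (M.n k)) : 0 ≤ M.t k i := by
  have h2 := (M.T_posSemidef k).conjTranspose_mul_mul_same (M.U k).1
  rw [M.diag_T k, conj_diagonal] at h2
  have := (Matrix.posSemidef_diagonal_iff.1 h2) i
  exact Complex.zero_le_real.1 this

lemma sT_mem (hK : 0 ≤ K) (i : Fin (M.n k)) : 0 ≤ M.sT K k i ∧ M.sT K k i ≤ K := by
  unfold sT
  split_ifs with h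
  · simp only [keep, Finset.mem_filter] at h
    exact ⟨M.s_nonneg i, h.2.1⟩
  · exact ⟨le_rfl, hK⟩

lemma tT_mem (hK : 0 ≤ K) (i : Fin (M.n k)) : 0 ≤ M.tT K k i ∧ M.tT K k i ≤ K := by
  unfold tT
  split_ifs with h
  · simp only [keep, Finset.mem_filter] at h
    exact ⟨M.t_nonneg i, h.2.2⟩
  · exact ⟨le_rfl, hK⟩

end Model

end Truncation


/-! ### From the averaged identity to approximate equations -/

section Stability

open scoped Matrix.Norms.L2Operator

/-- The compact set in which co-solutions at `z` are found. -/
def coSet (z : ℂ) : Set ℂ := {g | ‖g‖ ≤ 1 / z.im ∧ 0 ≤ (z * g).im ∧ 0 ≤ g.im}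

lemma isCompact_coSet (z : ℂ) : IsCompact (coSet z) := by
  have a : IsClosed {g : ℂ | 0 ≤ (z * g).im} :=
    isClosed_le continuous_const (Complex.continuous_im.comp (continuous_const.mul continuous_id))
  have h1 : IsClosed (coSet z) :=
    (isClosed_le continuous_norm continuous_const).inter
      (a.inter (isClosed_le continuous_const Complex.continuous_im))
  refine (isCompact_closedBall (0 : ℂ) (1 / z.im)).of_isClosed_subset h1 fun g hg => ?_
  simpa using hg.1

/-- Im(z(1 + sg + tm)) = Im z + s Im(zg) + t Im(zm). For this reason `coSet` records the sign of
Im(zg): it makes the denominators uniformly bounded below on the quadrant. -/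
lemma le_norm_mul_den {z m g : ℂ} (hm : 0 ≤ (z * m).im) (hg : 0 ≤ (z * g).im)
    {p : ℝ × ℝ} (h1 : 0 ≤ p.1) (h2 : 0 ≤ p.2) : z.im ≤ ‖z * den m g p‖ := by
  refine le_trans ?_ (Complex.abs_im_le_norm _)
  refine le_trans ?_ (le_abs_self _)
  have e : z * den m g p = z + p.1 * (z * g) + p.2 * (z * m) := by
    rw [den]; ring
  rw [e, Complex.add_im, Complex.add_im, Complex.im_ofReal_mul, Complex.im_ofReal_mul]
  have := mul_nonneg h1 hg
  have := mul_nonneg h2 hm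
  linarith

lemma im_neg_inv (w : ℂ) : (-1 / w).im = w.im / Complex.normSq w := by
  rw [neg_div, Complex.neg_im, one_div, Complex.inv_im]
  ring

variable {ι κ : Type*} [Fintype ι] [DecidableEq ι] [Fintype κ] [DecidableEq κ]
  {s t : ι → ℝ} {z : ℂ} {N : ℝ}

lemma gN_mem_coSet (hz : 0 < z.im) (hN : 0 < N) (ht : ∀ i, 0 ≤ t i) (y : κ → ι → ℂ) :
    gN t z N y ∈ coSet z := by
  have hz0 : 0 < ‖z‖ := norm_pos_iff.2 (by rintro rfl; simp at hz)
  have h1 := le_norm_one_add_deltaN hz hN ht y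
  obtain ⟨h2, h3⟩ := im_deltaN hz hN ht y
  refine ⟨?_, ?_, ?_⟩
  · rw [gN, norm_div, norm_neg, norm_one, norm_mul]
    rw [div_le_iff₀ hz0] at h1
    exact one_div_le_one_div_of_le hz (by linarith)
  · have hδ : 1 + deltaN t z N y ≠ 0 := norm_pos_iff.1 (lt_of_lt_of_le (by positivity) h1)
    have e : z * gN t z N y = -1 / (1 + deltaN t z N y) := by
      have := norm_pos_iff.1 hz0
      rw [gN]
      field_simp
    rw [e, im_neg_inv]
    have : 0 ≤ (1 + deltaN t z N y).im := by simpa using h2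
    exact div_nonneg this (Complex.normSq_nonneg _)
  · rw [gN, im_neg_inv]
    have : 0 ≤ (z * (1 + deltaN t z N y)).im := by
      rw [mul_add, mul_one, Complex.add_im]
      linarith
    exact div_nonneg this (Complex.normSq_nonneg _)

/-- From the weighted approximate equation to an approximate integral equation. -/
lemma norm_sum_resolvent_le (hz : 0 < z.im) (hN : 0 < N) {K ε ρ : ℝ} (hK : 1 ≤ K) (hε : 0 ≤ ε)
    (hs : ∀ i, 0 ≤ s i ∧ s i ≤ K) (ht : ∀ i, 0 ≤ t i ∧ t i ≤ K) (hρ : (Fintype.card ι : ℝ) / N ≤ ρ)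
    {W : Matrix ι ι ℂ} (hW : W.PosSemidef) {m g mn gn : ℂ} (hm : 0 ≤ (z * m).im)
    (hg : 0 ≤ (z * g).im) (hmn : ‖mn - m‖ ≤ ε) (hgn : ‖gn - g‖ ≤ ε) {h : ι → ℝ}
    (hh : ∀ i, 0 ≤ h i ∧ h i ≤ K)
    (hE : ‖(N : ℂ)⁻¹ * ∑ i, ((z.im / K * h i : ℝ) / (z * den m g (s i, t i))) *
      (z * (1 + t i * mn + s i * gn) * res W z i i + 1)‖ ≤ ε) :
    ‖(N : ℂ)⁻¹ * ∑ i, h i * res W z i i + (N : ℂ)⁻¹ * ∑ i, h i / (z * den m g (s i, t i))‖ ≤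
      (K / z.im + ρ * (2 * K ^ 2 * ‖z‖ / z.im ^ 2)) * ε := by
  have hz0 : z ≠ 0 := by rintro rfl; simp at hz
  have hz1 : 0 < ‖z‖ := norm_pos_iff.2 hz0
  have hK0 : 0 < K := by linarith
  have hd : ∀ i, z.im ≤ ‖z * den m g (s i, t i)‖ := fun i =>
    le_norm_mul_den hm hg (hs i).1 (ht i).1
  have hd0 : ∀ i, den m g (s i, t i) ≠ 0 := fun i h0 => by
    have := hd i
    rw [h0, mul_zero, norm_zero] at this
    linarith
  have hNn : ‖(N : ℂ)⁻¹‖ = N⁻¹ := by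
    rw [norm_inv, Complex.norm_real, Real.norm_eq_abs, abs_of_pos hN]
  -- `R` is the error of putting the deterministic pair (m, g) for the random (m_N, g_N) in the
  -- denominator. The factor K/Im z in the decomposition undoes the normalization that makes the
  -- weights at most 1.
  set R := (N : ℂ)⁻¹ * ∑ i, h i * (((1 + t i * mn + s i * gn) - den m g (s i, t i)) /
    den m g (s i, t i) * res W z i i) with hR
  have e : (N : ℂ)⁻¹ * ∑ i, h i * res W z i i + (N : ℂ)⁻¹ * ∑ i, h i / (z * den m g (s i, t i)) =
      ((K / z.im : ℝ) : ℂ) * ((N : ℂ)⁻¹ * ∑ i, ((z.im / K * h i : ℝ) / (z * den m g (s i, t i))) *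
      (z * (1 + t i * mn + s i * gn) * res W z i i + 1)) - R := by
    rw [hR, mul_left_comm, ← mul_add, ← mul_sub, Finset.mul_sum, ← Finset.sum_add_distrib,
      ← Finset.sum_sub_distrib]
    congr 1
    refine Finset.sum_congr rfl fun i _ => ?_
    have h1 := hd0 i
    have h2 : (K : ℂ) ≠ 0 := by exact_mod_cast hK0.ne'
    have h3 : (z.im : ℂ) ≠ 0 := by exact_mod_cast hz.ne'
    push_cast
    field_simp
    ring
  have hRb : ‖R‖ ≤ ρ * (2 * K ^ 2 * ‖z‖ / z.im ^ 2) * ε := by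
    rw [hR, norm_mul, hNn]
    have hterm : ∀ i, ‖(h i : ℂ) * (((1 + t i * mn + s i * gn) - den m g (s i, t i)) /
        den m g (s i, t i) * res W z i i)‖ ≤ (2 * K ^ 2 * ‖z‖ / z.im ^ 2) * ε := by
      intro i
      have h1 : ‖(1 + t i * mn + s i * gn) - den m g (s i, t i)‖ ≤ 2 * K * ε := by
        have : (1 + t i * mn + s i * gn) - den m g (s i, t i) =
            (s i : ℂ) * (gn - g) + (t i : ℂ) * (mn - m) := by
          rw [den]; ring
        rw [this]
        refine (norm_add_le _ _).trans ?_
        rw [norm_mul, norm_mul, Complex.norm_real, Complex.norm_real, Real.norm_eq_abs,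
          Real.norm_eq_abs, abs_of_nonneg (hs i).1, abs_of_nonneg (ht i).1]
        have := mul_le_mul (hs i).2 hgn (norm_nonneg _) hK0.le
        have := mul_le_mul (ht i).2 hmn (norm_nonneg _) hK0.le
        linarith
      have h2 : z.im / ‖z‖ ≤ ‖den m g (s i, t i)‖ := by
        have := hd i
        rw [norm_mul] at this
        rw [div_le_iff₀ hz1]
        linarith
      have h3 : ‖res W z i i‖ ≤ 1 / z.im :=
        (norm_entry_le _ i i).trans (norm_res_le hW.isHermitian hz)
      have h4 : ‖(h i : ℂ)‖ ≤ K := by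
        rw [Complex.norm_real, Real.norm_eq_abs, abs_of_nonneg (hh i).1]
        exact (hh i).2
      rw [norm_mul, norm_mul, norm_div]
      calc _ ≤ K * (2 * K * ε / (z.im / ‖z‖) * (1 / z.im)) := by gcongr
        _ = _ := by field_simp
    calc _ ≤ N⁻¹ * ∑ _i : ι, (2 * K ^ 2 * ‖z‖ / z.im ^ 2) * ε := by
          refine mul_le_mul_of_nonneg_left ?_ (by positivity)
          exact (norm_sum_le _ _).trans (Finset.sum_le_sum fun i _ => hterm i)
      _ = (Fintype.card ι : ℝ) / N * ((2 * K ^ 2 * ‖z‖ / z.im ^ 2) * ε) := by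
          rw [Finset.sum_const, Finset.card_univ, nsmul_eq_mul]
          ring
      _ ≤ ρ * ((2 * K ^ 2 * ‖z‖ / z.im ^ 2) * ε) := by gcongr
      _ = _ := by ring
  rw [e]
  refine (norm_sub_le _ _).trans ?_
  rw [norm_mul, Complex.norm_real, Real.norm_eq_abs, abs_of_nonneg (by positivity)]
  have := mul_le_mul_of_nonneg_left hE (by positivity : 0 ≤ K / z.im)
  linarith

/-- The constant in the approximate integral equations. -/
noncomputable def stabConst (z : ℂ) (K ρ : ℝ) : ℝ :=
  (1 + ‖z‖ / z.im) * (K / z.im + ρ * (2 * K ^ 2 * ‖z‖ / z.im ^ 2)) +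
    ‖z‖ * (1 + ρ * (K / z.im)) + 1

/-- Two weights suffice. With h = 1 the sum of the Q_ii gives m_N and hence the first equation of
(∗); with h = t it gives δ, which the exact relation z g_N (1 + δ) = -1 turns into the second. -/
lemma approx_equations (hz : 0 < z.im) (hN : 0 < N) {K ε ρ : ℝ} (hK : 1 ≤ K) (hε : 0 ≤ ε)
    (hs : ∀ i, 0 ≤ s i ∧ s i ≤ K) (ht : ∀ i, 0 ≤ t i ∧ t i ≤ K) (hρ : (Fintype.card ι : ℝ) / N ≤ ρ)
    (y : κ → ι → ℂ) {m g : ℂ} (hm : 0 ≤ (z * m).im)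
    (hg : g ∈ coSet z) (hmn : ‖mN z N y - m‖ ≤ ε) (hgn : ‖gN t z N y - g‖ ≤ ε)
    (hE : ∀ h : ι → ℝ, h = (fun _ => 1) ∨ h = t →
      ‖(N : ℂ)⁻¹ * ∑ i, ((z.im / K * h i : ℝ) / (z * den m g (s i, t i))) *
      (z * (1 + t i * mN z N y + s i * gN t z N y) * res (gram y Finset.univ) z i i + 1)‖ ≤ ε) :
    ‖m + (1 - (Fintype.card ι : ℂ) / N) / z + z⁻¹ * ((N : ℂ)⁻¹ * ∑ i, 1 / den m g (s i, t i))‖ ≤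
      stabConst z K ρ * ε ∧
    ‖z * g * (1 - z⁻¹ * ((N : ℂ)⁻¹ * ∑ i, t i / den m g (s i, t i))) + 1‖ ≤
      stabConst z K ρ * ε := by
  have hz0 : z ≠ 0 := by rintro rfl; simp at hz
  have hz1 : 0 < ‖z‖ := norm_pos_iff.2 hz0
  have hρ0 : 0 ≤ ρ := le_trans (by positivity) hρ
  have hK0 : 0 < K := by linarith
  set C0 := K / z.im + ρ * (2 * K ^ 2 * ‖z‖ / z.im ^ 2) with hC0
  have hC0' : 0 ≤ C0 := by positivity
  have h1 := norm_sum_resolvent_le hz hN hK hε hs ht hρ (gram_posSemidef y Finset.univ) hm hg.2.1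
    hmn hgn (h := fun _ => 1) (fun i => ⟨zero_le_one, hK⟩) (hE _ (Or.inl rfl))
  have h2 := norm_sum_resolvent_le hz hN hK hε hs ht hρ (gram_posSemidef y Finset.univ) hm hg.2.1
    hmn hgn (h := t) ht (hE _ (Or.inr rfl))
  rw [← hC0] at h1 h2
  have hpull : ∀ h : ι → ℂ, (N : ℂ)⁻¹ * ∑ i, h i / (z * den m g (s i, t i)) =
      z⁻¹ * ((N : ℂ)⁻¹ * ∑ i, h i / den m g (s i, t i)) := by
    intro h
    simp only [Finset.mul_sum]
    refine Finset.sum_congr rfl fun i _ => ?_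
    rw [div_eq_mul_inv, div_eq_mul_inv, mul_inv]
    ring
  rw [hpull] at h1 h2
  simp only [Complex.ofReal_one, one_mul] at h1
  constructor
  · have e : m + (1 - (Fintype.card ι : ℂ) / N) / z +
        z⁻¹ * ((N : ℂ)⁻¹ * ∑ i, 1 / den m g (s i, t i)) =
        (m - mN z N y) + ((N : ℂ)⁻¹ * ∑ i, res (gram y Finset.univ) z i i +
          z⁻¹ * ((N : ℂ)⁻¹ * ∑ i, 1 / den m g (s i, t i))) := by
      rw [mN, Matrix.trace]
      simp only [Matrix.diag]
      ring
    rw [e]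
    refine (norm_add_le _ _).trans ?_
    rw [norm_sub_rev] at hmn
    have h3 : 0 ≤ ‖z‖ / z.im * C0 := by positivity
    have h4 : 0 ≤ ‖z‖ * (1 + ρ * (K / z.im)) := by positivity
    have h5 : stabConst z K ρ = (C0 + 1) + (‖z‖ / z.im * C0 + ‖z‖ * (1 + ρ * (K / z.im))) := by
      rw [stabConst]; ring
    rw [h5]
    nlinarith [mul_nonneg (add_nonneg h3 h4) hε]
  · set δ := deltaN t z N y with hδ
    have hgz : z * gN t z N y * (1 + δ) = -1 := by
      have hδ0 : 1 + δ ≠ 0 := norm_pos_iff.1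
        (lt_of_lt_of_le (by positivity) (le_norm_one_add_deltaN hz hN (fun i => (ht i).1) y))
      rw [gN, ← hδ]
      field_simp
    set St := (N : ℂ)⁻¹ * ∑ i, (t i : ℂ) / den m g (s i, t i)
    have e : z * g * (1 - z⁻¹ * St) + 1 =
        z * (g - gN t z N y) * (1 + δ) - z * g * (δ + z⁻¹ * St) := by
      linear_combination hgz
    have hδe : δ = (N : ℂ)⁻¹ * ∑ i, (t i : ℂ) * res (gram y Finset.univ) z i i := deltaN_eq y
    rw [← hδe] at h2
    have hδb : ‖1 + δ‖ ≤ 1 + ρ * (K / z.im) := by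
      refine (norm_add_le _ _).trans ?_
      rw [norm_one, hδe, norm_mul, norm_inv, Complex.norm_real, Real.norm_eq_abs, abs_of_pos hN]
      refine add_le_add le_rfl ?_
      calc _ ≤ N⁻¹ * ∑ _i : ι, K * (1 / z.im) := by
            refine mul_le_mul_of_nonneg_left ?_ (by positivity)
            refine (norm_sum_le _ _).trans (Finset.sum_le_sum fun i _ => ?_)
            rw [norm_mul, Complex.norm_real, Real.norm_eq_abs, abs_of_nonneg (ht i).1]
            exact mul_le_mul (ht i).2 ((norm_entry_le _ i i).trans
              (norm_res_le (gram_posSemidef y _).isHermitian hz)) (norm_nonneg _) hK0.le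
        _ = (Fintype.card ι : ℝ) / N * (K / z.im) := by
            rw [Finset.sum_const, Finset.card_univ, nsmul_eq_mul]
            ring
        _ ≤ _ := by gcongr
    rw [e]
    refine (norm_sub_le _ _).trans ?_
    rw [norm_mul, norm_mul, norm_mul, norm_mul]
    rw [norm_sub_rev] at hgn
    have h3 : ‖z‖ * ‖g - gN t z N y‖ * ‖1 + δ‖ ≤ ‖z‖ * ε * (1 + ρ * (K / z.im)) := by gcongr
    have h4 : ‖z‖ * ‖g‖ * ‖δ + z⁻¹ * St‖ ≤ ‖z‖ * (1 / z.im) * (C0 * ε) := by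
      gcongr
      exact hg.1
    have h5 : stabConst z K ρ = (C0 + 1) + (‖z‖ / z.im * C0 + ‖z‖ * (1 + ρ * (K / z.im))) := by
      rw [stabConst]; ring
    rw [h5]
    have h6 : ‖z‖ * (1 / z.im) * (C0 * ε) = ‖z‖ / z.im * C0 * ε := by ring
    nlinarith [mul_nonneg (add_nonneg hC0' zero_le_one) hε]

end Stability

/-! ### Limits of empirical averages under truncation -/

section Truncation

variable {Ω : Type*} [MeasurableSpace Ω] {P : Measure Ω} [IsProbabilityMeasure P]
  {c : ℝ} {H : Measure (ℝ × ℝ)} [IsProbabilityMeasure H] {F : Measure ℝ} [IsProbabilityMeasure F]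

lemma EmpiricalTendsto.integral_eq_zero {d : ℕ → ℕ} {pts : ∀ k, Fin (d k) → ℝ × ℝ}
    {μ : Measure (ℝ × ℝ)} (h : EmpiricalTendsto d pts μ) (f : BoundedContinuousFunction (ℝ × ℝ) ℝ)
    (hf : ∀ k i, f (pts k i) = 0) : ∫ x, f x ∂μ = 0 := by
  refine tendsto_nhds_unique (h f) ?_
  simp [hf]

/-- The cut-off function `min 1 (max 0 (u p))`. -/
noncomputable def cutoff (u : ℝ × ℝ → ℝ) (hu : Continuous u) :
    BoundedContinuousFunction (ℝ × ℝ) ℝ :=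
  BoundedContinuousFunction.ofNormedAddCommGroup (fun p => min 1 (max 0 (u p))) (by fun_prop) 1
    (fun p => by
      rw [Real.norm_eq_abs, abs_le]
      constructor
      · have : (0 : ℝ) ≤ min 1 (max 0 (u p)) := by positivity
        linarith
      · exact min_le_left _ _)

/-- A weak limit of measures on the closed quadrant lives there: cut-offs that vanish on the
quadrant have integral 0. -/
lemma Model.ae_nonneg (M : Model P c H) : ∀ᵐ p ∂H, 0 ≤ p.1 ∧ 0 ≤ p.2 := by
  have key : ∀ (u : ℝ × ℝ → ℝ) (hu : Continuous u),
      (∀ k i, u (M.s k i, M.t k i) ≤ 0) → ∀ᵐ p ∂H, u p ≤ 0 := by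
    intro u hu h
    have h1 := M.joint_tendsto.integral_eq_zero (cutoff u hu) fun k i => by
      change min 1 (max 0 (u (M.s k i, M.t k i))) = 0
      rw [max_eq_left (h k i)]
      simp
    rw [integral_eq_zero_iff_of_nonneg (fun p => by
      change (0 : ℝ) ≤ min 1 (max 0 (u p)); positivity) ((cutoff u hu).integrable H)] at h1
    filter_upwards [h1] with p hp
    by_contra hcon
    push Not at hcon
    change min 1 (max 0 (u p)) = 0 at hp
    have : 0 < min 1 (max 0 (u p)) := lt_min one_pos (lt_max_of_lt_right hcon)
    linarith
  filter_upwards [key (fun p => -p.1) (by fun_prop) fun k i => by simpa using M.s_nonneg i,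
    key (fun p => -p.2) (by fun_prop) fun k i => by simpa using M.t_nonneg i] with p h1 h2
  exact ⟨by linarith, by linarith⟩

lemma ae_le_of_isBounded (h : Bornology.IsBounded H.support) :
    ∃ K : ℝ, 0 ≤ K ∧ ∀ᵐ p ∂H, p.1 ≤ K ∧ p.2 ≤ K := by
  obtain ⟨K, hK⟩ := h.exists_norm_le
  refine ⟨max K 0, le_max_right _ _, ?_⟩
  filter_upwards [H.support_mem_ae] with p hp
  have := hK p hp
  rw [Prod.norm_def] at this
  exact ⟨(le_abs_self _).trans ((le_max_left _ _).trans (this.trans (le_max_left _ _))),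
    (le_abs_self _).trans ((le_max_right _ _).trans (this.trans (le_max_left _ _)))⟩

/-- The cut-off `ψ` vanishes H-almost everywhere and equals 1 at every discarded pair. The margin
between K₀ and K₀ + 1 makes room for it to be continuous. -/
lemma Model.tendsto_card_compl_keep (M : Model P c H) {K₀ : ℝ}
    (hK : ∀ᵐ p ∂H, p.1 ≤ K₀ ∧ p.2 ≤ K₀) :
    Tendsto (fun k => ((M.keep (K₀ + 1) k)ᶜ.card : ℝ) / M.N k) atTop (𝓝 0) := by
  set ψ := cutoff (fun p => max p.1 p.2 - K₀) (by fun_prop) with hψ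
  have h0 : ∫ p, ψ p ∂H = 0 := by
    rw [integral_eq_zero_of_ae]
    filter_upwards [hK] with p hp
    change min 1 (max 0 (max p.1 p.2 - K₀)) = 0
    rw [max_eq_left (by linarith [max_le hp.1 hp.2])]
    simp
  have h1 := M.joint_tendsto ψ
  rw [h0] at h1
  have h2 := M.ratio_tendsto.mul h1
  rw [mul_zero] at h2
  refine squeeze_zero (fun k => by positivity) (fun k => ?_) h2
  have h3 : ((M.keep (K₀ + 1) k)ᶜ.card : ℝ) ≤ ∑ i, ψ (M.s k i, M.t k i) := by
    rw [Finset.card_eq_sum_ones]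
    push_cast
    have hnn : ∀ i, 0 ≤ ψ (M.s k i, M.t k i) := fun i => by
      change (0 : ℝ) ≤ min 1 (max 0 _); positivity
    refine le_trans (Finset.sum_le_sum fun i hi => ?_)
      (Finset.sum_le_sum_of_subset_of_nonneg (Finset.subset_univ _) fun i _ _ => hnn i)
    have hi : K₀ + 1 < max (M.s k i) (M.t k i) := by
      rw [Finset.mem_compl, Model.keep, Finset.mem_filter] at hi
      simp only [Finset.mem_univ, true_and] at hi
      by_contra hcon
      push Not at hcon
      exact hi ⟨(le_max_left _ _).trans hcon, (le_max_right _ _).trans hcon⟩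
    change 1 ≤ min 1 (max 0 (max (M.s k i) (M.t k i) - K₀))
    exact le_min le_rfl ((by linarith : (1 : ℝ) ≤ _).trans (le_max_right _ _))
  rcases Nat.eq_zero_or_pos (M.n k) with hn | hn
  · have : (M.keep (K₀ + 1) k)ᶜ = ∅ := by
      apply Finset.eq_empty_of_forall_notMem
      intro i
      exact (Fin.cast hn i).elim0
    simp [this, hn]
  · have hn' : (0 : ℝ) < M.n k := by exact_mod_cast hn
    calc _ ≤ (∑ i, ψ (M.s k i, M.t k i)) / M.N k := by gcongr
      _ = _ := by field_simp

/-- Truncation does not change the limit of empirical averages. -/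
lemma Model.tendsto_average_trunc (M : Model P c H) {K₀ : ℝ}
    (hK : ∀ᵐ p ∂H, p.1 ≤ K₀ ∧ p.2 ≤ K₀) {f : ℝ × ℝ → ℂ} (hf : Continuous f) {C : ℝ}
    (hC : ∀ x, ‖f x‖ ≤ C) :
    Tendsto (fun k => (M.N k : ℂ)⁻¹ * ∑ i, f (M.sT (K₀ + 1) k i, M.tT (K₀ + 1) k i)) atTop
      (𝓝 (c * ∫ p, f p ∂H)) := by
  have h1 := M.joint_tendsto.complex hf hC
  have h2 : Tendsto (fun k => (((M.n k : ℝ) / M.N k : ℝ) : ℂ)) atTop (𝓝 (c : ℂ)) :=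
    (Complex.continuous_ofReal.tendsto _).comp M.ratio_tendsto
  have h3 := h2.mul h1
  have h4 := (M.tendsto_card_compl_keep hK).mul_const (2 * C)
  rw [zero_mul] at h4
  have h5 : Tendsto (fun k => (M.N k : ℂ)⁻¹ * ∑ i, f (M.sT (K₀ + 1) k i, M.tT (K₀ + 1) k i) -
      (M.N k : ℂ)⁻¹ * ∑ i, f (M.s k i, M.t k i)) atTop (𝓝 0) := by
    refine squeeze_zero_norm (fun k => ?_) h4
    rw [← mul_sub, ← Finset.sum_sub_distrib, norm_mul, norm_inv, Complex.norm_natCast]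
    have h6 : ‖∑ i, (f (M.sT (K₀ + 1) k i, M.tT (K₀ + 1) k i) - f (M.s k i, M.t k i))‖ ≤
        ((M.keep (K₀ + 1) k)ᶜ.card : ℝ) * (2 * C) := by
      rw [← Finset.sum_compl_add_sum (M.keep (K₀ + 1) k)]
      have h7 : ∑ i ∈ M.keep (K₀ + 1) k,
          (f (M.sT (K₀ + 1) k i, M.tT (K₀ + 1) k i) - f (M.s k i, M.t k i)) = 0 := by
        refine Finset.sum_eq_zero fun i hi => ?_
        simp [Model.sT, Model.tT, hi]
      rw [h7, add_zero]
      refine (norm_sum_le _ _).trans ?_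
      rw [← nsmul_eq_mul]
      refine Finset.sum_le_card_nsmul _ _ _ fun i _ => ?_
      refine (norm_sub_le _ _).trans ?_
      have := hC (M.sT (K₀ + 1) k i, M.tT (K₀ + 1) k i)
      have := hC (M.s k i, M.t k i)
      linarith
    calc _ ≤ (M.N k : ℝ)⁻¹ * (((M.keep (K₀ + 1) k)ᶜ.card : ℝ) * (2 * C)) := by gcongr
      _ = _ := by ring
  have h6 := h5.add h3
  rw [zero_add] at h6
  refine h6.congr fun k => ?_
  rcases Nat.eq_zero_or_pos (M.n k) with hn | hn
  · have : IsEmpty (Fin (M.n k)) := by rw [hn]; infer_instance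
    simp
  · have hn' : (M.n k : ℂ) ≠ 0 := by exact_mod_cast hn.ne'
    push_cast
    field_simp
    ring

end Truncation


/-! ### Existence of co-solutions in the upper half-plane -/

section Existence

open scoped Matrix.Norms.L2Operator

variable {Ω : Type*} [MeasurableSpace Ω] {P : Measure Ω} [IsProbabilityMeasure P]
  {c : ℝ} {H : Measure (ℝ × ℝ)} [IsProbabilityMeasure H] {F : Measure ℝ} [IsProbabilityMeasure F]
  {z : ℂ}

lemma Model.tendsto_trace_res (M : Model P c H) (hF : M.IsLSD F) (hz : 0 < z.im) :
    ∀ᵐ ω ∂P, Tendsto (fun k => (M.N k : ℂ)⁻¹ * (res (M.companion k ω) z).trace) atTop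
      (𝓝 (stieltjes F z)) := by
  filter_upwards [hF] with ω hω
  have hcont : Continuous fun l : ℝ => ((l : ℂ) - z)⁻¹ :=
    Continuous.inv₀ (by fun_prop) fun l => ofReal_sub_ne_zero l hz.ne'
  refine (hω.complex hcont fun l => norm_inv_sub_le l hz).congr fun k => ?_
  rw [trace_res_eq_sum (M.companion_isHermitian k ω) hz.ne']

lemma Model.tendsto_mN (M : Model P c H) (hF : M.IsLSD F) (hz : 0 < z.im) {K₀ : ℝ}
    (hK : ∀ᵐ p ∂H, p.1 ≤ K₀ ∧ p.2 ≤ K₀) :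
    ∀ᵐ ω ∂P, Tendsto (fun k => mN z (M.N k) (M.tcols (K₀ + 1) k ω)) atTop
      (𝓝 (stieltjes F z)) := by
  filter_upwards [M.tendsto_trace_res hF hz] with ω hω
  have h1 := (M.tendsto_card_compl_keep hK).div_const z.im
  rw [zero_div] at h1
  have h2 : Tendsto (fun k => mN z (M.N k) (M.tcols (K₀ + 1) k ω) -
      (M.N k : ℂ)⁻¹ * (res (M.companion k ω) z).trace) atTop (𝓝 0) := by
    refine squeeze_zero_norm' ?_ h1
    filter_upwards [M.N_tendsto.eventually_gt_atTop 0] with k hk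
    exact M.norm_mN_sub_le hz hk ω
  simpa using h2.add hω

lemma Model.measurable_mN (M : Model P c H) (hz : 0 < z.im) (K : ℝ) (k : ℕ) :
    Measurable fun ω => mN z (M.N k) (M.tcols K k ω) := by
  have h1 : Continuous fun x : Fin (M.n k) × Fin (M.N k) → ℂ =>
      mN z (M.N k) (cols (M.signal K k) (M.factor K k) (M.N k) x) := by
    unfold mN
    have h0 := continuous_res_cols (a := M.signal K k) (B := M.factor K k) (N := M.N k) hz.ne'
      Finset.univ
    fun_prop
  exact h1.measurable.comp (measurable_pi_lambda _ fun p => M.X_measurable k p.1 p.2)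

/-- Almost sure convergence is weakened to convergence in probability, the form in which it can be
combined with the Markov bounds for the weighted equations. -/
lemma Model.tendsto_measure_mN (M : Model P c H) (hF : M.IsLSD F) (hz : 0 < z.im) {K₀ : ℝ}
    (hK : ∀ᵐ p ∂H, p.1 ≤ K₀ ∧ p.2 ≤ K₀) {ε : ℝ} (hε : 0 < ε) :
    Tendsto (fun k => P.real {ω | ε ≤ ‖mN z (M.N k) (M.tcols (K₀ + 1) k ω) - stieltjes F z‖})
      atTop (𝓝 0) := by
  have h1 := tendstoInMeasure_of_tendsto_ae
    (fun k => (M.measurable_mN hz (K₀ + 1) k).aestronglyMeasurable) (M.tendsto_mN hF hz hK)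
  rw [tendstoInMeasure_iff_norm] at h1
  have h2 := (ENNReal.tendsto_toReal ENNReal.zero_ne_top).comp (h1 ε hε)
  rw [ENNReal.toReal_zero] at h2
  exact h2

lemma Model.tendsto_lindeberg (M : Model P c H) {η : ℝ} (hη : 0 < η) :
    Tendsto (fun k => ((M.N k : ℝ)⁻¹ * ∑ i, ∑ j,
      ∫ ω in {ω | η * √(M.n k : ℝ) ≤ ‖M.X k ω i j‖}, ‖M.X k ω i j‖ ^ 2 ∂P) / M.N k)
      atTop (𝓝 0) := by
  have h := (M.lindeberg η hη).mul (M.ratio_tendsto.const_mul (η ^ 2))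
  rw [zero_mul] at h
  refine h.congr fun k => ?_
  rcases Nat.eq_zero_or_pos (M.n k) with hn | hn
  · have : IsEmpty (Fin (M.n k)) := by rw [hn]; infer_instance
    simp
  · have hn' : (0 : ℝ) < M.n k := by exact_mod_cast hn
    field_simp

/-- The weighted equations hold approximately with high probability. -/
lemma Model.tendsto_measure_average (M : Model P c H) (hz : 0 < z.im) {K : ℝ} (hK : 0 ≤ K)
    (w : ∀ k, Fin (M.n k) → ℂ) (hw : ∀ k i, ‖w k i‖ ≤ 1) {ε : ℝ} (hε : 0 < ε) :
    Tendsto (fun k => P.real {ω | ε ≤ ‖((M.N k : ℝ) : ℂ)⁻¹ * ∑ i, w k i *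
      (z * (1 + M.tT K k i * mN z (M.N k) (M.tcols K k ω) +
        M.sT K k i * gN (M.tT K k) z (M.N k) (M.tcols K k ω)) *
        res (gram (M.tcols K k ω) Finset.univ) z i i + 1)‖}) atTop (𝓝 0) := by
  rw [tendsto_order]
  refine ⟨fun a ha => Eventually.of_forall fun k => lt_of_lt_of_le ha measureReal_nonneg,
    fun δ hδ => ?_⟩
  set A := 2 * (‖z‖ / z.im + (‖z‖ / z.im) ^ 2 * (K / z.im) + (‖z‖ / z.im) ^ 2) *
        (K / z.im * c) with hA
  -- Aη is the limit of the expected error; below εδ, Markov's inequality makes the exceptional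
  -- probability less than δ.
  obtain ⟨η, hη, hηA⟩ : ∃ η : ℝ, 0 < η ∧ A * η < ε * δ := by
    refine ⟨ε * δ / (|A| + 1), by positivity, ?_⟩
    rw [← mul_div_assoc, div_lt_iff₀ (by positivity), mul_comm]
    exact mul_lt_mul_of_pos_left ((le_abs_self A).trans_lt (lt_add_one _)) (by positivity)
  have h1 := tendsto_colBound z K c η _ M.N_tendsto M.ratio_tendsto (M.tendsto_lindeberg hη)
  have h2 : 2 * (‖z‖ / z.im + (‖z‖ / z.im) ^ 2 * (K / z.im) + (‖z‖ / z.im) ^ 2) *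
        (K / z.im * (η * c)) < ε * δ := by
    rw [hA] at hηA
    linarith
  filter_upwards [h1.eventually_lt_const h2, M.N_tendsto.eventually_gt_atTop 0] with k hk hNk
  obtain ⟨f, hf, hfb, hfi⟩ := exists_average_bound (P := P) (ι := Fin (M.n k)) (κ := Fin (M.N k))
    (X := fun ω p => M.X k ω p.1 p.2) (a := M.signal K k) (B := M.factor K k) (s := M.sT K k)
    (t := M.tT K k) (K := K) (N := M.N k) (z := z)
    (fun p => M.X_measurable k p.1 p.2) (M.X_indep k) (fun p => M.X_memLp k p.1 p.2)
    (fun p => M.X_mean k p.1 p.2) (fun p => M.X_variance k p.1 p.2) hz (by simp)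
    (by exact_mod_cast hNk) hK (M.factor_mul K k) (M.gram_signal K k) (M.tT_mem hK)
    (fun i => (M.sT_mem hK i).2) (τ := η * √(M.n k)) (by positivity) (w k) (hw k)
  have h3 := mul_meas_ge_le_integral_of_nonneg
    (ae_of_all P fun ω => (norm_nonneg _).trans (hfb ω)) hf ε
  have h4 : P.real {ω | ε ≤ ‖((M.N k : ℝ) : ℂ)⁻¹ * ∑ i, w k i *
      (z * (1 + M.tT K k i * mN z (M.N k) (M.tcols K k ω) +
        M.sT K k i * gN (M.tT K k) z (M.N k) (M.tcols K k ω)) *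
        res (gram (M.tcols K k ω) Finset.univ) z i i + 1)‖} ≤ P.real {ω | ε ≤ f ω} :=
    measureReal_mono fun ω hω => le_trans hω (hfb ω)
  refine h4.trans_lt ?_
  rw [Fintype.card_fin] at hfi
  have h5 := (h3.trans hfi).trans_lt hk
  exact lt_of_mul_lt_mul_left h5 hε.le

lemma exists_forall_lt_of_tendsto_measure {α : Type*} (Γ : Finset α) (f : α → ℕ → Ω → ℝ) {ε : ℝ}
    (h : ∀ a ∈ Γ, Tendsto (fun k => P.real {ω | ε ≤ f a k ω}) atTop (𝓝 0)) :
    ∀ᶠ k in atTop, ∃ ω, ∀ a ∈ Γ, f a k ω < ε := by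
  have h1 : Tendsto (fun k => ∑ a ∈ Γ, P.real {ω | ε ≤ f a k ω}) atTop (𝓝 0) := by
    simpa using tendsto_finsetSum Γ h
  filter_upwards [h1.eventually_lt_const one_pos] with k hk
  by_contra hcon
  push Not at hcon
  have h2 : (Set.univ : Set Ω) ⊆ ⋃ a ∈ Γ, {ω | ε ≤ f a k ω} := by
    intro ω _
    obtain ⟨a, ha, hle⟩ := hcon ω
    simp only [Set.mem_iUnion]
    exact ⟨a, ha, hle⟩
  have h3 := measureReal_mono (μ := P) h2 (measure_ne_top _ _)
  have h4 := measureReal_biUnion_finset_le (μ := P) Γ fun a => {ω | ε ≤ f a k ω}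
  rw [probReal_univ] at h3
  linarith

lemma im_inv_ofReal_sub (l : ℝ) (z : ℂ) :
    (((l : ℂ) - z)⁻¹).im = z.im * (‖((l : ℂ) - z)⁻¹‖ ^ 2) := by
  rw [Complex.inv_im, norm_inv, inv_pow, ← Complex.normSq_eq_norm_sq]
  simp
  ring

lemma continuous_inv_ofReal_sub {z : ℂ} (hz : z.im ≠ 0) :
    Continuous fun l : ℝ => ((l : ℂ) - z)⁻¹ :=
  Continuous.inv₀ (by fun_prop) fun l => ofReal_sub_ne_zero l hz

lemma integrable_inv_ofReal_sub (F : Measure ℝ) [IsFiniteMeasure F] {z : ℂ} (hz : 0 < z.im) :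
    Integrable (fun l : ℝ => ((l : ℂ) - z)⁻¹) F :=
  Integrable.of_bound (continuous_inv_ofReal_sub hz.ne').aestronglyMeasurable _
    (ae_of_all _ fun l => norm_inv_sub_le l hz)

lemma im_integral {α : Type*} [MeasurableSpace α] {μ : Measure α} {f : α → ℂ}
    (hf : Integrable f μ) : (∫ x, f x ∂μ).im = ∫ x, (f x).im ∂μ :=
  ((Complex.imCLM.integral_comp_comm hf).symm)

lemma im_stieltjes_nonneg (hz : 0 < z.im) : 0 ≤ (stieltjes F z).im := by
  rw [stieltjes, im_integral (integrable_inv_ofReal_sub F hz)]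
  refine integral_nonneg fun l => ?_
  change 0 ≤ (((l : ℂ) - z)⁻¹).im
  rw [im_inv_ofReal_sub]
  positivity

lemma Model.im_mul_stieltjes_nonneg (M : Model P c H) (hF : M.IsLSD F) (hz : 0 < z.im) {K₀ : ℝ}
    (hK : ∀ᵐ p ∂H, p.1 ≤ K₀ ∧ p.2 ≤ K₀) : 0 ≤ (z * stieltjes F z).im := by
  obtain ⟨ω, hω⟩ := (M.tendsto_mN hF hz hK).exists
  have h1 := (Complex.continuous_im.tendsto _).comp (hω.const_mul z)
  refine ge_of_tendsto h1 ?_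
  filter_upwards [M.N_tendsto.eventually_gt_atTop 0] with k hk
  exact im_mul_mN hz (by exact_mod_cast hk) _

/-- The projection of the plane onto `[0, K]²`. -/
noncomputable def clamp (K : ℝ) (p : ℝ × ℝ) : ℝ × ℝ := (max 0 (min p.1 K), max 0 (min p.2 K))

lemma clamp_eq {K : ℝ} {p : ℝ × ℝ} (h1 : 0 ≤ p.1 ∧ p.1 ≤ K) (h2 : 0 ≤ p.2 ∧ p.2 ≤ K) :
    clamp K p = p := by
  rw [clamp, min_eq_left h1.2, min_eq_left h2.2, max_eq_right h1.1, max_eq_right h2.1]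

lemma clamp_mem {K : ℝ} (hK : 0 ≤ K) (p : ℝ × ℝ) :
    (0 ≤ (clamp K p).1 ∧ (clamp K p).1 ≤ K) ∧ (0 ≤ (clamp K p).2 ∧ (clamp K p).2 ≤ K) :=
  ⟨⟨le_max_left _ _, max_le hK (min_le_right _ _)⟩,
    ⟨le_max_left _ _, max_le hK (min_le_right _ _)⟩⟩

lemma continuous_clamp (K : ℝ) : Continuous (clamp K) := by
  unfold clamp
  fun_prop

lemma le_norm_den {m g : ℂ} (hz : 0 < z.im) (hm : 0 ≤ (z * m).im) (hg : 0 ≤ (z * g).im)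
    {p : ℝ × ℝ} (h1 : 0 ≤ p.1) (h2 : 0 ≤ p.2) : z.im / ‖z‖ ≤ ‖den m g p‖ := by
  have hz1 : 0 < ‖z‖ := norm_pos_iff.2 (by rintro rfl; simp at hz)
  have := le_norm_mul_den hm hg h1 h2
  rw [norm_mul] at this
  rw [div_le_iff₀ hz1]
  linarith

lemma continuous_den (m g : ℂ) : Continuous (den m g) := by
  unfold den
  fun_prop

/-- The denominator may vanish outside the quadrant. Composing with the projection onto a square
gives a bounded continuous test function that agrees with the integrand at all truncated pairs and
H-almost everywhere. -/
lemma Model.tendsto_average_den (M : Model P c H) {K₀ : ℝ} (hK0 : 0 ≤ K₀)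
    (hK : ∀ᵐ p ∂H, p.1 ≤ K₀ ∧ p.2 ≤ K₀) {m g : ℂ} (hz : 0 < z.im) (hm : 0 ≤ (z * m).im)
    (hg : 0 ≤ (z * g).im) {h : ℝ × ℝ → ℂ} (hh : Continuous h) {C : ℝ}
    (hC : ∀ p, ‖h (clamp (K₀ + 1) p)‖ ≤ C) :
    Tendsto (fun k => ((M.N k : ℝ) : ℂ)⁻¹ * ∑ i, h (M.sT (K₀ + 1) k i, M.tT (K₀ + 1) k i) /
      den m g (M.sT (K₀ + 1) k i, M.tT (K₀ + 1) k i)) atTop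
      (𝓝 (c * ∫ p, h p / den m g p ∂H)) := by
  have hK1 : 0 ≤ K₀ + 1 := by linarith
  have hz1 : 0 < ‖z‖ := norm_pos_iff.2 (by rintro rfl; simp at hz)
  have hlow := fun p => le_norm_den hz hm hg (clamp_mem hK1 p).1.1 (clamp_mem hK1 p).2.1
  have hv : 0 < z.im / ‖z‖ := by positivity
  have hC0 : 0 ≤ C := (norm_nonneg _).trans (hC 0)
  set f : ℝ × ℝ → ℂ := fun p => h (clamp (K₀ + 1) p) / den m g (clamp (K₀ + 1) p) with hf
  have hcf : Continuous f :=
    (hh.comp (continuous_clamp _)).div ((continuous_den m g).comp (continuous_clamp _))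
      fun p => norm_pos_iff.1 (hv.trans_le (hlow p))
  have h1 := M.tendsto_average_trunc hK hcf (C := C / (z.im / ‖z‖)) fun p => by
    rw [hf, norm_div]
    exact div_le_div₀ hC0 (hC p) hv (hlow p)
  have h2 : ∫ p, f p ∂H = ∫ p, h p / den m g p ∂H := by
    refine integral_congr_ae ?_
    filter_upwards [hK, M.ae_nonneg] with p hp hp'
    rw [hf]
    simp only
    rw [clamp_eq ⟨hp'.1, by linarith [hp.1]⟩ ⟨hp'.2, by linarith [hp.2]⟩]
  rw [h2] at h1
  refine h1.congr fun k => ?_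
  rw [Complex.ofReal_natCast]
  congr 1
  refine Finset.sum_congr rfl fun i _ => ?_
  rw [hf]
  simp only
  rw [clamp_eq (M.sT_mem hK1 i) (M.tT_mem hK1 i)]

/-- The error bounds require nonrandom weights, yet the useful weight contains the random g_N. A
finite ε-net of `coSet z` resolves this: with high probability the bounds hold for all net points at
once, and at one outcome the point closest to g_N is taken. -/
lemma Model.exists_approx (M : Model P c H) (hF : M.IsLSD F) {K₀ : ℝ} (hK0 : 0 ≤ K₀)
    (hK : ∀ᵐ p ∂H, p.1 ≤ K₀ ∧ p.2 ≤ K₀) (hz : 0 < z.im) {ε : ℝ} (hε : 0 < ε) :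
    ∃ g ∈ coSet z,
      ‖stieltjes F z + (1 - (c : ℂ)) / z +
        z⁻¹ * (c * ∫ p, 1 / den (stieltjes F z) g p ∂H)‖ ≤
        stabConst z (K₀ + 1) (c + 1) * ε + (2 * ‖z⁻¹‖ + ‖z‖ * (1 / z.im) * ‖z⁻¹‖) * ε ∧
      ‖z * g * (1 - z⁻¹ * (c * ∫ p : ℝ × ℝ, (p.2 : ℂ) / den (stieltjes F z) g p ∂H)) + 1‖ ≤
        stabConst z (K₀ + 1) (c + 1) * ε + (2 * ‖z⁻¹‖ + ‖z‖ * (1 / z.im) * ‖z⁻¹‖) * ε := by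
  classical
  set m := stieltjes F z with hm
  set K := K₀ + 1 with hKdef
  have hK1 : 1 ≤ K := by linarith
  have hK0' : 0 ≤ K := by linarith
  have hzm : 0 ≤ (z * m).im := M.im_mul_stieltjes_nonneg hF hz hK
  obtain ⟨Γ, hΓ, hΓc⟩ : ∃ Γ : Finset ℂ, (∀ g ∈ Γ, g ∈ coSet z) ∧
      ∀ g ∈ coSet z, ∃ g' ∈ Γ, ‖g - g'‖ ≤ ε := by
    obtain ⟨Γ, h1, h2, h3⟩ := (isCompact_coSet z).finite_cover_balls hε
    refine ⟨h2.toFinset, fun g hg => h1 (by simpa using hg), fun g hg => ?_⟩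
    have := h3 hg
    simp only [Set.mem_iUnion, Metric.mem_ball, dist_eq_norm] at this
    obtain ⟨g', hg', hlt⟩ := this
    exact ⟨g', by simpa using hg', hlt.le⟩
  set hfun : Bool → ∀ k, Fin (M.n k) → ℝ := fun b k i => if b then 1 else M.tT K k i with hhfun
  have hfunb : ∀ b k i, 0 ≤ hfun b k i ∧ hfun b k i ≤ K := by
    intro b k i
    cases b
    · simpa [hhfun] using M.tT_mem hK0' i
    · simpa [hhfun] using hK1
  set w : ℂ × Bool → ∀ k, Fin (M.n k) → ℂ := fun a k i =>
    ((z.im / K * hfun a.2 k i : ℝ) : ℂ) / (z * den m a.1 (M.sT K k i, M.tT K k i)) with hw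
  have hwb : ∀ a ∈ Γ ×ˢ (Finset.univ : Finset Bool), ∀ k i, ‖w a k i‖ ≤ 1 := by
    intro a ha k i
    have hg := hΓ a.1 (Finset.mem_product.1 ha).1
    have h1 := le_norm_mul_den hzm hg.2.1 (p := (M.sT K k i, M.tT K k i))
      (M.sT_mem hK0' i).1 (M.tT_mem hK0' i).1
    rw [hw]
    simp only
    rw [norm_div, Complex.norm_real, Real.norm_eq_abs,
      abs_of_nonneg (mul_nonneg (by positivity) (hfunb a.2 k i).1)]
    refine div_le_one_of_le₀ ?_ (norm_nonneg _)
    refine le_trans ?_ h1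
    calc z.im / K * hfun a.2 k i ≤ z.im / K * K := by
          gcongr
          exact (hfunb a.2 k i).2
      _ = z.im := by field_simp
  -- The index `none` stands for the convergence of m_N; `some (g, b)` stands for the weighted
  -- equation at the net point g, with h = 1 or h = t according to b.
  have e1 := exists_forall_lt_of_tendsto_measure (P := P)
    (insert none ((Γ ×ˢ (Finset.univ : Finset Bool)).image some))
    (fun o k ω => o.elim ‖mN z (M.N k) (M.tcols K k ω) - m‖ fun a =>
      ‖((M.N k : ℝ) : ℂ)⁻¹ * ∑ i, w a k i *
      (z * (1 + M.tT K k i * mN z (M.N k) (M.tcols K k ω) +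
        M.sT K k i * gN (M.tT K k) z (M.N k) (M.tcols K k ω)) *
        res (gram (M.tcols K k ω) Finset.univ) z i i + 1)‖) (ε := ε) (by
      intro o ho
      rcases o with _ | a
      · exact M.tendsto_measure_mN hF hz hK hε
      · have ha : a ∈ Γ ×ˢ (Finset.univ : Finset Bool) := by simpa using ho
        exact M.tendsto_measure_average hz hK0' (w a) (hwb a ha) hε)
  have e2 : ∀ᶠ k in atTop, ∀ g ∈ Γ, ‖((M.N k : ℝ) : ℂ)⁻¹ * ∑ i, 1 /
      den m g (M.sT K k i, M.tT K k i) - c * ∫ p, 1 / den m g p ∂H‖ ≤ ε := by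
    rw [Finset.eventually_all]
    intro g hg
    have := M.tendsto_average_den hK0 hK hz hzm (hΓ g hg).2.1 (h := fun _ => 1) (by fun_prop)
      (C := 1) (by simp)
    filter_upwards [Metric.tendsto_nhds.1 this ε hε] with k hk
    rw [dist_eq_norm] at hk
    exact hk.le
  have e3 : ∀ᶠ k in atTop, ∀ g ∈ Γ, ‖((M.N k : ℝ) : ℂ)⁻¹ * ∑ i, (M.tT K k i : ℂ) /
      den m g (M.sT K k i, M.tT K k i) - c * ∫ p : ℝ × ℝ, (p.2 : ℂ) / den m g p ∂H‖ ≤ ε := by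
    rw [Finset.eventually_all]
    intro g hg
    have := M.tendsto_average_den hK0 hK hz hzm (hΓ g hg).2.1 (h := fun p => (p.2 : ℂ))
      (by fun_prop) (C := K) (fun p => by
        rw [Complex.norm_real, Real.norm_eq_abs, abs_of_nonneg (clamp_mem hK0' p).2.1]
        exact (clamp_mem hK0' p).2.2)
    filter_upwards [Metric.tendsto_nhds.1 this ε hε] with k hk
    rw [dist_eq_norm] at hk
    exact hk.le
  have e4 : ∀ᶠ k in atTop, ‖((M.n k : ℂ) / (M.N k : ℝ)) - c‖ ≤ ε := by
    have : Tendsto (fun k => (((M.n k : ℝ) / M.N k : ℝ) : ℂ)) atTop (𝓝 (c : ℂ)) :=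
      (Complex.continuous_ofReal.tendsto _).comp M.ratio_tendsto
    filter_upwards [Metric.tendsto_nhds.1 this ε hε] with k hk
    rw [dist_eq_norm] at hk
    simpa using hk.le
  have e5 := M.ratio_tendsto.eventually_lt_const (lt_add_one c)
  obtain ⟨k, ⟨ω, hω⟩, h2, h3, h4, h5, hNk⟩ :=
    (e1.and (e2.and (e3.and (e4.and (e5.and (M.N_tendsto.eventually_gt_atTop 0)))))).exists
  have hN : (0 : ℝ) < M.N k := by exact_mod_cast hNk
  obtain ⟨g, hgΓ, hgd⟩ := hΓc _ (gN_mem_coSet hz hN (fun i => (M.tT_mem hK0' i).1)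
    (M.tcols K k ω))
  have hg := hΓ g hgΓ
  have h6 := approx_equations hz hN hK1 hε.le (fun i => M.sT_mem hK0' i) (fun i => M.tT_mem hK0' i)
    (ρ := c + 1) (by rw [Fintype.card_fin]; exact h5.le) (M.tcols K k ω) hzm hg
    (hω none (by simp)).le hgd (by
      intro h hh
      rcases hh with rfl | rfl
      · have := (hω (some (g, true)) (by simpa using hgΓ)).le
        simpa [hw, hhfun] using this
      · have := (hω (some (g, false)) (by simpa using hgΓ)).le
        simpa [hw, hhfun] using this)
  rw [Fintype.card_fin] at h6
  refine ⟨g, hg, ?_, ?_⟩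
  · have e : m + (1 - (c : ℂ)) / z + z⁻¹ * (c * ∫ p, 1 / den m g p ∂H) =
        (m + (1 - (M.n k : ℂ) / (M.N k : ℝ)) / z +
          z⁻¹ * (((M.N k : ℝ) : ℂ)⁻¹ * ∑ i, 1 / den m g (M.sT K k i, M.tT K k i))) +
        z⁻¹ * ((M.n k : ℂ) / (M.N k : ℝ) - c) -
        z⁻¹ * (((M.N k : ℝ) : ℂ)⁻¹ * ∑ i, 1 / den m g (M.sT K k i, M.tT K k i) -
          c * ∫ p, 1 / den m g p ∂H) := by
      ring
    rw [e]
    refine (norm_sub_le _ _).trans ?_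
    have h7 := norm_add_le (m + (1 - (M.n k : ℂ) / (M.N k : ℝ)) / z +
          z⁻¹ * (((M.N k : ℝ) : ℂ)⁻¹ * ∑ i, 1 / den m g (M.sT K k i, M.tT K k i)))
        (z⁻¹ * ((M.n k : ℂ) / (M.N k : ℝ) - c))
    have h8 : ‖z⁻¹ * ((M.n k : ℂ) / (M.N k : ℝ) - c)‖ ≤ ‖z⁻¹‖ * ε := by
      rw [norm_mul]; gcongr
    have h9 : ‖z⁻¹ * (((M.N k : ℝ) : ℂ)⁻¹ * ∑ i, 1 / den m g (M.sT K k i, M.tT K k i) -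
          c * ∫ p, 1 / den m g p ∂H)‖ ≤ ‖z⁻¹‖ * ε := by
      rw [norm_mul]
      gcongr
      exact h2 g hgΓ
    have h10 : 0 ≤ ‖z‖ * (1 / z.im) * ‖z⁻¹‖ * ε := by positivity
    linarith [h6.1]
  · have e : z * g * (1 - z⁻¹ * (c * ∫ p : ℝ × ℝ, (p.2 : ℂ) / den m g p ∂H)) + 1 =
        (z * g * (1 - z⁻¹ * (((M.N k : ℝ) : ℂ)⁻¹ * ∑ i, (M.tT K k i : ℂ) /
          den m g (M.sT K k i, M.tT K k i))) + 1) +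
        z * g * z⁻¹ * (((M.N k : ℝ) : ℂ)⁻¹ * ∑ i, (M.tT K k i : ℂ) /
          den m g (M.sT K k i, M.tT K k i) - c * ∫ p : ℝ × ℝ, (p.2 : ℂ) / den m g p ∂H) := by
      ring
    rw [e]
    refine (norm_add_le _ _).trans ?_
    have h9 : ‖z * g * z⁻¹ * (((M.N k : ℝ) : ℂ)⁻¹ * ∑ i, (M.tT K k i : ℂ) /
          den m g (M.sT K k i, M.tT K k i) - c * ∫ p : ℝ × ℝ, (p.2 : ℂ) / den m g p ∂H)‖ ≤
        ‖z‖ * (1 / z.im) * ‖z⁻¹‖ * ε := by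
      rw [norm_mul, norm_mul, norm_mul]
      gcongr
      · exact hg.1
      · exact h3 g hgΓ
    have h10 : 0 ≤ 2 * ‖z⁻¹‖ * ε := by positivity
    linarith [h6.2]

lemma continuousOn_integral_den (hz : 0 < z.im) {K : ℝ}
    (hH : ∀ᵐ p ∂H, 0 ≤ p.1 ∧ 0 ≤ p.2) {m : ℂ} (hm : 0 ≤ (z * m).im) {h : ℝ × ℝ → ℂ}
    (hh : Continuous h) (hhK : ∀ᵐ p ∂H, ‖h p‖ ≤ K) :
    ContinuousOn (fun g => ∫ p, h p / den m g p ∂H) (coSet z) := by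
  have hz1 : 0 < ‖z‖ := norm_pos_iff.2 (by rintro rfl; simp at hz)
  have hv : 0 < z.im / ‖z‖ := by positivity
  refine continuousOn_of_dominated (bound := fun _ => K / (z.im / ‖z‖)) ?_ ?_
    (integrable_const _) ?_
  · intro g _
    exact (hh.measurable.div (continuous_den m g).measurable).aestronglyMeasurable
  · intro g hg
    filter_upwards [hH, hhK] with p hp hpK
    rw [norm_div]
    exact div_le_div₀ ((norm_nonneg _).trans hpK) hpK hv (le_norm_den hz hm hg.2.1 hp.1 hp.2)
  · filter_upwards [hH] with p hp
    refine ContinuousOn.div continuousOn_const ?_ fun g hg =>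
      norm_pos_iff.1 (hv.trans_le (le_norm_den hz hm hg.2.1 hp.1 hp.2))
    unfold den
    fun_prop

lemma integrable_div_den (hz : 0 < z.im) {K : ℝ}
    (hH : ∀ᵐ p ∂H, 0 ≤ p.1 ∧ 0 ≤ p.2) {m g : ℂ} (hm : 0 ≤ (z * m).im) (hg : 0 ≤ (z * g).im)
    {h : ℝ × ℝ → ℂ} (hh : Measurable h) (hhK : ∀ᵐ p ∂H, ‖h p‖ ≤ K) :
    Integrable (fun p => h p / den m g p) H := by
  have hz1 : 0 < ‖z‖ := norm_pos_iff.2 (by rintro rfl; simp at hz)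
  have hv : 0 < z.im / ‖z‖ := by positivity
  refine Integrable.of_bound (hh.div (continuous_den m g).measurable).aestronglyMeasurable
    (K / (z.im / ‖z‖)) ?_
  filter_upwards [hH, hhK] with p hp hpK
  rw [norm_div]
  exact div_le_div₀ ((norm_nonneg _).trans hpK) hpK hv (le_norm_den hz hm hg hp.1 hp.2)

/-- Co-solutions exist everywhere in the upper half-plane. -/
theorem Model.exists_isCoSolution (M : Model P c H) (hF : M.IsLSD F) {K₀ : ℝ} (hK0 : 0 ≤ K₀)
    (hK : ∀ᵐ p ∂H, p.1 ≤ K₀ ∧ p.2 ≤ K₀) (hc0 : 0 < c) (hz : 0 < z.im) :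
    ∃ g, IsCoSolution c H F z g ∧ 0 ≤ (z * g).im := by
  have hz0 : z ≠ 0 := by rintro rfl; simp at hz
  set m := stieltjes F z with hm
  have hzm : 0 ≤ (z * m).im := M.im_mul_stieltjes_nonneg hF hz hK
  have hb1 : ∀ᵐ p : ℝ × ℝ ∂H, ‖(1 : ℂ)‖ ≤ 1 := by simp
  have hb2 : ∀ᵐ p : ℝ × ℝ ∂H, ‖(p.2 : ℂ)‖ ≤ K₀ := by
    filter_upwards [hK, M.ae_nonneg] with p hp hp'
    rw [Complex.norm_real, Real.norm_eq_abs, abs_of_nonneg hp'.2]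
    exact hp.2
  have hc1 := continuousOn_integral_den hz M.ae_nonneg hzm (h := fun _ => 1) (by fun_prop) hb1
  have hc2 := continuousOn_integral_den hz M.ae_nonneg hzm (h := fun p => (p.2 : ℂ))
    (by fun_prop) hb2
  set r1 : ℂ → ℂ := fun g => m + (1 - (c : ℂ)) / z + z⁻¹ * (c * ∫ p, 1 / den m g p ∂H) with hr1
  set r2 : ℂ → ℂ := fun g =>
    z * g * (1 - z⁻¹ * (c * ∫ p : ℝ × ℝ, (p.2 : ℂ) / den m g p ∂H)) + 1 with hr2
  have hcont : ContinuousOn (fun g => ‖r1 g‖ + ‖r2 g‖) (coSet z) := by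
    refine ContinuousOn.add (ContinuousOn.norm ?_) (ContinuousOn.norm ?_)
    · exact continuousOn_const.add (continuousOn_const.mul (continuousOn_const.mul hc1))
    · exact ((continuousOn_const.mul continuousOn_id).mul
        (continuousOn_const.sub (continuousOn_const.mul (continuousOn_const.mul hc2)))).add
        continuousOn_const
  obtain ⟨g₁, hg₁, -⟩ := M.exists_approx hF hK0 hK hz one_pos
  -- The residual of (∗) attains its minimum on the compact set, and the approximate solutions put
  -- this minimum below Dε for every ε; so it is 0.
  obtain ⟨g, hg, hmin⟩ := (isCompact_coSet z).exists_isMinOn ⟨g₁, hg₁⟩ hcont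
  set D := 2 * (stabConst z (K₀ + 1) (c + 1) + (2 * ‖z⁻¹‖ + ‖z‖ * (1 / z.im) * ‖z⁻¹‖)) with hD
  have hle : ∀ ε : ℝ, 0 < ε → ‖r1 g‖ + ‖r2 g‖ ≤ D * ε := by
    intro ε hε
    obtain ⟨g', hg', h1, h2⟩ := M.exists_approx hF hK0 hK hz hε
    have h3 : ‖r1 g‖ + ‖r2 g‖ ≤ ‖r1 g'‖ + ‖r2 g'‖ := hmin hg'
    rw [hD]
    change ‖r1 g'‖ ≤ _ at h1
    change ‖r2 g'‖ ≤ _ at h2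
    linarith
  have hzero : ‖r1 g‖ + ‖r2 g‖ ≤ 0 := by
    have h1 : Tendsto (fun ε : ℝ => D * ε) (𝓝[>] 0) (𝓝 0) := by
      have : Tendsto (fun ε : ℝ => D * ε) (𝓝 0) (𝓝 (D * 0)) := tendsto_id.const_mul D
      rw [mul_zero] at this
      exact this.mono_left nhdsWithin_le_nhds
    exact ge_of_tendsto h1 (eventually_nhdsWithin_of_forall fun ε hε => hle ε hε)
  have hz1 : r1 g = 0 := norm_eq_zero.1 (le_antisymm (by linarith [norm_nonneg (r2 g)]) (norm_nonneg _))
  have hz2 : r2 g = 0 := norm_eq_zero.1 (le_antisymm (by linarith [norm_nonneg (r1 g)]) (norm_nonneg _))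
  have hi1 := integrable_div_den hz M.ae_nonneg hzm hg.2.1 (h := fun _ => 1) (by fun_prop) hb1
  have hi2 := integrable_div_den hz M.ae_nonneg hzm hg.2.1 (h := fun p => (p.2 : ℂ))
    (by fun_prop) hb2
  have hg0 : g ≠ 0 := by
    rintro rfl
    simp [hr2] at hz2
  have heq2 : z = -1 / g + (c : ℂ) * ∫ p : ℝ × ℝ, (p.2 : ℂ) / den m g p ∂H := by
    rw [hr2] at hz2
    simp only at hz2
    field_simp at hz2 ⊢
    linear_combination hz2
  have hmi : 0 ≤ m.im := im_stieltjes_nonneg hz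
  refine ⟨g, ⟨?_, hg0, hi1, hi2, ?_, heq2⟩, hg.2.1⟩
  -- `coSet` gives only Im g ≥ 0. In the second equation the integral has nonpositive imaginary part
  -- while Im z > 0, so Im(-1/g) > 0 and the inequality is strict.
  · have h1 : (∫ p : ℝ × ℝ, (p.2 : ℂ) / den m g p ∂H).im ≤ 0 := by
      rw [im_integral hi2]
      refine integral_nonpos_of_ae ?_
      filter_upwards [M.ae_nonneg] with p hp
      rw [div_eq_mul_inv, Complex.im_ofReal_mul, Complex.inv_im]
      have h2 : 0 ≤ (den m g p).im := by
        rw [den, Complex.add_im, Complex.add_im, Complex.im_ofReal_mul, Complex.im_ofReal_mul]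
        have := mul_nonneg hp.1 hg.2.2
        have := mul_nonneg hp.2 hmi
        simp only [Complex.one_im]
        linarith
      refine mul_nonpos_of_nonneg_of_nonpos hp.2 ?_
      rw [neg_div]
      exact neg_nonpos.2 (div_nonneg h2 (Complex.normSq_nonneg _))
    have h3 := congrArg Complex.im heq2
    rw [Complex.add_im, Complex.im_ofReal_mul, im_neg_inv] at h3
    have h4 : 0 < g.im / Complex.normSq g := by
      have := mul_nonpos_of_nonneg_of_nonpos hc0.le h1
      linarith
    have h5 : 0 < Complex.normSq g := Complex.normSq_pos.2 hg0
    rwa [div_pos_iff_of_pos_right h5] at h4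
  · rw [hr1] at hz1
    simp only at hz1
    field_simp at hz1
    linear_combination hz1

end Existence


/-! ### One- and two-point integrals of the limiting system -/

section Moments

variable {c : ℝ} {H : Measure (ℝ × ℝ)} [IsProbabilityMeasure H]

/-- The properties of `H` used for the analysis of the limiting system. -/
structure Admissible (H : Measure (ℝ × ℝ)) : Prop where
  isCompact : IsCompact H.support
  nonneg : ∀ p ∈ H.support, 0 ≤ p.1 ∧ 0 ≤ p.2
  pos : ∀ᵐ p ∂H, 0 < p.2
  integrable_inv : Integrable (fun p : ℝ × ℝ => p.2⁻¹) H

/-- The denominator does not vanish on the support of `H` at `q = (g, m)`. -/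
def Regular (H : Measure (ℝ × ℝ)) (q : ℂ × ℂ) : Prop := ∀ p ∈ H.support, den q.2 q.1 p ≠ 0

/-- The integral of `s^i t^j / (1 + s g + t m)` at `q = (g, m)`. -/
noncomputable def mom (H : Measure (ℝ × ℝ)) (i j : ℕ) (q : ℂ × ℂ) : ℂ :=
  ∫ p : ℝ × ℝ, (p.1 : ℂ) ^ i * (p.2 : ℂ) ^ j / den q.2 q.1 p ∂H

/-- The integral of `s^i t^j / ((1 + s g + t m) (1 + s g' + t m'))`. -/
noncomputable def mom₂ (H : Measure (ℝ × ℝ)) (i j : ℕ) (q q' : ℂ × ℂ) : ℂ :=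
  ∫ p : ℝ × ℝ, (p.1 : ℂ) ^ i * (p.2 : ℂ) ^ j / (den q.2 q.1 p * den q'.2 q'.1 p) ∂H

/-- Complex conjugation of pairs. -/
noncomputable def conjPair (q : ℂ × ℂ) : ℂ × ℂ := (star q.1, star q.2)

lemma den_conjPair (q : ℂ × ℂ) (p : ℝ × ℝ) :
    den (conjPair q).2 (conjPair q).1 p = star (den q.2 q.1 p) := by
  simp [den, conjPair]

lemma continuous_conjPair : Continuous conjPair := by
  unfold conjPair
  fun_prop

lemma Regular.conjPair {q : ℂ × ℂ} (h : Regular H q) : Regular H (conjPair q) := by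
  intro p hp
  rw [den_conjPair]
  exact star_ne_zero.2 (h p hp)

lemma regular_zero : Regular H 0 := by
  intro p _
  simp [den]

lemma im_den (q : ℂ × ℂ) (p : ℝ × ℝ) : (den q.2 q.1 p).im = p.1 * q.1.im + p.2 * q.2.im := by
  simp [den]

/-- The imaginary part of the denominator vanishes only at s = t = 0, and there the denominator is
1. -/
lemma Admissible.regular (hA : Admissible H) {q : ℂ × ℂ} (h1 : 0 < q.1.im) (h2 : 0 < q.2.im) :
    Regular H q := by
  intro p hp h0
  obtain ⟨hs, ht⟩ := hA.nonneg p hp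
  have h3 := congrArg Complex.im h0
  rw [im_den, Complex.zero_im] at h3
  have h4 := mul_nonneg hs h1.le
  have h5 := mul_nonneg ht h2.le
  have h6 : p.1 = 0 := by
    rcases mul_eq_zero.1 (by linarith : p.1 * q.1.im = 0) with h | h
    · exact h
    · exact absurd h h1.ne'
  have h7 : p.2 = 0 := by
    rcases mul_eq_zero.1 (by linarith : p.2 * q.2.im = 0) with h | h
    · exact h
    · exact absurd h h2.ne'
  simp [den, h6, h7] at h0

lemma continuous_den_uncurry :
    Continuous fun a : (ℂ × ℂ) × (ℝ × ℝ) => den a.1.2 a.1.1 a.2 := by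
  unfold den
  fun_prop

lemma Regular.exists_le (hA : Admissible H) {q : ℂ × ℂ} (h : Regular H q) :
    ∃ d : ℝ, 0 < d ∧ ∀ᶠ q' in 𝓝 q, ∀ p ∈ H.support, d ≤ ‖den q'.2 q'.1 p‖ := by
  obtain ⟨d, hd, hle⟩ := hA.isCompact.exists_forall_le' (f := fun p => ‖den q.2 q.1 p‖)
    (continuous_den q.2 q.1).norm.continuousOn (a := 0) fun p hp => norm_pos_iff.2 (h p hp)
  refine ⟨d / 2, by positivity, ?_⟩
  refine hA.isCompact.eventually_forall_of_forall_eventually fun p hp => ?_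
  have := (continuous_den_uncurry.norm.tendsto (q, p)).eventually_const_lt
    (show d / 2 < _ from lt_of_lt_of_le (by linarith) (hle p hp))
  filter_upwards [this] with a ha
  exact ha.le

lemma Regular.eventually (hA : Admissible H) {q : ℂ × ℂ} (h : Regular H q) :
    ∀ᶠ q' in 𝓝 q, Regular H q' := by
  obtain ⟨d, hd, h1⟩ := h.exists_le hA
  filter_upwards [h1] with q' hq' p hp
  exact norm_pos_iff.1 (hd.trans_le (hq' p hp))

lemma Admissible.exists_bound (hA : Admissible H) (i j : ℕ) :
    ∃ C : ℝ, 0 ≤ C ∧ ∀ p ∈ H.support, ‖(p.1 : ℂ) ^ i * (p.2 : ℂ) ^ j‖ ≤ C := by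
  obtain ⟨C, hC⟩ := hA.isCompact.exists_bound_of_continuousOn
    (f := fun p : ℝ × ℝ => (p.1 : ℂ) ^ i * (p.2 : ℂ) ^ j) (by fun_prop)
  exact ⟨max C 0, le_max_right _ _, fun p hp => (hC p hp).trans (le_max_left _ _)⟩

lemma continuousAt_mom₂ (hA : Admissible H) (i j : ℕ) {q q' : ℂ × ℂ} (h : Regular H q)
    (h' : Regular H q') :
    ContinuousAt (fun a : (ℂ × ℂ) × (ℂ × ℂ) => mom₂ H i j a.1 a.2) (q, q') := by
  obtain ⟨d, hd, h1⟩ := h.exists_le hA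
  obtain ⟨d', hd', h2⟩ := h'.exists_le hA
  obtain ⟨C, hC0, hC⟩ := hA.exists_bound i j
  unfold mom₂
  refine continuousAt_of_dominated (bound := fun _ => C / (d * d')) ?_ ?_
    (integrable_const _) ?_
  · refine Eventually.of_forall fun a => ?_
    have h3 : Measurable fun p : ℝ × ℝ => (p.1 : ℂ) ^ i * (p.2 : ℂ) ^ j := by fun_prop
    exact (h3.div ((continuous_den _ _).mul (continuous_den _ _)).measurable).aestronglyMeasurable
  · filter_upwards [(continuous_fst.tendsto (q, q')).eventually h1,
      (continuous_snd.tendsto (q, q')).eventually h2] with a ha1 ha2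
    filter_upwards [H.support_mem_ae] with p hp
    rw [norm_div, norm_mul]
    rw [norm_mul (den _ _ _)]
    have := hC p hp
    rw [norm_mul] at this
    exact div_le_div₀ hC0 this (by positivity)
      (mul_le_mul (ha1 p hp) (ha2 p hp) hd'.le (norm_nonneg _))
  · filter_upwards [H.support_mem_ae] with p hp
    refine ContinuousAt.div continuousAt_const ?_ (mul_ne_zero (h p hp) (h' p hp))
    unfold den
    fun_prop

lemma mom_eq_mom₂ (i j : ℕ) (q : ℂ × ℂ) : mom H i j q = mom₂ H i j q 0 := by
  simp [mom, mom₂, den]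

lemma continuousAt_mom (hA : Admissible H) (i j : ℕ) {q : ℂ × ℂ} (h : Regular H q) :
    ContinuousAt (mom H i j) q := by
  have h1 := continuousAt_mom₂ hA i j h regular_zero
  have h2 : mom H i j = (fun a : (ℂ × ℂ) × (ℂ × ℂ) => mom₂ H i j a.1 a.2) ∘ fun q => (q, 0) := by
    funext q
    exact mom_eq_mom₂ i j q
  rw [h2]
  exact ContinuousAt.comp (x := q) h1 (by fun_prop)

lemma integrable_mom₂ (hA : Admissible H) (i j : ℕ) {q q' : ℂ × ℂ} (h : Regular H q)
    (h' : Regular H q') :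
    Integrable (fun p : ℝ × ℝ => (p.1 : ℂ) ^ i * (p.2 : ℂ) ^ j /
      (den q.2 q.1 p * den q'.2 q'.1 p)) H := by
  obtain ⟨d, hd, h1⟩ := h.exists_le hA
  obtain ⟨d', hd', h2⟩ := h'.exists_le hA
  obtain ⟨C, hC0, hC⟩ := hA.exists_bound i j
  have h3 : Measurable fun p : ℝ × ℝ => (p.1 : ℂ) ^ i * (p.2 : ℂ) ^ j := by fun_prop
  refine Integrable.of_bound
    (h3.div ((continuous_den _ _).mul (continuous_den _ _)).measurable).aestronglyMeasurable
    (C / (d * d')) ?_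
  filter_upwards [H.support_mem_ae] with p hp
  rw [norm_div, norm_mul (den _ _ _)]
  exact div_le_div₀ hC0 (hC p hp) (by positivity)
    (mul_le_mul (h1.self_of_nhds p hp) (h2.self_of_nhds p hp) hd'.le (norm_nonneg _))

lemma integrable_mom (hA : Admissible H) (i j : ℕ) {q : ℂ × ℂ} (h : Regular H q) :
    Integrable (fun p : ℝ × ℝ => (p.1 : ℂ) ^ i * (p.2 : ℂ) ^ j / den q.2 q.1 p) H := by
  simpa [den] using integrable_mom₂ hA i j h regular_zero

/-- An exact divided difference. It replaces differentiation under the integral, and uniqueness,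
Lipschitz bounds and analyticity all rest on it. -/
lemma mom_sub_mom (hA : Admissible H) (i j : ℕ) {q q' : ℂ × ℂ} (h : Regular H q)
    (h' : Regular H q') :
    mom H i j q - mom H i j q' =
      -((q.1 - q'.1) * mom₂ H (i + 1) j q q' + (q.2 - q'.2) * mom₂ H i (j + 1) q q') := by
  rw [mom, mom, ← integral_sub (integrable_mom hA i j h) (integrable_mom hA i j h'), mom₂, mom₂,
    ← integral_const_mul, ← integral_const_mul, ← integral_add
      ((integrable_mom₂ hA (i + 1) j h h').const_mul _)
      ((integrable_mom₂ hA i (j + 1) h h').const_mul _), ← integral_neg]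
  refine integral_congr_ae ?_
  filter_upwards [H.support_mem_ae] with p hp
  have h1 := h p hp
  have h2 := h' p hp
  field_simp
  simp only [den]
  ring

lemma quad_eq_mom₂ (i j : ℕ) (q : ℂ × ℂ) :
    (quad H i j q.2 q.1 : ℂ) = mom₂ H i j q (conjPair q) := by
  refine (integral_ofReal (𝕜 := ℂ)).symm.trans ?_
  rw [mom₂]
  congr 1
  funext p
  rw [den_conjPair, Complex.star_def, Complex.mul_conj', kern]
  push_cast
  rfl

lemma integrable_kern (hA : Admissible H) (i j : ℕ) {q : ℂ × ℂ} (h : Regular H q) :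
    Integrable (kern i j q.2 q.1) H := by
  have h1 := (integrable_mom₂ hA i j h h.conjPair).re
  refine h1.congr (ae_of_all _ fun p => ?_)
  have : (p.1 : ℂ) ^ i * (p.2 : ℂ) ^ j / (den q.2 q.1 p * den (conjPair q).2 (conjPair q).1 p) =
      (kern i j q.2 q.1 p : ℝ) := by
    rw [den_conjPair, Complex.star_def, Complex.mul_conj', kern]
    push_cast
    rfl
  simp only [this]
  exact Complex.ofReal_re _

lemma continuousAt_quad (hA : Admissible H) (i j : ℕ) {q : ℂ × ℂ} (h : Regular H q) :
    ContinuousAt (fun q : ℂ × ℂ => quad H i j q.2 q.1) q := by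
  have h1 := continuousAt_mom₂ hA i j h h.conjPair
  have h2 : ContinuousAt (fun q : ℂ × ℂ => (q, conjPair q)) q :=
    continuousAt_id.prodMk continuous_conjPair.continuousAt
  have h3 : ContinuousAt (fun q : ℂ × ℂ => (mom₂ H i j q (conjPair q)).re) q :=
    Complex.continuous_re.continuousAt.comp
      (ContinuousAt.comp (x := q) (f := fun q : ℂ × ℂ => (q, conjPair q))
        (g := fun a : (ℂ × ℂ) × (ℂ × ℂ) => mom₂ H i j a.1 a.2) h1 h2)
  refine h3.congr (Eventually.of_forall fun q => ?_)
  change (mom₂ H i j q (conjPair q)).re = _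
  rw [← quad_eq_mom₂, Complex.ofReal_re]

lemma im_mom (hA : Admissible H) (i j : ℕ) {q : ℂ × ℂ} (h : Regular H q) :
    (mom H i j q).im =
      -(q.1.im * quad H (i + 1) j q.2 q.1 + q.2.im * quad H i (j + 1) q.2 q.1) := by
  rw [mom, im_integral (integrable_mom hA i j h), quad, quad, ← integral_const_mul,
    ← integral_const_mul, ← integral_add ((integrable_kern hA _ _ h).const_mul _)
      ((integrable_kern hA _ _ h).const_mul _), ← integral_neg]
  congr 1
  funext p
  have e : (p.1 : ℂ) ^ i * (p.2 : ℂ) ^ j / den q.2 q.1 p =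
      ((p.1 ^ i * p.2 ^ j : ℝ) : ℂ) * (den q.2 q.1 p)⁻¹ := by
    push_cast
    rw [div_eq_mul_inv]
  rw [e, Complex.im_ofReal_mul, Complex.inv_im, im_den, kern, kern, Complex.normSq_eq_norm_sq]
  ring

lemma quad_nonneg (hA : Admissible H) (i j : ℕ) (m g : ℂ) : 0 ≤ quad H i j m g := by
  refine integral_nonneg_of_ae ?_
  filter_upwards [H.support_mem_ae] with p hp
  obtain ⟨h1, h2⟩ := hA.nonneg p hp
  change 0 ≤ kern i j m g p
  unfold kern
  positivity

/-- Cauchy–Schwarz for the two-point integrals. -/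
lemma norm_mom₂_le (hA : Admissible H) (i j : ℕ) {q q' : ℂ × ℂ} (h : Regular H q)
    (h' : Regular H q') :
    ‖mom₂ H i j q q'‖ ≤ √(quad H i j q.2 q.1) * √(quad H i j q'.2 q'.1) := by
  -- Cauchy–Schwarz through ab ≤ (x a² + b²/x)/2, integrated and then optimized in x.
  have hle : ∀ᵐ p ∂H, ∀ x : ℝ, 0 < x → ‖(p.1 : ℂ) ^ i * (p.2 : ℂ) ^ j /
      (den q.2 q.1 p * den q'.2 q'.1 p)‖ ≤
      (x * kern i j q.2 q.1 p + x⁻¹ * kern i j q'.2 q'.1 p) / 2 := by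
    filter_upwards [H.support_mem_ae] with p hp x hx
    obtain ⟨h1, h2⟩ := hA.nonneg p hp
    have ha := norm_pos_iff.2 (h p hp)
    have hb := norm_pos_iff.2 (h' p hp)
    rw [norm_div, norm_mul, norm_mul, norm_pow, norm_pow, Complex.norm_real, Complex.norm_real,
      Real.norm_eq_abs, Real.norm_eq_abs, abs_of_nonneg h1, abs_of_nonneg h2, kern, kern]
    set a := ‖den q.2 q.1 p‖⁻¹
    set b := ‖den q'.2 q'.1 p‖⁻¹
    have hw : 0 ≤ p.1 ^ i * p.2 ^ j := by positivity
    have e1 : p.1 ^ i * p.2 ^ j / (‖den q.2 q.1 p‖ * ‖den q'.2 q'.1 p‖) =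
        p.1 ^ i * p.2 ^ j * (a * b) := by
      rw [div_eq_mul_inv, mul_inv]
    have e2 : (x * (p.1 ^ i * p.2 ^ j / ‖den q.2 q.1 p‖ ^ 2) +
        x⁻¹ * (p.1 ^ i * p.2 ^ j / ‖den q'.2 q'.1 p‖ ^ 2)) / 2 =
        p.1 ^ i * p.2 ^ j * ((x * a ^ 2 + x⁻¹ * b ^ 2) / 2) := by
      rw [div_eq_mul_inv _ (‖den q.2 q.1 p‖ ^ 2), div_eq_mul_inv _ (‖den q'.2 q'.1 p‖ ^ 2),
        ← inv_pow, ← inv_pow]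
      ring
    rw [e1, e2]
    refine mul_le_mul_of_nonneg_left ?_ hw
    have e3 : (x * a ^ 2 + x⁻¹ * b ^ 2) / 2 - a * b = (x * a - b) ^ 2 / (2 * x) := by
      field_simp
      ring
    have : 0 ≤ (x * a - b) ^ 2 / (2 * x) := by positivity
    linarith
  have hle2 : ∀ x : ℝ, 0 < x → ‖mom₂ H i j q q'‖ ≤
      (x * quad H i j q.2 q.1 + x⁻¹ * quad H i j q'.2 q'.1) / 2 := by
    intro x hx
    have e : (x * quad H i j q.2 q.1 + x⁻¹ * quad H i j q'.2 q'.1) / 2 =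
        ∫ p, (x * kern i j q.2 q.1 p + x⁻¹ * kern i j q'.2 q'.1 p) / 2 ∂H := by
      rw [integral_div, integral_add ((integrable_kern hA _ _ h).const_mul _)
        ((integrable_kern hA _ _ h').const_mul _), integral_const_mul, integral_const_mul]
      rfl
    rw [e]
    refine norm_integral_le_of_norm_le ((((integrable_kern hA _ _ h).const_mul _).add
      ((integrable_kern hA _ _ h').const_mul _)).div_const 2) ?_
    filter_upwards [hle] with p hp
    exact hp x hx
  set a := quad H i j q.2 q.1 with ha
  set b := quad H i j q'.2 q'.1 with hb
  have ha0 : 0 ≤ a := quad_nonneg hA _ _ _ _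
  have hb0 : 0 ≤ b := quad_nonneg hA _ _ _ _
  refine le_of_forall_pos_le_add fun ε hε => ?_
  -- The optimal x is √b/√a; the shift by δ covers the cases in which a or b is 0.
  have hcont : Tendsto (fun δ : ℝ => √(a + δ) * √(b + δ)) (𝓝[>] 0) (𝓝 (√a * √b)) := by
    have : Continuous fun δ : ℝ => √(a + δ) * √(b + δ) := by fun_prop
    have := this.tendsto 0
    simp only [add_zero] at this
    exact this.mono_left nhdsWithin_le_nhds
  refine le_trans (ge_of_tendsto hcont (eventually_nhdsWithin_of_forall fun δ (hδ : 0 < δ) => ?_))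
    (le_add_of_nonneg_right hε.le)
  have hx : 0 < √(a + δ) := Real.sqrt_pos.2 (by linarith)
  have hy : 0 < √(b + δ) := Real.sqrt_pos.2 (by linarith)
  refine (hle2 (√(b + δ) / √(a + δ)) (by positivity)).trans ?_
  have e1 := Real.sq_sqrt (show 0 ≤ a + δ by linarith)
  have e2 := Real.sq_sqrt (show 0 ≤ b + δ by linarith)
  set X := √(a + δ)
  set Y := √(b + δ)
  have h1 : Y / X * a ≤ Y * X := by
    rw [div_mul_eq_mul_div, div_le_iff₀ hx]
    nlinarith
  have h2 : (Y / X)⁻¹ * b ≤ X * Y := by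
    rw [inv_div, div_mul_eq_mul_div, div_le_iff₀ hy]
    nlinarith
  linarith

end Moments


/-! ### Elimination of z and the two-point identity -/

section System

variable {c : ℝ} {H : Measure (ℝ × ℝ)} [IsProbabilityMeasure H]

lemma mom_total (hA : Admissible H) {q : ℂ × ℂ} (h : Regular H q) :
    mom H 0 0 q + q.1 * mom H 1 0 q + q.2 * mom H 0 1 q = 1 := by
  rw [mom, mom, mom, ← integral_const_mul, ← integral_const_mul,
    ← integral_add (integrable_mom hA 0 0 h) ((integrable_mom hA 1 0 h).const_mul _),
    ← integral_add _ ((integrable_mom hA 0 1 h).const_mul _)]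
  · have : (∫ _ : ℝ × ℝ, (1 : ℂ) ∂H) = 1 := by simp
    rw [← this]
    refine integral_congr_ae ?_
    filter_upwards [H.support_mem_ae] with p hp
    have h1 := h p hp
    have e : (p.1 : ℂ) ^ 0 * (p.2 : ℂ) ^ 0 / den q.2 q.1 p + q.1 * ((p.1 : ℂ) ^ 1 * (p.2 : ℂ) ^ 0 /
        den q.2 q.1 p) + q.2 * ((p.1 : ℂ) ^ 0 * (p.2 : ℂ) ^ 1 / den q.2 q.1 p) =
        den q.2 q.1 p / den q.2 q.1 p := by
      simp only [den]
      ring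
    rw [e, div_self h1]
  · exact (integrable_mom hA 0 0 h).add ((integrable_mom hA 1 0 h).const_mul _)

/-- Integrating den/den = 1 (`mom_total`) expresses the integral in the first equation through the
other two. Multiplying that equation by g and inserting the second then removes z, which leaves a
single equation for (g, m). -/
lemma solves_iff (hA : Admissible H) {q : ℂ × ℂ} (h : Regular H q) (hg : q.1 ≠ 0) {z : ℂ} :
    Solves c H z q.2 q.1 ↔
      z = -1 / q.1 + c * mom H 0 1 q ∧ c * q.1 ^ 2 * mom H 1 0 q + q.2 - q.1 = 0 := by
  have e0 : mom H 0 0 q = ∫ p, 1 / den q.2 q.1 p ∂H := by simp [mom]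
  have e1 : mom H 0 1 q = ∫ p : ℝ × ℝ, (p.2 : ℂ) / den q.2 q.1 p ∂H := by simp [mom]
  have i0 : Integrable (fun p => 1 / den q.2 q.1 p) H := by simpa using integrable_mom hA 0 0 h
  have i1 : Integrable (fun p : ℝ × ℝ => (p.2 : ℂ) / den q.2 q.1 p) H := by
    simpa using integrable_mom hA 0 1 h
  have ht := mom_total hA h
  unfold Solves
  rw [← e0, ← e1]
  constructor
  · rintro ⟨-, -, -, h1, h2⟩
    refine ⟨h2, ?_⟩
    have h3 : z * q.1 = -1 + c * q.1 * mom H 0 1 q := by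
      rw [h2]; field_simp
    linear_combination (-q.1) * h1 + q.2 * h3 + c * q.1 * ht
  · rintro ⟨h2, h1⟩
    refine ⟨hg, i0, i1, ?_, h2⟩
    have h3 : z * q.1 = -1 + c * q.1 * mom H 0 1 q := by
      rw [h2]; field_simp
    have : q.1 * (z * q.2 - (-(1 - (c : ℂ)) - c * mom H 0 0 q)) = 0 := by
      linear_combination (-1) * h1 + q.2 * h3 + c * q.1 * ht
    rcases mul_eq_zero.1 this with h4 | h4
    · exact absurd h4 hg
    · linear_combination h4

lemma Solves.eq_left {z : ℂ} {q : ℂ × ℂ} (h : Solves c H z q.2 q.1) :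
    z * q.2 = -(1 - (c : ℂ)) - c * mom H 0 0 q := by
  have e0 : mom H 0 0 q = ∫ p, 1 / den q.2 q.1 p ∂H := by simp [mom]
  rw [e0]
  exact h.2.2.2.1

lemma Solves.eq_right {z : ℂ} {q : ℂ × ℂ} (h : Solves c H z q.2 q.1) :
    z = -1 / q.1 + c * mom H 0 1 q := by
  have e1 : mom H 0 1 q = ∫ p : ℝ × ℝ, (p.2 : ℂ) / den q.2 q.1 p ∂H := by simp [mom]
  rw [e1]
  exact h.2.2.2.2

/-- The second equation of (∗) at two points, subtracted. The factor of g - g' is a two-point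
version of V₀; when it is nonzero, g is governed by z and m. -/
lemma Solves.two_point (hA : Admissible H) {z z' : ℂ} {q q' : ℂ × ℂ} (h : Solves c H z q.2 q.1)
    (h' : Solves c H z' q'.2 q'.1) (hq : Regular H q) (hq' : Regular H q') :
    (q.1 - q'.1) * (1 / (q.1 * q'.1) - c * mom₂ H 1 1 q q') =
      (z - z') + c * (q.2 - q'.2) * mom₂ H 0 2 q q' := by
  have h1 := mom_sub_mom hA 0 1 hq hq'
  have e : z - z' = (q.1 - q'.1) * (1 / (q.1 * q'.1)) + c * (mom H 0 1 q - mom H 0 1 q') := by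
    have hg := h.1
    have hg' := h'.1
    rw [h.eq_right, h'.eq_right]
    field_simp
    ring
  rw [e, h1]
  ring

lemma V₀_le (hA : Admissible H) (hc : 0 ≤ c) (m g : ℂ) : V₀ c H m g ≤ (‖g‖ ^ 2)⁻¹ := by
  have := mul_nonneg hc (quad_nonneg hA 1 1 m g)
  rw [V₀]
  linarith

/-- A reversed Cauchy–Schwarz inequality: if x² - a ≥ κ and y² - b ≥ κ, then xy - √a√b ≥ κ. It
applies with x = 1/|g|, a = cA₂ and the same quantities at the second point. -/
lemma le_norm_bracket (hA : Admissible H) (hc : 0 ≤ c) {q q' : ℂ × ℂ} (hq : Regular H q)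
    (hq' : Regular H q') {κ : ℝ} (hκ : 0 ≤ κ) (h1 : κ ≤ V₀ c H q.2 q.1)
    (h2 : κ ≤ V₀ c H q'.2 q'.1) :
    κ ≤ ‖1 / (q.1 * q'.1) - c * mom₂ H 1 1 q q'‖ := by
  have hCS := norm_mom₂_le hA 1 1 hq hq'
  have ha := quad_nonneg hA 1 1 q.2 q.1
  have hb := quad_nonneg hA 1 1 q'.2 q'.1
  have h3 := norm_sub_norm_le (1 / (q.1 * q'.1)) (c * mom₂ H 1 1 q q')
  rw [norm_div, norm_mul, norm_one, norm_mul, Complex.norm_real, Real.norm_eq_abs,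
    abs_of_nonneg hc] at h3
  refine le_trans ?_ h3
  have h4 : c * ‖mom₂ H 1 1 q q'‖ ≤
      √(c * quad H 1 1 q.2 q.1) * √(c * quad H 1 1 q'.2 q'.1) := by
    rw [Real.sqrt_mul hc, Real.sqrt_mul hc]
    calc _ ≤ c * (√(quad H 1 1 q.2 q.1) * √(quad H 1 1 q'.2 q'.1)) := by gcongr
      _ = √c * √c * (√(quad H 1 1 q.2 q.1) * √(quad H 1 1 q'.2 q'.1)) := by
          rw [Real.mul_self_sqrt hc]
      _ = _ := by ring
  rw [V₀, ← inv_pow] at h1 h2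
  set x := ‖q.1‖⁻¹
  set y := ‖q'.1‖⁻¹
  have hx : 0 ≤ x := by positivity
  have hy : 0 ≤ y := by positivity
  set a := c * quad H 1 1 q.2 q.1
  set b := c * quad H 1 1 q'.2 q'.1
  have ha0 : 0 ≤ a := mul_nonneg hc ha
  have hb0 : 0 ≤ b := mul_nonneg hc hb
  have e : 1 / (‖q.1‖ * ‖q'.1‖) = x * y := by rw [one_div, mul_inv]
  rw [e]
  have hκxy : κ ≤ x * y := by
    have h5 : κ * κ ≤ x ^ 2 * y ^ 2 := by
      apply mul_le_mul <;> linarith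
    nlinarith [mul_nonneg hx hy]
  have h6 : √a * √b ≤ x * y - κ := by
    rw [← Real.sqrt_mul ha0]
    apply Real.sqrt_le_iff.2
    refine ⟨by linarith, ?_⟩
    calc a * b ≤ (x ^ 2 - κ) * (y ^ 2 - κ) := by
          apply mul_le_mul <;> linarith
      _ ≤ (x * y - κ) ^ 2 := by nlinarith [mul_nonneg hκ (sq_nonneg (x - y))]
  linarith

end System

/-! ### Positivity and holomorphy of the Stieltjes transform -/

section Stieltjes

variable {F : Measure ℝ} [IsProbabilityMeasure F]

lemma im_stieltjes_pos {z : ℂ} (hz : 0 < z.im) : 0 < (stieltjes F z).im := by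
  have hi := integrable_inv_ofReal_sub F hz
  rw [stieltjes, im_integral hi]
  have hpos : ∀ l : ℝ, 0 < (((l : ℂ) - z)⁻¹).im := by
    intro l
    rw [im_inv_ofReal_sub]
    have := norm_pos_iff.2 (inv_ne_zero (ofReal_sub_ne_zero l hz.ne'))
    positivity
  rw [integral_pos_iff_support_of_nonneg (fun l => (hpos l).le) hi.im]
  have : Function.support (fun l : ℝ => (((l : ℂ) - z)⁻¹).im) = Set.univ := by
    ext l
    simpa using (hpos l).ne'
  change 0 < F (Function.support (fun l : ℝ => (((l : ℂ) - z)⁻¹).im))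
  rw [this]
  simp

lemma hasDerivAt_stieltjes {z : ℂ} {ρ : ℝ} (hρ : 0 < ρ) (h : ∀ᵐ l : ℝ ∂F, ρ ≤ ‖(l : ℂ) - z‖) :
    HasDerivAt (stieltjes F) (∫ l : ℝ, (((l : ℂ) - z) ^ 2)⁻¹ ∂F) z := by
  have hlow : ∀ᵐ l : ℝ ∂F, ∀ w ∈ Metric.ball z (ρ / 2), ρ / 2 ≤ ‖(l : ℂ) - w‖ := by
    filter_upwards [h] with l hl w hw
    rw [Metric.mem_ball, dist_eq_norm] at hw
    have h2 := norm_sub_norm_le ((l : ℂ) - z) (w - z)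
    rw [show (l : ℂ) - z - (w - z) = (l : ℂ) - w by ring] at h2
    linarith
  have hmeas : ∀ w : ℂ, Measurable fun l : ℝ => ((l : ℂ) - w)⁻¹ := fun w =>
    (Complex.measurable_ofReal.sub_const w).inv
  refine (hasDerivAt_integral_of_dominated_loc_of_deriv_le (μ := F)
    (F := fun (w : ℂ) (l : ℝ) => ((l : ℂ) - w)⁻¹)
    (F' := fun (w : ℂ) (l : ℝ) => (((l : ℂ) - w) ^ 2)⁻¹) (s := Metric.ball z (ρ / 2))
    (bound := fun _ => ((ρ / 2) ^ 2)⁻¹) (Metric.ball_mem_nhds z (by positivity))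
    (Eventually.of_forall fun w => (hmeas w).aestronglyMeasurable) ?_ ?_ ?_
    (integrable_const _) ?_).2
  · refine Integrable.of_bound (hmeas z).aestronglyMeasurable ρ⁻¹ ?_
    filter_upwards [h] with l hl
    rw [norm_inv]
    exact inv_anti₀ hρ hl
  · exact (((Complex.measurable_ofReal.sub_const z).pow_const 2).inv).aestronglyMeasurable
  · filter_upwards [hlow] with l hl w hw
    rw [norm_inv, norm_pow]
    exact inv_anti₀ (by positivity) (pow_le_pow_left₀ (by positivity) (hl w hw) 2)
  · filter_upwards [hlow] with l hl w hw
    have hne : (l : ℂ) - w ≠ 0 := norm_pos_iff.1 (lt_of_lt_of_le (by positivity) (hl w hw))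
    refine (((hasDerivAt_id w).const_sub (l : ℂ)).inv hne).congr_deriv ?_
    simp

lemma differentiableAt_stieltjes {z : ℂ} (hz : 0 < z.im) :
    DifferentiableAt ℂ (stieltjes F) z := by
  refine (hasDerivAt_stieltjes hz (ae_of_all _ fun l => ?_)).differentiableAt
  have := Complex.abs_im_le_norm ((l : ℂ) - z)
  simpa [abs_of_pos hz] using this

end Stieltjes

/-! ### Uniqueness and holomorphy of co-solutions -/

section CoSolution

variable {c : ℝ} {H : Measure (ℝ × ℝ)} [IsProbabilityMeasure H] {F : Measure ℝ}
  [IsProbabilityMeasure F] {z z' g g' : ℂ}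

lemma IsCoSolution.regular (hA : Admissible H) (hz : 0 < z.im) (h : IsCoSolution c H F z g) :
    Regular H (g, stieltjes F z) :=
  hA.regular h.1 (im_stieltjes_pos hz)

lemma IsCoSolution.im_mul (hA : Admissible H) (hz : 0 < z.im) (h : IsCoSolution c H F z g) :
    (z * stieltjes F z).im = c * (g.im * quad H 1 0 (stieltjes F z) g +
      (stieltjes F z).im * quad H 0 1 (stieltjes F z) g) := by
  have h1 := congrArg Complex.im (Solves.eq_left (q := (g, stieltjes F z)) h.2)
  have h2 := im_mom hA 0 0 (h.regular hA hz)
  simp only [zero_add] at h1 h2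
  rw [h1, Complex.sub_im, Complex.neg_im, Complex.sub_im, Complex.one_im, Complex.ofReal_im,
    Complex.im_ofReal_mul, h2]
  ring

/-- Imaginary part of the second equation; `IsCoSolution.im_mul` is that of the first. Positivity of
V₀ in the upper half-plane is immediate from it, and the pair of identities drives all estimates in
gaps. -/
lemma IsCoSolution.im_mul_V₀ (hA : Admissible H) (hz : 0 < z.im) (h : IsCoSolution c H F z g) :
    g.im * V₀ c H (stieltjes F z) g =
      z.im + c * ((stieltjes F z).im * quad H 0 2 (stieltjes F z) g) := by
  have h1 := congrArg Complex.im (Solves.eq_right (q := (g, stieltjes F z)) h.2)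
  have h2 := im_mom hA 0 1 (h.regular hA hz)
  simp only [zero_add, Nat.reduceAdd] at h1 h2
  rw [Complex.add_im, Complex.im_ofReal_mul, h2, im_neg_inv, Complex.normSq_eq_norm_sq] at h1
  rw [h1, V₀]
  ring

lemma IsCoSolution.V₀_ge (hA : Admissible H) (hc : 0 ≤ c) (hz : 0 < z.im)
    (h : IsCoSolution c H F z g) : z.im / g.im ≤ V₀ c H (stieltjes F z) g := by
  rw [div_le_iff₀ h.1, mul_comm, h.im_mul_V₀ hA hz]
  have := mul_nonneg hc (mul_nonneg (im_stieltjes_pos (F := F) hz).le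
    (quad_nonneg hA 0 2 (stieltjes F z) g))
  linarith

lemma IsCoSolution.V₀_pos (hA : Admissible H) (hc : 0 ≤ c) (hz : 0 < z.im)
    (h : IsCoSolution c H F z g) : 0 < V₀ c H (stieltjes F z) g :=
  (div_pos hz h.1).trans_le (h.V₀_ge hA hc hz)

lemma IsCoSolution.mul_norm_sq_le (hA : Admissible H) (hc : 0 ≤ c) (hz : 0 < z.im)
    (h : IsCoSolution c H F z g) : z.im * ‖g‖ ^ 2 ≤ g.im := by
  have h1 := (h.V₀_ge hA hc hz).trans (V₀_le hA hc _ _)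
  have h2 : 0 < ‖g‖ := norm_pos_iff.2 h.2.1
  rwa [← one_div, div_le_div_iff₀ h.1 (by positivity), one_mul] at h1

/-- From Im z |g|² ≤ Im g ≤ |g| follows Im g ≤ 1/Im z. The resulting bound does not mention g, so it
is locally uniform before any continuity of g is known. -/
lemma IsCoSolution.sq_le_V₀ (hA : Admissible H) (hc : 0 ≤ c) (hz : 0 < z.im)
    (h : IsCoSolution c H F z g) : z.im ^ 2 ≤ V₀ c H (stieltjes F z) g := by
  refine le_trans ?_ (h.V₀_ge hA hc hz)
  have h2 : 0 < ‖g‖ := norm_pos_iff.2 h.2.1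
  have h1 := h.mul_norm_sq_le hA hc hz
  have h3 := (le_abs_self _).trans (Complex.abs_im_le_norm g)
  rw [le_div_iff₀ h.1]
  have h4 : z.im * ‖g‖ ≤ 1 := by nlinarith
  nlinarith

lemma IsCoSolution.two_point (hA : Admissible H) (hz : 0 < z.im) (hz' : 0 < z'.im)
    (h : IsCoSolution c H F z g) (h' : IsCoSolution c H F z' g') :
    (g - g') * (1 / (g * g') - c * mom₂ H 1 1 (g, stieltjes F z) (g', stieltjes F z')) =
      (z - z') + c * (stieltjes F z - stieltjes F z') *
        mom₂ H 0 2 (g, stieltjes F z) (g', stieltjes F z') :=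
  Solves.two_point (q := (g, stieltjes F z)) (q' := (g', stieltjes F z')) hA h.2 h'.2
    (h.regular hA hz) (h'.regular hA hz')

lemma IsCoSolution.norm_sub_le (hA : Admissible H) (hc : 0 ≤ c) (hz : 0 < z.im) (hz' : 0 < z'.im)
    (h : IsCoSolution c H F z g) (h' : IsCoSolution c H F z' g') {κ β : ℝ} (hκ : 0 ≤ κ)
    (h1 : κ ≤ V₀ c H (stieltjes F z) g) (h2 : κ ≤ V₀ c H (stieltjes F z') g')
    (h3 : quad H 0 2 (stieltjes F z) g ≤ β) (h4 : quad H 0 2 (stieltjes F z') g' ≤ β) :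
    κ * ‖g - g'‖ ≤ ‖z - z'‖ + c * ‖stieltjes F z - stieltjes F z'‖ * β := by
  have hr := h.regular hA hz
  have hr' := h'.regular hA hz'
  have hb := le_norm_bracket hA hc hr hr' hκ h1 h2
  have hβ : 0 ≤ β := (quad_nonneg hA _ _ _ _).trans h3
  have hm : ‖mom₂ H 0 2 (g, stieltjes F z) (g', stieltjes F z')‖ ≤ β := by
    refine (norm_mom₂_le hA 0 2 hr hr').trans ?_
    calc _ ≤ √β * √β := by
          apply mul_le_mul (Real.sqrt_le_sqrt h3) (Real.sqrt_le_sqrt h4) <;> positivity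
      _ = β := Real.mul_self_sqrt hβ
  have e := congrArg norm (h.two_point hA hz hz' h')
  rw [norm_mul] at e
  calc κ * ‖g - g'‖ ≤ ‖g - g'‖ * ‖1 / (g * g') -
        c * mom₂ H 1 1 (g, stieltjes F z) (g', stieltjes F z')‖ := by
        rw [mul_comm]
        exact mul_le_mul_of_nonneg_left hb (norm_nonneg _)
    _ ≤ _ := by
        rw [e]
        refine (norm_add_le _ _).trans ?_
        rw [norm_mul, norm_mul, Complex.norm_real, Real.norm_eq_abs, abs_of_nonneg hc]
        gcongr

/-- At equal z the right side of the two-point estimate vanishes, while V₀ > 0 for both candidates.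
-/
lemma IsCoSolution.unique (hA : Admissible H) (hc : 0 ≤ c) (hz : 0 < z.im)
    (h : IsCoSolution c H F z g) (h' : IsCoSolution c H F z g') : g = g' := by
  have h1 := h.norm_sub_le hA hc hz hz h'
    (κ := min (V₀ c H (stieltjes F z) g) (V₀ c H (stieltjes F z) g'))
    (β := max (quad H 0 2 (stieltjes F z) g) (quad H 0 2 (stieltjes F z) g'))
    (le_min (h.V₀_pos hA hc hz).le (h'.V₀_pos hA hc hz).le) (min_le_left _ _) (min_le_right _ _)
    (le_max_left _ _) (le_max_right _ _)
  have h2 : 0 < min (V₀ c H (stieltjes F z) g) (V₀ c H (stieltjes F z) g') :=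
    lt_min (h.V₀_pos hA hc hz) (h'.V₀_pos hA hc hz)
  simp only [sub_self, norm_zero, mul_zero, zero_mul, add_zero] at h1
  have h3 : ‖g - g'‖ ≤ 0 := by
    by_contra hcon
    push Not at hcon
    nlinarith [mul_pos h2 hcon]
  exact sub_eq_zero.1 (norm_le_zero_iff.1 h3)

/-- Pointwise, |1 + sg + tm| ≥ t Im m, so the integrand of B₂ is at most (Im m)⁻². -/
lemma IsCoSolution.quad_le (hA : Admissible H) (hz : 0 < z.im) (h : IsCoSolution c H F z g) :
    quad H 0 2 (stieltjes F z) g ≤ ((stieltjes F z).im ^ 2)⁻¹ := by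
  have hm := im_stieltjes_pos (F := F) hz
  have hr := h.regular hA hz
  have hk : ∀ᵐ p ∂H, kern 0 2 (stieltjes F z) g p ≤ ((stieltjes F z).im ^ 2)⁻¹ := by
    filter_upwards [H.support_mem_ae] with p hp
    obtain ⟨h1, h2⟩ := hA.nonneg p hp
    have h3 : 0 < ‖den (stieltjes F z) g p‖ := norm_pos_iff.2 (hr p hp)
    have h4 : p.2 * (stieltjes F z).im ≤ ‖den (stieltjes F z) g p‖ := by
      have h5 := (le_abs_self _).trans (Complex.abs_im_le_norm (den (stieltjes F z) g p))
      rw [im_den (g, stieltjes F z) p] at h5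
      have := mul_nonneg h1 h.1.le
      linarith
    rw [kern, pow_zero, one_mul, ← one_div, div_le_div_iff₀ (by positivity) (by positivity),
      one_mul, ← mul_pow]
    exact pow_le_pow_left₀ (mul_nonneg h2 hm.le) h4 2
  refine (integral_mono_ae (integrable_kern hA 0 2 hr) (integrable_const _) hk).trans_eq ?_
  simp

variable {γ : ℂ → ℂ}

lemma continuousAt_coSolution (hA : Admissible H) (hc : 0 ≤ c)
    (hγ : ∀ z : ℂ, 0 < z.im → IsCoSolution c H F z (γ z)) (hz : 0 < z.im) :
    ContinuousAt γ z := by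
  have hms : ContinuousAt (stieltjes F) z := (differentiableAt_stieltjes hz).continuousAt
  set v := z.im with hv
  set μ := (stieltjes F z).im with hμ
  have hμ0 : 0 < μ := im_stieltjes_pos hz
  have e1 : ∀ᶠ w in 𝓝 z, v / 2 < w.im :=
    (Complex.continuous_im.tendsto z).eventually_const_lt (by linarith)
  have e2 : ∀ᶠ w in 𝓝 z, μ / 2 < (stieltjes F w).im :=
    (Complex.continuous_im.continuousAt.comp hms).eventually_const_lt
      (show μ / 2 < (stieltjes F z).im by linarith)
  have e3 : ∀ᶠ w in 𝓝 z, ‖γ w - γ z‖ ≤ ((v / 2) ^ 2)⁻¹ *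
      (‖w - z‖ + c * ‖stieltjes F w - stieltjes F z‖ * ((μ / 2) ^ 2)⁻¹) := by
    filter_upwards [e1, e2] with w h1 h2
    have hw : 0 < w.im := by linarith
    have h3 := (hγ w hw).norm_sub_le hA hc hw hz (hγ z hz) (κ := (v / 2) ^ 2)
      (β := ((μ / 2) ^ 2)⁻¹) (by positivity)
      (le_trans (pow_le_pow_left₀ (by positivity) h1.le 2) ((hγ w hw).sq_le_V₀ hA hc hw))
      (le_trans (pow_le_pow_left₀ (by positivity) (by linarith) 2) ((hγ z hz).sq_le_V₀ hA hc hz))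
      (((hγ w hw).quad_le hA hw).trans
        (inv_anti₀ (by positivity) (pow_le_pow_left₀ (by positivity) h2.le 2)))
      (((hγ z hz).quad_le hA hz).trans
        (inv_anti₀ (by positivity) (pow_le_pow_left₀ (by positivity) (by linarith) 2)))
    rw [inv_mul_eq_div, le_div_iff₀ (by positivity), mul_comm]
    exact h3
  rw [ContinuousAt, tendsto_iff_norm_sub_tendsto_zero]
  refine squeeze_zero' (Eventually.of_forall fun _ => norm_nonneg _) e3 ?_
  have h4 : Tendsto (fun w => ‖w - z‖) (𝓝 z) (𝓝 0) :=
    tendsto_iff_norm_sub_tendsto_zero.1 tendsto_id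
  have h5 : Tendsto (fun w => ‖stieltjes F w - stieltjes F z‖) (𝓝 z) (𝓝 0) :=
    tendsto_iff_norm_sub_tendsto_zero.1 hms
  simpa using (h4.add ((h5.const_mul c).mul_const _)).const_mul (((v / 2) ^ 2)⁻¹)

lemma differentiableAt_coSolution (hA : Admissible H) (hc : 0 ≤ c)
    (hγ : ∀ z : ℂ, 0 < z.im → IsCoSolution c H F z (γ z)) (hz : 0 < z.im) :
    DifferentiableAt ℂ γ z := by
  have hcγ := continuousAt_coSolution hA hc hγ hz
  have hd := differentiableAt_stieltjes (F := F) hz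
  have hr := (hγ z hz).regular hA hz
  have hq : ContinuousAt (fun w => (((γ w, stieltjes F w) : ℂ × ℂ), ((γ z, stieltjes F z) : ℂ × ℂ)))
      z := (hcγ.prodMk hd.continuousAt).prodMk continuousAt_const
  have hmom : ∀ i j, ContinuousAt (fun w => mom₂ H i j (γ w, stieltjes F w) (γ z, stieltjes F z)) z :=
    fun i j => ContinuousAt.comp (x := z)
      (f := fun w => (((γ w, stieltjes F w) : ℂ × ℂ), ((γ z, stieltjes F z) : ℂ × ℂ)))
      (g := fun a : (ℂ × ℂ) × (ℂ × ℂ) => mom₂ H i j a.1 a.2) (continuousAt_mom₂ hA i j hr hr) hq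
  have hg0 : γ z ≠ 0 := (hγ z hz).2.1
  set Br : ℂ → ℂ := fun w =>
    1 / (γ w * γ z) - c * mom₂ H 1 1 (γ w, stieltjes F w) (γ z, stieltjes F z) with hBr
  have hBrc : ContinuousAt Br z :=
    (continuousAt_const.div (hcγ.mul continuousAt_const) (mul_ne_zero hg0 hg0)).sub
      (continuousAt_const.mul (hmom 1 1))
  have hBr0 : ∀ w, 0 < w.im → Br w ≠ 0 := by
    intro w hw
    have h1 := le_norm_bracket hA hc ((hγ w hw).regular hA hw) hr
      (κ := min (V₀ c H (stieltjes F w) (γ w)) (V₀ c H (stieltjes F z) (γ z)))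
      (le_min ((hγ w hw).V₀_pos hA hc hw).le ((hγ z hz).V₀_pos hA hc hz).le)
      (min_le_left _ _) (min_le_right _ _)
    exact norm_pos_iff.1 ((lt_min ((hγ w hw).V₀_pos hA hc hw)
      ((hγ z hz).V₀_pos hA hc hz)).trans_le h1)
  -- The two-point identity solved for (γ w - γ z)/(w - z); its value at w = z is defined through
  -- `dslope`, and continuity there makes it the derivative.
  set φ : ℂ → ℂ := fun w => (1 + c * dslope (stieltjes F) z w *
    mom₂ H 0 2 (γ w, stieltjes F w) (γ z, stieltjes F z)) / Br w with hφ
  have hφc : ContinuousAt φ z := by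
    refine ContinuousAt.div (continuousAt_const.add ((continuousAt_const.mul ?_).mul (hmom 0 2)))
      hBrc (hBr0 z hz)
    exact continuousAt_dslope_same.2 hd
  refine (hasDerivAt_iff_tendsto_slope.2 ((hφc.tendsto.mono_left nhdsWithin_le_nhds).congr' ?_)
    : HasDerivAt γ (φ z) z).differentiableAt
  have e1 : ∀ᶠ w in 𝓝[≠] z, 0 < w.im :=
    ((Complex.continuous_im.tendsto z).eventually_const_lt hz).filter_mono nhdsWithin_le_nhds
  filter_upwards [e1, self_mem_nhdsWithin] with w hw hne
  have hne : w - z ≠ 0 := sub_ne_zero.2 hne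
  have h1 := (hγ w hw).two_point hA hw hz (hγ z hz)
  have h2 : (w - z) * dslope (stieltjes F) z w = stieltjes F w - stieltjes F z := by
    have := sub_smul_dslope (stieltjes F) z w
    simpa using this
  rw [slope_def_field, hφ]
  simp only
  rw [div_eq_div_iff (hBr0 w hw) hne]
  rw [hBr]
  simp only
  rw [h1, ← h2]
  ring

end CoSolution


/-! ### Convergence of integrals under a weighted L² bound -/

section WeightedConvergence

variable {α : Type*} [MeasurableSpace α] {μ : Measure α}

lemma norm_le_half_weight {w h : ℝ} (hw : 0 < w) : h ≤ (w * h ^ 2 + w⁻¹) / 2 := by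
  have e : (w * h ^ 2 + w⁻¹) / 2 - h = (w * h - 1) ^ 2 / (2 * w) := by
    field_simp
    ring
  have : 0 ≤ (w * h - 1) ^ 2 / (2 * w) := by positivity
  linarith

/-- Convergence of integrals under a uniform weighted second moment bound. -/
lemma tendsto_integral_of_weight {f : ℕ → α → ℂ} {f' : α → ℂ} {w : α → ℝ}
    (hw : ∀ᵐ x ∂μ, 0 < w x) (hwm : Measurable w) (hwi : Integrable (fun x => (w x)⁻¹) μ)
    (hf : ∀ n, AEStronglyMeasurable (f n) μ)
    (hi : ∀ n, Integrable (fun x => w x * ‖f n x‖ ^ 2) μ) {C : ℝ}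
    (hC : ∀ n, ∫ x, w x * ‖f n x‖ ^ 2 ∂μ ≤ C)
    (hlim : ∀ᵐ x ∂μ, Tendsto (fun n => f n x) atTop (𝓝 (f' x))) :
    Integrable f' μ ∧ Tendsto (fun n => ∫ x, f n x ∂μ) atTop (𝓝 (∫ x, f' x ∂μ)) := by
  have hf' : AEStronglyMeasurable f' μ := aestronglyMeasurable_of_tendsto_ae _ hf hlim
  have hC0 : 0 ≤ C := by
    refine le_trans (integral_nonneg_of_ae ?_) (hC 0)
    filter_upwards [hw] with x hx
    positivity
  have hnn : ∀ g : α → ℂ, ∀ᵐ x ∂μ, 0 ≤ w x * ‖g x‖ ^ 2 := by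
    intro g
    filter_upwards [hw] with x hx
    positivity
  have hmeas : AEStronglyMeasurable (fun x => w x * ‖f' x‖ ^ 2) μ :=
    hwm.aestronglyMeasurable.mul (hf'.norm.pow 2)
  have hfatou : ∫⁻ x, ENNReal.ofReal (w x * ‖f' x‖ ^ 2) ∂μ ≤ ENNReal.ofReal C := by
    have h1 : ∫⁻ x, ENNReal.ofReal (w x * ‖f' x‖ ^ 2) ∂μ ≤
        ∫⁻ x, liminf (fun n => ENNReal.ofReal (w x * ‖f n x‖ ^ 2)) atTop ∂μ := by
      refine lintegral_mono_ae ?_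
      filter_upwards [hlim] with x hx
      have : Tendsto (fun n => ENNReal.ofReal (w x * ‖f n x‖ ^ 2)) atTop
          (𝓝 (ENNReal.ofReal (w x * ‖f' x‖ ^ 2))) :=
        (ENNReal.continuous_ofReal.tendsto _).comp ((hx.norm.pow 2).const_mul _)
      exact this.liminf_eq.ge
    refine h1.trans ((lintegral_liminf_le' fun n => (hi n).aemeasurable.ennreal_ofReal).trans ?_)
    refine liminf_le_of_frequently_le' (Frequently.of_forall fun n => ?_)
    rw [← ofReal_integral_eq_lintegral_ofReal (hi n) (hnn _)]
    exact ENNReal.ofReal_le_ofReal (hC n)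
  have hi' : Integrable (fun x => w x * ‖f' x‖ ^ 2) μ := by
    refine ⟨hmeas, ?_⟩
    rw [hasFiniteIntegral_iff_ofReal (hnn _)]
    exact hfatou.trans_lt ENNReal.ofReal_lt_top
  have hC' : ∫ x, w x * ‖f' x‖ ^ 2 ∂μ ≤ C := by
    rw [integral_eq_lintegral_of_nonneg_ae (hnn _) hmeas]
    exact ENNReal.toReal_le_of_le_ofReal hC0 hfatou
  have hint : ∀ g : α → ℂ, AEStronglyMeasurable g μ → Integrable (fun x => w x * ‖g x‖ ^ 2) μ →
      Integrable g μ := by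
    intro g hg hgi
    refine Integrable.mono' ((hgi.add hwi).div_const 2) hg ?_
    filter_upwards [hw] with x hx
    exact norm_le_half_weight hx
  refine ⟨hint _ hf' hi', ?_⟩
  have hfi := fun n => hint _ (hf n) (hi n)
  set h : ℕ → α → ℝ := fun n x => ‖f n x - f' x‖ with hh
  have hhi : ∀ n, Integrable (h n) μ := fun n => ((hfi n).sub (hint _ hf' hi')).norm
  -- The difference is cut at M/w. Below this level integrability of 1/w allows dominated
  -- convergence; above it h ≤ w h²/M, which the second moment bound makes small.
  have hle : ∀ M : ℝ, 0 < M → ∀ n, ∫ x, h n x ∂μ ≤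
      ∫ x, min (h n x) (M * (w x)⁻¹) ∂μ + 4 * C / M := by
    intro M hM n
    have i1 : Integrable (fun x => min (h n x) (M * (w x)⁻¹)) μ := (hhi n).inf (hwi.const_mul M)
    have i2 : Integrable (fun x => (2 * (w x * ‖f n x‖ ^ 2) + 2 * (w x * ‖f' x‖ ^ 2)) / M) μ :=
      (((hi n).const_mul 2).add (hi'.const_mul 2)).div_const M
    calc ∫ x, h n x ∂μ ≤ ∫ x, (min (h n x) (M * (w x)⁻¹) +
          (2 * (w x * ‖f n x‖ ^ 2) + 2 * (w x * ‖f' x‖ ^ 2)) / M) ∂μ := by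
          refine integral_mono_ae (hhi n) (i1.add i2) ?_
          filter_upwards [hw] with x hx
          have h1 : h n x ≤ ‖f n x‖ + ‖f' x‖ := norm_sub_le _ _
          have h0 : 0 ≤ h n x := norm_nonneg _
          have h2 : h n x ^ 2 ≤ 2 * ‖f n x‖ ^ 2 + 2 * ‖f' x‖ ^ 2 := by
            nlinarith [sq_nonneg (‖f n x‖ - ‖f' x‖)]
          rcases le_total (h n x) (M * (w x)⁻¹) with h3 | h3
          · rw [min_eq_left h3]
            have : 0 ≤ (2 * (w x * ‖f n x‖ ^ 2) + 2 * (w x * ‖f' x‖ ^ 2)) / M := by positivity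
            linarith
          · rw [min_eq_right h3]
            have h4 : 0 ≤ M * (w x)⁻¹ := by positivity
            have h5 : h n x ≤ (2 * (w x * ‖f n x‖ ^ 2) + 2 * (w x * ‖f' x‖ ^ 2)) / M := by
              rw [le_div_iff₀ hM]
              rw [← div_eq_mul_inv, div_le_iff₀ hx] at h3
              nlinarith
            linarith
      _ = ∫ x, min (h n x) (M * (w x)⁻¹) ∂μ +
          (2 * ∫ x, w x * ‖f n x‖ ^ 2 ∂μ + 2 * ∫ x, w x * ‖f' x‖ ^ 2 ∂μ) / M := by
          rw [integral_add i1 i2, integral_div, integral_add ((hi n).const_mul 2)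
            (hi'.const_mul 2), integral_const_mul, integral_const_mul]
      _ ≤ _ := by
          have := hC n
          gcongr
          linarith
  have hmin : ∀ M : ℝ, 0 < M → Tendsto (fun n => ∫ x, min (h n x) (M * (w x)⁻¹) ∂μ) atTop
      (𝓝 0) := by
    intro M hM
    have : (0 : ℝ) = ∫ _ : α, (0 : ℝ) ∂μ := by simp
    rw [this]
    refine tendsto_integral_of_dominated_convergence (fun x => M * (w x)⁻¹)
      (fun n => ((hhi n).inf (hwi.const_mul M)).aestronglyMeasurable) (hwi.const_mul M) ?_ ?_
    · intro n
      filter_upwards [hw] with x hx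
      have h4 : 0 ≤ M * (w x)⁻¹ := by positivity
      rw [Real.norm_eq_abs, abs_of_nonneg (le_min (norm_nonneg _) h4)]
      exact min_le_right _ _
    · filter_upwards [hw, hlim] with x hx hl
      have h4 : 0 ≤ M * (w x)⁻¹ := by positivity
      have h5 : Tendsto (fun n => h n x) atTop (𝓝 0) := tendsto_iff_norm_sub_tendsto_zero.1 hl
      have h6 := h5.min (tendsto_const_nhds (x := M * (w x)⁻¹))
      rwa [min_eq_left h4] at h6
  rw [tendsto_iff_norm_sub_tendsto_zero]
  have hnorm : ∀ n, ‖∫ x, f n x ∂μ - ∫ x, f' x ∂μ‖ ≤ ∫ x, h n x ∂μ := by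
    intro n
    rw [← integral_sub (hfi n) (hint _ hf' hi')]
    exact norm_integral_le_integral_norm _
  rw [tendsto_order]
  refine ⟨fun a ha => Eventually.of_forall fun n => ha.trans_le (norm_nonneg _), fun δ hδ => ?_⟩
  set M := 8 * (C + 1) / δ with hM
  have hM0 : 0 < M := by positivity
  filter_upwards [(hmin M hM0).eventually_lt_const (half_pos hδ)] with n hn
  refine (hnorm n).trans_lt ((hle M hM0 n).trans_lt ?_)
  have : 4 * C / M ≤ δ / 2 := by
    rw [hM, div_div_eq_mul_div, div_le_iff₀ (by positivity)]
    nlinarith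
  linarith

end WeightedConvergence

/-! ### The Stieltjes transform near a gap of the support -/

section Gap

variable {F : Measure ℝ} [IsProbabilityMeasure F] {x₀ ρ : ℝ} {z : ℂ}

lemma exists_gap {x₀ : ℝ} (h0 : 0 < x₀) (hx : x₀ ∉ F.support) :
    ∃ ρ, 0 < ρ ∧ ρ < x₀ ∧ ∀ᵐ l ∂F, 2 * ρ ≤ |l - x₀| := by
  obtain ⟨U, hU, hU0⟩ := Measure.notMem_support_iff_exists.1 hx
  obtain ⟨ε, hε, hball⟩ := Metric.mem_nhds_iff.1 hU
  -- Half of the gap is used, so that the closed disc of radius ρ keeps distance ρ from the support;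
  -- x₀/2 keeps it in the right half-plane.
  refine ⟨min (ε / 2) (x₀ / 2), by positivity, (min_le_right _ _).trans_lt (by linarith), ?_⟩
  have : F (Metric.ball x₀ ε) = 0 := measure_mono_null hball hU0
  rw [measure_eq_zero_iff_ae_notMem] at this
  filter_upwards [this] with l hl
  rw [Metric.mem_ball, Real.dist_eq, not_lt] at hl
  have := min_le_left (ε / 2) (x₀ / 2)
  linarith

lemma gap_norm (hgap : ∀ᵐ l ∂F, 2 * ρ ≤ |l - x₀|) (hz : z ∈ Metric.closedBall (x₀ : ℂ) ρ) :
    ∀ᵐ l : ℝ ∂F, ρ ≤ ‖(l : ℂ) - z‖ := by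
  filter_upwards [hgap] with l hl
  rw [Metric.mem_closedBall, dist_eq_norm] at hz
  have h2 := norm_sub_norm_le ((l : ℂ) - x₀) (z - x₀)
  rw [show (l : ℂ) - x₀ - (z - x₀) = (l : ℂ) - z by ring, ← Complex.ofReal_sub,
    Complex.norm_real, Real.norm_eq_abs] at h2
  linarith

lemma gap_differentiableAt (hρ : 0 < ρ) (hgap : ∀ᵐ l ∂F, 2 * ρ ≤ |l - x₀|)
    (hz : z ∈ Metric.closedBall (x₀ : ℂ) ρ) : DifferentiableAt ℂ (stieltjes F) z :=
  (hasDerivAt_stieltjes hρ (gap_norm hgap hz)).differentiableAt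

lemma gap_norm_le (hρ : 0 < ρ) (hgap : ∀ᵐ l ∂F, 2 * ρ ≤ |l - x₀|)
    (hz : z ∈ Metric.closedBall (x₀ : ℂ) ρ) : ‖stieltjes F z‖ ≤ ρ⁻¹ := by
  have := norm_integral_le_of_norm_le_const (μ := F) (f := fun l : ℝ => ((l : ℂ) - z)⁻¹)
    (C := ρ⁻¹) (by
      filter_upwards [gap_norm hgap hz] with l hl
      rw [norm_inv]
      exact inv_anti₀ hρ hl)
  simpa [stieltjes] using this

lemma gap_integrable_sq (hρ : 0 < ρ) (hgap : ∀ᵐ l ∂F, 2 * ρ ≤ |l - x₀|)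
    (hz : z ∈ Metric.closedBall (x₀ : ℂ) ρ) :
    Integrable (fun l : ℝ => ‖((l : ℂ) - z)⁻¹‖ ^ 2) F ∧
      ∀ᵐ l : ℝ ∂F, ‖((l : ℂ) - z)⁻¹‖ ^ 2 ≤ (ρ ^ 2)⁻¹ := by
  have h1 : ∀ᵐ l : ℝ ∂F, ‖((l : ℂ) - z)⁻¹‖ ^ 2 ≤ (ρ ^ 2)⁻¹ := by
    filter_upwards [gap_norm hgap hz] with l hl
    rw [norm_inv, ← inv_pow]
    exact pow_le_pow_left₀ (by positivity) (inv_anti₀ hρ hl) 2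
  refine ⟨Integrable.of_bound ((Complex.measurable_ofReal.sub_const z).inv.norm.pow_const
    2).aestronglyMeasurable (ρ ^ 2)⁻¹ ?_, h1⟩
  filter_upwards [h1] with l hl
  rwa [Real.norm_eq_abs, abs_of_nonneg (by positivity)]

lemma gap_im_eq (hρ : 0 < ρ) (hgap : ∀ᵐ l ∂F, 2 * ρ ≤ |l - x₀|)
    (hz : z ∈ Metric.closedBall (x₀ : ℂ) ρ) :
    (stieltjes F z).im = z.im * ∫ l : ℝ, ‖((l : ℂ) - z)⁻¹‖ ^ 2 ∂F := by
  have hi : Integrable (fun l : ℝ => ((l : ℂ) - z)⁻¹) F := by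
    refine Integrable.of_bound (Complex.measurable_ofReal.sub_const z).inv.aestronglyMeasurable
      ρ⁻¹ ?_
    filter_upwards [gap_norm hgap hz] with l hl
    rw [norm_inv]
    exact inv_anti₀ hρ hl
  rw [stieltjes, im_integral hi, ← integral_const_mul]
  simp only [im_inv_ofReal_sub]

lemma gap_im_le (hρ : 0 < ρ) (hgap : ∀ᵐ l ∂F, 2 * ρ ≤ |l - x₀|)
    (hz : z ∈ Metric.closedBall (x₀ : ℂ) ρ) (hz0 : 0 ≤ z.im) :
    (stieltjes F z).im ≤ (ρ ^ 2)⁻¹ * z.im := by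
  rw [gap_im_eq hρ hgap hz, mul_comm]
  obtain ⟨h1, h2⟩ := gap_integrable_sq hρ hgap hz
  refine mul_le_mul_of_nonneg_right ?_ hz0
  refine (integral_mono_ae h1 (integrable_const _) h2).trans_eq ?_
  simp

/-- Im m/Im z is the integral of |l - z|⁻², and |l - z| ≤ |l - x₀| + ρ on the disc. Together with
`gap_im_le` this makes Im m and Im z comparable. -/
lemma gap_le_im (hρ : 0 < ρ) (hgap : ∀ᵐ l ∂F, 2 * ρ ≤ |l - x₀|) :
    ∃ k, 0 < k ∧ ∀ z ∈ Metric.closedBall (x₀ : ℂ) ρ, 0 ≤ z.im →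
      k * z.im ≤ (stieltjes F z).im := by
  have hcont : Continuous fun l : ℝ => ((|l - x₀| + ρ) ^ 2)⁻¹ :=
    Continuous.inv₀ (by fun_prop) fun l => by positivity
  have hi : Integrable (fun l : ℝ => ((|l - x₀| + ρ) ^ 2)⁻¹) F := by
    refine Integrable.of_bound hcont.aestronglyMeasurable (ρ ^ 2)⁻¹ (ae_of_all _ fun l => ?_)
    rw [Real.norm_eq_abs, abs_of_nonneg (by positivity)]
    exact inv_anti₀ (by positivity)
      (pow_le_pow_left₀ hρ.le (le_add_of_nonneg_left (abs_nonneg _)) 2)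
  refine ⟨∫ l : ℝ, ((|l - x₀| + ρ) ^ 2)⁻¹ ∂F, ?_, fun z hz hz0 => ?_⟩
  · rw [integral_pos_iff_support_of_nonneg (fun l => by positivity) hi]
    have : Function.support (fun l : ℝ => ((|l - x₀| + ρ) ^ 2)⁻¹) = Set.univ := by
      ext l
      simp only [Function.mem_support, Set.mem_univ, iff_true]
      positivity
    rw [this]
    simp
  · rw [gap_im_eq hρ hgap hz, mul_comm]
    obtain ⟨h1, -⟩ := gap_integrable_sq hρ hgap hz
    refine mul_le_mul_of_nonneg_left ?_ hz0
    refine integral_mono_ae hi h1 ?_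
    filter_upwards [gap_norm hgap hz] with l hl
    rw [norm_inv, inv_pow]
    refine inv_anti₀ (pow_pos (hρ.trans_le hl) 2) (pow_le_pow_left₀ (norm_nonneg _) ?_ 2)
    rw [Metric.mem_closedBall, dist_eq_norm] at hz
    have h2 := norm_sub_le ((l : ℂ) - x₀) (z - x₀)
    rw [show (l : ℂ) - x₀ - (z - x₀) = (l : ℂ) - z by ring, ← Complex.ofReal_sub,
      Complex.norm_real, Real.norm_eq_abs] at h2
    linarith

lemma stieltjes_conj (z : ℂ) : stieltjes F (star z) = star (stieltjes F z) := by
  rw [stieltjes, stieltjes]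
  have := integral_conj (μ := F) (f := fun l : ℝ => ((l : ℂ) - z)⁻¹)
  rw [Complex.star_def, ← this]
  simp

lemma stieltjes_im_ofReal (x : ℝ) : (stieltjes F (x : ℂ)).im = 0 := by
  have := stieltjes_conj (F := F) (x : ℂ)
  rw [Complex.star_def, Complex.conj_ofReal] at this
  exact Complex.conj_eq_iff_im.1 this.symm

lemma gap_lipschitz (hρ : 0 < ρ) (hgap : ∀ᵐ l ∂F, 2 * ρ ≤ |l - x₀|) {w : ℂ}
    (hz : z ∈ Metric.closedBall (x₀ : ℂ) ρ) (hw : w ∈ Metric.closedBall (x₀ : ℂ) ρ) :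
    ‖stieltjes F z - stieltjes F w‖ ≤ (ρ ^ 2)⁻¹ * ‖z - w‖ := by
  refine (convex_closedBall (x₀ : ℂ) ρ).norm_image_sub_le_of_norm_hasDerivWithin_le
    (fun x hx => (hasDerivAt_stieltjes hρ (gap_norm hgap hx)).hasDerivWithinAt) (fun x hx => ?_)
    hw hz
  have := norm_integral_le_of_norm_le_const (μ := F) (f := fun l : ℝ => (((l : ℂ) - x) ^ 2)⁻¹)
    (C := (ρ ^ 2)⁻¹) (by
      filter_upwards [gap_norm hgap hx] with l hl
      rw [norm_inv, norm_pow]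
      exact inv_anti₀ (by positivity) (pow_le_pow_left₀ hρ.le hl 2))
  simpa using this

end Gap


/-! ### A priori bounds for co-solutions near a gap -/

section LocalBounds

variable {c : ℝ} {H : Measure (ℝ × ℝ)} [IsProbabilityMeasure H] {F : Measure ℝ}
  [IsProbabilityMeasure F] {x₀ ρ : ℝ} {γ : ℂ → ℂ}

lemma re_le_of_mem {z : ℂ} (hz : z ∈ Metric.closedBall (x₀ : ℂ) ρ) :
    x₀ - ρ ≤ z.re ∧ z.re ≤ x₀ + ρ := by
  rw [Metric.mem_closedBall, dist_eq_norm] at hz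
  have h := (Complex.abs_re_le_norm (z - x₀)).trans hz
  rw [Complex.sub_re, Complex.ofReal_re, abs_le] at h
  constructor <;> linarith

lemma norm_le_of_mem (h0 : 0 < x₀) {z : ℂ} (hz : z ∈ Metric.closedBall (x₀ : ℂ) ρ) :
    ‖z‖ ≤ x₀ + ρ := by
  rw [Metric.mem_closedBall, dist_eq_norm] at hz
  have h := norm_sub_norm_le z x₀
  rw [Complex.norm_real, Real.norm_eq_abs, abs_of_pos h0] at h
  linarith

/-- `B₁` is bounded next to a gap. -/
lemma exists_quad_le (hA : Admissible H) (hc : 0 < c) (h0 : 0 < x₀) (hρ : 0 < ρ)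
    (hgap : ∀ᵐ l ∂F, 2 * ρ ≤ |l - x₀|)
    (hγ : ∀ z : ℂ, 0 < z.im → IsCoSolution c H F z (γ z)) :
    ∃ C, 0 < C ∧ ∀ z ∈ Metric.closedBall (x₀ : ℂ) ρ, 0 < z.im →
      quad H 0 1 (stieltjes F z) (γ z) ≤ C := by
  obtain ⟨k, hk, hkm⟩ := gap_le_im hρ hgap
  refine ⟨(x₀ + ρ + ρ⁻¹ / k) / c, by positivity, fun z hz hz0 => ?_⟩
  have hm := im_stieltjes_pos (F := F) hz0
  have h1 := (hγ z hz0).im_mul hA hz0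
  have h2 := quad_nonneg hA 1 0 (stieltjes F z) (γ z)
  have h3 := mul_nonneg hc.le (mul_nonneg (hγ z hz0).1.le h2)
  have h4 := gap_norm_le hρ hgap hz
  have h5 := (le_abs_self _).trans ((Complex.abs_re_le_norm (stieltjes F z)).trans h4)
  have h6 : z.im ≤ (stieltjes F z).im / k := by
    rw [le_div_iff₀ hk, mul_comm]
    exact hkm z hz hz0.le
  rw [Complex.mul_im] at h1
  have h7 : z.im * (stieltjes F z).re ≤ (stieltjes F z).im / k * ρ⁻¹ := by
    have : 0 ≤ ρ⁻¹ := by positivity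
    calc z.im * (stieltjes F z).re ≤ z.im * ρ⁻¹ := by gcongr
      _ ≤ _ := by gcongr
  have h8 := mul_le_mul_of_nonneg_right (re_le_of_mem hz).2 hm.le
  rw [le_div_iff₀ hc]
  have h9 : (stieltjes F z).im * (quad H 0 1 (stieltjes F z) (γ z) * c) ≤
      (stieltjes F z).im * (x₀ + ρ + ρ⁻¹ / k) := by
    have e : (stieltjes F z).im / k * ρ⁻¹ = (stieltjes F z).im * (ρ⁻¹ / k) := by ring
    rw [e] at h7
    linarith
  exact le_of_mul_le_mul_left h9 hm

lemma norm_mom_le (hA : Admissible H) {q : ℂ × ℂ} (hq : Regular H q) :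
    ‖mom H 0 1 q‖ ≤ (quad H 0 1 q.2 q.1 + ∫ p : ℝ × ℝ, p.2 ∂H) / 2 := by
  have hi : Integrable (fun p : ℝ × ℝ => p.2) H := by
    have := integrable_mom hA 0 1 (regular_zero (H := H))
    refine (this.re).congr (ae_of_all _ fun p => ?_)
    simp [den]
  have e : (quad H 0 1 q.2 q.1 + ∫ p : ℝ × ℝ, p.2 ∂H) / 2 =
      ∫ p, (kern 0 1 q.2 q.1 p + p.2) / 2 ∂H := by
    rw [integral_div, integral_add (integrable_kern hA 0 1 hq) hi, quad]
  rw [e]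
  refine norm_integral_le_of_norm_le (((integrable_kern hA 0 1 hq).add hi).div_const 2) ?_
  filter_upwards [H.support_mem_ae] with p hp
  obtain ⟨-, h2⟩ := hA.nonneg p hp
  rw [pow_zero, one_mul, pow_one, norm_div, Complex.norm_real, Real.norm_eq_abs, abs_of_nonneg h2,
    kern, pow_zero, one_mul, pow_one, div_eq_mul_inv, div_eq_mul_inv p.2, ← inv_pow]
  have := mul_nonneg h2 (sq_nonneg (‖den q.2 q.1 p‖⁻¹ - 1))
  linarith

/-- Co-solutions stay away from zero next to a gap. -/
lemma exists_le_norm (hA : Admissible H) (hc : 0 < c) (h0 : 0 < x₀) (hρ : 0 < ρ)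
    (hgap : ∀ᵐ l ∂F, 2 * ρ ≤ |l - x₀|)
    (hγ : ∀ z : ℂ, 0 < z.im → IsCoSolution c H F z (γ z)) :
    ∃ b, 0 < b ∧ ∀ z ∈ Metric.closedBall (x₀ : ℂ) ρ, 0 < z.im → b ≤ ‖γ z‖ := by
  obtain ⟨C, hC, hB⟩ := exists_quad_le hA hc h0 hρ hgap hγ
  set T := ∫ p : ℝ × ℝ, p.2 ∂H with hT
  have hT0 : 0 ≤ T := integral_nonneg_of_ae (by
    filter_upwards [hA.pos] with p hp
    exact hp.le)
  refine ⟨(x₀ + ρ + c * ((C + T) / 2))⁻¹, by positivity, fun z hz hz0 => ?_⟩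
  have hq := (hγ z hz0).regular hA hz0
  have hg : 0 < ‖γ z‖ := norm_pos_iff.2 (hγ z hz0).2.1
  have h1 := Solves.eq_right (q := (γ z, stieltjes F z)) (hγ z hz0).2
  -- The second equation bounds 1/|g| by |z| and the integral of t/|den|; the latter is at most (B₁
  -- + ∫ t dH)/2.
  have h2 : 1 / γ z = c * mom H 0 1 (γ z, stieltjes F z) - z := by
    simp only at h1
    linear_combination h1
  have h3 := congrArg norm h2
  rw [norm_div, norm_one] at h3
  rw [inv_le_comm₀ (by positivity) hg, ← one_div, h3]
  refine (norm_sub_le _ _).trans ?_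
  rw [norm_mul, Complex.norm_real, Real.norm_eq_abs, abs_of_pos hc]
  have h4 := norm_mom_le hA hq
  have h5 := hB z hz hz0
  have h6 := norm_le_of_mem h0 hz
  have h7 : c * ‖mom H 0 1 (γ z, stieltjes F z)‖ ≤ c * ((C + T) / 2) := by
    refine mul_le_mul_of_nonneg_left (h4.trans ?_) hc.le
    simp only at h5 ⊢
    linarith
  linarith

lemma Admissible.exists_le (hA : Admissible H) :
    ∃ K : ℝ, 0 < K ∧ ∀ p ∈ H.support, p.1 ≤ K ∧ p.2 ≤ K := by
  obtain ⟨C, h0, hC⟩ := hA.exists_bound 1 0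
  obtain ⟨D, h1, hD⟩ := hA.exists_bound 0 1
  refine ⟨C + D + 1, by positivity, fun p hp => ?_⟩
  have h2 := hC p hp
  have h3 := hD p hp
  simp only [pow_one, pow_zero, mul_one, one_mul, Complex.norm_real, Real.norm_eq_abs] at h2 h3
  constructor
  · linarith [le_abs_self p.1]
  · linarith [le_abs_self p.2]

/-- The denominators converge off a null set when the co-solutions tend to infinity. -/
lemma ae_ne_zero_of_tendsto (hA : Admissible H) {q : ℕ → ℂ × ℂ} (hq : ∀ n, Regular H (q n))
    {m : ℂ} (hm : Tendsto (fun n => (q n).2) atTop (𝓝 m)) {C : ℝ}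
    (hC : ∀ n, quad H 0 1 (q n).2 (q n).1 ≤ C) :
    ∀ᵐ p ∂H, p.1 = 0 → 1 + (p.2 : ℂ) * m ≠ 0 := by
  obtain ⟨K, hK, hKb⟩ := hA.exists_le
  have hC0 : 0 ≤ C := (quad_nonneg hA _ _ _ _).trans (hC 0)
  -- On `E` the denominator is t(m_n - m), so B₁ is at least H(E)/(K|m_n - m|²), with K a bound for
  -- t. Bounded B₁ and m_n → m force H(E) = 0.
  set E : Set (ℝ × ℝ) := {p | p ∈ H.support ∧ p.1 = 0 ∧ 1 + (p.2 : ℂ) * m = 0} with hE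
  have hbound : ∀ n, H.real E ≤ C * (K * ‖(q n).2 - m‖ ^ 2) := by
    intro n
    have h1 := mul_meas_ge_le_integral_of_nonneg (μ := H) (f := kern 0 1 (q n).2 (q n).1) (by
      filter_upwards [H.support_mem_ae] with p hp
      obtain ⟨-, h2⟩ := hA.nonneg p hp
      simp only [kern, Pi.zero_apply]
      positivity) (integrable_kern hA 0 1 (hq n)) (1 / (K * ‖(q n).2 - m‖ ^ 2))
    rcases Set.eq_empty_or_nonempty E with hEe | ⟨p₀, hp₀⟩
    · rw [hEe, measureReal_empty]
      positivity
    have hden : ∀ p ∈ E, ‖den (q n).2 (q n).1 p‖ = p.2 * ‖(q n).2 - m‖ := by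
      rintro p ⟨hp, hp1, hp2⟩
      have : den (q n).2 (q n).1 p = (p.2 : ℂ) * ((q n).2 - m) := by
        rw [den, hp1]
        push_cast
        linear_combination hp2
      rw [this, norm_mul, Complex.norm_real, Real.norm_eq_abs, abs_of_nonneg (hA.nonneg p hp).2]
    have hpos : ∀ p ∈ E, 0 < p.2 ∧ 0 < ‖(q n).2 - m‖ := by
      intro p hp
      have h2 := norm_pos_iff.2 (hq n p hp.1)
      rw [hden p hp] at h2
      have h3 := (hA.nonneg p hp.1).2
      have h4 : p.2 ≠ 0 := by
        rintro h5
        rw [h5, zero_mul] at h2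
        exact lt_irrefl _ h2
      exact ⟨lt_of_le_of_ne h3 h4.symm, pos_of_mul_pos_right h2 h3⟩
    have hd := (hpos p₀ hp₀).2
    have hsub : E ⊆ {p | 1 / (K * ‖(q n).2 - m‖ ^ 2) ≤ kern 0 1 (q n).2 (q n).1 p} := by
      intro p hp
      have h2 := (hpos p hp).1
      change _ ≤ kern 0 1 (q n).2 (q n).1 p
      rw [kern, hden p hp, pow_zero, one_mul, pow_one,
        div_le_div_iff₀ (by positivity) (by positivity)]
      have h3 := (hKb p hp.1).2
      have : 0 ≤ p.2 * ‖(q n).2 - m‖ ^ 2 := by positivity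
      nlinarith
    have h2 := measureReal_mono (μ := H) hsub
    have h3 : 1 / (K * ‖(q n).2 - m‖ ^ 2) * H.real E ≤ C :=
      (mul_le_mul_of_nonneg_left h2 (by positivity)).trans (h1.trans (hC n))
    rwa [one_div, inv_mul_le_iff₀ (by positivity), mul_comm] at h3
  have hlim : Tendsto (fun n => C * (K * ‖(q n).2 - m‖ ^ 2)) atTop (𝓝 0) := by
    have h1 : Tendsto (fun n => ‖(q n).2 - m‖) atTop (𝓝 0) :=
      tendsto_iff_norm_sub_tendsto_zero.1 hm
    simpa using ((h1.pow 2).const_mul K).const_mul C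
  have hE0 : H.real E ≤ 0 := ge_of_tendsto' hlim hbound
  have hE1 : H E = 0 := by
    have := le_antisymm hE0 measureReal_nonneg
    exact (measureReal_eq_zero_iff (measure_ne_top _ _)).1 this
  rw [measure_eq_zero_iff_ae_notMem] at hE1
  filter_upwards [hE1, H.support_mem_ae] with p hp hps hp1 hp2
  exact hp ⟨hps, hp1, hp2⟩

/-- Co-solutions are bounded next to a gap. -/
lemma exists_norm_le (hA : Admissible H) (hc : 0 < c) (hc1 : c ≤ 1) (h0 : 0 < x₀) (hρ : 0 < ρ)
    (hρx : ρ < x₀) (hgap : ∀ᵐ l ∂F, 2 * ρ ≤ |l - x₀|)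
    (hγ : ∀ z : ℂ, 0 < z.im → IsCoSolution c H F z (γ z)) :
    ∃ G, 0 < G ∧ ∀ z ∈ Metric.closedBall (x₀ : ℂ) ρ, 0 < z.im → ‖γ z‖ ≤ G := by
  by_contra hcon
  push Not at hcon
  choose zs hzs using fun n : ℕ => hcon (n + 1) (by positivity)
  obtain ⟨z, hz, φ, hφ, hlim⟩ := (isCompact_closedBall (x₀ : ℂ) ρ).tendsto_subseq
    fun n => (hzs n).1
  obtain ⟨C, hC, hB⟩ := exists_quad_le hA hc h0 hρ hgap hγ
  obtain ⟨K, hK, hKb⟩ := hA.exists_le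
  set w : ℕ → ℂ := fun n => zs (φ n) with hw
  have hwm : ∀ n, w n ∈ Metric.closedBall (x₀ : ℂ) ρ := fun n => (hzs (φ n)).1
  have hwi : ∀ n, 0 < (w n).im := fun n => (hzs (φ n)).2.1
  set q : ℕ → ℂ × ℂ := fun n => (γ (w n), stieltjes F (w n)) with hq
  have hreg : ∀ n, Regular H (q n) := fun n => (hγ _ (hwi n)).regular hA (hwi n)
  set m := stieltjes F z with hm
  have hmlim : Tendsto (fun n => (q n).2) atTop (𝓝 m) :=
    ((gap_differentiableAt hρ hgap hz).continuousAt.tendsto).comp hlim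
  have hglim : Tendsto (fun n => ‖(q n).1‖) atTop atTop := by
    refine tendsto_atTop_mono (fun n => ?_) (tendsto_natCast_atTop_atTop (R := ℝ))
    have h1 := (hzs (φ n)).2.2
    have h2 : (n : ℝ) ≤ φ n := by exact_mod_cast hφ.id_le n
    change (n : ℝ) ≤ ‖γ (zs (φ n))‖
    linarith
  have hBn : ∀ n, quad H 0 1 (q n).2 (q n).1 ≤ C := fun n => hB _ (hwm n) (hwi n)
  have hne := ae_ne_zero_of_tendsto hA hreg hmlim hBn
  -- If |g| tends to infinity, the denominators diverge wherever s > 0, and only {s = 0} survives in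
  -- the limit.
  set u : ℝ × ℝ → ℂ := fun p => if p.1 = 0 then 1 / (1 + (p.2 : ℂ) * m) else 0 with hu
  have hulim : ∀ᵐ p ∂H, Tendsto (fun n => 1 / den (q n).2 (q n).1 p) atTop (𝓝 (u p)) := by
    filter_upwards [hne, H.support_mem_ae] with p hp hps
    by_cases hp1 : p.1 = 0
    · rw [hu]
      simp only [hp1, if_true]
      refine Tendsto.div tendsto_const_nhds ?_ (hp hp1)
      simp only [den, hp1, Complex.ofReal_zero, zero_mul, add_zero]
      exact (hmlim.const_mul _).const_add _
    · rw [hu]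
      simp only [hp1, if_false]
      rw [tendsto_zero_iff_norm_tendsto_zero]
      simp only [one_div, norm_inv]
      refine tendsto_inv_atTop_zero.comp ?_
      have hp1' : 0 < p.1 := lt_of_le_of_ne (hA.nonneg p hps).1 (Ne.symm hp1)
      have h1 : Tendsto (fun n => p.1 * ‖(q n).1‖ + -(1 + p.2 * ρ⁻¹)) atTop atTop :=
        tendsto_atTop_add_const_right _ _ (hglim.const_mul_atTop hp1')
      refine tendsto_atTop_mono (fun n => ?_) h1
      have h2 := norm_sub_le (den (q n).2 (q n).1 p) (1 + (p.2 : ℂ) * (q n).2)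
      rw [show den (q n).2 (q n).1 p - (1 + (p.2 : ℂ) * (q n).2) = (p.1 : ℂ) * (q n).1 by
        rw [den]; ring, norm_mul, Complex.norm_real, Real.norm_eq_abs, abs_of_pos hp1'] at h2
      have h3 : ‖1 + (p.2 : ℂ) * (q n).2‖ ≤ 1 + p.2 * ρ⁻¹ := by
        refine (norm_add_le _ _).trans ?_
        rw [norm_one, norm_mul, Complex.norm_real, Real.norm_eq_abs,
          abs_of_nonneg (hA.nonneg p hps).2]
        have := gap_norm_le hρ hgap (hwm n)
        have := mul_le_mul_of_nonneg_left this (hA.nonneg p hps).2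
        linarith
      linarith
  have hmeas : ∀ n, Measurable fun p => 1 / den (q n).2 (q n).1 p := fun n =>
    measurable_const.div (continuous_den _ _).measurable
  have hkern : ∀ n p, p.2 * ‖1 / den (q n).2 (q n).1 p‖ ^ 2 = kern 0 1 (q n).2 (q n).1 p := by
    intro n p
    rw [kern, norm_div, norm_one]
    ring
  -- The bound on B₁ is a second moment bound with weight t, and the assumption on ∫ 1/t dH makes it
  -- strong enough for the integrals of 1/den to converge.
  obtain ⟨hi1, hl1⟩ := tendsto_integral_of_weight hA.pos measurable_snd hA.integrable_inv
    (fun n => (hmeas n).aestronglyMeasurable)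
    (fun n => (integrable_kern hA 0 1 (hreg n)).congr (ae_of_all _ fun p => (hkern n p).symm))
    (C := C) (fun n => by
      simp only [hkern]
      exact hBn n) hulim
  have hkern2 : ∀ n p, p.2 * ‖(p.2 : ℂ) * (1 / den (q n).2 (q n).1 p)‖ ^ 2 =
      kern 0 3 (q n).2 (q n).1 p := by
    intro n p
    rw [norm_mul, mul_pow, Complex.norm_real, Real.norm_eq_abs, sq_abs, mul_left_comm, hkern, kern,
      kern]
    ring
  obtain ⟨hi2, hl2⟩ := tendsto_integral_of_weight hA.pos measurable_snd hA.integrable_inv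
    (f := fun n p => (p.2 : ℂ) * (1 / den (q n).2 (q n).1 p)) (f' := fun p => (p.2 : ℂ) * u p)
    (fun n => ((Complex.measurable_ofReal.comp measurable_snd).mul (hmeas n)).aestronglyMeasurable)
    (fun n => (integrable_kern hA 0 3 (hreg n)).congr (ae_of_all _ fun p => (hkern2 n p).symm))
    (C := K ^ 2 * C) (fun n => by
      simp only [hkern2]
      refine le_trans ?_ (mul_le_mul_of_nonneg_left (hBn n) (by positivity))
      rw [quad, ← integral_const_mul]
      refine integral_mono_ae (integrable_kern hA 0 3 (hreg n))
        ((integrable_kern hA 0 1 (hreg n)).const_mul _) ?_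
      filter_upwards [H.support_mem_ae] with p hp
      have h1 := (hKb p hp).2
      have h2 := (hA.nonneg p hp).2
      simp only [kern, pow_zero, one_mul, pow_one]
      rw [← mul_div_assoc]
      gcongr
      nlinarith [mul_le_mul h1 h1 h2 hK.le]) (by
      filter_upwards [hulim] with p hp
      exact hp.const_mul _)
  have hmom0 : ∀ n, mom H 0 0 (q n) = ∫ p, 1 / den (q n).2 (q n).1 p ∂H := fun n => by simp [mom]
  have hmom1 : ∀ n, mom H 0 1 (q n) = ∫ p : ℝ × ℝ, (p.2 : ℂ) * (1 / den (q n).2 (q n).1 p) ∂H :=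
    fun n => by simp [mom, div_eq_mul_inv]
  have hE1 : z * m = -(1 - (c : ℂ)) - c * ∫ p, u p ∂H := by
    refine tendsto_nhds_unique (hlim.mul hmlim) ?_
    refine ((hl1.const_mul (c : ℂ)).const_sub _).congr fun n => ?_
    rw [← hmom0]
    exact (Solves.eq_left (q := q n) (hγ _ (hwi n)).2).symm
  have hE2 : z = c * ∫ p : ℝ × ℝ, (p.2 : ℂ) * u p ∂H := by
    refine tendsto_nhds_unique hlim ?_
    have h1 : Tendsto (fun n => -1 / (q n).1) atTop (𝓝 0) := by
      rw [tendsto_zero_iff_norm_tendsto_zero]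
      simp only [norm_div, norm_neg, norm_one, one_div]
      exact tendsto_inv_atTop_zero.comp hglim
    have h2 := h1.add (hl2.const_mul (c : ℂ))
    rw [zero_add] at h2
    refine h2.congr fun n => ?_
    rw [← hmom1]
    exact (Solves.eq_right (q := q n) (hγ _ (hwi n)).2).symm
  set S : Set (ℝ × ℝ) := {p | p.1 = 0} with hS
  have hSm : MeasurableSet S := measurable_fst (measurableSet_singleton 0)
  have hsum : ∫ p, u p ∂H + m * ∫ p : ℝ × ℝ, (p.2 : ℂ) * u p ∂H = (H.real S : ℂ) := by
    rw [← integral_const_mul, ← integral_add hi1 (hi2.const_mul m)]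
    have : ((H.real S : ℝ) : ℂ) = ∫ p, S.indicator (fun _ => (1 : ℂ)) p ∂H := by
      rw [integral_indicator_const _ hSm]
      simp
    rw [this]
    refine integral_congr_ae ?_
    filter_upwards [hne] with p hp
    by_cases hp1 : p.1 = 0
    · have hpS : p ∈ S := hp1
      have h1 := hp hp1
      rw [Set.indicator_of_mem hpS, hu]
      simp only [hp1, if_true]
      field_simp
    · have hpS : p ∉ S := hp1
      rw [Set.indicator_of_notMem hpS, hu]
      simp [hp1]
  -- Both limiting equations together say c H(s = 0) = c - 1. As c ≤ 1, this forces H(s = 0) = 0;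
  -- then the limit of the integrands is 0 and z = 0, outside the disc.
  have hcS : (c : ℂ) * (H.real S : ℂ) = c - 1 := by
    linear_combination (-(c : ℂ)) * hsum + hE1 - m * hE2
  have hcS' : c * H.real S = c - 1 := by exact_mod_cast hcS
  have hS0 : H.real S = 0 := by
    have h1 : 0 ≤ c * H.real S := mul_nonneg hc.le measureReal_nonneg
    have h2 : c * H.real S = 0 := le_antisymm (by linarith) h1
    rcases mul_eq_zero.1 h2 with h | h
    · exact absurd h hc.ne'
    · exact h
  have hSae : ∀ᵐ p ∂H, p ∉ S := by
    rw [← measure_eq_zero_iff_ae_notMem]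
    exact (measureReal_eq_zero_iff (measure_ne_top _ _)).1 hS0
  have hz0 : z = 0 := by
    rw [hE2, integral_eq_zero_of_ae, mul_zero]
    filter_upwards [hSae] with p hp
    have : ¬ p.1 = 0 := hp
    simp [hu, this]
  have h1 := (re_le_of_mem hz).1
  rw [hz0, Complex.zero_re] at h1
  linarith

lemma Admissible.integrable_fst (hA : Admissible H) : Integrable (fun p : ℝ × ℝ => p.1) H := by
  have := integrable_mom hA 1 0 (regular_zero (H := H))
  refine (this.re).congr (ae_of_all _ fun p => ?_)
  simp [den]

lemma le_quad (hA : Admissible H) {q : ℂ × ℂ} (hq : Regular H q) {D : ℝ}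
    (hD : ∀ p ∈ H.support, ‖den q.2 q.1 p‖ ≤ D) :
    (∫ p : ℝ × ℝ, p.1 ∂H) / D ^ 2 ≤ quad H 1 0 q.2 q.1 := by
  rw [quad, ← integral_div]
  refine integral_mono_ae (hA.integrable_fst.div_const _) (integrable_kern hA 1 0 hq) ?_
  filter_upwards [H.support_mem_ae] with p hp
  have h1 := hA.nonneg p hp
  simp only [kern, pow_one, pow_zero, mul_one]
  have h3 := norm_pos_iff.2 (hq p hp)
  exact div_le_div_of_nonneg_left h1.1 (by positivity) (pow_le_pow_left₀ h3.le (hD p hp) 2)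

lemma quad_le_mul (hA : Admissible H) {q : ℂ × ℂ} (hq : Regular H q) {K : ℝ}
    (hK : ∀ p ∈ H.support, p.2 ≤ K) : quad H 0 2 q.2 q.1 ≤ K * quad H 0 1 q.2 q.1 := by
  rw [quad, quad, ← integral_const_mul]
  refine integral_mono_ae (integrable_kern hA 0 2 hq) ((integrable_kern hA 0 1 hq).const_mul _) ?_
  filter_upwards [H.support_mem_ae] with p hp
  have h1 := hK p hp
  have h2 := (hA.nonneg p hp).2
  simp only [kern, pow_zero, one_mul, pow_one]
  rw [← mul_div_assoc]
  gcongr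
  nlinarith

/-- The imaginary part of co-solutions is at most proportional to that of `z` next to a gap. -/
lemma exists_im_le (hA : Admissible H) (hc : 0 < c) (hc1 : c ≤ 1) (h0 : 0 < x₀) (hρ : 0 < ρ)
    (hρx : ρ < x₀) (hgap : ∀ᵐ l ∂F, 2 * ρ ≤ |l - x₀|)
    (hγ : ∀ z : ℂ, 0 < z.im → IsCoSolution c H F z (γ z)) :
    ∃ C, 0 < C ∧ ∀ z ∈ Metric.closedBall (x₀ : ℂ) ρ, 0 < z.im → (γ z).im ≤ C * z.im := by
  obtain ⟨G, hG, hGb⟩ := exists_norm_le hA hc hc1 h0 hρ hρx hgap hγ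
  obtain ⟨K, hK, hKb⟩ := hA.exists_le
  have hi := hA.integrable_fst
  have hnn : 0 ≤ᵐ[H] fun p : ℝ × ℝ => p.1 := by
    filter_upwards [H.support_mem_ae] with p hp
    exact (hA.nonneg p hp).1
  rcases (integral_nonneg_of_ae hnn).eq_or_lt with hS | hS
  -- If s = 0 almost everywhere, A₁ vanishes and gives no control of Im g; but then the equation
  -- without z reads g = m.
  · have hae := (integral_eq_zero_iff_of_nonneg_ae hnn hi).1 hS.symm
    refine ⟨(ρ ^ 2)⁻¹, by positivity, fun z hz hz0 => ?_⟩
    have hm : mom H 1 0 (γ z, stieltjes F z) = 0 := by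
      refine integral_eq_zero_of_ae ?_
      filter_upwards [hae] with p hp
      have : p.1 = 0 := hp
      simp [this]
    have h1 := ((solves_iff hA ((hγ z hz0).regular hA hz0) (hγ z hz0).2.1).1 (hγ z hz0).2).2
    rw [hm, mul_zero, zero_add] at h1
    have h2 : γ z = stieltjes F z := (sub_eq_zero.1 h1).symm
    rw [h2]
    exact gap_im_le hρ hgap hz hz0.le
  · set S := ∫ p : ℝ × ℝ, p.1 ∂H with hSdef
    set D := 1 + K * G + K * ρ⁻¹ with hD
    have hD0 : 0 < D := by positivity
    refine ⟨((x₀ + ρ) * (ρ ^ 2)⁻¹ + ρ⁻¹) / (c * (S / D ^ 2)), by positivity, fun z hz hz0 => ?_⟩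
    have hreg := (hγ z hz0).regular hA hz0
    have hmi := im_stieltjes_pos (F := F) hz0
    -- The upper bounds for |g| and |m| bound the denominators by D, hence A₁ from below; and cA₁ Im
    -- g ≤ Im(zm) = O(Im z).
    have hA1 : S / D ^ 2 ≤ quad H 1 0 (stieltjes F z) (γ z) := by
      refine le_quad hA hreg fun p hp => ?_
      have h1 := hA.nonneg p hp
      have h2 := hKb p hp
      rw [den]
      refine (norm_add_le _ _).trans (add_le_add ((norm_add_le _ _).trans (add_le_add ?_ ?_)) ?_)
      · rw [norm_one]
      · rw [norm_mul, Complex.norm_real, Real.norm_eq_abs, abs_of_nonneg h1.1]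
        exact mul_le_mul h2.1 (hGb z hz hz0) (norm_nonneg _) hK.le
      · rw [norm_mul, Complex.norm_real, Real.norm_eq_abs, abs_of_nonneg h1.2]
        exact mul_le_mul h2.2 (gap_norm_le hρ hgap hz) (norm_nonneg _) hK.le
    have h1 := (hγ z hz0).im_mul hA hz0
    rw [Complex.mul_im] at h1
    have h2 : 0 ≤ c * ((stieltjes F z).im * quad H 0 1 (stieltjes F z) (γ z)) :=
      mul_nonneg hc.le (mul_nonneg hmi.le (quad_nonneg hA _ _ _ _))
    have h3 : z.re * (stieltjes F z).im ≤ (x₀ + ρ) * ((ρ ^ 2)⁻¹ * z.im) :=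
      mul_le_mul (re_le_of_mem hz).2 (gap_im_le hρ hgap hz hz0.le) hmi.le (by positivity)
    have h4 : z.im * (stieltjes F z).re ≤ z.im * ρ⁻¹ :=
      mul_le_mul_of_nonneg_left ((le_abs_self _).trans
        ((Complex.abs_re_le_norm _).trans (gap_norm_le hρ hgap hz))) hz0.le
    have h5 : c * (S / D ^ 2) * (γ z).im ≤ ((x₀ + ρ) * (ρ ^ 2)⁻¹ + ρ⁻¹) * z.im := by
      have h6 : c * ((γ z).im * (S / D ^ 2)) ≤
          c * ((γ z).im * quad H 1 0 (stieltjes F z) (γ z)) :=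
        mul_le_mul_of_nonneg_left (mul_le_mul_of_nonneg_left hA1 (hγ z hz0).1.le) hc.le
      linarith
    rw [div_mul_eq_mul_div, le_div_iff₀ (by positivity), mul_comm]
    exact h5

/-- Next to a gap, co-solutions are Lipschitz continuous and `V₀` is bounded below. -/
lemma exists_lipschitz (hA : Admissible H) (hc : 0 < c) (hc1 : c ≤ 1) (h0 : 0 < x₀) (hρ : 0 < ρ)
    (hρx : ρ < x₀) (hgap : ∀ᵐ l ∂F, 2 * ρ ≤ |l - x₀|)
    (hγ : ∀ z : ℂ, 0 < z.im → IsCoSolution c H F z (γ z)) :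
    ∃ κ L : ℝ, 0 < κ ∧ 0 < L ∧
      (∀ z ∈ Metric.closedBall (x₀ : ℂ) ρ, 0 < z.im → κ ≤ V₀ c H (stieltjes F z) (γ z)) ∧
      ∀ z ∈ Metric.closedBall (x₀ : ℂ) ρ, 0 < z.im →
        ∀ z' ∈ Metric.closedBall (x₀ : ℂ) ρ, 0 < z'.im → ‖γ z - γ z'‖ ≤ L * ‖z - z'‖ := by
  obtain ⟨C, hC, hCb⟩ := exists_im_le hA hc hc1 h0 hρ hρx hgap hγ
  obtain ⟨B, hB, hBb⟩ := exists_quad_le hA hc h0 hρ hgap hγ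
  obtain ⟨K, hK, hKb⟩ := hA.exists_le
  have hV : ∀ z ∈ Metric.closedBall (x₀ : ℂ) ρ, 0 < z.im →
      C⁻¹ ≤ V₀ c H (stieltjes F z) (γ z) := by
    intro z hz hz0
    refine le_trans ?_ ((hγ z hz0).V₀_ge hA hc.le hz0)
    rw [← one_div, div_le_div_iff₀ hC (hγ z hz0).1, one_mul, mul_comm]
    exact hCb z hz hz0
  have hB2 : ∀ z ∈ Metric.closedBall (x₀ : ℂ) ρ, 0 < z.im →
      quad H 0 2 (stieltjes F z) (γ z) ≤ K * B := by
    intro z hz hz0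
    have hreg := (hγ z hz0).regular hA hz0
    exact (quad_le_mul hA hreg fun p hp => (hKb p hp).2).trans
      (mul_le_mul_of_nonneg_left (hBb z hz hz0) hK.le)
  refine ⟨C⁻¹, C * (1 + c * (ρ ^ 2)⁻¹ * (K * B)), by positivity, by positivity, hV,
    fun z hz hz0 z' hz' hz0' => ?_⟩
  have h1 := (hγ z hz0).norm_sub_le hA hc.le hz0 hz0' (hγ z' hz0') (by positivity)
    (hV z hz hz0) (hV z' hz' hz0') (hB2 z hz hz0) (hB2 z' hz' hz0')
  rw [inv_mul_le_iff₀ hC] at h1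
  refine h1.trans ?_
  rw [mul_assoc C]
  refine mul_le_mul_of_nonneg_left ?_ hC.le
  have h2 : c * ‖stieltjes F z - stieltjes F z'‖ * (K * B) ≤
      c * ((ρ ^ 2)⁻¹ * ‖z - z'‖) * (K * B) := by
    gcongr
    exact gap_lipschitz hρ hgap hz hz'
  linarith

end LocalBounds


/-! ### Morera's theorem across the real line and reflection -/

section Reflection

open Complex in
/-- A function that is continuous on a disc centred on the real line, and holomorphic off the real
line, is holomorphic. -/
lemma differentiableOn_ball_of_off_real {f : ℂ → ℂ} {x₀ ρ : ℝ}
    (hc : ContinuousOn f (Metric.ball (x₀ : ℂ) ρ))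
    (hd : ∀ z ∈ Metric.ball (x₀ : ℂ) ρ, z.im ≠ 0 → DifferentiableAt ℂ f z) :
    DifferentiableOn ℂ f (Metric.ball (x₀ : ℂ) ρ) := by
  rw [← Complex.isConservativeOn_and_continuousOn_iff_isDifferentiableOn Metric.isOpen_ball]
  refine ⟨fun z w hzw => ?_, hc⟩
  rw [← add_eq_zero_iff_eq_neg, wedgeIntegral_add_wedgeIntegral_eq]
  -- The rectangle is written as a difference of two with one side on the real axis. Since the
  -- centre is real, decreasing |Im| stays in the disc, even if the given rectangle does not meet
  -- the axis.
  have hmem : ∀ x ∈ Set.uIcc z.re w.re, ∀ y : ℝ, |y| ≤ |z.im| ∨ |y| ≤ |w.im| →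
      (x + y * I : ℂ) ∈ Metric.ball (x₀ : ℂ) ρ := by
    have key : ∀ x ∈ Set.uIcc z.re w.re, ∀ y y' : ℝ, |y| ≤ |y'| → y' ∈ Set.uIcc z.im w.im →
        (x + y * I : ℂ) ∈ Metric.ball (x₀ : ℂ) ρ := by
      intro x hx y y' hy hy'
      have h1 : (x + y' * I : ℂ) ∈ Metric.ball (x₀ : ℂ) ρ := hzw (by
        rw [Rectangle, Complex.mem_reProdIm]
        simpa using ⟨hx, hy'⟩)
      rw [Metric.mem_ball, dist_eq_norm] at h1 ⊢
      refine lt_of_le_of_lt ?_ h1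
      have e : ∀ y : ℝ, ‖(x + y * I : ℂ) - x₀‖ = √((x - x₀) ^ 2 + y ^ 2) := by
        intro y
        rw [← Complex.norm_add_mul_I]
        congr 1
        push_cast
        ring
      rw [e, e]
      exact Real.sqrt_le_sqrt (add_le_add le_rfl (sq_le_sq.2 hy))
    rintro x hx y (h | h)
    · exact key x hx y _ h Set.left_mem_uIcc
    · exact key x hx y _ h Set.right_mem_uIcc
  have habs : ∀ {y b : ℝ}, y ∈ Set.uIcc b 0 → |y| ≤ |b| := by
    intro y b hy
    rcases Set.mem_uIcc.1 hy with h | h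
    · rw [abs_of_nonpos h.2, abs_of_nonpos (h.1.trans h.2)]
      linarith [h.1]
    · rw [abs_of_nonneg h.1, abs_of_nonneg (h.1.trans h.2)]
      linarith [h.2]
  have hint : ∀ x ∈ Set.uIcc z.re w.re, ∀ b : ℝ, |b| ≤ |z.im| ∨ |b| ≤ |w.im| →
      IntervalIntegrable (fun y : ℝ => f (x + y * I)) volume b 0 := by
    intro x hx b hb
    refine ContinuousOn.intervalIntegrable (hc.comp (by fun_prop) fun y hy => ?_)
    exact hmem x hx y (hb.imp (habs hy).trans (habs hy).trans)
  have hside : ∀ b : ℝ, |b| ≤ |z.im| ∨ |b| ≤ |w.im| →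
      (∫ x : ℝ in z.re..w.re, f (x + b * I)) - (∫ x : ℝ in z.re..w.re, f (x + (0 : ℝ) * I)) +
      I • (∫ y : ℝ in b..0, f (w.re + y * I)) - I • (∫ y : ℝ in b..0, f (z.re + y * I)) = 0 := by
    intro b hb
    have h := integral_boundary_rect_eq_zero_of_continuousOn_of_differentiableOn f
      (z.re + b * I) (w.re + (0 : ℝ) * I) (by
        refine hc.mono fun u hu => ?_
        rw [Complex.mem_reProdIm] at hu
        simp only [add_re, ofReal_re, mul_re, I_re, mul_zero, ofReal_im, I_im, mul_one, sub_self,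
          add_zero, add_im, mul_im, zero_add] at hu
        have := hmem u.re hu.1 u.im (hb.imp (habs hu.2).trans (habs hu.2).trans)
        rwa [Complex.re_add_im] at this) (by
        intro u hu
        rw [Complex.mem_reProdIm] at hu
        simp only [add_re, ofReal_re, mul_re, I_re, mul_zero, ofReal_im, I_im, mul_one, sub_self,
          add_zero, add_im, mul_im, zero_add] at hu
        refine (hd u ?_ ?_).differentiableWithinAt
        · have h2 : u.im ∈ Set.uIcc b 0 := ⟨hu.2.1.le, hu.2.2.le⟩
          have := hmem u.re ⟨hu.1.1.le, hu.1.2.le⟩ u.im (hb.imp (habs h2).trans (habs h2).trans)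
          rwa [Complex.re_add_im] at this
        · intro h0
          rw [h0] at hu
          rcases le_total b 0 with h | h
          · rw [max_eq_right h] at hu
            exact lt_irrefl _ hu.2.2
          · rw [min_eq_right h] at hu
            exact lt_irrefl _ hu.2.1)
    simpa using h
  have h1 := hside z.im (Or.inl le_rfl)
  have h2 := hside w.im (Or.inr le_rfl)
  have h3 : ∀ x ∈ Set.uIcc z.re w.re, ∫ y : ℝ in z.im..w.im, f (x + y * I) =
      (∫ y : ℝ in z.im..0, f (x + y * I)) - ∫ y : ℝ in w.im..0, f (x + y * I) := by
    intro x hx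
    rw [← intervalIntegral.integral_add_adjacent_intervals (hint x hx _ (Or.inl le_rfl))
      (hint x hx _ (Or.inr le_rfl)).symm, intervalIntegral.integral_symm w.im 0, sub_eq_add_neg]
  rw [h3 _ Set.left_mem_uIcc, h3 _ Set.right_mem_uIcc]
  simp only [smul_eq_mul] at h1 h2 ⊢
  linear_combination h1 - h2

/-- Reflection of a Lipschitz continuous holomorphic function with real boundary values. -/
lemma exists_reflection {f : ℂ → ℂ} {x₀ ρ L C : ℝ} (hL : 0 ≤ L)
    (hd : ∀ z ∈ Metric.ball (x₀ : ℂ) ρ, 0 < z.im → DifferentiableAt ℂ f z)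
    (hLip : ∀ z ∈ Metric.ball (x₀ : ℂ) ρ, 0 < z.im → ∀ z' ∈ Metric.ball (x₀ : ℂ) ρ, 0 < z'.im →
      ‖f z - f z'‖ ≤ L * ‖z - z'‖)
    (him : ∀ z ∈ Metric.ball (x₀ : ℂ) ρ, 0 < z.im → |(f z).im| ≤ C * z.im) :
    ∃ g : ℂ → ℂ, (∀ z, 0 < z.im → g z = f z) ∧ AnalyticOnNhd ℂ g (Metric.ball (x₀ : ℂ) ρ) ∧
      (∀ x : ℝ, (x : ℂ) ∈ Metric.ball (x₀ : ℂ) ρ → (g x).im = 0) ∧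
      ∃ K : ℝ, 0 ≤ K ∧ ∀ z ∈ Metric.ball (x₀ : ℂ) ρ, 0 ≤ z.im →
        ∀ z' ∈ Metric.ball (x₀ : ℂ) ρ, 0 ≤ z'.im → ‖g z - g z'‖ ≤ K * ‖z - z'‖ := by
  set D : Set ℂ := {z | z ∈ Metric.ball (x₀ : ℂ) ρ ∧ 0 < z.im} with hD
  have hlip : LipschitzOnWith ⟨L, hL⟩ f D := by
    refine LipschitzOnWith.of_dist_le_mul fun z hz z' hz' => ?_
    rw [dist_eq_norm, dist_eq_norm]
    exact hLip z hz.1 hz.2 z' hz'.1 hz'.2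
  -- A Lipschitz extension to the plane supplies the boundary values.
  obtain ⟨fe, hfe, hEq⟩ := hlip.extend_finite_dimension
  have hfec := hfe.continuous
  have hreal : ∀ x : ℝ, (x : ℂ) ∈ Metric.ball (x₀ : ℂ) ρ → (fe x).im = 0 := by
    intro x hx
    have hpath : Tendsto (fun ε : ℝ => (x + ε * Complex.I : ℂ)) (𝓝[>] 0) (𝓝 (x : ℂ)) := by
      have : Continuous fun ε : ℝ => (x + ε * Complex.I : ℂ) := by fun_prop
      have := this.tendsto 0
      simp only [Complex.ofReal_zero, zero_mul, add_zero] at this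
      exact this.mono_left nhdsWithin_le_nhds
    have h1 : Tendsto (fun ε : ℝ => (fe (x + ε * Complex.I)).im) (𝓝[>] 0) (𝓝 (fe x).im) :=
      ((Complex.continuous_im.comp hfec).tendsto _).comp hpath
    have h2 : Tendsto (fun ε : ℝ => (fe (x + ε * Complex.I)).im) (𝓝[>] 0) (𝓝 0) := by
      have h3 : Tendsto (fun ε : ℝ => C * ε) (𝓝[>] 0) (𝓝 0) := by
        have : Tendsto (fun ε : ℝ => C * ε) (𝓝 0) (𝓝 (C * 0)) := tendsto_id.const_mul C
        rw [mul_zero] at this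
        exact this.mono_left nhdsWithin_le_nhds
      refine squeeze_zero_norm' ?_ h3
      filter_upwards [hpath.eventually (Metric.isOpen_ball.mem_nhds hx), self_mem_nhdsWithin]
        with ε h4 (h5 : 0 < ε)
      have h6 : 0 < (x + ε * Complex.I : ℂ).im := by simpa using h5
      rw [← hEq ⟨h4, h6⟩]
      have := him _ h4 h6
      simpa using this
    exact tendsto_nhds_unique h1 h2
  have hball : ∀ z, star z ∈ Metric.ball (x₀ : ℂ) ρ ↔ z ∈ Metric.ball (x₀ : ℂ) ρ := by
    intro z
    rw [Metric.mem_ball, Metric.mem_ball, dist_eq_norm, dist_eq_norm]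
    have : star z - (x₀ : ℂ) = star (z - x₀) := by simp
    rw [this, norm_star]
  -- `G` is suited to continuity and differentiability in the disc; `g` equals f in the whole upper
  -- half-plane, where the extension may differ from f. They agree in the disc.
  set G : ℂ → ℂ := fun z => if 0 ≤ z.im then fe z else star (fe (star z)) with hG
  set g : ℂ → ℂ := fun z => if 0 < z.im then f z else star (fe (star z)) with hg
  have hconj : ∀ z ∈ Metric.ball (x₀ : ℂ) ρ, z.im = 0 → star (fe (star z)) = fe z := by
    intro z hz h0
    have e : z = (z.re : ℂ) := by
      apply Complex.ext <;> simp [h0]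
    have h1 := hreal z.re (e ▸ hz)
    rw [← e] at h1
    have h2 : star z = z := Complex.conj_eq_iff_im.2 h0
    rw [h2]
    exact Complex.conj_eq_iff_im.2 h1
  have hgG : ∀ z ∈ Metric.ball (x₀ : ℂ) ρ, g z = G z := by
    intro z hz
    rcases lt_trichotomy z.im 0 with h | h | h
    · simp only [hg, hG, not_lt.2 h.le, not_le.2 h, if_false]
    · simp only [hg, hG, h, lt_irrefl, le_refl, if_false, if_true]
      exact hconj z hz h
    · simp only [hg, hG, h, h.le, if_true]
      exact hEq ⟨hz, h⟩
  have hGc : ContinuousOn G (Metric.ball (x₀ : ℂ) ρ) := by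
    refine ContinuousOn.if ?_ hfec.continuousOn ?_
    · rintro z ⟨hz, hfr⟩
      have h0 : (0 : ℝ) = z.im := frontier_le_subset_eq continuous_const Complex.continuous_im hfr
      exact (hconj z hz h0.symm).symm
    · exact (continuous_star.comp (hfec.comp continuous_star)).continuousOn
  have hGd : DifferentiableOn ℂ G (Metric.ball (x₀ : ℂ) ρ) := by
    refine differentiableOn_ball_of_off_real hGc fun z hz h0 => ?_
    rcases lt_or_gt_of_ne h0 with h | h
    · have h1 : 0 < (star z).im := by simpa using h
      have h2 := (hd _ ((hball z).2 hz) h1).star_star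
      rw [star_star] at h2
      refine h2.congr_of_eventuallyEq ?_
      filter_upwards [Metric.isOpen_ball.mem_nhds hz,
        (Complex.continuous_im.tendsto z).eventually_lt_const h] with w hw hw0
      simp only [hG, not_le.2 hw0, if_false, Function.comp]
      have h3 : 0 < (star w).im := by simpa using hw0
      rw [hEq ⟨(hball w).2 hw, h3⟩]
    · refine (hd z hz h).congr_of_eventuallyEq ?_
      filter_upwards [Metric.isOpen_ball.mem_nhds hz,
        (Complex.continuous_im.tendsto z).eventually_const_lt h] with w hw hw0
      simp only [hG, hw0.le, if_true]
      exact (hEq ⟨hw, hw0⟩).symm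
  refine ⟨g, fun z hz => by simp [hg, hz], ?_, fun x hx => ?_,
    ((lipschitzExtensionConstant ℂ * ⟨L, hL⟩ : NNReal) : ℝ), NNReal.coe_nonneg _,
    fun z hz hz0 z' hz' hz0' => ?_⟩
  · exact (hGd.congr hgG).analyticOnNhd Metric.isOpen_ball
  · rw [hgG _ hx]
    simp only [hG, Complex.ofReal_im, le_refl, if_true]
    exact hreal x hx
  · rw [hgG _ hz, hgG _ hz']
    simp only [hG, hz0, hz0', if_true]
    rw [← dist_eq_norm, ← dist_eq_norm]
    exact hfe.dist_le_mul z z'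

end Reflection


/-! ### Null sets from quadratically small pieces -/

section Covering

/-- A set that is covered by small pieces of quadratically small measure is a null set. -/
lemma measure_eq_zero_of_sq_le {α : Type*} [MeasurableSpace α] (μ : Measure α) {S : Set α}
    {r : α → ℝ} {a b C η₀ : ℝ} (hab : a < b) (hη₀ : 0 < η₀) (hr : ∀ p ∈ S, r p ∈ Set.Icc a b)
    (h : ∀ η : ℝ, 0 < η → η < η₀ → ∀ x ∈ Set.Icc a b,
      μ {p | p ∈ S ∧ |r p - x| ≤ η} ≤ ENNReal.ofReal (C * η ^ 2)) : μ S = 0 := by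
  have hd : 0 < b - a := sub_pos.2 hab
  have hbound : ∀ᶠ n : ℕ in atTop, μ S ≤
      ENNReal.ofReal (((n : ℝ) + 1) * (C * ((b - a) / n) ^ 2)) := by
    have h1 : Tendsto (fun n : ℕ => (b - a) / (n : ℝ)) atTop (𝓝 0) :=
      tendsto_const_div_atTop_nhds_zero_nat _
    filter_upwards [h1.eventually_lt_const hη₀, eventually_gt_atTop 0] with n hn hn0
    have hn' : (0 : ℝ) < n := by exact_mod_cast hn0
    -- About 1/η intervals cover [a, b], each with mass at most Cη²; the total is of order 1/n.
    set η := (b - a) / n with hη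
    have hη0 : 0 < η := by positivity
    have hηn : η * n = b - a := by
      rw [hη]
      field_simp
    have hcover : S ⊆ ⋃ j ∈ Finset.range (n + 1), {p | p ∈ S ∧ |r p - (a + j * η)| ≤ η} := by
      intro p hp
      obtain ⟨h2, h3⟩ := hr p hp
      have h4 : 0 ≤ (r p - a) / η := div_nonneg (by linarith) hη0.le
      have h5 := Nat.floor_le h4
      have h6 := Nat.lt_floor_add_one ((r p - a) / η)
      rw [le_div_iff₀ hη0] at h5
      rw [div_lt_iff₀ hη0] at h6
      simp only [Set.mem_iUnion]
      refine ⟨⌊(r p - a) / η⌋₊, ?_, hp, ?_⟩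
      · rw [Finset.mem_range]
        have h7 : ((⌊(r p - a) / η⌋₊ : ℕ) : ℝ) ≤ n := by
          have : ((⌊(r p - a) / η⌋₊ : ℕ) : ℝ) * η ≤ n * η := by linarith
          exact le_of_mul_le_mul_right this hη0
        have : ⌊(r p - a) / η⌋₊ ≤ n := by exact_mod_cast h7
        omega
      · rw [abs_le]
        constructor <;> linarith
    calc μ S ≤ ∑ j ∈ Finset.range (n + 1), μ {p | p ∈ S ∧ |r p - (a + j * η)| ≤ η} :=
          (measure_mono hcover).trans (measure_biUnion_finset_le _ _)
      _ ≤ ∑ _j ∈ Finset.range (n + 1), ENNReal.ofReal (C * η ^ 2) := by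
          refine Finset.sum_le_sum fun j hj => h η hη0 hn _ ⟨?_, ?_⟩
          · have : 0 ≤ (j : ℝ) * η := by positivity
            linarith
          · have h8 : (j : ℝ) ≤ n := by
              have := Finset.mem_range.1 hj
              exact_mod_cast Nat.lt_succ_iff.1 this
            have := mul_le_mul_of_nonneg_right h8 hη0.le
            linarith
      _ = _ := by
          rw [Finset.sum_const, Finset.card_range, nsmul_eq_mul,
            ENNReal.ofReal_mul (by positivity : (0 : ℝ) ≤ (n : ℝ) + 1)]
          congr 1
          rw [← Nat.cast_succ, ENNReal.ofReal_natCast]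
  have hlim : Tendsto (fun n : ℕ => ENNReal.ofReal (((n : ℝ) + 1) * (C * ((b - a) / n) ^ 2)))
      atTop (𝓝 0) := by
    have h1 : Tendsto (fun n : ℕ => (1 : ℝ) / (n : ℝ)) atTop (𝓝 0) :=
      tendsto_const_div_atTop_nhds_zero_nat _
    have h2 : Tendsto (fun n : ℕ => C * (b - a) ^ 2 * ((1 : ℝ) / n + ((1 : ℝ) / n) ^ 2)) atTop
        (𝓝 0) := by
      simpa using (h1.add (h1.pow 2)).const_mul (C * (b - a) ^ 2)
    have h3 : Tendsto (fun n : ℕ => ((n : ℝ) + 1) * (C * ((b - a) / n) ^ 2)) atTop (𝓝 0) := by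
      refine h2.congr' ?_
      filter_upwards [eventually_gt_atTop 0] with n hn
      have : (n : ℝ) ≠ 0 := by exact_mod_cast hn.ne'
      field_simp
    simpa using ENNReal.tendsto_ofReal h3
  exact le_antisymm (ge_of_tendsto hlim hbound) zero_le

end Covering

/-! ### Inequalities at real solutions -/

section RealPoints

variable {c : ℝ} {H : Measure (ℝ × ℝ)} [IsProbabilityMeasure H]

lemma tendsto_add_mul_I (x : ℝ) :
    Tendsto (fun ε : ℝ => (x + ε * Complex.I : ℂ)) (𝓝[>] 0) (𝓝 (x : ℂ)) := by
  have : Continuous fun ε : ℝ => (x + ε * Complex.I : ℂ) := by fun_prop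
  have := this.tendsto 0
  simp only [Complex.ofReal_zero, zero_mul, add_zero] at this
  exact this.mono_left nhdsWithin_le_nhds

/-- The sign of a function that is real on the real line and whose imaginary part grows. -/
lemma eventually_sign_of_im_ge {d : ℂ → ℂ} {x₁ δ : ℝ} (hd : DifferentiableAt ℂ d x₁) (hδ : 0 < δ)
    (h0 : d x₁ = 0) (him : ∀ᶠ ε : ℝ in 𝓝[>] 0, δ * ε ≤ (d (x₁ + ε * Complex.I)).im) :
    ∀ᶠ x : ℝ in 𝓝 x₁, SignType.sign (d x).re = SignType.sign (x - x₁) := by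
  obtain ⟨d', hd'⟩ : ∃ d', HasDerivAt d d' (x₁ : ℂ) := ⟨_, hd.hasDerivAt⟩
  have h1 : Tendsto (fun ε : ℝ => (x₁ + ε * Complex.I : ℂ)) (𝓝[>] 0) (𝓝[≠] (x₁ : ℂ)) := by
    refine tendsto_nhdsWithin_iff.2 ⟨tendsto_add_mul_I x₁, ?_⟩
    filter_upwards [self_mem_nhdsWithin] with ε (hε : 0 < ε)
    simp [hε.ne']
  have h2 := (hasDerivAt_iff_tendsto_slope.1 hd').comp h1
  have h3 : δ ≤ d'.re := by
    refine ge_of_tendsto ((Complex.continuous_re.tendsto _).comp h2) ?_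
    filter_upwards [him, self_mem_nhdsWithin] with ε hε (hε0 : 0 < ε)
    -- The vertical slope is -i d(x₁ + iε)/ε, with real part Im d/ε ≥ δ. So the derivative has
    -- positive real part, and Re d changes sign along the real line.
    have e : slope d x₁ (x₁ + ε * Complex.I) =
        ((ε⁻¹ : ℝ) : ℂ) * (-Complex.I * d (x₁ + ε * Complex.I)) := by
      rw [slope_def_field, h0, sub_zero, add_sub_cancel_left, div_eq_mul_inv, mul_inv,
        Complex.inv_I]
      push_cast
      ring
    simp only [Function.comp]
    rw [e, Complex.re_ofReal_mul]
    have : (-Complex.I * d (x₁ + ε * Complex.I)).re = (d (x₁ + ε * Complex.I)).im := by simp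
    rw [this, inv_mul_eq_div, le_div_iff₀ hε0]
    exact hε
  have h4 : HasDerivAt (fun x : ℝ => (d x).re) d'.re x₁ := hd'.real_of_complex
  exact eventually_nhdsWithin_sign_eq_of_deriv_pos (by rw [h4.deriv]; linarith) (by simp [h0])

lemma den_ofReal {m g : ℝ} (p : ℝ × ℝ) :
    den (m : ℂ) (g : ℂ) p = ((1 + p.1 * g + p.2 * m : ℝ) : ℂ) := by
  simp [den]

lemma kern_ofReal (i j : ℕ) (m g : ℝ) (p : ℝ × ℝ) :
    kern i j (m : ℂ) (g : ℂ) p = p.1 ^ i * p.2 ^ j / (1 + p.1 * g + p.2 * m) ^ 2 := by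
  rw [kern, den_ofReal, Complex.norm_real, Real.norm_eq_abs, sq_abs]

lemma mom_ofReal (i j : ℕ) (m g : ℝ) :
    mom H i j ((g : ℂ), (m : ℂ)) =
      ((∫ p : ℝ × ℝ, p.1 ^ i * p.2 ^ j / (1 + p.1 * g + p.2 * m) ∂H : ℝ) : ℂ) := by
  rw [mom]
  refine Eq.trans ?_ (integral_ofReal (𝕜 := ℂ))
  congr 1
  funext p
  simp only
  rw [den_ofReal]
  push_cast
  rfl

lemma integrable_mom_ofReal (hA : Admissible H) (i j : ℕ) {m g : ℝ}
    (h : Regular H ((g : ℂ), (m : ℂ))) :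
    Integrable (fun p : ℝ × ℝ => p.1 ^ i * p.2 ^ j / (1 + p.1 * g + p.2 * m)) H := by
  refine (integrable_mom hA i j h).re.congr (ae_of_all _ fun p => ?_)
  simp only
  rw [den_ofReal, ← Complex.ofReal_pow, ← Complex.ofReal_pow, ← Complex.ofReal_mul,
    ← Complex.ofReal_div]
  exact Complex.ofReal_re _

lemma Regular.ofReal_ne_zero {m g : ℝ} (h : Regular H ((g : ℂ), (m : ℂ))) {p : ℝ × ℝ}
    (hp : p ∈ H.support) : 1 + p.1 * g + p.2 * m ≠ 0 := by
  have := h p hp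
  simp only at this
  rw [den_ofReal] at this
  exact_mod_cast this

/-- The real form of the system. -/
lemma Solves.real (hA : Admissible H) {x m g : ℝ} (hr : Regular H ((g : ℂ), (m : ℂ)))
    (h : Solves c H x m g) :
    g ≠ 0 ∧ x * m = -(1 - c) - c * (∫ p : ℝ × ℝ, 1 / (1 + p.1 * g + p.2 * m) ∂H) ∧
      g = m + c * g ^ 2 * ∫ p : ℝ × ℝ, p.1 / (1 + p.1 * g + p.2 * m) ∂H := by
  have hg : g ≠ 0 := by exact_mod_cast h.1
  have h1 := Solves.eq_left (q := ((g : ℂ), (m : ℂ))) h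
  have h2 := ((solves_iff (q := ((g : ℂ), (m : ℂ))) hA hr h.1).1 h).2
  rw [mom_ofReal] at h1 h2
  simp only [pow_zero, pow_one, mul_one] at h1 h2
  refine ⟨hg, by exact_mod_cast h1, ?_⟩
  have h3 : c * g ^ 2 * (∫ p : ℝ × ℝ, p.1 / (1 + p.1 * g + p.2 * m) ∂H) + m - g = 0 := by
    exact_mod_cast h2
  linarith

lemma integrable_kern_ofReal (hA : Admissible H) (i j : ℕ) {m g : ℝ}
    (h : Regular H ((g : ℂ), (m : ℂ))) :
    Integrable (fun p => kern i j (m : ℂ) (g : ℂ) p) H :=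
  integrable_kern (q := ((g : ℂ), (m : ℂ))) hA i j h

lemma sq_integral_le_quad (hA : Admissible H) {m g : ℝ} (hr : Regular H ((g : ℂ), (m : ℂ))) :
    (∫ p : ℝ × ℝ, p.1 / (1 + p.1 * g + p.2 * m) ∂H) ^ 2 ≤ quad H 2 0 m g := by
  have hIi : Integrable (fun p : ℝ × ℝ => p.1 / (1 + p.1 * g + p.2 * m)) H := by
    simpa using integrable_mom_ofReal hA 1 0 hr
  have i1 : Integrable (fun p => kern 2 0 (m : ℂ) (g : ℂ) p) H := integrable_kern_ofReal hA 2 0 hr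
  have e0 : quad H 2 0 m g = ∫ p, kern 2 0 (m : ℂ) (g : ℂ) p ∂H := rfl
  rw [e0]
  generalize hI : ∫ p : ℝ × ℝ, p.1 / (1 + p.1 * g + p.2 * m) ∂H = I
  have h3 : ∫ p : ℝ × ℝ, 2 * I * (p.1 / (1 + p.1 * g + p.2 * m)) ∂H ≤
      ∫ p, (kern 2 0 (m : ℂ) (g : ℂ) p + I ^ 2) ∂H := by
    refine integral_mono (hIi.const_mul _) (i1.add (integrable_const _)) fun p => ?_
    simp only [kern_ofReal, pow_zero, mul_one]
    rw [← div_pow]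
    nlinarith [sq_nonneg (p.1 / (1 + p.1 * g + p.2 * m) - I)]
  rw [integral_add i1 (integrable_const _), integral_const_mul, hI] at h3
  simp only [integral_const, probReal_univ, one_smul] at h3
  linarith

/-- From s(1 + tm) = s·den - s²g, divided by den². -/
lemma quad_add_mul_quad (hA : Admissible H) {m g : ℝ} (hr : Regular H ((g : ℂ), (m : ℂ))) :
    quad H 1 0 m g + m * quad H 1 1 m g =
      (∫ p : ℝ × ℝ, p.1 / (1 + p.1 * g + p.2 * m) ∂H) - g * quad H 2 0 m g := by
  have hIi : Integrable (fun p : ℝ × ℝ => p.1 / (1 + p.1 * g + p.2 * m)) H := by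
    simpa using integrable_mom_ofReal hA 1 0 hr
  have i1 : Integrable (fun p => kern 1 0 (m : ℂ) (g : ℂ) p) H := integrable_kern_ofReal hA 1 0 hr
  have i2 : Integrable (fun p => m * kern 1 1 (m : ℂ) (g : ℂ) p) H :=
    (integrable_kern_ofReal hA 1 1 hr).const_mul m
  have i3 : Integrable (fun p => g * kern 2 0 (m : ℂ) (g : ℂ) p) H :=
    (integrable_kern_ofReal hA 2 0 hr).const_mul g
  unfold quad
  rw [← integral_const_mul, ← integral_const_mul, ← integral_add i1 i2, ← integral_sub hIi i3]
  refine integral_congr_ae ?_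
  filter_upwards [H.support_mem_ae] with p hp
  have h3 := hr.ofReal_ne_zero hp
  simp only [kern_ofReal]
  field_simp
  ring

/-- For m < 0 the signs decide. For m = 0, A₁ = 0 would mean s = 0 almost everywhere and g = m = 0.
For m > 0 one has g = -a < 0, and I = ∫ s/den satisfies cI = -(a+m)/a². Jensen's inequality bounds ∫
s²/den² below by I², and with `quad_add_mul_quad` and c² ≤ c the difference of the two sides is at
least m²/a³. -/
lemma Solves.lt_of_real (hA : Admissible H) (hc : 0 < c) (hc1 : c ≤ 1) {x m g : ℝ} (hx : 0 < x)
    (hr : Regular H ((g : ℂ), (m : ℂ))) (h : Solves c H x m g) (hV : 0 < V₀ c H m g) :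
    m * V₀ c H m g < c * quad H 1 0 m g := by
  obtain ⟨hg, h1, h2⟩ := h.real hA hr
  have hA1 := quad_nonneg hA 1 0 (m : ℂ) (g : ℂ)
  rcases lt_trichotomy m 0 with hm | hm | hm
  · have := mul_neg_of_neg_of_pos hm hV
    have := mul_nonneg hc.le hA1
    linarith
  · have h00 : m * V₀ c H m g = 0 := by rw [hm, zero_mul]
    rw [h00]
    refine mul_pos hc (lt_of_le_of_ne hA1 fun h0 => hg ?_)
    have h3 : ∀ᵐ p ∂H, p.1 = 0 := by
      have h4 := (integral_eq_zero_iff_of_nonneg_ae (by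
        filter_upwards [H.support_mem_ae] with p hp
        obtain ⟨ha, hb⟩ := hA.nonneg p hp
        simp only [kern, Pi.zero_apply]
        positivity) (integrable_kern_ofReal hA 1 0 hr)).1 h0.symm
      filter_upwards [h4, H.support_mem_ae] with p hp hps
      simp only [kern_ofReal, Pi.zero_apply, pow_one, pow_zero, mul_one] at hp
      rcases div_eq_zero_iff.1 hp with h5 | h5
      · exact h5
      · exact absurd (pow_eq_zero_iff (two_ne_zero)|>.1 h5) (hr.ofReal_ne_zero hps)
    have h5 : ∫ p : ℝ × ℝ, p.1 / (1 + p.1 * g + p.2 * m) ∂H = 0 := by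
      refine integral_eq_zero_of_ae ?_
      filter_upwards [h3] with p hp
      simp [hp]
    rw [h5, mul_zero, add_zero] at h2
    rw [h2, hm]
  -- If g ≥ 0, all denominators are positive, and the first equation equates xm > 0 with a number
  -- that is at most 0 because c ≤ 1.
  · have hg0 : g < 0 := by
      by_contra hcon
      push Not at hcon
      have h3 : 0 ≤ ∫ p : ℝ × ℝ, 1 / (1 + p.1 * g + p.2 * m) ∂H := by
        refine integral_nonneg_of_ae ?_
        filter_upwards [H.support_mem_ae] with p hp
        obtain ⟨ha, hb⟩ := hA.nonneg p hp
        simp only [Pi.zero_apply]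
        positivity
      have h4 := mul_pos hx hm
      have h5 := mul_nonneg hc.le h3
      linarith
    set I := ∫ p : ℝ × ℝ, p.1 / (1 + p.1 * g + p.2 * m) ∂H with hI
    have hsq : I ^ 2 ≤ quad H 2 0 m g := sq_integral_le_quad hA hr
    have hid : quad H 1 0 m g + m * quad H 1 1 m g = I - g * quad H 2 0 m g :=
      quad_add_mul_quad hA hr
    obtain ⟨a, ha⟩ : ∃ a, a = -g := ⟨_, rfl⟩
    have ha0 : 0 < a := by linarith
    have hga : g = -a := by linarith
    have hVe : V₀ c H m g = (a ^ 2)⁻¹ - c * quad H 1 1 m g := by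
      rw [V₀, Complex.norm_real, Real.norm_eq_abs, sq_abs, hga, neg_sq]
    have hcI : c * I = -((a + m) / a ^ 2) := by
      rw [hga] at h2
      field_simp
      linarith
    have hq : (a + m) ^ 2 / a ^ 4 ≤ c * quad H 2 0 m g := by
      have h3 : (c * I) ^ 2 = (a + m) ^ 2 / a ^ 4 := by
        rw [hcI, neg_sq, div_pow]
        ring
      rw [← h3]
      have h4 : 0 ≤ quad H 2 0 m g := quad_nonneg hA 2 0 _ _
      calc (c * I) ^ 2 = c ^ 2 * I ^ 2 := by ring
        _ ≤ c ^ 2 * quad H 2 0 m g := by gcongr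
        _ ≤ c * quad H 2 0 m g := by
            have : c ^ 2 ≤ c := by nlinarith
            exact mul_le_mul_of_nonneg_right this h4
    have hfin : m / a ^ 2 < c * quad H 1 0 m g + m * (c * quad H 1 1 m g) := by
      have e1 : c * quad H 1 0 m g + m * (c * quad H 1 1 m g) =
          c * I + a * (c * quad H 2 0 m g) := by
        rw [hga] at hid
        rw [hga]
        linear_combination c * hid
      rw [e1, hcI]
      have h3 := mul_le_mul_of_nonneg_left hq ha0.le
      have h4 : a * ((a + m) ^ 2 / a ^ 4) - (a + m) / a ^ 2 = m / a ^ 2 + m ^ 2 / a ^ 3 := by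
        field_simp
        ring
      have h5 : 0 < m ^ 2 / a ^ 3 := by positivity
      linarith
    rw [hVe]
    have : m * ((a ^ 2)⁻¹ - c * quad H 1 1 m g) = m / a ^ 2 - m * (c * quad H 1 1 m g) := by
      rw [div_eq_mul_inv]
      ring
    linarith

/-- At m = 0 the equation without z gives c g ∫ s/den = 1. The arithmetic–geometric mean inequality
bounds the left side by (g² cA₂ + c ∫ s/t)/2, where g² cA₂ < 1 by V₀ > 0 and c ∫ s/t ≤ 1; a
contradiction. -/
lemma Solves.ne_zero_of_real (hA : Admissible H) (hc : 0 < c) {x m g : ℝ}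
    (hr : Regular H ((g : ℂ), (m : ℂ))) (h : Solves c H x m g) (hV : 0 < V₀ c H m g)
    (hst : ∫⁻ p : ℝ × ℝ, ENNReal.ofReal p.1 / ENNReal.ofReal p.2 ∂H ≤ ENNReal.ofReal (1 / c)) :
    m ≠ 0 := by
  intro hm
  obtain ⟨hg, -, h2⟩ := h.real hA hr
  have hnn : 0 ≤ᵐ[H] fun p : ℝ × ℝ => p.1 / p.2 := by
    filter_upwards [H.support_mem_ae] with p hp
    exact div_nonneg (hA.nonneg p hp).1 (hA.nonneg p hp).2
  have e1 : ∫⁻ p : ℝ × ℝ, ENNReal.ofReal p.1 / ENNReal.ofReal p.2 ∂H =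
      ∫⁻ p : ℝ × ℝ, ENNReal.ofReal (p.1 / p.2) ∂H := by
    refine lintegral_congr_ae ?_
    filter_upwards [hA.pos] with p hp
    rw [ENNReal.ofReal_div_of_pos hp]
  rw [e1] at hst
  have hmeas : AEStronglyMeasurable (fun p : ℝ × ℝ => p.1 / p.2) H :=
    (measurable_fst.div measurable_snd).aestronglyMeasurable
  have hi : Integrable (fun p : ℝ × ℝ => p.1 / p.2) H := by
    refine ⟨hmeas, ?_⟩
    rw [hasFiniteIntegral_iff_ofReal hnn]
    exact hst.trans_lt ENNReal.ofReal_lt_top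
  have hW : ∫ p : ℝ × ℝ, p.1 / p.2 ∂H ≤ 1 / c := by
    rw [integral_eq_lintegral_of_nonneg_ae hnn hmeas]
    exact ENNReal.toReal_le_of_le_ofReal (by positivity) hst
  set W := ∫ p : ℝ × ℝ, p.1 / p.2 ∂H with hWd
  set I := ∫ p : ℝ × ℝ, p.1 / (1 + p.1 * g + p.2 * m) ∂H with hI
  have ha : 0 < |g| := abs_pos.2 hg
  have hIb : |I| ≤ (|g| * quad H 1 1 m g + |g|⁻¹ * W) / 2 := by
    have e : (|g| * quad H 1 1 m g + |g|⁻¹ * W) / 2 =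
        ∫ p : ℝ × ℝ, (|g| * kern 1 1 m g p + |g|⁻¹ * (p.1 / p.2)) / 2 ∂H := by
      rw [integral_div, integral_add ((integrable_kern_ofReal hA 1 1 hr).const_mul _) (hi.const_mul _),
        integral_const_mul, integral_const_mul, quad]
    rw [e, ← Real.norm_eq_abs]
    refine norm_integral_le_of_norm_le ((((integrable_kern_ofReal hA 1 1 hr).const_mul _).add
      (hi.const_mul _)).div_const 2) ?_
    filter_upwards [H.support_mem_ae, hA.pos] with p hp ht
    have hs := (hA.nonneg p hp).1
    rw [kern_ofReal, Real.norm_eq_abs, abs_div, abs_of_nonneg hs, ← sq_abs (1 + p.1 * g + p.2 * m)]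
    have hD := abs_pos.2 (hr.ofReal_ne_zero hp)
    set D := |1 + p.1 * g + p.2 * m|
    have e2 : (|g| * (p.1 ^ 1 * p.2 ^ 1 / D ^ 2) + |g|⁻¹ * (p.1 / p.2)) / 2 - p.1 / D =
        p.1 * (|g| * p.2 / D - 1) ^ 2 / (2 * |g| * p.2) := by
      field_simp
      ring
    have : 0 ≤ p.1 * (|g| * p.2 / D - 1) ^ 2 / (2 * |g| * p.2) := by positivity
    linarith
  rw [hm, zero_add] at h2
  rw [hm] at hI hIb hV
  have h3 : c * (g * I) = 1 := by
    have : g * (c * (g * I)) = g * 1 := by linear_combination -h2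
    exact mul_left_cancel₀ hg this
  have h4 : c * (|g| * |I|) = 1 := by
    rw [← abs_mul, ← abs_of_pos hc, ← abs_mul, h3, abs_one]
  have h5 : c * quad H 1 1 ((0 : ℝ) : ℂ) g < (|g| ^ 2)⁻¹ := by
    have := hV
    rw [V₀, Complex.norm_real, Real.norm_eq_abs] at this
    linarith
  have h6 : c * W ≤ 1 := by
    have := mul_le_mul_of_nonneg_left hW hc.le
    rwa [mul_one_div_cancel hc.ne'] at this
  have h7 : c * (|g| * |I|) ≤ (|g| ^ 2 * (c * quad H 1 1 ((0 : ℝ) : ℂ) g) + c * W) / 2 := by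
    have := mul_le_mul_of_nonneg_left hIb (mul_pos hc ha).le
    have e3 : c * |g| * ((|g| * quad H 1 1 ((0 : ℝ) : ℂ) g + |g|⁻¹ * W) / 2) =
        (|g| ^ 2 * (c * quad H 1 1 ((0 : ℝ) : ℂ) g) + c * W) / 2 := by
      field_simp
    linarith
  have h8 : |g| ^ 2 * (c * quad H 1 1 ((0 : ℝ) : ℂ) g) < 1 := by
    have := mul_lt_mul_of_pos_left h5 (pow_pos ha 2)
    rwa [mul_inv_cancel₀ (pow_pos ha 2).ne'] at this
  linarith

end RealPoints


/-! ### Nonvanishing of the denominators in a gap -/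

section GapRegular

variable {c : ℝ} {H : Measure (ℝ × ℝ)} [IsProbabilityMeasure H] {F : Measure ℝ}
  [IsProbabilityMeasure F] {x₀ ρ : ℝ} {g : ℂ → ℂ}

lemma add_mul_I_mem_ball {x x₁ ε η : ℝ} (hx : |x - x₁| ≤ ε) (hη : 0 ≤ η) (hηε : η < ε)
    (hε : |x₁ - x₀| + 2 * ε ≤ ρ) : (x + η * Complex.I : ℂ) ∈ Metric.ball (x₀ : ℂ) ρ := by
  rw [Metric.mem_ball, dist_eq_norm]
  have e : (x + η * Complex.I : ℂ) - x₀ = ((x - x₁ : ℝ) : ℂ) + ((x₁ - x₀ : ℝ) : ℂ) +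
      (η : ℂ) * Complex.I := by
    push_cast
    ring
  rw [e]
  have h1 := norm_add₃_le (a := ((x - x₁ : ℝ) : ℂ)) (b := ((x₁ - x₀ : ℝ) : ℂ))
    (c := (η : ℂ) * Complex.I)
  rw [norm_mul, Complex.norm_I, mul_one, Complex.norm_real, Complex.norm_real, Complex.norm_real,
    Real.norm_eq_abs, Real.norm_eq_abs, Real.norm_eq_abs, abs_of_nonneg hη] at h1
  linarith

/-- Chebyshev's inequality for B₁, in the measure t dH: small denominators are quadratically rare.
-/
lemma withDensity_le_of_norm_den_le (hA : Admissible H) {q : ℂ × ℂ} (hq : Regular H q)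
    {D C : ℝ} (hC : quad H 0 1 q.2 q.1 ≤ C) :
    (H.withDensity fun p => ENNReal.ofReal p.2) {p | p ∈ H.support ∧ ‖den q.2 q.1 p‖ ≤ D} ≤
      ENNReal.ofReal (D ^ 2 * C) := by
  have hT : MeasurableSet {p | p ∈ H.support ∧ ‖den q.2 q.1 p‖ ≤ D} :=
    H.isClosed_support.measurableSet.inter
      (measurableSet_le (continuous_den _ _).norm.measurable measurable_const)
  rw [withDensity_apply _ hT]
  calc _ ≤ ∫⁻ p in {p | p ∈ H.support ∧ ‖den q.2 q.1 p‖ ≤ D},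
        ENNReal.ofReal (D ^ 2 * kern 0 1 q.2 q.1 p) ∂H := by
        refine setLIntegral_mono' hT fun p hp => ENNReal.ofReal_le_ofReal ?_
        have h1 := norm_pos_iff.2 (hq p hp.1)
        rw [kern, pow_zero, one_mul, pow_one, mul_div_assoc', le_div_iff₀ (by positivity), mul_comm]
        exact mul_le_mul_of_nonneg_right (pow_le_pow_left₀ h1.le hp.2 2) (hA.nonneg p hp.1).2
    _ ≤ ∫⁻ p, ENNReal.ofReal (D ^ 2 * kern 0 1 q.2 q.1 p) ∂H := setLIntegral_le_lintegral _ _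
    _ = ENNReal.ofReal (∫ p, D ^ 2 * kern 0 1 q.2 q.1 p ∂H) := by
        refine (ofReal_integral_eq_lintegral_ofReal ((integrable_kern hA 0 1 hq).const_mul _) ?_).symm
        filter_upwards [H.support_mem_ae] with p hp
        have := (hA.nonneg p hp).2
        simp only [kern, Pi.zero_apply]
        positivity
    _ ≤ _ := by
        rw [integral_const_mul]
        exact ENNReal.ofReal_le_ofReal (mul_le_mul_of_nonneg_left hC (by positivity))

/-- In a gap the denominators do not vanish on the support of `H`. -/
lemma regular_of_gap (hA : Admissible H) (hc : 0 < c) (h0 : 0 < x₀) (hρ : 0 < ρ)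
    (hgap : ∀ᵐ l ∂F, 2 * ρ ≤ |l - x₀|)
    (hg : ∀ z : ℂ, 0 < z.im → IsCoSolution c H F z (g z))
    (hgA : AnalyticOnNhd ℂ g (Metric.ball (x₀ : ℂ) ρ))
    (hgr : ∀ x : ℝ, (x : ℂ) ∈ Metric.ball (x₀ : ℂ) ρ → (g x).im = 0) {L : ℝ} (hL : 0 ≤ L)
    (hgL : ∀ z ∈ Metric.ball (x₀ : ℂ) ρ, 0 ≤ z.im →
        ∀ z' ∈ Metric.ball (x₀ : ℂ) ρ, 0 ≤ z'.im → ‖g z - g z'‖ ≤ L * ‖z - z'‖)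
    {x₁ : ℝ} (hx₁ : (x₁ : ℂ) ∈ Metric.ball (x₀ : ℂ) ρ) :
    Regular H (g x₁, stieltjes F x₁) := by
  by_contra hcon
  unfold Regular at hcon
  push Not at hcon
  obtain ⟨p₀, hp₀, hden0⟩ := hcon
  simp only at hden0
  obtain ⟨b, hb, hbl⟩ := exists_le_norm hA hc h0 hρ hgap hg
  obtain ⟨k, hk, hkm⟩ := gap_le_im hρ hgap
  obtain ⟨C, hC, hCb⟩ := exists_quad_le hA hc h0 hρ hgap hg
  obtain ⟨K, hK, hKb⟩ := hA.exists_le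
  have hsub := Metric.ball_subset_closedBall (x := (x₀ : ℂ)) (ε := ρ)
  obtain ⟨hs0, ht0⟩ := hA.nonneg p₀ hp₀
  -- At height ε above the real line Im g ≥ b²ε and Im m ≥ kε, so this is the rate at which the
  -- imaginary part of the denominator at p₀ grows. It is nonzero, since at s = t = 0 the
  -- denominator would be 1.
  have hδ : 0 < p₀.1 * b ^ 2 + p₀.2 * k := by
    rcases hs0.eq_or_lt with h | h
    · rcases ht0.eq_or_lt with h' | h'
      · simp [den, ← h, ← h'] at hden0
      · positivity
    · positivity
  have hcm : ∀ z ∈ Metric.ball (x₀ : ℂ) ρ, ContinuousAt (stieltjes F) z := fun z hz =>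
    (gap_differentiableAt hρ hgap (hsub hz)).continuousAt
  have hcg : ∀ z ∈ Metric.ball (x₀ : ℂ) ρ, ContinuousAt g z := fun z hz => (hgA z hz).continuousAt
  have hdd : DifferentiableAt ℂ (fun z => den (stieltjes F z) (g z) p₀) (x₁ : ℂ) := by
    have h1 := gap_differentiableAt hρ hgap (hsub hx₁)
    have h2 := (hgA _ hx₁).differentiableAt
    unfold den
    fun_prop
  have hsign := eventually_sign_of_im_ge hdd hδ hden0 (by
    filter_upwards [(tendsto_add_mul_I x₁).eventually (Metric.isOpen_ball.mem_nhds hx₁),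
      self_mem_nhdsWithin] with ε hε (hε0 : 0 < ε)
    have him : (x₁ + ε * Complex.I : ℂ).im = ε := by simp
    have hpos : 0 < (x₁ + ε * Complex.I : ℂ).im := by rw [him]; exact hε0
    rw [im_den (g (x₁ + ε * Complex.I), stieltjes F (x₁ + ε * Complex.I)) p₀]
    have h1 := hkm _ (hsub hε) hpos.le
    have h2 := (hg _ hpos).mul_norm_sq_le hA hc.le hpos
    have h3 := pow_le_pow_left₀ hb.le (hbl _ (hsub hε) hpos) 2
    rw [him] at h1 h2
    have h4 := mul_le_mul_of_nonneg_left h1 ht0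
    have h5 := mul_le_mul_of_nonneg_left ((mul_le_mul_of_nonneg_left h3 hε0.le).trans h2) hs0
    simp only
    linarith)
  obtain ⟨ε', hε', hball⟩ := Metric.eventually_nhds_iff.1 hsign
  have hx₁' : |x₁ - x₀| < ρ := by
    rw [Metric.mem_ball, dist_eq_norm, ← Complex.ofReal_sub, Complex.norm_real] at hx₁
    exact hx₁
  obtain ⟨ε, hε, hεε', hερ⟩ : ∃ ε : ℝ, 0 < ε ∧ ε < ε' ∧ |x₁ - x₀| + 2 * ε ≤ ρ := by
    refine ⟨min (ε' / 2) ((ρ - |x₁ - x₀|) / 2), lt_min (by linarith) (by linarith),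
      (min_le_left _ _).trans_lt (by linarith), ?_⟩
    have := min_le_right (ε' / 2) ((ρ - |x₁ - x₀|) / 2)
    linarith
  have hmemr : ∀ x ∈ Set.Icc (x₁ - ε) (x₁ + ε), (x : ℂ) ∈ Metric.ball (x₀ : ℂ) ρ := by
    intro x hx
    have := add_mul_I_mem_ball (x := x) (x₁ := x₁) (ε := ε) (η := 0)
      (abs_le.2 ⟨by linarith [hx.1], by linarith [hx.2]⟩) le_rfl hε hερ
    simpa using this
  set φ : ℝ × ℝ → ℝ → ℝ := fun p x => (den (stieltjes F x) (g x) p).re with hφ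
  have hneg : φ p₀ (x₁ - ε) < 0 := by
    have h1 := hball (y := x₁ - ε) (by
      rw [Real.dist_eq, sub_sub_cancel_left, abs_neg, abs_of_pos hε]; exact hεε')
    rw [sub_sub_cancel_left, sign_neg (by linarith : -ε < 0)] at h1
    exact sign_eq_neg_one_iff.1 h1
  have hpos : 0 < φ p₀ (x₁ + ε) := by
    have h1 := hball (y := x₁ + ε) (by
      rw [Real.dist_eq, add_sub_cancel_left, abs_of_pos hε]; exact hεε')
    rw [add_sub_cancel_left, sign_pos hε] at h1
    exact sign_eq_one_iff.1 h1
  have hφp : ∀ x, Continuous fun p => φ p x := fun x =>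
    Complex.continuous_re.comp (continuous_den _ _)
  -- The sign change at p₀ is an open condition in p, so every p in a neighbourhood of p₀ has a root
  -- r(p) near x₁.
  set U : Set (ℝ × ℝ) := {p | φ p (x₁ - ε) < 0 ∧ 0 < φ p (x₁ + ε)} with hU
  have hUn : U ∈ 𝓝 p₀ :=
    (((hφp _).tendsto p₀).eventually_lt_const hneg).and
      (((hφp _).tendsto p₀).eventually_const_lt hpos)
  have hroot : ∀ p, ∃ r : ℝ, p ∈ U → r ∈ Set.Icc (x₁ - ε) (x₁ + ε) ∧
      den (stieltjes F r) (g r) p = 0 := by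
    intro p
    by_cases hp : p ∈ U
    · have hcont : ContinuousOn (φ p) (Set.Icc (x₁ - ε) (x₁ + ε)) := by
        intro x hx
        have h1 := hcm _ (hmemr x hx)
        have h2 := hcg _ (hmemr x hx)
        have h3 : ContinuousAt (fun z => (den (stieltjes F z) (g z) p).re) (x : ℂ) := by
          unfold den
          fun_prop
        exact (ContinuousAt.comp (f := fun x : ℝ => (x : ℂ)) h3
          Complex.continuous_ofReal.continuousAt).continuousWithinAt
      obtain ⟨r, hr, hr0⟩ := intermediate_value_Icc (by linarith) hcont ⟨hp.1.le, hp.2.le⟩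
      refine ⟨r, fun _ => ⟨hr, Complex.ext hr0 ?_⟩⟩
      rw [im_den (g r, stieltjes F r) p]
      simp [hgr r (hmemr r hr), stieltjes_im_ofReal]
    · exact ⟨0, fun h => absurd h hp⟩
  choose r hr using hroot
  set M := K * (L + (ρ ^ 2)⁻¹) * 2 with hM
  have hM0 : 0 ≤ M := by positivity
  -- If r(p) is within η of x, the Lipschitz bounds make the denominator at x + iη at most Mη;
  -- Chebyshev gives mass O(η²), and the covering lemma mass 0. As t > 0 almost everywhere, `U` is
  -- then H-null, against p₀ in the support.
  have hzero : (H.withDensity fun p => ENNReal.ofReal p.2) (U ∩ H.support) = 0 := by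
    refine measure_eq_zero_of_sq_le _ (r := r) (a := x₁ - ε) (b := x₁ + ε) (C := M ^ 2 * C)
      (η₀ := ε) (by linarith) hε (fun p hp => (hr p hp.1).1) fun η hη hηε x hx => ?_
    have hz : (x + η * Complex.I : ℂ) ∈ Metric.ball (x₀ : ℂ) ρ :=
      add_mul_I_mem_ball (abs_le.2 ⟨by linarith [hx.1], by linarith [hx.2]⟩) hη.le hηε hερ
    set z : ℂ := x + η * Complex.I with hzdef
    have hzi : 0 < z.im := by simpa [hzdef] using hη
    have hreg := (hg z hzi).regular hA hzi
    have h1 := withDensity_le_of_norm_den_le hA hreg (D := M * η)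
      (hCb z (hsub hz) hzi)
    rw [show (M * η) ^ 2 * C = M ^ 2 * C * η ^ 2 by ring] at h1
    refine (measure_mono ?_).trans h1
    rintro p ⟨⟨hpU, hps⟩, hpr⟩
    refine ⟨hps, ?_⟩
    obtain ⟨hrI, hr0⟩ := hr p hpU
    have hrb := hmemr _ hrI
    simp only
    have e : den (stieltjes F z) (g z) p = (p.1 : ℂ) * (g z - g (r p)) +
        (p.2 : ℂ) * (stieltjes F z - stieltjes F (r p)) := by
      have : den (stieltjes F z) (g z) p = den (stieltjes F z) (g z) p -
          den (stieltjes F (r p)) (g (r p)) p := by rw [hr0, sub_zero]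
      rw [this]
      simp only [den]
      ring
    have hzr : ‖z - (r p : ℂ)‖ ≤ 2 * η := by
      have : z - (r p : ℂ) = ((x - r p : ℝ) : ℂ) + (η : ℂ) * Complex.I := by
        rw [hzdef]; push_cast; ring
      rw [this]
      refine (norm_add_le _ _).trans ?_
      rw [norm_mul, Complex.norm_I, mul_one, Complex.norm_real, Complex.norm_real,
        Real.norm_eq_abs, Real.norm_eq_abs, abs_of_pos hη, abs_sub_comm]
      linarith
    rw [e]
    refine (norm_add_le _ _).trans ?_
    rw [norm_mul, norm_mul, Complex.norm_real, Complex.norm_real, Real.norm_eq_abs,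
      Real.norm_eq_abs, abs_of_nonneg (hA.nonneg p hps).1, abs_of_nonneg (hA.nonneg p hps).2]
    have h2 := hgL z hz hzi.le (r p) hrb (by simp)
    have h3 := gap_lipschitz hρ hgap (hsub hz) (hsub hrb)
    have h4 : p.1 * ‖g z - g (r p)‖ ≤ K * (L * (2 * η)) :=
      mul_le_mul (hKb p hps).1 (h2.trans (by gcongr)) (norm_nonneg _) hK.le
    have h5 : p.2 * ‖stieltjes F z - stieltjes F (r p)‖ ≤ K * ((ρ ^ 2)⁻¹ * (2 * η)) :=
      mul_le_mul (hKb p hps).2 (h3.trans (by gcongr)) (norm_nonneg _) hK.le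
    rw [hM]
    linarith
  rw [withDensity_apply_eq_zero' (by fun_prop)] at hzero
  refine absurd hp₀ (Measure.notMem_support_iff_exists.2 ⟨U, hUn, ?_⟩)
  rw [measure_eq_zero_iff_ae_notMem] at hzero ⊢
  filter_upwards [hzero, hA.pos, H.support_mem_ae] with p h1 h2 h3 h4
  exact h1 ⟨by simpa using h2, h4, h3⟩

end GapRegular

/-! ### The direct part of the theorem -/

section GapTheorem

variable {c : ℝ} {H : Measure (ℝ × ℝ)} [IsProbabilityMeasure H] {F : Measure ℝ}
  [IsProbabilityMeasure F]

lemma Solves.of_tendsto (hA : Admissible H) {α : Type*} {l : Filter α} [l.NeBot] {zs : α → ℂ}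
    {qs : α → ℂ × ℂ} {z : ℂ} {q : ℂ × ℂ} (hz : Tendsto zs l (𝓝 z)) (hq : Tendsto qs l (𝓝 q))
    (hr : Regular H q) (hg : q.1 ≠ 0)
    (h : ∀ᶠ a in l, Solves c H (zs a) (qs a).2 (qs a).1) : Solves c H z q.2 q.1 := by
  have h1 : Tendsto (fun a => (qs a).1) l (𝓝 q.1) := (continuous_fst.tendsto q).comp hq
  have h2 : Tendsto (fun a => (qs a).2) l (𝓝 q.2) := (continuous_snd.tendsto q).comp hq
  have hm : ∀ i j, Tendsto (fun a => mom H i j (qs a)) l (𝓝 (mom H i j q)) := fun i j =>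
    (continuousAt_mom hA i j hr).tendsto.comp hq
  have he : ∀ᶠ a in l, zs a = -1 / (qs a).1 + c * mom H 0 1 (qs a) ∧
      c * (qs a).1 ^ 2 * mom H 1 0 (qs a) + (qs a).2 - (qs a).1 = 0 := by
    filter_upwards [h, hq.eventually (hr.eventually hA)] with a ha har
    exact (solves_iff hA har ha.1).1 ha
  refine (solves_iff hA hr hg).2 ⟨?_, ?_⟩
  · refine tendsto_nhds_unique (hz.congr' (he.mono fun a ha => ha.1)) ?_
    exact (tendsto_const_nhds.div h1 hg).add ((hm 0 1).const_mul _)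
  · refine tendsto_nhds_unique ?_ (tendsto_const_nhds.congr' (he.mono fun a ha => ha.2.symm))
    exact ((((h1.pow 2).const_mul _).mul (hm 1 0)).add h2).sub h1

lemma continuousAt_V₀ (hA : Admissible H) {q : ℂ × ℂ} (hr : Regular H q) (hg : q.1 ≠ 0) :
    ContinuousAt (fun q : ℂ × ℂ => V₀ c H q.2 q.1) q := by
  unfold V₀
  refine ContinuousAt.sub ?_ (continuousAt_const.mul (continuousAt_quad hA 1 1 hr))
  exact ContinuousAt.inv₀ (by fun_prop) (by simpa using hg)

lemma continuousAt_V (hA : Admissible H) {q : ℂ × ℂ} (hr : Regular H q) (hg : q.1 ≠ 0)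
    (hV : V₀ c H q.2 q.1 ≠ 0) : ContinuousAt (fun q : ℂ × ℂ => V c H q.2 q.1) q := by
  unfold V
  exact ((((continuousAt_const.mul (continuousAt_quad hA 1 0 hr)).mul
    (continuousAt_quad hA 0 2 hr)).div (continuousAt_V₀ hA hr hg) hV).add
    (continuousAt_const.mul (continuousAt_quad hA 0 1 hr)))

/-- Elimination of Im g from the two imaginary part identities; V is what multiplies Im m
afterwards. -/
lemma IsCoSolution.sub_V_eq (hA : Admissible H) (hc : 0 ≤ c) {z g : ℂ} (hz : 0 < z.im)
    (h : IsCoSolution c H F z g) :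
    (stieltjes F z).im * (z.re - V c H (stieltjes F z) g) =
      z.im * (c * quad H 1 0 (stieltjes F z) g / V₀ c H (stieltjes F z) g - (stieltjes F z).re) := by
  have h1 := h.im_mul hA hz
  have h2 := h.im_mul_V₀ hA hz
  have hV := h.V₀_pos hA hc hz
  rw [Complex.mul_im] at h1
  rw [V]
  generalize V₀ c H (stieltjes F z) g = v at *
  generalize quad H 1 0 (stieltjes F z) g = a at *
  generalize quad H 0 2 (stieltjes F z) g = b at *
  generalize quad H 0 1 (stieltjes F z) g = d at *
  generalize (stieltjes F z).im = y at *
  generalize (stieltjes F z).re = x at *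
  field_simp
  linear_combination v * h1 + c * a * h2

/-- The behaviour of the co-solution in a gap of the support of `F`. -/
theorem gap_theorem (hA : Admissible H) (hc : 0 < c) (hc1 : c ≤ 1)
    (hex : ∀ z : ℂ, 0 < z.im → ∃ g, IsCoSolution c H F z g) {x₀ : ℝ} (h0 : 0 < x₀)
    (hx₀ : x₀ ∉ F.support) :
    ∃ (ε : ℝ) (g : ℂ → ℂ), 0 < ε ∧ (∀ z : ℂ, 0 < z.im → IsCoSolution c H F z (g z)) ∧
      AnalyticOnNhd ℂ (stieltjes F) (Metric.ball (x₀ : ℂ) ε) ∧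
      AnalyticOnNhd ℂ g (Metric.ball (x₀ : ℂ) ε) ∧
      (∀ x : ℝ, 0 < x → (x : ℂ) ∈ Metric.ball (x₀ : ℂ) ε →
        (stieltjes F x).im = 0 ∧ (g x).im = 0 ∧
        IsExtendedSolution c H F x (stieltjes F x) (g x) ∧
        Solves c H x (stieltjes F x) (g x) ∧
        (∫⁻ p : ℝ × ℝ, ENNReal.ofReal p.1 / ENNReal.ofReal p.2 ∂H ≤ ENNReal.ofReal (1 / c) →
          stieltjes F x ≠ 0) ∧
        VDefined c H (stieltjes F x) (g x) ∧
        V c H (stieltjes F x) (g x) < x) ∧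
      (∀ p ∈ H.support, den (stieltjes F x₀) (g x₀) p ≠ 0) := by
  choose! γ hγ using hex
  obtain ⟨ρ, hρ, hρx, hgap⟩ := exists_gap h0 hx₀
  have hsub := Metric.ball_subset_closedBall (x := (x₀ : ℂ)) (ε := ρ)
  obtain ⟨κ, L, hκ, hL, hκV, hLip⟩ := exists_lipschitz hA hc hc1 h0 hρ hρx hgap hγ
  obtain ⟨C, hC, hCi⟩ := exists_im_le hA hc hc1 h0 hρ hρx hgap hγ
  obtain ⟨g, hgγ, hgA, hgr, L', hL', hgL⟩ := exists_reflection (f := γ) (x₀ := x₀) (ρ := ρ)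
    (C := C) hL.le
    (fun z _ hz0 => differentiableAt_coSolution hA hc.le hγ hz0)
    (fun z hz hz0 z' hz' hz0' => hLip z (hsub hz) hz0 z' (hsub hz') hz0')
    (fun z hz hz0 => by
      rw [abs_of_pos (hγ z hz0).1]
      exact hCi z (hsub hz) hz0)
  have hg : ∀ z : ℂ, 0 < z.im → IsCoSolution c H F z (g z) := fun z hz => by
    rw [hgγ z hz]
    exact hγ z hz
  have hreg : ∀ x : ℝ, (x : ℂ) ∈ Metric.ball (x₀ : ℂ) ρ → Regular H (g x, stieltjes F x) :=
    fun x hx => regular_of_gap hA hc h0 hρ hgap hg hgA hgr hL' hgL hx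
  have hmA : DifferentiableOn ℂ (stieltjes F) (Metric.ball (x₀ : ℂ) ρ) := fun z hz =>
    (gap_differentiableAt hρ hgap (hsub hz)).differentiableWithinAt
  refine ⟨ρ, g, hρ, hg, hmA.analyticOnNhd Metric.isOpen_ball, hgA, ?_,
    hreg x₀ (Metric.mem_ball_self hρ)⟩
  intro x hx hxb
  have hr := hreg x hxb
  have hcq : ContinuousAt (fun z => (g z, stieltjes F z)) (x : ℂ) :=
    (hgA _ hxb).continuousAt.prodMk (gap_differentiableAt hρ hgap (hsub hxb)).continuousAt
  have hpath : Tendsto (fun ε : ℝ => (x + ε * Complex.I : ℂ)) (𝓝[>] 0) (𝓝 (x : ℂ)) :=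
    tendsto_add_mul_I x
  have hqpath : Tendsto (fun ε : ℝ => (g (x + ε * Complex.I), stieltjes F (x + ε * Complex.I)))
      (𝓝[>] 0) (𝓝 (g x, stieltjes F x)) := hcq.tendsto.comp hpath
  have him : ∀ ε : ℝ, (x + ε * Complex.I : ℂ).im = ε := fun ε => by simp
  have hre : ∀ ε : ℝ, (x + ε * Complex.I : ℂ).re = x := fun ε => by simp
  have hpos : ∀ᶠ ε : ℝ in 𝓝[>] 0, 0 < (x + ε * Complex.I : ℂ).im ∧
      (x + ε * Complex.I : ℂ) ∈ Metric.ball (x₀ : ℂ) ρ := by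
    filter_upwards [self_mem_nhdsWithin, hpath.eventually (Metric.isOpen_ball.mem_nhds hxb)]
      with ε (hε : 0 < ε) h2
    exact ⟨by rw [him]; exact hε, h2⟩
  obtain ⟨b, hb, hbl⟩ := exists_le_norm hA hc h0 hρ hgap hg
  have hg0 : g x ≠ 0 := by
    have h1 : Tendsto (fun ε : ℝ => ‖g (x + ε * Complex.I)‖) (𝓝[>] 0) (𝓝 ‖g x‖) :=
      ((hgA _ hxb).continuousAt.tendsto.comp hpath).norm
    have h2 : b ≤ ‖g x‖ := ge_of_tendsto h1 (by
      filter_upwards [hpos] with ε hε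
      exact hbl _ (hsub hε.2) hε.1)
    exact norm_pos_iff.1 (hb.trans_le h2)
  have hsol : Solves c H x (stieltjes F x) (g x) :=
    Solves.of_tendsto (q := (g x, stieltjes F x)) hA hpath hqpath hr hg0
      (hpos.mono fun ε hε => (hg _ hε.1).2)
  have hVc := continuousAt_V₀ (c := c) hA hr hg0
  have hV : κ ≤ V₀ c H (stieltjes F x) (g x) := by
    refine ge_of_tendsto (hVc.tendsto.comp hqpath) ?_
    filter_upwards [hpos] with ε hε
    have := hκV _ (hsub hε.2) hε.1
    rw [← hgγ _ hε.1] at this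
    exact this
  have hV0 : 0 < V₀ c H (stieltjes F x) (g x) := hκ.trans_le hV
  have hgi := hgr x hxb
  have hmi := stieltjes_im_ofReal (F := F) x
  refine ⟨hmi, hgi, ?_, hsol, ?_, ⟨?_, ?_, ?_, ?_, hV0⟩, ?_⟩
  · obtain ⟨u, -, hu0, hu⟩ := exists_seq_strictAnti_tendsto' (show (0 : ℝ) < 1 by norm_num)
    have hu' : Tendsto u atTop (𝓝[>] 0) :=
      tendsto_nhdsWithin_iff.2 ⟨hu, Eventually.of_forall fun n => (hu0 n).1⟩
    refine ⟨fun n => x + u n * Complex.I, fun n => g (x + u n * Complex.I), fun n => ?_,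
      hpath.comp hu', ?_, ?_⟩
    · have : 0 < (x + u n * Complex.I : ℂ).im := by rw [him]; exact (hu0 n).1
      exact ⟨this, hg _ this⟩
    · exact ((gap_differentiableAt hρ hgap (hsub hxb)).continuousAt.tendsto.comp hpath).comp hu'
    · exact ((hgA _ hxb).continuousAt.tendsto.comp hpath).comp hu'
  all_goals
    obtain ⟨mr, hmr⟩ : ∃ mr : ℝ, stieltjes F x = mr :=
      ⟨(stieltjes F x).re, Complex.ext rfl (by simpa using hmi)⟩
    obtain ⟨gr, hgr'⟩ : ∃ gr : ℝ, g x = gr := ⟨(g x).re, Complex.ext rfl (by simpa using hgi)⟩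
  · intro hst
    rw [hmr, hgr'] at hr hsol hV0
    rw [hmr]
    exact_mod_cast hsol.ne_zero_of_real hA hc hr hV0 hst
  · exact integrable_kern (q := (g x, stieltjes F x)) hA 1 0 hr
  · exact integrable_kern (q := (g x, stieltjes F x)) hA 1 1 hr
  · exact integrable_kern (q := (g x, stieltjes F x)) hA 0 1 hr
  · exact integrable_kern (q := (g x, stieltjes F x)) hA 0 2 hr
  · have hΛ : 0 < c * quad H 1 0 (stieltjes F x) (g x) / V₀ c H (stieltjes F x) (g x) -
        (stieltjes F x).re := by
      rw [sub_pos, lt_div_iff₀ hV0]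
      rw [hmr, hgr'] at hr hsol hV0 ⊢
      rw [Complex.ofReal_re]
      exact hsol.lt_of_real hA hc hc1 hx hr hV0
    have hΛc : ContinuousAt (fun q : ℂ × ℂ => c * quad H 1 0 q.2 q.1 / V₀ c H q.2 q.1 - q.2.re)
        (g x, stieltjes F x) :=
      ((continuousAt_const.mul (continuousAt_quad hA 1 0 hr)).div hVc hV0.ne').sub (by fun_prop)
    have hVV := (continuousAt_V (c := c) hA hr hg0 hV0.ne').tendsto.comp hqpath
    have hlim := hΛc.tendsto.comp hqpath
    -- Division of `IsCoSolution.sub_V_eq` by Im m, with Im z ≥ ρ² Im m, leaves a definite margin,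
    -- so strictness survives the limit to the real point.
    have hle : V c H (stieltjes F x) (g x) ≤ x - ρ ^ 2 *
        (c * quad H 1 0 (stieltjes F x) (g x) / V₀ c H (stieltjes F x) (g x) -
        (stieltjes F x).re) := by
      refine le_of_tendsto_of_tendsto hVV ((hlim.const_mul (ρ ^ 2)).const_sub x) ?_
      filter_upwards [hpos, hlim.eventually_const_lt hΛ] with ε hε hΛε
      have h1 := (hg _ hε.1).sub_V_eq hA hc.le hε.1
      have h2 := gap_im_le hρ hgap (hsub hε.2) hε.1.le
      have h3 := im_stieltjes_pos (F := F) hε.1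
      simp only [Function.comp] at hΛε ⊢
      rw [hre] at h1
      generalize hw : (x + ε * Complex.I : ℂ) = w at *
      rw [inv_mul_eq_div, le_div_iff₀ (by positivity)] at h2
      generalize c * quad H 1 0 (stieltjes F w) (g w) / V₀ c H (stieltjes F w) (g w) -
        (stieltjes F w).re = Λ at *
      generalize V c H (stieltjes F w) (g w) = v at *
      generalize (stieltjes F w).im = y at *
      have h4 : y * (ρ ^ 2 * Λ) ≤ y * (x - v) := by
        rw [h1]
        calc y * (ρ ^ 2 * Λ) = y * ρ ^ 2 * Λ := by ring
          _ ≤ w.im * Λ := mul_le_mul_of_nonneg_right h2 hΛε.le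
      have := le_of_mul_le_mul_left h4 h3
      linarith
    have := mul_pos (pow_pos hρ 2) hΛ
    linarith

end GapTheorem


/-! ### An analytic implicit function theorem from divided differences -/

section Implicit

lemma hasStrictFDerivAt_of_divided {f : ℂ × ℂ → ℂ} {a b : (ℂ × ℂ) × (ℂ × ℂ) → ℂ}
    {U : Set (ℂ × ℂ)} {u : ℂ × ℂ} (hU : IsOpen U) (hu : u ∈ U)
    (hf : ∀ q ∈ U, ∀ q' ∈ U, f q - f q' = a (q, q') * (q.1 - q'.1) + b (q, q') * (q.2 - q'.2))
    (ha : ContinuousAt a (u, u)) (hb : ContinuousAt b (u, u)) :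
    HasStrictFDerivAt f (a (u, u) • ContinuousLinearMap.fst ℂ ℂ ℂ +
      b (u, u) • ContinuousLinearMap.snd ℂ ℂ ℂ) u := by
  rw [hasStrictFDerivAt_iff_isLittleO, Asymptotics.isLittleO_iff]
  intro ε hε
  have h1 := (Metric.continuousAt_iff'.1 ha) (ε / 2) (half_pos hε)
  have h2 := (Metric.continuousAt_iff'.1 hb) (ε / 2) (half_pos hε)
  have h3 : ∀ᶠ p : (ℂ × ℂ) × (ℂ × ℂ) in 𝓝 (u, u), p.1 ∈ U ∧ p.2 ∈ U :=
    prod_mem_nhds (hU.mem_nhds hu) (hU.mem_nhds hu)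
  filter_upwards [h1, h2, h3] with p h1 h2 h3
  rw [dist_eq_norm] at h1 h2
  rw [hf p.1 h3.1 p.2 h3.2]
  have e : a (p.1, p.2) * (p.1.1 - p.2.1) + b (p.1, p.2) * (p.1.2 - p.2.2) -
      (a (u, u) • ContinuousLinearMap.fst ℂ ℂ ℂ +
        b (u, u) • ContinuousLinearMap.snd ℂ ℂ ℂ) (p.1 - p.2) =
      (a p - a (u, u)) * (p.1 - p.2).1 + (b p - b (u, u)) * (p.1 - p.2).2 := by
    simp
    ring
  rw [e]
  refine (norm_add_le _ _).trans ?_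
  rw [norm_mul, norm_mul]
  have h4 := mul_le_mul h1.le (norm_fst_le (p.1 - p.2)) (norm_nonneg _) (half_pos hε).le
  have h5 := mul_le_mul h2.le (norm_snd_le (p.1 - p.2)) (norm_nonneg _) (half_pos hε).le
  linarith

/-- An analytic implicit function theorem for functions with continuous divided differences. -/
lemma exists_analyticAt_implicit {f : ℂ × ℂ → ℂ} {a b : (ℂ × ℂ) × (ℂ × ℂ) → ℂ} {U : Set (ℂ × ℂ)}
    {u : ℂ × ℂ} (hU : IsOpen U) (hu : u ∈ U)
    (hf : ∀ q ∈ U, ∀ q' ∈ U, f q - f q' = a (q, q') * (q.1 - q'.1) + b (q, q') * (q.2 - q'.2))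
    (ha : ∀ q ∈ U, ∀ q' ∈ U, ContinuousAt a (q, q'))
    (hb : ∀ q ∈ U, ∀ q' ∈ U, ContinuousAt b (q, q')) (hb0 : b (u, u) ≠ 0) (hfu : f u = 0) :
    ∃ ψ : ℂ → ℂ, AnalyticAt ℂ ψ u.1 ∧ ψ u.1 = u.2 ∧ ∀ᶠ q in 𝓝 u, f q = 0 ↔ q.2 = ψ q.1 := by
  set f' : ℂ × ℂ →L[ℂ] ℂ := a (u, u) • ContinuousLinearMap.fst ℂ ℂ ℂ +
    b (u, u) • ContinuousLinearMap.snd ℂ ℂ ℂ with hf'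
  have hstrict : HasStrictFDerivAt f f' u :=
    hasStrictFDerivAt_of_divided hU hu hf (ha u hu u hu) (hb u hu u hu)
  have hinv : (f' ∘L .inr ℂ ℂ ℂ).IsInvertible := by
    refine ⟨ContinuousLinearEquiv.unitsEquivAut ℂ (Units.mk0 _ hb0), ?_⟩
    ext
    simp [hf']
  set ψ := hstrict.implicitFunctionOfProdDomain hinv with hψ
  have hiff : ∀ᶠ q in 𝓝 u, f q = 0 ↔ q.2 = ψ q.1 := by
    filter_upwards [hstrict.eventually_apply_eq_iff_implicitFunctionOfProdDomain hinv] with q hq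
    rw [hfu] at hq
    exact hq.trans eq_comm
  have hψu : ψ u.1 = u.2 := ((hiff.self_of_nhds).1 hfu).symm
  have hψt : Tendsto (fun w => (w, ψ w)) (𝓝 u.1) (𝓝 u) :=
    tendsto_id.prodMk_nhds (hstrict.tendsto_implicitFunctionOfProdDomain hinv)
  refine ⟨ψ, ?_, hψu, hiff⟩
  have hquot : ∀ q ∈ U, ∀ q' ∈ U, b (q, q') ≠ 0 →
      ContinuousAt (fun p => a p / b p) (q, q') := fun q hq q' hq' h0 =>
    (ha q hq q' hq').div (hb q hq q' hq') h0
  set C := ‖a (u, u) / b (u, u)‖ + 1 with hC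
  have hP : ∀ᶠ p : (ℂ × ℂ) × (ℂ × ℂ) in 𝓝 (u, u),
      p.1 ∈ U ∧ p.2 ∈ U ∧ b p ≠ 0 ∧ ‖a p / b p‖ < C := by
    have h1 : ∀ᶠ p : (ℂ × ℂ) × (ℂ × ℂ) in 𝓝 (u, u), p.1 ∈ U ∧ p.2 ∈ U :=
      prod_mem_nhds (hU.mem_nhds hu) (hU.mem_nhds hu)
    filter_upwards [h1, (hb u hu u hu).eventually_ne hb0,
      (hquot u hu u hu hb0).norm.tendsto.eventually_lt_const (lt_add_one _)] with p h1 h2 h3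
    exact ⟨h1.1, h1.2, h2, h3⟩
  have hQ : ∀ᶠ w : ℂ × ℂ in 𝓝 (u.1, u.1), (w.1, ψ w.1) ∈ U ∧ (w.2, ψ w.2) ∈ U ∧
      b ((w.1, ψ w.1), (w.2, ψ w.2)) ≠ 0 ∧
      ‖a ((w.1, ψ w.1), (w.2, ψ w.2)) / b ((w.1, ψ w.1), (w.2, ψ w.2))‖ < C ∧
      f (w.1, ψ w.1) = 0 ∧ f (w.2, ψ w.2) = 0 := by
    have t1 : Tendsto (fun w : ℂ × ℂ => (w.1, ψ w.1)) (𝓝 (u.1, u.1)) (𝓝 u) :=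
      hψt.comp (continuous_fst.tendsto (u.1, u.1))
    have t2 : Tendsto (fun w : ℂ × ℂ => (w.2, ψ w.2)) (𝓝 (u.1, u.1)) (𝓝 u) :=
      hψt.comp (continuous_snd.tendsto (u.1, u.1))
    filter_upwards [(t1.prodMk_nhds t2).eventually hP, t1.eventually hiff, t2.eventually hiff]
      with w h1 h2 h3
    exact ⟨h1.1, h1.2.1, h1.2.2.1, h1.2.2.2, h2.2 rfl, h3.2 rfl⟩
  -- The implicit function theorem controls ψ at the base point only. The divided differences
  -- express ψ w - ψ v as -(a/b)(w - v) for all nearby v, which gives continuity first (a/b is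
  -- bounded by C) and then the derivative.
  rw [Complex.analyticAt_iff_eventually_differentiableAt]
  have hdiag : Tendsto (fun w : ℂ => (w, w)) (𝓝 u.1) (𝓝 (u.1, u.1)) :=
    tendsto_id.prodMk_nhds tendsto_id
  filter_upwards [hdiag.eventually hQ.eventually_nhds] with v hv
  have hv0 := hv.self_of_nhds
  have hslice : Tendsto (fun w : ℂ => (w, v)) (𝓝 v) (𝓝 (v, v)) :=
    tendsto_id.prodMk_nhds tendsto_const_nhds
  have hvw := hslice.eventually hv
  have hdd : ∀ᶠ w in 𝓝 v, ψ w - ψ v =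
      -(a ((w, ψ w), (v, ψ v)) / b ((w, ψ w), (v, ψ v))) * (w - v) := by
    filter_upwards [hvw] with w ⟨h1, h2, h3, _, h4, h5⟩
    have h6 := hf _ h1 _ h2
    simp only at h3 h4 h5 h6
    rw [h4, h5] at h6
    field_simp
    linear_combination -h6
  have hcont : ContinuousAt ψ v := by
    rw [ContinuousAt, tendsto_iff_norm_sub_tendsto_zero]
    have h0 : Tendsto (fun w => C * ‖w - v‖) (𝓝 v) (𝓝 0) := by
      have : Continuous fun w => C * ‖w - v‖ := by fun_prop
      simpa using this.tendsto v
    refine squeeze_zero' (Eventually.of_forall fun w => norm_nonneg _) ?_ h0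
    filter_upwards [hdd, hvw] with w h1 h2
    rw [h1, norm_mul, norm_neg]
    exact mul_le_mul_of_nonneg_right h2.2.2.2.1.le (norm_nonneg _)
  have hder : HasDerivAt ψ (-(a ((v, ψ v), (v, ψ v)) / b ((v, ψ v), (v, ψ v)))) v := by
    rw [hasDerivAt_iff_tendsto_slope]
    have h1 : Tendsto (fun w => (((w, ψ w) : ℂ × ℂ), ((v, ψ v) : ℂ × ℂ))) (𝓝 v)
        (𝓝 ((v, ψ v), (v, ψ v))) :=
      (tendsto_id.prodMk_nhds hcont).prodMk_nhds tendsto_const_nhds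
    have h2 := ((hquot _ hv0.1 _ hv0.2.1 hv0.2.2.1).tendsto.comp h1).neg
    refine (h2.mono_left nhdsWithin_le_nhds).congr' ?_
    filter_upwards [nhdsWithin_le_nhds hdd, self_mem_nhdsWithin] with w h3 (h4 : w ≠ v)
    rw [slope_def_field, h3, mul_div_cancel_right₀ _ (sub_ne_zero.2 h4)]
    rfl
  exact hder.differentiableAt

end Implicit

/-! ### Mass of short intervals and the Stieltjes transform -/

section Support

variable {F : Measure ℝ} [IsProbabilityMeasure F]

/-- On |l - x| ≤ η the Poisson kernel η/((l-x)² + η²) is at least 1/(2η). -/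
lemma measure_abs_sub_le (x : ℝ) {η : ℝ} (hη : 0 < η) :
    F {l | |l - x| ≤ η} ≤ ENNReal.ofReal (2 * η * (stieltjes F (x + η * Complex.I)).im) := by
  set z : ℂ := x + η * Complex.I with hz
  have hzi : z.im = η := by simp [hz]
  have hzr : z.re = x := by simp [hz]
  have hint := integrable_inv_ofReal_sub (F := F) (z := z) (by rw [hzi]; exact hη)
  have hm : MeasurableSet {l : ℝ | |l - x| ≤ η} :=
    measurableSet_le (by fun_prop) measurable_const
  have hpt : ∀ l : ℝ, (((l : ℂ) - z)⁻¹).im = η / ((l - x) ^ 2 + η ^ 2) := by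
    intro l
    rw [Complex.inv_im, Complex.normSq_apply]
    simp [hzi, hzr]
    ring
  rw [← ofReal_measureReal]
  refine ENNReal.ofReal_le_ofReal ?_
  rw [stieltjes, im_integral hint, ← integral_const_mul, ← integral_indicator_one hm]
  refine integral_mono ((integrable_const (1 : ℝ)).indicator hm) (hint.im.const_mul _) fun l => ?_
  simp only [hpt, Set.indicator_apply, Set.mem_ofPred_eq]
  split_ifs with h
  · have : (l - x) ^ 2 ≤ η ^ 2 := sq_le_sq' (by linarith [(abs_le.1 h).1]) (abs_le.1 h).2
    rw [mul_div_assoc', le_div_iff₀ (by positivity), Pi.one_apply]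
    nlinarith
  · positivity

lemma notMem_support_of_im_le {x₀ r K : ℝ} (hr : 0 < r)
    (h : ∀ x η : ℝ, |x - x₀| < r → 0 < η → η < r →
      (stieltjes F (x + η * Complex.I)).im ≤ K * η) : x₀ ∉ F.support := by
  refine Measure.notMem_support_iff_exists.2
    ⟨Set.Icc (x₀ - r / 2) (x₀ + r / 2), Icc_mem_nhds (by linarith) (by linarith), ?_⟩
  refine measure_eq_zero_of_sq_le F (r := id) (a := x₀ - r / 2) (b := x₀ + r / 2) (C := 2 * K)
    (η₀ := r) (by linarith) hr (fun p hp => hp) fun η hη hηr x hx => ?_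
  refine (measure_mono fun p hp => hp.2).trans ((measure_abs_sub_le x hη).trans
    (ENNReal.ofReal_le_ofReal ?_))
  have h1 := h x η (abs_lt.2 ⟨by linarith [hx.1], by linarith [hx.2]⟩) hη hηr
  calc 2 * η * (stieltjes F (x + η * Complex.I)).im ≤ 2 * η * (K * η) :=
        mul_le_mul_of_nonneg_left h1 (by positivity)
    _ = 2 * K * η ^ 2 := by ring

end Support


/-! ### Positivity of V₀ at extended solutions -/

section ExtendedSolution

variable {c : ℝ} {H : Measure (ℝ × ℝ)} [IsProbabilityMeasure H] {F : Measure ℝ}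
  [IsProbabilityMeasure F] {z : ℂ} {q : ℂ × ℂ} {zs gs : ℕ → ℂ}

/-- The second equation in the form g(z - c ∫ t/den) = -1 passes to the limit, where g = 0 is
impossible. -/
lemma ne_zero_of_tendsto_coSolution (hA : Admissible H)
    (hs : ∀ k, 0 < (zs k).im ∧ IsCoSolution c H F (zs k) (gs k)) (hz : Tendsto zs atTop (𝓝 z))
    (hq : Tendsto (fun k => (gs k, stieltjes F (zs k))) atTop (𝓝 q)) (hr : Regular H q) :
    q.1 ≠ 0 := by
  intro h0
  have hg : Tendsto gs atTop (𝓝 q.1) := (continuous_fst.tendsto q).comp hq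
  have hm := (continuousAt_mom hA 0 1 hr).tendsto.comp hq
  have h1 := hg.mul (hz.sub (hm.const_mul (c : ℂ)))
  rw [h0, zero_mul] at h1
  have h2 : ∀ k, gs k * (zs k - c * (mom H 0 1 ∘ fun k => (gs k, stieltjes F (zs k))) k) = -1 := by
    intro k
    have h3 := Solves.eq_right (q := (gs k, stieltjes F (zs k))) (hs k).2.2
    have h4 := (hs k).2.2.1
    simp only [Function.comp] at h3 ⊢
    have h5 : zs k - c * mom H 0 1 (gs k, stieltjes F (zs k)) = -1 / gs k := by
      linear_combination h3
    rw [h5]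
    field_simp
  have h6 := tendsto_nhds_unique h1 (tendsto_const_nhds.congr fun k => (h2 k).symm)
  norm_num at h6

lemma quad_zero_two_pos (hA : Admissible H) (hr : Regular H q) : 0 < quad H 0 2 q.2 q.1 := by
  refine (quad_nonneg hA 0 2 _ _).lt_of_ne fun h0 => ?_
  have h1 : 0 ≤ᵐ[H] kern 0 2 q.2 q.1 := ae_of_all _ fun p => by
    simp only [kern, Pi.zero_apply]
    positivity
  have h2 := (integral_eq_zero_iff_of_nonneg_ae h1 (integrable_kern hA 0 2 hr)).1 h0.symm
  have h3 : ∀ᵐ p ∂H, False := by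
    filter_upwards [h2, hA.pos, H.support_mem_ae] with p h4 h5 h6
    have h7 := norm_pos_iff.2 (hr p h6)
    have : 0 < kern 0 2 q.2 q.1 p := by
      unfold kern
      positivity
    exact absurd h4 this.ne'
  exact h3.exists.elim fun _ h => h

lemma quad_one_one_eq_zero (hA : Admissible H) (hr : Regular H q) (hA1 : quad H 1 0 q.2 q.1 = 0) :
    quad H 1 1 q.2 q.1 = 0 := by
  have h1 : 0 ≤ᵐ[H] kern 1 0 q.2 q.1 := by
    filter_upwards [H.support_mem_ae] with p hp
    have := (hA.nonneg p hp).1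
    simp only [kern, Pi.zero_apply]
    positivity
  have h2 := (integral_eq_zero_iff_of_nonneg_ae h1 (integrable_kern hA 1 0 hr)).1 hA1
  refine integral_eq_zero_of_ae ?_
  filter_upwards [h2] with p h3
  have : kern 1 1 q.2 q.1 p = p.2 * kern 1 0 q.2 q.1 p := by
    simp only [kern]
    ring
  rw [this, h3]
  simp

/-- Here v, γ, μ stand for Im z, Im g, Im m; ξ, ν for Re z, Re m; a, b, b₂ for A₁, B₁, B₂; and V for
V₀. If V₀ tends to 0, the second identity makes Im z and Im m negligible against Im g, and the
first, divided by Im g, leaves cA₁ → 0. -/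
lemma eq_zero_of_tendsto_of_im_identities {v γ μ ξ ν a b b₂ V : ℕ → ℝ} {A B B₂ X N : ℝ} (hc : 0 < c)
    (hv : ∀ k, 0 < v k) (hγ : ∀ k, 0 < γ k) (hvV : ∀ k, v k / γ k ≤ V k)
    (hV : ∀ k, γ k * V k = v k + c * (μ k * b₂ k))
    (him : ∀ k, ξ k * μ k + v k * ν k = c * (γ k * a k + μ k * b k))
    (hV0 : Tendsto V atTop (𝓝 0)) (ha : Tendsto a atTop (𝓝 A)) (hb : Tendsto b atTop (𝓝 B))
    (hb₂ : Tendsto b₂ atTop (𝓝 B₂)) (hB₂ : 0 < B₂) (hξ : Tendsto ξ atTop (𝓝 X))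
    (hν : Tendsto ν atTop (𝓝 N)) : A = 0 := by
  have hvγ : Tendsto (fun k => v k / γ k) atTop (𝓝 0) :=
    squeeze_zero (fun k => (div_pos (hv k) (hγ k)).le) hvV hV0
  have hμb : Tendsto (fun k => μ k / γ k * b₂ k) atTop (𝓝 0) := by
    have h1 := (hV0.sub hvγ).const_mul c⁻¹
    rw [sub_zero, mul_zero] at h1
    refine h1.congr fun k => ?_
    have h2 := hV k
    have h3 := (hγ k).ne'
    field_simp
    linear_combination h2
  have hμγ : Tendsto (fun k => μ k / γ k) atTop (𝓝 0) := by
    have h1 := hμb.div hb₂ hB₂.ne'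
    rw [zero_div] at h1
    refine h1.congr' ?_
    filter_upwards [hb₂.eventually_const_lt hB₂] with k hk
    exact mul_div_cancel_right₀ _ hk.ne'
  have h1 := (hμγ.mul (hξ.sub (hb.const_mul c))).add (hvγ.mul hν)
  rw [zero_mul, zero_mul, add_zero] at h1
  have h2 : ∀ k, μ k / γ k * (ξ k - c * b k) + v k / γ k * ν k = c * a k := by
    intro k
    have h3 := him k
    have h4 := (hγ k).ne'
    field_simp
    linear_combination h3
  have h5 := tendsto_nhds_unique (h1.congr h2) (ha.const_mul c)
  exact (mul_eq_zero.1 h5.symm).resolve_left hc.ne'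

/-- If the limit of V₀ were 0, then A₁ would vanish there, so s = 0 almost everywhere and A₂ = 0.
But then V₀ = |g|⁻² > 0. -/
lemma V₀_pos_of_tendsto_coSolution (hA : Admissible H) (hc : 0 < c)
    (hs : ∀ k, 0 < (zs k).im ∧ IsCoSolution c H F (zs k) (gs k)) (hz : Tendsto zs atTop (𝓝 z))
    (hq : Tendsto (fun k => (gs k, stieltjes F (zs k))) atTop (𝓝 q)) (hr : Regular H q) :
    0 < V₀ c H q.2 q.1 := by
  have hg0 := ne_zero_of_tendsto_coSolution hA hs hz hq hr
  have hV := (continuousAt_V₀ (c := c) hA hr hg0).tendsto.comp hq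
  simp only [Function.comp_def] at hV
  have hV0 : 0 ≤ V₀ c H q.2 q.1 :=
    ge_of_tendsto' hV fun k => ((hs k).2.V₀_pos hA hc.le (hs k).1).le
  refine hV0.lt_of_ne fun hcon => ?_
  rw [← hcon] at hV
  have hm : Tendsto (fun k => stieltjes F (zs k)) atTop (𝓝 q.2) :=
    (continuous_snd.tendsto q).comp hq
  have hquad : ∀ i j, Tendsto (fun k => quad H i j (stieltjes F (zs k)) (gs k)) atTop
      (𝓝 (quad H i j q.2 q.1)) := by
    intro i j
    have h := (continuousAt_quad hA i j hr).tendsto.comp hq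
    simpa only [Function.comp_def] using h
  have him : ∀ k, (zs k).re * (stieltjes F (zs k)).im + (zs k).im * (stieltjes F (zs k)).re =
      c * ((gs k).im * quad H 1 0 (stieltjes F (zs k)) (gs k) +
        (stieltjes F (zs k)).im * quad H 0 1 (stieltjes F (zs k)) (gs k)) := fun k =>
    (Complex.mul_im _ _).symm.trans ((hs k).2.im_mul hA (hs k).1)
  have hA1 := eq_zero_of_tendsto_of_im_identities hc (fun k => (hs k).1) (fun k => (hs k).2.1)
    (fun k => (hs k).2.V₀_ge hA hc.le (hs k).1) (fun k => (hs k).2.im_mul_V₀ hA (hs k).1) him hV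
    (hquad 1 0) (hquad 0 1) (hquad 0 2) (quad_zero_two_pos hA hr)
    ((Complex.continuous_re.tendsto z).comp hz) ((Complex.continuous_re.tendsto q.2).comp hm)
  rw [V₀, quad_one_one_eq_zero hA hr hA1, mul_zero, sub_zero] at hcon
  have := norm_pos_iff.2 hg0
  exact absurd hcon.symm (by positivity)

end ExtendedSolution


/-! ### The converse part: local parametrization by g -/

section LocalInverse

variable {c : ℝ} {H : Measure (ℝ × ℝ)} [IsProbabilityMeasure H] {F : Measure ℝ}
  [IsProbabilityMeasure F]

lemma isOpen_regular (hA : Admissible H) : IsOpen {q : ℂ × ℂ | Regular H q} :=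
  isOpen_iff_mem_nhds.2 fun _ hq => hq.eventually hA

lemma mom_conjPair (i j : ℕ) (q : ℂ × ℂ) : mom H i j (conjPair q) = star (mom H i j q) := by
  rw [mom, mom, Complex.star_def, ← integral_conj]
  congr 1
  funext p
  rw [den_conjPair]
  simp

lemma differentiableAt_mom (hA : Admissible H) (i j : ℕ) {q : ℂ × ℂ} (hq : Regular H q) :
    DifferentiableAt ℂ (mom H i j) q := by
  refine (hasStrictFDerivAt_of_divided (f := mom H i j) (u := q)
    (a := fun p => -mom₂ H (i + 1) j p.1 p.2) (b := fun p => -mom₂ H i (j + 1) p.1 p.2)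
    (isOpen_regular hA) hq (fun w hw w' hw' => ?_) (continuousAt_mom₂ hA _ _ hq hq).neg
    (continuousAt_mom₂ hA _ _ hq hq).neg).hasFDerivAt.differentiableAt
  rw [mom_sub_mom hA i j hw hw']
  ring

/-- The equation for `(g, m)` that remains after the elimination of `z`. -/
noncomputable def constraint (c : ℝ) (H : Measure (ℝ × ℝ)) (q : ℂ × ℂ) : ℂ :=
  c * q.1 ^ 2 * mom H 1 0 q + q.2 - q.1

lemma constraint_conjPair (q : ℂ × ℂ) :
    constraint c H (conjPair q) = star (constraint c H q) := by
  rw [constraint, mom_conjPair, constraint]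
  simp [conjPair]

lemma constraint_ofReal (g m : ℝ) : constraint c H ((g : ℂ), (m : ℂ)) =
    ((c * g ^ 2 * (∫ p : ℝ × ℝ, p.1 / (1 + p.1 * g + p.2 * m) ∂H) + m - g : ℝ) : ℂ) := by
  rw [constraint, mom_ofReal]
  simp

/-- The two-point integrals are the divided differences of the constraint; the hypothesis `hb` says
that its derivative in m is nonzero. -/
lemma exists_analyticAt_constraint (hA : Admissible H) {u : ℂ × ℂ} (hu : Regular H u)
    (hu0 : constraint c H u = 0) (hb : 1 - c * u.1 ^ 2 * mom₂ H 1 1 u u ≠ 0) :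
    ∃ ψ : ℂ → ℂ, AnalyticAt ℂ ψ u.1 ∧ ψ u.1 = u.2 ∧
      ∀ᶠ q in 𝓝 u, constraint c H q = 0 ↔ q.2 = ψ q.1 := by
  refine exists_analyticAt_implicit (U := {q | Regular H q})
    (a := fun p => c * (p.1.1 + p.2.1) * mom H 1 0 p.1 - c * p.2.1 ^ 2 * mom₂ H 2 0 p.1 p.2 - 1)
    (b := fun p => 1 - c * p.2.1 ^ 2 * mom₂ H 1 1 p.1 p.2) (isOpen_regular hA) hu
    (fun q hq q' hq' => ?_) (fun q hq q' hq' => ?_) (fun q hq q' hq' => ?_) hb hu0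
  · have h := mom_sub_mom hA 1 0 hq hq'
    simp only [zero_add, Nat.reduceAdd] at h
    simp only [constraint]
    linear_combination c * q'.1 ^ 2 * h
  · have h1 : ContinuousAt (fun p : (ℂ × ℂ) × (ℂ × ℂ) => mom H 1 0 p.1) (q, q') :=
      (continuousAt_mom hA 1 0 hq).comp_of_eq continuousAt_fst rfl
    have h2 := continuousAt_mom₂ hA 2 0 hq hq'
    fun_prop
  · have h2 := continuousAt_mom₂ hA 1 1 hq hq'
    fun_prop

/-- The value of `z` determined by `(g, m)`. -/
noncomputable def zOf (c : ℝ) (H : Measure (ℝ × ℝ)) (q : ℂ × ℂ) : ℂ :=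
  -1 / q.1 + c * mom H 0 1 q

lemma zOf_conjPair (q : ℂ × ℂ) : zOf c H (conjPair q) = star (zOf c H q) := by
  rw [zOf, mom_conjPair, zOf]
  simp [conjPair]

lemma differentiableAt_zOf (hA : Admissible H) {q : ℂ × ℂ} (hq : Regular H q) (h0 : q.1 ≠ 0) :
    DifferentiableAt ℂ (zOf c H) q := by
  unfold zOf
  have h1 := differentiableAt_mom hA 0 1 hq
  have h2 : DifferentiableAt ℂ (fun q : ℂ × ℂ => -1 / q.1) q := by
    simp only [div_eq_mul_inv]
    exact (differentiableAt_fst.fun_inv h0).const_mul _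
  exact h2.add (h1.const_mul _)

lemma solves_iff_zOf (hA : Admissible H) {q : ℂ × ℂ} (h : Regular H q) (hg : q.1 ≠ 0) {z : ℂ} :
    Solves c H z q.2 q.1 ↔ z = zOf c H q ∧ constraint c H q = 0 :=
  solves_iff hA h hg

/-- If `z` is locally invertible as a function of `g` near an extended solution, then the
Stieltjes transform of `F` extends analytically, and is real on the real line. -/
lemma notMem_support_of_deriv_ne_zero (hA : Admissible H) (hc : 0 ≤ c)
    (hex : ∀ z : ℂ, 0 < z.im → ∃ g, IsCoSolution c H F z g) {x₀ g₀ : ℝ} {ψ X : ℂ → ℂ}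
    {zs gs : ℕ → ℂ} (hs : ∀ k, 0 < (zs k).im ∧ IsCoSolution c H F (zs k) (gs k))
    (hz : Tendsto zs atTop (𝓝 (x₀ : ℂ)))
    (hq : Tendsto (fun k => (gs k, stieltjes F (zs k))) atTop (𝓝 ((g₀ : ℂ), ψ g₀)))
    (hψ : AnalyticAt ℂ ψ g₀) (hX : AnalyticAt ℂ X g₀) (hX0 : X g₀ = x₀)
    (hψc : ∀ᶠ w in 𝓝 (g₀ : ℂ), ψ (star w) = star (ψ w))
    (hXc : ∀ᶠ w in 𝓝 (g₀ : ℂ), X (star w) = star (X w))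
    (hloc : ∀ᶠ q in 𝓝 ((g₀ : ℂ), ψ g₀), ∀ z, Solves c H z q.2 q.1 → z = X q.1 ∧ q.2 = ψ q.1)
    (hd : deriv X g₀ ≠ 0) : x₀ ∉ F.support := by
  choose! γ hγ using hex
  set Ψ := hX.hasStrictDerivAt.localInverse _ _ _ hd with hΨ
  have hΨA : AnalyticAt ℂ Ψ x₀ := hX0 ▸ hX.analyticAt_localInverse hd
  have hleft : ∀ᶠ w in 𝓝 (g₀ : ℂ), Ψ (X w) = w := hX.hasStrictDerivAt.eventually_left_inverse hd
  have hright : ∀ᶠ z in 𝓝 (x₀ : ℂ), X (Ψ z) = z :=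
    hX0 ▸ hX.hasStrictDerivAt.eventually_right_inverse hd
  have hΨ0 : Ψ x₀ = g₀ := hX0 ▸ hleft.self_of_nhds
  have hΨt : Tendsto Ψ (𝓝 (x₀ : ℂ)) (𝓝 (g₀ : ℂ)) := by
    have := hΨA.continuousAt.tendsto
    rwa [hΨ0] at this
  have hstar : Tendsto (star : ℂ → ℂ) (𝓝 (g₀ : ℂ)) (𝓝 (g₀ : ℂ)) := by
    have := (continuous_star (R := ℂ)).tendsto (g₀ : ℂ)
    simpa using this
  set h : ℂ → ℂ := fun z => ψ (Ψ z) with hh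
  have hhA : AnalyticAt ℂ h x₀ := by
    have h1 : AnalyticAt ℂ ψ (Ψ x₀) := by rwa [hΨ0]
    exact h1.comp hΨA
  -- For real z, X takes the value z at Ψ z and at its conjugate; applying the left inverse Ψ shows
  -- that Ψ z is real, and so is ψ(Ψ z).
  have hreal : ∀ᶠ z in 𝓝 (x₀ : ℂ), z.im = 0 → (h z).im = 0 := by
    filter_upwards [hΨt.eventually hψc, hΨt.eventually hXc,
      hΨt.eventually (hstar.eventually hleft), hright] with z h1 h2 h3 h4 h5
    have hzz : star z = z := Complex.conj_eq_iff_im.2 h5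
    rw [h2, h4, hzz] at h3
    rw [← h3] at h1
    exact Complex.conj_eq_iff_im.1 h1.symm
  obtain ⟨K, S, hS, hK⟩ := hhA.hasStrictDerivAt.hasStrictFDerivAt.exists_lipschitzOnWith
  obtain ⟨r, hr, hball⟩ := Metric.eventually_nhds_iff_ball.1
    ((hhA.eventually_analyticAt.and hreal).and hS)
  -- One late z_k suffices: near it the co-solution stays in the region where (∗) is equivalent to
  -- the parametrization, and the identity theorem spreads the equality over the half-disc.
  have hagree : Set.EqOn (stieltjes F) h (Metric.ball (x₀ : ℂ) r ∩ {z | 0 < z.im}) := by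
    have hev : ∀ᶠ k in atTop, (∀ᶠ q in 𝓝 (gs k, stieltjes F (zs k)),
        (∀ z, Solves c H z q.2 q.1 → z = X q.1 ∧ q.2 = ψ q.1) ∧ Ψ (X q.1) = q.1) ∧
        zs k ∈ Metric.ball (x₀ : ℂ) r :=
      (hq.eventually (hloc.and ((continuous_fst.tendsto
        ((g₀ : ℂ), ψ g₀)).eventually hleft)).eventually_nhds).and
        (hz.eventually (Metric.ball_mem_nhds _ hr))
    obtain ⟨k, hk, hkb⟩ := hev.exists
    have hk0 := (hs k).1
    have hgk : gs k = γ (zs k) := (hs k).2.unique hA hc hk0 (hγ _ hk0)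
    have hpair : Tendsto (fun w => (γ w, stieltjes F w)) (𝓝 (zs k))
        (𝓝 (gs k, stieltjes F (zs k))) := by
      rw [hgk]
      exact (continuousAt_coSolution hA hc hγ hk0).tendsto.prodMk_nhds
        (differentiableAt_stieltjes hk0).continuousAt.tendsto
    have hloceq : stieltjes F =ᶠ[𝓝 (zs k)] h := by
      filter_upwards [hpair.eventually hk,
        (Complex.continuous_im.tendsto (zs k)).eventually_const_lt hk0] with w h1 h2
      obtain ⟨h3, h4⟩ : w = X (γ w) ∧ stieltjes F w = ψ (γ w) := h1.1 w (hγ w h2).2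
      have h5 : Ψ (X (γ w)) = γ w := h1.2
      rw [← h3] at h5
      rw [hh]
      simp only
      rw [h5]
      exact h4
    refine AnalyticOnNhd.eqOn_of_preconnected_of_eventuallyEq (𝕜 := ℂ) ?_
      (fun z hz => (hball z hz.1).1.1)
      ((convex_ball _ _).inter (convex_halfSpace_im_gt 0)).isPreconnected ⟨hkb, hk0⟩ hloceq
    have hop : IsOpen {z : ℂ | 0 < z.im} := isOpen_lt continuous_const Complex.continuous_im
    have hd1 : DifferentiableOn ℂ (stieltjes F) {z : ℂ | 0 < z.im} := fun z hz =>
      (differentiableAt_stieltjes hz).differentiableWithinAt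
    exact (hd1.analyticOnNhd hop).mono Set.inter_subset_right
  -- The continuation is Lipschitz and real on the real line, so its imaginary part at x + iη is at
  -- most Kη.
  refine notMem_support_of_im_le (r := r / 2) (K := K) (half_pos hr) fun x η hx hη hηr => ?_
  have hm1 : (x + η * Complex.I : ℂ) ∈ Metric.ball (x₀ : ℂ) r :=
    add_mul_I_mem_ball hx.le hη.le hηr (by rw [sub_self, abs_zero]; linarith)
  have hm2 : (x : ℂ) ∈ Metric.ball (x₀ : ℂ) r := by
    rw [Metric.mem_ball, dist_eq_norm, ← Complex.ofReal_sub, Complex.norm_real, Real.norm_eq_abs]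
    linarith
  rw [hagree ⟨hm1, by simpa using hη⟩]
  have h1 := hK.dist_le_mul _ (hball _ hm1).2 _ (hball _ hm2).2
  have h2 : (h x).im = 0 := (hball _ hm2).1.2 (Complex.ofReal_im x)
  rw [dist_eq_norm, dist_eq_norm, add_sub_cancel_left, norm_mul, Complex.norm_I, mul_one,
    Complex.norm_real, Real.norm_eq_abs, abs_of_pos hη] at h1
  have h3 := (le_abs_self _).trans (Complex.abs_im_le_norm (h (x + η * Complex.I) - h x))
  rw [Complex.sub_im, h2, sub_zero] at h3
  exact h3.trans h1

/-- The behaviour near a real extended solution at which the denominators do not vanish. -/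
theorem local_theorem (hA : Admissible H) (hc : 0 < c)
    (hex : ∀ z : ℂ, 0 < z.im → ∃ g, IsCoSolution c H F z g) {x₀ m₀ g₀ : ℝ}
    (hext : IsExtendedSolution c H F x₀ m₀ g₀) (hr : ∀ p ∈ H.support, den m₀ g₀ p ≠ 0) :
    ∃ (ε : ℝ) (x m : ℝ → ℝ), 0 < ε ∧
      AnalyticOnNhd ℝ x (Set.Ioo (g₀ - ε) (g₀ + ε)) ∧
      AnalyticOnNhd ℝ m (Set.Ioo (g₀ - ε) (g₀ + ε)) ∧
      x g₀ = x₀ ∧ m g₀ = m₀ ∧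
      (∀ g ∈ Set.Ioo (g₀ - ε) (g₀ + ε), Solves c H (x g) (m g) g) ∧
      (∀ᶠ q : ℝ × ℝ in 𝓝 (g₀, m₀),
        c * q.1 ^ 2 * (∫ p : ℝ × ℝ, p.1 / (1 + p.1 * q.1 + p.2 * q.2) ∂H) + q.2 - q.1 = 0 ↔
          q.2 = m q.1) ∧
      (deriv x g₀ ≠ 0 → x₀ ∉ F.support) := by
  obtain ⟨zs, gs, hs, hz, hm, hg⟩ := hext
  set u : ℂ × ℂ := ((g₀ : ℂ), (m₀ : ℂ)) with hu
  have hreg : Regular H u := hr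
  have hq : Tendsto (fun k => (gs k, stieltjes F (zs k))) atTop (𝓝 u) := hg.prodMk_nhds hm
  have hu0 : u.1 ≠ 0 := ne_zero_of_tendsto_coSolution hA hs hz hq hreg
  have hV := V₀_pos_of_tendsto_coSolution hA hc hs hz hq hreg
  have hsol : Solves c H x₀ u.2 u.1 :=
    Solves.of_tendsto hA hz hq hreg hu0 (Eventually.of_forall fun k => (hs k).2.2)
  obtain ⟨hx0, hcon⟩ := (solves_iff_zOf hA hreg hu0).1 hsol
  have hconj : conjPair u = u := by simp [conjPair, hu]
  -- At a real pair the two-point integral is A₂, and 1 - c g² A₂ = g² V₀ > 0.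
  have hb : 1 - c * u.1 ^ 2 * mom₂ H 1 1 u u ≠ 0 := by
    have h1 := quad_eq_mom₂ (H := H) 1 1 u
    rw [hconj] at h1
    rw [V₀] at hV
    rw [← h1]
    generalize quad H 1 1 u.2 u.1 = a at hV
    have h2 : g₀ ≠ 0 := by simpa [hu] using hu0
    have h3 : 0 < 1 - c * g₀ ^ 2 * a := by
      have h4 := mul_pos hV (pow_pos (norm_pos_iff.2 hu0) 2)
      rw [sub_mul, inv_mul_cancel₀ (pow_ne_zero 2 (norm_pos_iff.2 hu0).ne')] at h4
      simp only [hu, Complex.norm_real, Real.norm_eq_abs, sq_abs] at h4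
      linarith
    have h5 : (1 - c * u.1 ^ 2 * a : ℂ) = ((1 - c * g₀ ^ 2 * a : ℝ) : ℂ) := by simp [hu]
    rw [h5]
    exact_mod_cast h3.ne'
  obtain ⟨ψ, hψA, hψu, hψ⟩ := exists_analyticAt_constraint hA hreg hcon hb
  have hψt : Tendsto (fun w => (w, ψ w)) (𝓝 u.1) (𝓝 u) := by
    have := hψA.continuousAt.tendsto
    rw [hψu] at this
    exact tendsto_id.prodMk_nhds this
  set X : ℂ → ℂ := fun w => zOf c H (w, ψ w) with hX
  have hXu : X u.1 = x₀ := by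
    simp only [hX, hψu]
    exact hx0.symm
  have hnear : ∀ᶠ w in 𝓝 u.1, Regular H (w, ψ w) ∧ w ≠ 0 ∧ constraint c H (w, ψ w) = 0 := by
    filter_upwards [hψt.eventually (hreg.eventually hA), eventually_ne_nhds hu0,
      hψt.eventually hψ] with w h1 h2 h3
    exact ⟨h1, h2, h3.2 rfl⟩
  have hXA : AnalyticAt ℂ X u.1 := by
    rw [Complex.analyticAt_iff_eventually_differentiableAt]
    filter_upwards [hnear, hψA.eventually_analyticAt] with w h1 h2
    exact (differentiableAt_zOf hA h1.1 h1.2.1).comp w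
      (differentiableAt_id.prodMk h2.differentiableAt)
  -- The constraint is invariant under conjugation, and its solutions near `u` form the graph of ψ;
  -- so ψ commutes with conjugation and is real at real points.
  have hψc : ∀ᶠ w in 𝓝 u.1, ψ (star w) = star (ψ w) := by
    have h1 : Tendsto (fun w => conjPair (w, ψ w)) (𝓝 u.1) (𝓝 u) := by
      have := (continuous_conjPair.tendsto u).comp hψt
      rwa [hconj] at this
    filter_upwards [h1.eventually hψ, hnear] with w h2 h3
    refine (h2.1 ?_).symm
    rw [constraint_conjPair, h3.2.2, star_zero]
  have hXc : ∀ᶠ w in 𝓝 u.1, X (star w) = star (X w) := by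
    filter_upwards [hψc] with w h1
    simp only [hX]
    rw [h1, ← zOf_conjPair]
    rfl
  have hre : ∀ w : ℝ, ψ (star (w : ℂ)) = star (ψ w) → ψ w = ((ψ w).re : ℂ) := fun w h =>
    (Complex.conj_eq_iff_re.1 (by simpa using h.symm)).symm
  have hre' : ∀ w : ℝ, X (star (w : ℂ)) = star (X w) → X w = ((X w).re : ℂ) := fun w h =>
    (Complex.conj_eq_iff_re.1 (by simpa using h.symm)).symm
  have hcast : Tendsto (fun w : ℝ => (w : ℂ)) (𝓝 g₀) (𝓝 u.1) :=
    Complex.continuous_ofReal.tendsto g₀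
  obtain ⟨ε, hε, hball⟩ := Metric.eventually_nhds_iff_ball.1
    (hcast.eventually (((hXA.eventually_analyticAt.and hψA.eventually_analyticAt).and
      (hXc.and hψc)).and hnear))
  rw [Real.ball_eq_Ioo] at hball
  refine ⟨ε, fun w => (X w).re, fun w => (ψ w).re, hε, fun w hw => (hball w hw).1.1.1.re_ofReal,
    fun w hw => (hball w hw).1.1.2.re_ofReal, ?_, ?_, fun w hw => ?_, ?_, fun hd => ?_⟩
  · change (X u.1).re = x₀
    rw [hXu, Complex.ofReal_re]
  · change (ψ u.1).re = m₀
    rw [hψu, Complex.ofReal_re]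
  · obtain ⟨⟨-, h1, h2⟩, h3, h4, h5⟩ := hball w hw
    rw [← hre' w h1, ← hre w h2]
    exact (solves_iff_zOf (q := ((w : ℂ), ψ w)) hA h3 h4).2 ⟨rfl, h5⟩
  · have h1 : Tendsto (fun q : ℝ × ℝ => ((q.1 : ℂ), (q.2 : ℂ))) (𝓝 (g₀, m₀)) (𝓝 u) := by
      have : Continuous fun q : ℝ × ℝ => ((q.1 : ℂ), (q.2 : ℂ)) := by fun_prop
      exact this.tendsto (g₀, m₀)
    filter_upwards [h1.eventually hψ,
      (hcast.comp (continuous_fst.tendsto (g₀, m₀))).eventually hψc] with q h2 h3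
    rw [constraint_ofReal, Complex.ofReal_eq_zero] at h2
    simp only [Function.comp] at h3
    rw [h2, hre q.1 h3, Complex.ofReal_inj, Complex.ofReal_re]
  -- The derivative of the real function x is the real part of that of X.
  · have hd' : deriv X u.1 ≠ 0 := by
      intro h0
      have h1 := (hXA.differentiableAt.hasDerivAt (x := (g₀ : ℂ))).real_of_complex
      have h2 : deriv X (g₀ : ℂ) = 0 := h0
      rw [h2, Complex.zero_re] at h1
      exact hd h1.deriv
    have hu' : u = ((g₀ : ℂ), ψ g₀) := Prod.ext rfl hψu.symm
    refine notMem_support_of_deriv_ne_zero hA hc.le hex hs hz (hu' ▸ hq) hψA hXA hXu hψc hXc ?_ hd'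
    rw [← hu']
    filter_upwards [hreg.eventually hA, hψ] with q h1 h2 z h3
    obtain ⟨h4, h5⟩ := (solves_iff_zOf hA h1 h3.1).1 h3
    have h6 := h2.1 h5
    refine ⟨?_, h6⟩
    simp only [hX]
    rw [← h6]
    exact h4

end LocalInverse


/-! ### Properties of H inherited from the model -/

section

variable {Ω : Type*} [MeasurableSpace Ω] {P : Measure Ω} [IsProbabilityMeasure P] {c : ℝ}
  {H : Measure (ℝ × ℝ)} [IsProbabilityMeasure H]

lemma Model.admissible (M : Model P c H) (hb : Bornology.IsBounded H.support)
    (hinv : ∫⁻ p : ℝ × ℝ, (ENNReal.ofReal p.2)⁻¹ ∂H < ⊤) : Admissible H where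
  isCompact := Metric.isCompact_of_isClosed_isBounded H.isClosed_support hb
  nonneg := by
    have hcl : IsClosed {p : ℝ × ℝ | 0 ≤ p.1 ∧ 0 ≤ p.2} :=
      (isClosed_le continuous_const continuous_fst).inter
        (isClosed_le continuous_const continuous_snd)
    exact Measure.support_subset_of_isClosed hcl M.ae_nonneg
  pos := by
    filter_upwards [ae_lt_top (by fun_prop) hinv.ne] with p hp
    simpa using hp
  integrable_inv := by
    refine ⟨by fun_prop, ?_⟩
    refine lt_of_le_of_lt (lintegral_mono_ae ?_) hinv
    filter_upwards [ae_lt_top (by fun_prop) hinv.ne] with p hp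
    have hp : 0 < p.2 := by simpa using hp
    rw [← ENNReal.ofReal_inv_of_pos hp, Real.enorm_eq_ofReal (inv_pos.2 hp).le]

end

end NoncentralCov

theorem mainTheorem4 {Ω : Type*} [MeasurableSpace Ω] (P : Measure Ω) [IsProbabilityMeasure P]
    (c : ℝ) (hc0 : 0 < c) (hc1 : c ≤ 1)
    (H : Measure (ℝ × ℝ)) [IsProbabilityMeasure H]
    (hHbdd : Bornology.IsBounded H.support)
    (hHinv : ∫⁻ p : ℝ × ℝ, (ENNReal.ofReal p.2)⁻¹ ∂H < ⊤)
    (M : NoncentralCov.Model P c H)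
    (F : Measure ℝ) [IsProbabilityMeasure F] (hF : M.IsLSD F) :
    (∀ x₀ : ℝ, 0 < x₀ → x₀ ∉ F.support →
      ∃ (ε : ℝ) (g : ℂ → ℂ), 0 < ε ∧
        (∀ z : ℂ, 0 < z.im → NoncentralCov.IsCoSolution c H F z (g z)) ∧
        AnalyticOnNhd ℂ (NoncentralCov.stieltjes F) (Metric.ball (x₀ : ℂ) ε) ∧
        AnalyticOnNhd ℂ g (Metric.ball (x₀ : ℂ) ε) ∧
        (∀ x : ℝ, 0 < x → (x : ℂ) ∈ Metric.ball (x₀ : ℂ) ε →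
          (NoncentralCov.stieltjes F x).im = 0 ∧ (g x).im = 0 ∧
          NoncentralCov.IsExtendedSolution c H F x (NoncentralCov.stieltjes F x) (g x) ∧
          NoncentralCov.Solves c H x (NoncentralCov.stieltjes F x) (g x) ∧
          (∫⁻ p : ℝ × ℝ, ENNReal.ofReal p.1 / ENNReal.ofReal p.2 ∂H ≤ ENNReal.ofReal (1 / c) →
            NoncentralCov.stieltjes F x ≠ 0) ∧
          NoncentralCov.VDefined c H (NoncentralCov.stieltjes F x) (g x) ∧
          NoncentralCov.V c H (NoncentralCov.stieltjes F x) (g x) < x) ∧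
        (∀ p ∈ H.support, NoncentralCov.den (NoncentralCov.stieltjes F x₀) (g x₀) p ≠ 0)) ∧
    (∀ x₀ m₀ g₀ : ℝ, 0 < x₀ → NoncentralCov.IsExtendedSolution c H F x₀ m₀ g₀ →
      (∀ p ∈ H.support, NoncentralCov.den m₀ g₀ p ≠ 0) →
      ∃ (ε : ℝ) (x m : ℝ → ℝ), 0 < ε ∧
        AnalyticOnNhd ℝ x (Set.Ioo (g₀ - ε) (g₀ + ε)) ∧
        AnalyticOnNhd ℝ m (Set.Ioo (g₀ - ε) (g₀ + ε)) ∧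
        x g₀ = x₀ ∧ m g₀ = m₀ ∧
        (∀ g ∈ Set.Ioo (g₀ - ε) (g₀ + ε), NoncentralCov.Solves c H (x g) (m g) g) ∧
        (∀ᶠ q : ℝ × ℝ in 𝓝 (g₀, m₀),
          c * q.1 ^ 2 * (∫ p : ℝ × ℝ, p.1 / (1 + p.1 * q.1 + p.2 * q.2) ∂H) + q.2 - q.1 = 0 ↔
            q.2 = m q.1) ∧
        (deriv x g₀ ≠ 0 → x₀ ∉ F.support)) := by
  have hA := M.admissible hHbdd hHinv
  obtain ⟨K, hK0, hK⟩ := NoncentralCov.ae_le_of_isBounded hHbdd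
  have hex : ∀ z : ℂ, 0 < z.im → ∃ g, NoncentralCov.IsCoSolution c H F z g := fun z hz =>
    let ⟨g, hg, _⟩ := M.exists_isCoSolution hF hK0 hK hc0 hz
    ⟨g, hg⟩
  exact ⟨fun x₀ h0 hx₀ => NoncentralCov.gap_theorem hA hc0 hc1 hex h0 hx₀,
    fun x₀ m₀ g₀ _ hext hr => NoncentralCov.local_theorem hA hc0 hex hext hr⟩
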